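/- **Conventions.** A rational Fermat theory $T$ is a Lawvere theory with a morphism from the theory $\mathrm{Com}_{\mathbb Q}$ of commutative $\mathbb Q$-algebras such that, writing $T[x_1,\dots,x_n]$ for the set of $n$-ary operations (the free $T$-algebra on $n$ generators), for every $f\in T[x,z_1,\dots,z_n]$ there is a unique $g\in T[x,y,z_1,\dots,z_n]$ with $f(x,z)-f(y,z)=(x-y)\,g(x,y,z)$. A $T$-algebra is finitely presented if it is a quotient of some $T[x_1,\dots,x_n]$ by a finitely generated ideal. Let $\mathcal E$ be a class of flat morphisms between finitely presented $T$-algebras which (1) is closed under pushouts along arbitrary morphisms of finitely presented $T$-algebras; (2) satisfies right cancellation: if $f$ and $g\circ f$ lie in $\mathcal E$, then so does $g$; and (3) for each $f\colon A\to B$ in $\mathcal E$ and each $i\colon B\to C$ with $i\circ f$ surjective, $i$ factorises as $B\xrightarrow{j}B'\to C$ with $j\in\mathcal E$ such that the induced map from the pushout of $B'\leftarrow A\to C$ to $C$ is an isomorphism. An $\mathcal E$-morphism is a pushout, along an arbitrary morphism of $T$-algebras, of a morphism in $\mathcal E$. A non-negatively graded $T$-DGA is a non-negatively graded, graded-commutative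 differential graded $\mathbb Q$-algebra $B$ (with differential of degree $-1$), together with a $T$-algebra structure on $B_0$ enhancing its $\mathbb Q$-algebra structure; $T$-algebras are regarded as $T$-DGAs concentrated in degree $0$, and $\mathrm H_0B$ is a $T$-algebra as a quotient of $B_0$. Weak equivalences are quasi-isomorphisms; in the standard model structure, fibrations are the morphisms which are surjective in strictly positive degrees. For $T$-DGAs $A,B$, write $\mathrm{map}(A,B)$ for the derived mapping space, i.e. the mapping space in the $\infty$-category of non-negatively graded $T$-DGAs localised at weak equivalences. It is calculated as the simplicial set $k\mapsto \mathrm{Hom}(Q,R_k)$, for $Q\to A$ a quasi-isomorphism from a cofibrant object, and $B\to R_\bullet$ a levelwise quasi-isomorphism to a Reedy fibrant simplicial $T$-DGA. **Lemma.** Let $f\colon T[x_1,\dots,x_n]\to A$ be an $\mathcal E$-morphism of $T$-algebras and $B$ a non-negatively graded $T$-DGA. Choices as above exist for $A$, $T[x_1,\dots,x_n]$ and $B$, together with a lift of $f$ to a morphism of the cofibrant replacements of $T[x_1,\dots,x_n]$ and $A$; and for all such choices $\mathrm{map}(A,B)$ is a Kan complex and the following hold. 1. The maps induced by $f$ and by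 passage to $\mathrm H_0$ form a commutative square which exhibits $\mathrm{map}(A,B)$ as the homotopy fibre product $$\mathrm{map}(A,B)\simeq \mathrm{map}(T[x_1,\dots,x_n],B)\times^h_{\mathrm{Hom}_{\mathrm{Alg}(T)}(T[x_1,\dots,x_n],\mathrm H_0B)}\mathrm{Hom}_{\mathrm{Alg}(T)}(A,\mathrm H_0B),$$ where the two sets $\mathrm{Hom}_{\mathrm{Alg}(T)}(-,\mathrm H_0B)$ are regarded as discrete spaces. 2. Passage to $\mathrm H_0$ induces a bijection $\pi_0\,\mathrm{map}(A,B)\cong \mathrm{Hom}_{\mathrm{Alg}(T)}(A,\mathrm H_0B)$. 3. For every $i>0$ and every base point, there is a group isomorphism $\pi_i\,\mathrm{map}(A,B)\cong(\mathrm H_iB)^n$. -/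

import Mathlib

open CategoryTheory

universe u v

noncomputable section

namespace FermatDG

/-! ### Lawvere theories and rational Fermat theories -/

/-- A (one-sorted) Lawvere theory, presented by its operations: `Op n` is the set
`Hom(𝔸ⁿ, 𝔸¹)`, the elements `var i` are the projections `𝔸ⁿ ⟶ 𝔸¹`, and `subst f g` is the
composite of `f : 𝔸ⁿ ⟶ 𝔸¹` with `(g₁, …, gₙ) : 𝔸ᵐ ⟶ 𝔸ⁿ`. -/
structure LawvereTheory where
  Op : ℕ → Type u
  var : ∀ {n : ℕ}, Fin n → Op n
  subst : ∀ {n m : ℕ}, Op n → (Fin n → Op m) → Op m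
  var_subst : ∀ {n m : ℕ} (i : Fin n) (g : Fin n → Op m), subst (var i) g = g i
  subst_var : ∀ {n : ℕ} (f : Op n), subst f var = f
  subst_subst : ∀ {n m k : ℕ} (f : Op n) (g : Fin n → Op m) (h : Fin m → Op k),
    subst (subst f g) h = subst f (fun i => subst (g i) h)

/-- A morphism of Lawvere theories. -/
structure LawvereTheory.Hom (S : LawvereTheory.{v}) (T : LawvereTheory.{u}) where
  map : ∀ {n : ℕ}, S.Op n → T.Op n
  map_var : ∀ {n : ℕ} (i : Fin n), map (S.var i) = T.var i
  map_subst : ∀ {n m : ℕ} (f : S.Op n) (g : Fin n → S.Op m),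
    map (S.subst f g) = T.subst (map f) (fun i => map (g i))

/-- The Lawvere theory of commutative `ℚ`-algebras: operations are polynomials. -/
def comQ : LawvereTheory.{0} where
  Op n := MvPolynomial (Fin n) ℚ
  var i := MvPolynomial.X i
  subst f g := MvPolynomial.bind₁ g f
  var_subst i g := MvPolynomial.bind₁_X_right g i
  subst_var f := by
    change MvPolynomial.bind₁ MvPolynomial.X f = f
    rw [MvPolynomial.bind₁_X_left]; rfl
  subst_subst f g h := MvPolynomial.bind₁_bind₁ g h f

/-- A Lawvere theory with a morphism from the theory of commutative `ℚ`-algebras. -/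
structure RationalTheory extends LawvereTheory.{u} where
  ofCom : LawvereTheory.Hom comQ toLawvereTheory

namespace RationalTheory

variable (T : RationalTheory.{u})

/-- The operation given by a polynomial with rational coefficients. -/
def poly {n : ℕ} (p : MvPolynomial (Fin n) ℚ) : T.Op n :=
  T.ofCom.map (n := n) p

/-- Evaluation of a polynomial on elements of `T.Op m`. -/
def ev {n m : ℕ} (p : MvPolynomial (Fin n) ℚ) (a : Fin n → T.Op m) : T.Op m :=
  T.subst (T.poly p) a

variable {T}

lemma poly_X {n : ℕ} (i : Fin n) : T.poly (MvPolynomial.X i) = T.var i :=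
  T.ofCom.map_var i

lemma poly_bind {n m : ℕ} (g : Fin n → MvPolynomial (Fin m) ℚ) (p : MvPolynomial (Fin n) ℚ) :
    T.poly (MvPolynomial.bind₁ g p) = T.subst (T.poly p) (fun i => T.poly (g i)) :=
  T.ofCom.map_subst p g

lemma ev_X {n m : ℕ} (i : Fin n) (a : Fin n → T.Op m) : T.ev (MvPolynomial.X i) a = a i := by
  simp [ev, poly_X, T.var_subst]

lemma ev_bind {n m k : ℕ} (g : Fin n → MvPolynomial (Fin m) ℚ) (p : MvPolynomial (Fin n) ℚ)
    (a : Fin m → T.Op k) :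
    T.ev (MvPolynomial.bind₁ g p) a = T.ev p (fun i => T.ev (g i) a) := by
  simp [ev, poly_bind, T.subst_subst]

instance (m : ℕ) : Add (T.Op m) := ⟨fun a b => T.ev (.X 0 + .X 1) ![a, b]⟩
instance (m : ℕ) : Mul (T.Op m) := ⟨fun a b => T.ev (.X 0 * .X 1) ![a, b]⟩
instance (m : ℕ) : Neg (T.Op m) := ⟨fun a => T.ev (-.X 0) ![a]⟩
instance (m : ℕ) : Zero (T.Op m) := ⟨T.poly 0⟩
instance (m : ℕ) : One (T.Op m) := ⟨T.poly 1⟩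

lemma ev_add {n m : ℕ} (p q : MvPolynomial (Fin n) ℚ) (a : Fin n → T.Op m) :
    T.ev (p + q) a = T.ev p a + T.ev q a := by
  have h : p + q = MvPolynomial.bind₁ ![p, q] (.X 0 + .X 1) := by simp
  rw [h, ev_bind]
  change _ = T.ev _ _
  congr 1
  funext i
  fin_cases i <;> rfl

lemma ev_mul {n m : ℕ} (p q : MvPolynomial (Fin n) ℚ) (a : Fin n → T.Op m) :
    T.ev (p * q) a = T.ev p a * T.ev q a := by
  have h : p * q = MvPolynomial.bind₁ ![p, q] (.X 0 * .X 1) := by simp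
  rw [h, ev_bind]
  change _ = T.ev _ _
  congr 1
  funext i
  fin_cases i <;> rfl

lemma ev_neg {n m : ℕ} (p : MvPolynomial (Fin n) ℚ) (a : Fin n → T.Op m) :
    T.ev (-p) a = -T.ev p a := by
  have h : -p = MvPolynomial.bind₁ ![p] (-.X 0) := by simp
  rw [h, ev_bind]
  change _ = T.ev _ _
  congr 1
  funext i
  fin_cases i; rfl

/-- Constants are preserved by substitution. -/
lemma ev_C {n m : ℕ} (q : ℚ) (a : Fin n → T.Op m) :
    T.ev (MvPolynomial.C q) a = T.poly (MvPolynomial.C q) := by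
  have h : (MvPolynomial.C q : MvPolynomial (Fin n) ℚ)
      = MvPolynomial.bind₁ (![] : Fin 0 → MvPolynomial (Fin n) ℚ) (MvPolynomial.C q) := by simp
  have h' : (MvPolynomial.C q : MvPolynomial (Fin m) ℚ)
      = MvPolynomial.bind₁ (![] : Fin 0 → MvPolynomial (Fin m) ℚ) (MvPolynomial.C q) := by simp
  rw [h, h', ev_bind, poly_bind, ev]
  congr 1
  funext i
  exact i.elim0

lemma ev_zero {n m : ℕ} (a : Fin n → T.Op m) : T.ev 0 a = 0 := by
  have := ev_C (T := T) 0 a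
  rw [map_zero, map_zero] at this
  exact this

lemma ev_one {n m : ℕ} (a : Fin n → T.Op m) : T.ev 1 a = 1 := by
  have := ev_C (T := T) 1 a
  rw [map_one, map_one] at this
  exact this

/-- The set `T.Op m = T[x₁, …, xₘ]` is a commutative ring, its operations being induced by
polynomials. -/
instance (m : ℕ) : CommRing (T.Op m) where
  add_assoc a b c := by
    have h := congrArg (fun p => T.ev p ![a, b, c])
      (add_assoc (MvPolynomial.X 0) (MvPolynomial.X 1) (MvPolynomial.X 2))
    simpa [ev_add, ev_X] using h
  zero_add a := by
    have h := congrArg (fun p => T.ev p ![a]) (zero_add (MvPolynomial.X 0))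
    simp only [ev_add, ev_X, ev_zero] at h
    exact h
  add_zero a := by
    have h := congrArg (fun p => T.ev p ![a]) (add_zero (MvPolynomial.X 0))
    simp only [ev_add, ev_X, ev_zero] at h
    exact h
  add_comm a b := by
    have h := congrArg (fun p => T.ev p ![a, b])
      (add_comm (MvPolynomial.X 0) (MvPolynomial.X 1))
    simpa [ev_add, ev_X] using h
  neg_add_cancel a := by
    have h := congrArg (fun p => T.ev p ![a]) (neg_add_cancel (MvPolynomial.X 0))
    simp only [ev_add, ev_X, ev_zero, ev_neg] at h
    exact h
  mul_assoc a b c := by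
    have h := congrArg (fun p => T.ev p ![a, b, c])
      (mul_assoc (MvPolynomial.X 0) (MvPolynomial.X 1) (MvPolynomial.X 2))
    simpa [ev_mul, ev_X] using h
  one_mul a := by
    have h := congrArg (fun p => T.ev p ![a]) (one_mul (MvPolynomial.X 0))
    simp only [ev_mul, ev_X, ev_one] at h
    exact h
  mul_one a := by
    have h := congrArg (fun p => T.ev p ![a]) (mul_one (MvPolynomial.X 0))
    simp only [ev_mul, ev_X, ev_one] at h
    exact h
  mul_comm a b := by
    have h := congrArg (fun p => T.ev p ![a, b])
      (mul_comm (MvPolynomial.X 0) (MvPolynomial.X 1))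
    simpa [ev_mul, ev_X] using h
  zero_mul a := by
    have h := congrArg (fun p => T.ev p ![a]) (zero_mul (MvPolynomial.X 0))
    simp only [ev_mul, ev_X, ev_zero] at h
    exact h
  mul_zero a := by
    have h := congrArg (fun p => T.ev p ![a]) (mul_zero (MvPolynomial.X 0))
    simp only [ev_mul, ev_X, ev_zero] at h
    exact h
  left_distrib a b c := by
    have h := congrArg (fun p => T.ev p ![a, b, c])
      (mul_add (MvPolynomial.X 0) (MvPolynomial.X 1) (MvPolynomial.X 2))
    simpa [ev_mul, ev_add, ev_X] using h
  right_distrib a b c := by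
    have h := congrArg (fun p => T.ev p ![a, b, c])
      (add_mul (MvPolynomial.X 0) (MvPolynomial.X 1) (MvPolynomial.X 2))
    simpa [ev_mul, ev_add, ev_X] using h
  nsmul := nsmulRec
  zsmul := zsmulRec

lemma poly_eq_ev {m : ℕ} (p : MvPolynomial (Fin m) ℚ) : T.poly p = T.ev p T.var :=
  (T.subst_var _).symm

instance (m : ℕ) : Algebra ℚ (T.Op m) :=
  RingHom.toAlgebra
    { toFun q := T.poly (MvPolynomial.C q)
      map_zero' := by rw [map_zero]; rfl
      map_one' := by rw [map_one]; rfl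
      map_add' q r := by simp only [map_add, poly_eq_ev, ev_add]
      map_mul' q r := by simp only [map_mul, poly_eq_ev, ev_mul] }

lemma ev_eq_aeval {n m : ℕ} (p : MvPolynomial (Fin n) ℚ) (a : Fin n → T.Op m) :
    T.ev p a = MvPolynomial.aeval a p := by
  induction p using MvPolynomial.induction_on with
  | C q => rw [ev_C, MvPolynomial.aeval_C]; rfl
  | add p q hp hq => rw [ev_add, hp, hq, map_add]
  | mul_X p i hp => rw [ev_mul, hp, ev_X, map_mul, MvPolynomial.aeval_X]

end RationalTheory

/-- The Fermat property: for every `f(x, z₁, …, zₙ)` there is a unique `g(x, y, z₁, …, zₙ)` with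
`f(x, z) - f(y, z) = (x - y) g(x, y, z)`. -/
def RationalTheory.IsFermat (T : RationalTheory.{u}) : Prop :=
  ∀ (n : ℕ) (f : T.Op (n + 1)), ∃! g : T.Op (n + 2),
    T.subst f (Fin.cons (T.var 0) fun i : Fin n => T.var i.succ.succ)
      - T.subst f (Fin.cons (T.var 1) fun i : Fin n => T.var i.succ.succ)
      = (T.var 0 - T.var 1) * g

/-- A rational Fermat theory. -/
structure RationalFermatTheory extends RationalTheory.{u} where
  fermat : toRationalTheory.IsFermat

variable (T : RationalFermatTheory.{u})

/-! ### Algebras over a rational Fermat theory -/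

/-- An enhancement of the structure of a commutative `ℚ`-algebra `R` to a `T`-algebra
structure. (The ring structure is determined by the operations, through `op_poly`.) -/
structure TStructure (R : Type u) [CommRing R] [Algebra ℚ R] where
  op : ∀ {n : ℕ}, T.Op n → (Fin n → R) → R
  op_var : ∀ {n : ℕ} (i : Fin n) (a : Fin n → R), op (T.var i) a = a i
  op_subst : ∀ {n m : ℕ} (f : T.Op n) (g : Fin n → T.Op m) (a : Fin m → R),
    op (T.subst f g) a = op f (fun i => op (g i) a)
  op_poly : ∀ {n : ℕ} (p : MvPolynomial (Fin n) ℚ) (a : Fin n → R),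
    op (T.poly p) a = MvPolynomial.aeval a p

namespace TStructure

variable {T} {R : Type u} [CommRing R] [Algebra ℚ R] (S : TStructure T R)

lemma op_add {m : ℕ} (f g : T.Op m) (a : Fin m → R) :
    S.op (f + g) a = S.op f a + S.op g a := by
  change S.op (T.subst (T.poly (.X 0 + .X 1)) ![f, g]) a = _
  rw [S.op_subst, S.op_poly]; simp

lemma op_mul {m : ℕ} (f g : T.Op m) (a : Fin m → R) :
    S.op (f * g) a = S.op f a * S.op g a := by
  change S.op (T.subst (T.poly (.X 0 * .X 1)) ![f, g]) a = _
  rw [S.op_subst, S.op_poly]; simp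

lemma op_sub {m : ℕ} (f g : T.Op m) (a : Fin m → R) :
    S.op (f - g) a = S.op f a - S.op g a := by
  have h := S.op_add (f - g) g a
  rw [sub_add_cancel] at h
  rw [h, add_sub_cancel_right]

lemma op_update_sub_mem (I : Ideal R) {n : ℕ} (f : T.Op n) (a : Fin n → R) (i : Fin n)
    (x y : R) (h : x - y ∈ I) :
    S.op f (Function.update a i x) - S.op f (Function.update a i y) ∈ I := by
  let F : T.Op (n + 1) := T.subst f (fun j => if j = i then T.var 0 else T.var j.succ)
  have hF : ∀ w : R, S.op F (Fin.cons w a) = S.op f (Function.update a i w) := by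
    intro w
    simp only [F, S.op_subst]
    congr 1
    funext j
    by_cases hj : j = i
    · subst hj; simp [S.op_var]
    · simp [hj, S.op_var]
  obtain ⟨g, hg, -⟩ := T.fermat n F
  have key := congrArg (fun e => S.op e (Fin.cons x (Fin.cons y a))) hg
  simp only [S.op_sub, S.op_mul, S.op_subst, S.op_var] at key
  have e1 : (fun j : Fin (n + 1) => S.op ((Fin.cons (T.var 0)
      (fun k : Fin n => T.var k.succ.succ) : Fin (n + 1) → T.Op (n + 2)) j)
      (Fin.cons x (Fin.cons y a))) = Fin.cons x a := by
    funext j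
    refine Fin.cases ?_ (fun k => ?_) j <;> simp [S.op_var]
  have e2 : (fun j : Fin (n + 1) => S.op ((Fin.cons (T.var 1)
      (fun k : Fin n => T.var k.succ.succ) : Fin (n + 1) → T.Op (n + 2)) j)
      (Fin.cons x (Fin.cons y a))) = Fin.cons y a := by
    funext j
    refine Fin.cases ?_ (fun k => ?_) j
    · simp only [Fin.cons_zero, S.op_var]; rfl
    · simp [S.op_var]
  rw [e1, e2, hF, hF] at key
  rw [key]
  exact I.mul_mem_right _ h

/-- Operations are compatible with congruence modulo an ideal. -/
lemma op_sub_mem (I : Ideal R) {n : ℕ} (f : T.Op n) (a b : Fin n → R)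
    (h : ∀ i, b i - a i ∈ I) : S.op f b - S.op f a ∈ I := by
  classical
  have key : ∀ s : Finset (Fin n), S.op f (s.piecewise b a) - S.op f a ∈ I := by
    intro s
    induction s using Finset.induction_on with
    | empty => simp
    | insert j s hj ih =>
      have h1 := S.op_update_sub_mem I f (s.piecewise b a) j (b j) (a j) (h j)
      rw [← Finset.piecewise_insert] at h1
      have h2 : Function.update (s.piecewise b a) j (a j) = s.piecewise b a := by
        apply Function.update_eq_self_iff.2
        simp [hj]
      rw [h2] at h1
      have := I.add_mem h1 ih
      rwa [sub_add_sub_cancel] at this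
  simpa using key Finset.univ

/-- The quotient of a `T`-algebra by an ideal is a `T`-algebra. -/
def quotient (I : Ideal R) : TStructure T (R ⧸ I) :=
  let q {n : ℕ} (f : T.Op n) (a : Fin n → R ⧸ I) : R ⧸ I :=
    Ideal.Quotient.mk I (S.op f fun i => (Ideal.Quotient.mk_surjective (a i)).choose)
  have hq : ∀ {n : ℕ} (f : T.Op n) (a : Fin n → R),
      q f (fun i => Ideal.Quotient.mk I (a i)) = Ideal.Quotient.mk I (S.op f a) := by
    intro n f a
    refine Ideal.Quotient.eq.2 (S.op_sub_mem I f _ _ fun i => ?_)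
    exact Ideal.Quotient.eq.1 (Ideal.Quotient.mk_surjective (Ideal.Quotient.mk I (a i))).choose_spec
  { op := q
    op_var := by
      intro n i a
      obtain ⟨b, rfl⟩ : ∃ b : Fin n → R, (fun i => Ideal.Quotient.mk I (b i)) = a :=
        ⟨_, funext fun i => (Ideal.Quotient.mk_surjective (a i)).choose_spec⟩
      rw [hq, S.op_var]
    op_subst := by
      intro n m f g a
      obtain ⟨b, rfl⟩ : ∃ b : Fin m → R, (fun i => Ideal.Quotient.mk I (b i)) = a :=
        ⟨_, funext fun i => (Ideal.Quotient.mk_surjective (a i)).choose_spec⟩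
      simp only [hq, S.op_subst]
    op_poly := by
      intro n p a
      obtain ⟨b, rfl⟩ : ∃ b : Fin n → R, (fun i => Ideal.Quotient.mk I (b i)) = a :=
        ⟨_, funext fun i => (Ideal.Quotient.mk_surjective (a i)).choose_spec⟩
      rw [hq, S.op_poly]
      have := MvPolynomial.aeval_algebraMap_apply (R := ℚ) (A := R) (R ⧸ I) b p
      exact this.symm }

lemma quotient_op_mk (I : Ideal R) {n : ℕ} (f : T.Op n) (a : Fin n → R) :
    (S.quotient I).op f (fun i => Ideal.Quotient.mk I (a i)) =
      Ideal.Quotient.mk I (S.op f a) := by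
  refine Ideal.Quotient.eq.2 (S.op_sub_mem I f _ _ fun i => ?_)
  exact Ideal.Quotient.eq.1 (Ideal.Quotient.mk_surjective (Ideal.Quotient.mk I (a i))).choose_spec

end TStructure

/-- A `T`-algebra. -/
structure TAlg where
  carrier : Type u
  [commRing : CommRing carrier]
  [algebra : Algebra ℚ carrier]
  str : TStructure T carrier

attribute [instance] TAlg.commRing TAlg.algebra

namespace TAlg

variable {T}

/-- A morphism of `T`-algebras: a map which commutes with all operations (in particular a
homomorphism of `ℚ`-algebras). -/
@[ext]
structure Hom (A B : TAlg T) where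
  toAlgHom : A.carrier →ₐ[ℚ] B.carrier
  map_op : ∀ {n : ℕ} (f : T.Op n) (a : Fin n → A.carrier),
    toAlgHom (A.str.op f a) = B.str.op f (fun i => toAlgHom (a i))

instance : Category (TAlg T) where
  Hom := Hom
  id A := ⟨AlgHom.id ℚ A.carrier, fun _ _ => rfl⟩
  comp f g := ⟨g.toAlgHom.comp f.toAlgHom, fun φ a => by simp [f.map_op, g.map_op]⟩

@[ext]
lemma hom_ext {A B : TAlg T} {f g : A ⟶ B} (h : ∀ a, f.toAlgHom a = g.toAlgHom a) : f = g :=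
  Hom.ext (AlgHom.ext h)

lemma isIso_of_bijective {A B : TAlg T} (f : A ⟶ B) (hf : Function.Bijective f.toAlgHom) :
    IsIso f := by
  let e := AlgEquiv.ofBijective f.toAlgHom hf
  have he : ∀ x, f.toAlgHom (e.symm x) = x := e.apply_symm_apply
  have he' : ∀ x, e.symm (f.toAlgHom x) = x := e.symm_apply_apply
  refine ⟨⟨⟨e.symm, fun φ a => ?_⟩, ?_, ?_⟩⟩
  · apply hf.1
    rw [f.map_op]
    exact (he _).trans (congrArg _ (funext fun i => (he _).symm))
  · exact hom_ext he'
  · exact hom_ext he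

variable (T) in
/-- The free `T`-algebra `T[x₁, …, xₙ]`. -/
def free (n : ℕ) : TAlg T where
  carrier := T.Op n
  str :=
    { op := fun f a => T.subst f a
      op_var := fun i a => T.var_subst i a
      op_subst := fun f g a => T.subst_subst f g a
      op_poly := fun p a => RationalTheory.ev_eq_aeval p a }

/-- Finitely presented `T`-algebras: quotients of some `T[x₁, …, xₙ]` by a finitely generated
ideal. -/
def IsFinPres (A : TAlg T) : Prop :=
  ∃ (n : ℕ) (p : free T n ⟶ A), Function.Surjective p.toAlgHom ∧
    (RingHom.ker p.toAlgHom).FG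

end TAlg

/-- The assumptions on a class `E` of morphisms of `T`-algebras (behaving like open immersions,
or like étale maps). -/
structure IsOpenEtaleClass {T : RationalFermatTheory.{u}} (E : MorphismProperty (TAlg T)) :
    Prop where
  finPres_source : ∀ {A B : TAlg T} (f : A ⟶ B), E f → A.IsFinPres
  finPres_target : ∀ {A B : TAlg T} (f : A ⟶ B), E f → B.IsFinPres
  flat : ∀ {A B : TAlg T} (f : A ⟶ B), E f → (f.toAlgHom : A.carrier →+* B.carrier).Flat
  pushout : ∀ {A B A' B' : TAlg T} (f : A ⟶ B) (g : A ⟶ A') (g' : B ⟶ B') (f' : A' ⟶ B'),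
    E f → A'.IsFinPres → IsPushout f g g' f' → E f'
  right_cancel : ∀ {A B C : TAlg T} (f : A ⟶ B) (g : B ⟶ C), E f → E (f ≫ g) → E g
  factor : ∀ {A B C : TAlg T} (f : A ⟶ B) (i : B ⟶ C), E f →
    Function.Surjective (f ≫ i).toAlgHom →
    ∃ (B' : TAlg T) (j : B ⟶ B') (k : B' ⟶ C), E j ∧ j ≫ k = i ∧
      IsPushout (f ≫ j) (f ≫ i) k (𝟙 C)

/-! ### Non-negatively graded differential graded `T`-algebras -/

/-- A non-negatively graded commutative differential graded `ℚ`-algebra (with homological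
grading, i.e. a differential of degree `-1`). -/
structure CDGA where
  carrier : Type u
  [ring : Ring carrier]
  [algebra : Algebra ℚ carrier]
  deg : ℕ → Submodule ℚ carrier
  [graded : GradedAlgebra deg]
  graded_comm : ∀ {i j : ℕ} {a b : carrier}, a ∈ deg i → b ∈ deg j →
    a * b = (-1) ^ (i * j) * (b * a)
  d : carrier →ₗ[ℚ] carrier
  d_mem : ∀ {i : ℕ} {a : carrier}, a ∈ deg (i + 1) → d a ∈ deg i
  d_zero : ∀ {a : carrier}, a ∈ deg 0 → d a = 0
  d_d : ∀ a : carrier, d (d a) = 0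
  leibniz : ∀ {i : ℕ} {a : carrier} (b : carrier), a ∈ deg i →
    d (a * b) = d a * b + (-1) ^ i * (a * d b)

attribute [instance] CDGA.ring CDGA.algebra CDGA.graded

instance (A : CDGA.{u}) : CommRing (A.deg 0) :=
  { SetLike.GradeZero.instRing A.deg with
    mul_comm := fun a b => Subtype.ext (by
      have h := A.graded_comm a.2 b.2
      simp only [mul_zero, pow_zero, one_mul] at h
      exact h) }

instance (A : CDGA.{u}) : Algebra ℚ (A.deg 0) :=
  { SetLike.GradeZero.instAlgebra A.deg with
    commutes' := fun _ _ => mul_comm _ _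
    smul_def' := fun r x => Algebra.smul_def (A := SetLike.GradeZero.subalgebra A.deg) r x }

/-- An enhancement of the `ℚ`-algebra structure on the degree `0` part (which consists of
cycles) to a `T`-algebra structure. -/
abbrev CDGA.ZeroTStructure (A : CDGA.{u}) : Type u := TStructure T (A.deg 0)

/-- A non-negatively graded differential graded `T`-algebra. -/
structure TDGA extends CDGA.{u} where
  str : toCDGA.ZeroTStructure T

namespace TDGA

variable {T}

/-- A morphism of differential graded `T`-algebras. -/
@[ext]
structure Hom (A B : TDGA T) where
  toAlgHom : A.carrier →ₐ[ℚ] B.carrier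
  map_deg : ∀ {i : ℕ} {a : A.carrier}, a ∈ A.deg i → toAlgHom a ∈ B.deg i
  map_d : ∀ a : A.carrier, toAlgHom (A.d a) = B.d (toAlgHom a)
  map_op : ∀ {n : ℕ} (f : T.Op n) (a : Fin n → A.deg 0),
    toAlgHom (A.str.op f a : A.carrier) =
      B.str.op f (fun i => (⟨toAlgHom (a i), map_deg (a i).2⟩ : B.deg 0))

instance : Category (TDGA T) where
  Hom := Hom
  id A := ⟨AlgHom.id ℚ A.carrier, fun h => h, fun _ => rfl, fun _ _ => rfl⟩
  comp f g := ⟨g.toAlgHom.comp f.toAlgHom, fun h => g.map_deg (f.map_deg h),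
    fun a => by simp [f.map_d, g.map_d], fun φ a => by
      have h := congrArg g.toAlgHom (f.map_op φ a)
      rw [g.map_op] at h
      exact h⟩

@[ext]
lemma hom_ext {A B : TDGA T} {f g : A ⟶ B} (h : ∀ a, f.toAlgHom a = g.toAlgHom a) : f = g :=
  Hom.ext (AlgHom.ext h)

/-! #### Homology and quasi-isomorphisms -/

/-- The cycles of degree `i`. -/
def cycles (B : TDGA T) (i : ℕ) : Submodule ℚ B.carrier :=
  B.deg i ⊓ LinearMap.ker B.d

/-- The boundaries of degree `i`. -/
def boundaries (B : TDGA T) (i : ℕ) : Submodule ℚ B.carrier :=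
  (B.deg (i + 1)).map B.d

/-- The homology group `Hᵢ B`. -/
abbrev H (B : TDGA T) (i : ℕ) : Type u :=
  B.cycles i ⧸ (B.boundaries i).submoduleOf (B.cycles i)

/-- The map induced by a morphism on cycles. -/
def cyclesMap {A B : TDGA T} (f : A ⟶ B) (i : ℕ) : A.cycles i →ₗ[ℚ] B.cycles i :=
  f.toAlgHom.toLinearMap.restrict (p := A.cycles i) (q := B.cycles i) fun x hx =>
    ⟨f.map_deg hx.1, by
      have h : A.d x = 0 := hx.2
      change B.d (f.toAlgHom x) = 0
      rw [← f.map_d, h, map_zero]⟩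

/-- The map induced by a morphism on homology. -/
def homologyMap {A B : TDGA T} (f : A ⟶ B) (i : ℕ) : A.H i →ₗ[ℚ] B.H i :=
  Submodule.mapQ _ _ (cyclesMap f i) (by
    rintro ⟨x, hx⟩ ⟨y, hy, hyx⟩
    exact ⟨f.toAlgHom y, f.map_deg hy, by rw [← f.map_d, hyx]; rfl⟩)

/-- Quasi-isomorphisms: the weak equivalences of the standard model structure. -/
def QuasiIso {A B : TDGA T} (f : A ⟶ B) : Prop :=
  ∀ i : ℕ, Function.Bijective (homologyMap f i)

/-- Fibrations of the standard model structure: morphisms which are surjective in strictly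
positive degrees. -/
def IsFibration {A B : TDGA T} (f : A ⟶ B) : Prop :=
  ∀ (i : ℕ), ∀ b ∈ B.deg (i + 1), ∃ a ∈ A.deg (i + 1), f.toAlgHom a = b

/-- Cofibrant objects of the standard model structure: objects with the left lifting property
with respect to trivial fibrations. -/
def IsCofibrant (Q : TDGA T) : Prop :=
  ∀ {X Y : TDGA T} (p : X ⟶ Y), IsFibration p → QuasiIso p →
    ∀ g : Q ⟶ Y, ∃ h : Q ⟶ X, h ≫ p = g

/-! #### The `T`-algebra `H₀ B` -/

/-- The ideal of boundaries in degree `0`. -/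
def boundaryIdeal (B : TDGA T) : Ideal (B.deg 0) where
  carrier := {x | ∃ y ∈ B.deg 1, B.d y = x}
  zero_mem' := ⟨0, zero_mem _, map_zero _⟩
  add_mem' := by
    rintro a b ⟨y, hy, hya⟩ ⟨z, hz, hzb⟩
    exact ⟨y + z, add_mem hy hz, by rw [map_add, hya, hzb]; rfl⟩
  smul_mem' := by
    rintro c x ⟨y, hy, hyx⟩
    refine ⟨c * y, by simpa using SetLike.GradedMul.mul_mem c.2 hy, ?_⟩
    rw [B.leibniz y c.2, B.d_zero c.2, hyx]
    simp only [zero_mul, pow_zero, one_mul, zero_add]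
    rfl

/-- The `T`-algebra `H₀ B`. -/
def H0 (B : TDGA T) : TAlg T where
  carrier := B.deg 0 ⧸ B.boundaryIdeal
  str := B.str.quotient B.boundaryIdeal

/-- The restriction of a morphism to degree `0`. -/
def zeroMap {A B : TDGA T} (f : A ⟶ B) : A.deg 0 →ₐ[ℚ] B.deg 0 where
  toFun a := ⟨f.toAlgHom a, f.map_deg a.2⟩
  map_one' := Subtype.ext (map_one f.toAlgHom)
  map_mul' a b := Subtype.ext (map_mul f.toAlgHom a.1 b.1)
  map_zero' := Subtype.ext (map_zero f.toAlgHom)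
  map_add' a b := Subtype.ext (map_add f.toAlgHom a.1 b.1)
  commutes' q := Subtype.ext (f.toAlgHom.commutes q)

/-- The morphism of `T`-algebras induced on `H₀`. -/
def H0map {A B : TDGA T} (f : A ⟶ B) : A.H0 ⟶ B.H0 where
  toAlgHom := Ideal.quotientMapₐ B.boundaryIdeal (zeroMap f) (by
    rintro x ⟨y, hy, hyx⟩
    exact ⟨f.toAlgHom y, f.map_deg hy, by rw [← f.map_d, hyx]; rfl⟩)
  map_op {n} φ a := by
    obtain ⟨b, rfl⟩ : ∃ b : Fin n → A.deg 0,
        (fun i => Ideal.Quotient.mk A.boundaryIdeal (b i)) = a :=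
      ⟨_, funext fun i => (Ideal.Quotient.mk_surjective (a i)).choose_spec⟩
    change Ideal.quotientMapₐ B.boundaryIdeal (zeroMap f) _
      ((A.str.quotient A.boundaryIdeal).op φ _) = (B.str.quotient B.boundaryIdeal).op φ _
    rw [A.str.quotient_op_mk]
    refine Eq.trans ?_ (B.str.quotient_op_mk B.boundaryIdeal φ (fun i => zeroMap f (b i))).symm
    exact congrArg (Ideal.Quotient.mk B.boundaryIdeal) (Subtype.ext (f.map_op φ b))

lemma H0map_comp {A B C : TDGA T} (f : A ⟶ B) (g : B ⟶ C) :
    H0map (f ≫ g) = H0map f ≫ H0map g := by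
  apply TAlg.hom_ext
  intro a
  obtain ⟨b, rfl⟩ := Ideal.Quotient.mk_surjective a
  rfl

lemma QuasiIso.bijective_H0map {A B : TDGA T} {f : A ⟶ B} (hf : QuasiIso f) :
    Function.Bijective (H0map f).toAlgHom := by
  constructor
  · rw [injective_iff_map_eq_zero]
    intro a ha
    obtain ⟨b, rfl⟩ := Ideal.Quotient.mk_surjective a
    have hb : zeroMap f b ∈ B.boundaryIdeal := Ideal.Quotient.eq_zero_iff_mem.1 ha
    refine Ideal.Quotient.eq_zero_iff_mem.2 ?_
    obtain ⟨y, hy, hyb⟩ := hb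
    let z : A.cycles 0 := ⟨b, b.2, A.d_zero b.2⟩
    have hz : homologyMap f 0 (Submodule.Quotient.mk z) = 0 :=
      (Submodule.Quotient.mk_eq_zero _).2 ⟨y, hy, hyb⟩
    have hz' := (hf 0).1 (hz.trans (map_zero _).symm)
    obtain ⟨w, hw, hwb⟩ := (Submodule.Quotient.mk_eq_zero _).1 hz'
    exact ⟨w, hw, hwb⟩
  · intro c
    obtain ⟨c, rfl⟩ := Ideal.Quotient.mk_surjective c
    let z : B.cycles 0 := ⟨c, c.2, B.d_zero c.2⟩
    obtain ⟨x, hx⟩ := (hf 0).2 (Submodule.Quotient.mk z)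
    obtain ⟨x, rfl⟩ := Submodule.Quotient.mk_surjective _ x
    obtain ⟨y, hy, hyx⟩ := (Submodule.Quotient.eq _).1 hx
    refine ⟨Ideal.Quotient.mk A.boundaryIdeal ⟨x, x.2.1⟩, ?_⟩
    refine Ideal.Quotient.eq.2 ⟨y, hy, hyx⟩

lemma QuasiIso.isIso_H0map {A B : TDGA T} {f : A ⟶ B} (hf : QuasiIso f) : IsIso (H0map f) :=
  TAlg.isIso_of_bijective _ hf.bijective_H0map

end TDGA

/-! #### `T`-algebras as differential graded `T`-algebras -/

namespace TAlg

variable {T}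

/-- The grading concentrated in degree `0`. -/
def trivialDeg (A : TAlg T) : ℕ → Submodule ℚ A.carrier
  | 0 => ⊤
  | _ + 1 => ⊥

instance (A : TAlg T) : GradedAlgebra A.trivialDeg where
  one_mem := Submodule.mem_top
  mul_mem := by
    rintro (_ | i) (_ | j) a b ha hb
    · exact Submodule.mem_top
    · have hb' : b = 0 := hb
      subst hb'; rw [mul_zero]; exact zero_mem _
    · have ha' : a = 0 := ha
      subst ha'; rw [zero_mul]; exact zero_mem _
    · have ha' : a = 0 := ha
      subst ha'; rw [zero_mul]; exact zero_mem _
  decompose' a := DirectSum.of (fun i => A.trivialDeg i) 0 ⟨a, Submodule.mem_top⟩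
  left_inv a := by simp
  right_inv x := by
    induction x using DirectSum.induction_on with
    | zero => rw [map_zero]; exact map_zero (DirectSum.of (fun i => A.trivialDeg i) 0)
    | of i x =>
      rw [DirectSum.coeAddMonoidHom_of]
      cases i with
      | zero => rfl
      | succ i =>
        obtain ⟨x, hx⟩ := x
        have hx' : x = 0 := hx
        subst hx'
        exact (map_zero (DirectSum.of (fun i => A.trivialDeg i) 0)).trans
          (map_zero (DirectSum.of (fun i => A.trivialDeg i) (i + 1))).symm
    | add x y hx hy =>
      rw [map_add]
      refine Eq.trans ?_ (congrArg₂ (· + ·) hx hy)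
      exact map_add (DirectSum.of (fun i => A.trivialDeg i) 0) ⟨_, Submodule.mem_top⟩
        ⟨_, Submodule.mem_top⟩

/-- The underlying differential graded algebra of a `T`-algebra concentrated in degree `0`. -/
def toCDGA (A : TAlg T) : CDGA.{u} where
  carrier := A.carrier
  deg := A.trivialDeg
  graded_comm := by
    rintro (_ | i) (_ | j) a b ha hb
    · simp [mul_comm a b]
    · have hb' : b = 0 := hb
      simp [hb']
    · have ha' : a = 0 := ha
      simp [ha']
    · have ha' : a = 0 := ha
      simp [ha']
  d := 0
  d_mem _ := zero_mem (A.trivialDeg _)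
  d_zero _ := rfl
  d_d _ := rfl
  leibniz := by simp

/-- The inclusion of the degree `0` part, for an algebra concentrated in degree `0`. -/
def zeroVal (A : TAlg T) : A.toCDGA.deg 0 →ₐ[ℚ] A.carrier where
  toFun a := a.1
  map_one' := rfl
  map_mul' _ _ := rfl
  map_zero' := rfl
  map_add' _ _ := rfl
  commutes' _ := rfl

/-- A `T`-algebra regarded as a differential graded `T`-algebra concentrated in degree `0`. -/
def toTDGA (A : TAlg T) : TDGA T where
  toCDGA := A.toCDGA
  str :=
    { op := fun φ a => ⟨A.str.op φ fun i => A.zeroVal (a i),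
        Submodule.mem_top (R := ℚ) (M := A.carrier)⟩
      op_var := fun i a => Subtype.ext (A.str.op_var i _)
      op_subst := fun f g a => Subtype.ext (A.str.op_subst f g _)
      op_poly := fun p a => Subtype.ext (by
        refine (A.str.op_poly p _).trans ?_
        exact (MvPolynomial.comp_aeval_apply a A.zeroVal p).symm) }

/-- A morphism of `T`-algebras regarded as a morphism of differential graded `T`-algebras. -/
def mapTDGA {A B : TAlg T} (f : A ⟶ B) : A.toTDGA ⟶ B.toTDGA where
  toAlgHom := f.toAlgHom
  map_deg := by
    rintro (_ | i) a ha
    · exact Submodule.mem_top (R := ℚ) (M := B.carrier)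
    · have ha' : a = 0 := ha
      subst ha'
      exact map_zero f.toAlgHom
  map_d a := map_zero f.toAlgHom
  map_op φ a := f.map_op φ _

/-- The canonical morphism (in fact, isomorphism) from `A` to `H₀ A`. -/
def toH0 (A : TAlg T) : A ⟶ A.toTDGA.H0 where
  toAlgHom :=
    { toFun a := Ideal.Quotient.mk A.toTDGA.boundaryIdeal
        ⟨a, Submodule.mem_top (R := ℚ) (M := A.carrier)⟩
      map_one' := rfl
      map_mul' _ _ := rfl
      map_zero' := rfl
      map_add' _ _ := rfl
      commutes' _ := rfl }
  map_op φ a := (A.toTDGA.str.quotient_op_mk A.toTDGA.boundaryIdeal φ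
    fun i => ⟨a i, Submodule.mem_top (R := ℚ) (M := A.carrier)⟩).symm

end TAlg

/-! ### Simplicial sets: weak equivalences, homotopy groups, homotopy fibre products -/

namespace Simp

open Simplicial HomotopicalAlgebra SSet.modelCategoryQuillen

/-- A map `φ : X ⟶ Y` of simplicial sets is a weak homotopy equivalence if, for every Kan
complex `K`, composition with `φ` is a bijection from homotopy classes of maps `Y ⟶ K` to homotopy
classes of maps `X ⟶ K`. -/
def WeakEquiv {X Y : SSet.{u}} (φ : X ⟶ Y) : Prop :=
  ∀ (K : SSet.{u}), SSet.KanComplex K →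
    (∀ g : X ⟶ K, ∃ h : Y ⟶ K, Nonempty (SSet.Homotopy (φ ≫ h) g)) ∧
    (∀ h h' : Y ⟶ K, Nonempty (SSet.Homotopy (φ ≫ h) (φ ≫ h')) → Nonempty (SSet.Homotopy h h'))

/-- A commutative square of simplicial sets

`X --a--> Y`
`|        |`
`b        g`
`v        v`
`Z --h--> W`

exhibits `X` as the homotopy fibre product of `Y` and `Z` over `W`: after factorising `g` as a
weak equivalence `Y ⟶ Y'` followed by a Kan fibration `Y' ⟶ W`, the map from `X` to the fibre
product of `Y'` and `Z` over `W` is a weak equivalence. -/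
def IsHomotopyPullback {X Y Z W : SSet.{u}} (a : X ⟶ Y) (b : X ⟶ Z) (g : Y ⟶ W) (h : Z ⟶ W) :
    Prop :=
  ∃ (sq : a ≫ g = b ≫ h) (Y' : SSet.{u}) (j : Y ⟶ Y') (p : Y' ⟶ W) (fac : j ≫ p = g),
    WeakEquiv j ∧ Fibration p ∧
      WeakEquiv (Limits.pullback.lift (f := p) (g := h) (a ≫ j) b (by
        rw [Category.assoc, fac, sq]))

/-- A set regarded as a constant (discrete) simplicial set. -/
abbrev disc (S : Type u) : SSet.{u} := (Functor.const _).obj S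

/-- The map of discrete simplicial sets induced by a map of sets. -/
abbrev discMap {S S' : Type u} (f : S → S') : disc S ⟶ disc S' := (Functor.const _).map (↾f)

/-- The map from connected components induced by a map to a discrete simplicial set. -/
def π₀ToSet {X : SSet.{u}} {S : Type u} (φ : X ⟶ disc S) : SSet.π₀ X → S :=
  SSet.π₀.lift (fun x => φ.app _ x) (fun x y e => by
    have h0 := ConcreteCategory.congr_hom (φ.naturality (SimplexCategory.δ (1 : Fin 2)).op) e.edge
    have h1 := ConcreteCategory.congr_hom (φ.naturality (SimplexCategory.δ (0 : Fin 2)).op) e.edge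
    have hs : X.map (SimplexCategory.δ (1 : Fin 2)).op e.edge = x := e.src_eq
    have ht : X.map (SimplexCategory.δ (0 : Fin 2)).op e.edge = y := e.tgt_eq
    simp only [types_comp_apply] at h0 h1
    rw [hs] at h0
    rw [ht] at h1
    exact h0.trans h1.symm)

/-- The underlying set of the `n`-th homotopy group of a Kan complex at a vertex `x`:
homotopy classes, relative to the boundary, of `n`-simplices with boundary constant at `x`. -/
abbrev HomotopyGroup (X : SSet.{u}) (n : ℕ) (x : X _⦋0⦌) : Type u :=
  SSet.RelativeMorphism.HomotopyClass (SSet.boundary n) (SSet.Subcomplex.ofSimplex x)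
    (SSet.const ⟨x, SSet.Subcomplex.mem_ofSimplex_obj x⟩)

/-- An isomorphism from the homotopy group `πₙ₊₁(X, x)` of a Kan complex to an
(additive) group `G`. The product of the classes of `f` and `g` is the class of `fg` whenever there
is an `(n + 2)`-simplex whose last three faces are `g`, `fg` and `f` (in this order), and whose
other faces are constant. -/
structure HomotopyGroupIso (X : SSet.{u}) (n : ℕ) (x : X _⦋0⦌) (G : Type u) [AddGroup G] where
  equiv : HomotopyGroup X (n + 1) x ≃ G
  map_mul : ∀ f g fg : X.PtSimplex (n + 1) x,
    Nonempty (SSet.PtSimplex.MulStruct f g fg (Fin.last n)) →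
      equiv fg.homotopyClass = equiv f.homotopyClass + equiv g.homotopyClass

end Simp

/-! ### Derived mapping spaces of differential graded `T`-algebras -/

namespace TDGA

open Simplicial

variable {T}

/-- A cofibrant replacement in the standard model structure. -/
structure CofibrantReplacement (A : TDGA T) where
  obj : TDGA T
  hom : obj ⟶ A
  cofibrant : obj.IsCofibrant
  quasiIso : QuasiIso hom

/-- The functor which sends a differential graded `T`-algebra to the set of its elements of
degree `i`. -/
def degFunctor (i : ℕ) : TDGA T ⥤ Type u where
  obj A := A.deg i
  map f := ↾fun a => ⟨f.toAlgHom a, f.map_deg a.2⟩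

/-- A (fibrant) simplicial resolution `B ⟶ R₀, R₁, …` in the standard model structure: a Reedy
fibrant simplicial object, with a levelwise weak equivalence from the constant simplicial
object `B`. Reedy fibrancy says that the `n`-th matching map is a fibration, i.e. surjective in
degrees `i + 1` for all `i`; a degree `i + 1` element of the `n`-th matching object is a map from
the boundary of the `n`-simplex to the simplicial set of elements of degree `i + 1`. -/
structure SimplicialResolution (B : TDGA T) where
  obj : SimplicialObject (TDGA T)
  ι : (Functor.const _).obj B ⟶ obj
  quasiIso : ∀ k : SimplexCategoryᵒᵖ, QuasiIso (ι.app k)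
  fibrant : ∀ (i n : ℕ) (σ : (SSet.boundary n : SSet.{u}) ⟶ obj ⋙ degFunctor (i + 1)),
    ∃ τ : SSet.stdSimplex.obj ⦋n⦌ ⟶ obj ⋙ degFunctor (i + 1), (SSet.boundary n).ι ≫ τ = σ

/-- The derived mapping space `map(A, B)`, as the homotopy function complex
`k ↦ Hom(Q, R k)` for a cofibrant replacement `Q` of `A` and a simplicial resolution `R` of `B`. -/
def mapSpace {A B : TDGA T} (Q : CofibrantReplacement A) (R : SimplicialResolution B) : SSet.{u} :=
  R.obj ⋙ coyoneda.obj (Opposite.op Q.obj)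

/-- The map of mapping spaces given by composition with a morphism of cofibrant replacements. -/
def mapSpacePrecomp {A A' B : TDGA T} {Q : CofibrantReplacement A} {Q' : CofibrantReplacement A'}
    (q : Q.obj ⟶ Q'.obj) (R : SimplicialResolution B) : mapSpace Q' R ⟶ mapSpace Q R :=
  Functor.whiskerLeft R.obj (coyoneda.map q.op)

/-- For a `T`-algebra `A`, the map `map(A, B) ⟶ Hom(A, H₀ B)` given by passing to `H₀`, using the
isomorphisms `A ≅ H₀ Q` and `H₀ B ≅ H₀ (R k)`. -/
def mapSpaceToHom {A : TAlg T} {B : TDGA T} (Q : CofibrantReplacement A.toTDGA)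
    (R : SimplicialResolution B) : mapSpace Q R ⟶ Simp.disc (A ⟶ B.H0) where
  app k := ↾fun f : Q.obj ⟶ R.obj.obj k =>
    haveI := Q.quasiIso.isIso_H0map
    haveI := (R.quasiIso k).isIso_H0map
    A.toH0 ≫ inv (H0map Q.hom) ≫ H0map f ≫ inv (H0map (R.ι.app k))
  naturality k l θ := by
    ext f
    have := Q.quasiIso.isIso_H0map
    have hk := (R.quasiIso k).isIso_H0map
    have hl := (R.quasiIso l).isIso_H0map
    have e : R.ι.app k ≫ R.obj.map θ = R.ι.app l := by
      rw [← R.ι.naturality θ]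
      exact Category.id_comp _
    have e' : inv (H0map (R.ι.app k)) = H0map (R.obj.map θ) ≫ inv (H0map (R.ι.app l)) := by
      rw [IsIso.eq_comp_inv, IsIso.inv_comp_eq, ← H0map_comp]
      exact congrArg H0map e.symm
    change A.toH0 ≫ inv (H0map Q.hom) ≫ H0map (f ≫ R.obj.map θ) ≫ inv (H0map (R.ι.app l)) =
      A.toH0 ≫ inv (H0map Q.hom) ≫ H0map f ≫ inv (H0map (R.ι.app k))
    rw [e']
    refine congrArg (fun x => A.toH0 ≫ inv (H0map Q.hom) ≫ x) ?_
    exact (congrArg (· ≫ inv (H0map (R.ι.app l))) (H0map_comp f (R.obj.map θ))).trans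
      (Category.assoc _ _ _)

end TDGA

end FermatDG
end

noncomputable section

namespace FermatDG

open Opposite Category

variable {T : RationalFermatTheory.{u}}

instance {A B : TAlg T} : CoeFun (A ⟶ B) fun _ => A.carrier → B.carrier := ⟨fun f => f.toAlgHom⟩
instance {A B : TDGA T} : CoeFun (A ⟶ B) fun _ => A.carrier → B.carrier := ⟨fun f => f.toAlgHom⟩

lemma TAlg.congr_toAlgHom {A B : TAlg T} {f g : A ⟶ B} (h : f = g) (x : A.carrier) :
    f x = g x := by rw [h]

lemma TDGA.congr_toAlgHom {A B : TDGA T} {f g : A ⟶ B} (h : f = g) (x : A.carrier) :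
    f x = g x := by rw [h]

/-! ### Building gradings and differential graded algebras -/

/-- The homogeneous components of elements of a differential graded algebra. -/
def CDGA.pr (A : CDGA.{u}) (i : ℕ) : A.carrier →ₗ[ℚ] A.carrier := GradedAlgebra.proj A.deg i

namespace CDGA

variable (A : CDGA.{u})

lemma pr_mem (i : ℕ) (x : A.carrier) : A.pr i x ∈ A.deg i := by
  rw [pr, GradedAlgebra.proj_apply]; exact SetLike.coe_mem _

lemma pr_of_mem {i : ℕ} {x : A.carrier} (hx : x ∈ A.deg i) : A.pr i x = x := by
  rw [pr, GradedAlgebra.proj_apply]; exact DirectSum.decompose_of_mem_same _ hx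

lemma pr_of_mem_ne {i j : ℕ} {x : A.carrier} (hx : x ∈ A.deg i) (h : i ≠ j) : A.pr j x = 0 := by
  rw [pr, GradedAlgebra.proj_apply]; exact DirectSum.decompose_of_mem_ne _ hx h

lemma mem_deg_iff {i : ℕ} {x : A.carrier} : x ∈ A.deg i ↔ A.pr i x = x :=
  ⟨A.pr_of_mem, fun h => h ▸ A.pr_mem i x⟩

open Classical in
lemma exists_bound (x : A.carrier) : ∃ N, ∀ i, N ≤ i → A.pr i x = 0 := by
  refine ⟨(DirectSum.decompose A.deg x).support.sup id + 1, fun i hi => ?_⟩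
  rw [pr, GradedAlgebra.proj_apply]
  by_contra h
  have hi' : i ∈ (DirectSum.decompose A.deg x).support := by
    rw [DFinsupp.mem_support_iff]
    exact fun h' => h (by rw [h']; rfl)
  have := Finset.le_sup (f := id) hi'
  simp only [id] at this
  omega

open Classical in
lemma sum_pr (x : A.carrier) {N : ℕ} (hN : ∀ i, N ≤ i → A.pr i x = 0) :
    x = ∑ i ∈ Finset.range N, A.pr i x := by
  conv_lhs => rw [← DirectSum.sum_support_decompose A.deg x]
  refine Finset.sum_subset_zero_on_sdiff ?_ ?_ fun _ _ => rfl
  · intro i hi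
    rw [DFinsupp.mem_support_iff] at hi
    by_contra h
    refine hi (Subtype.ext ?_)
    have := hN i (by simpa using h)
    rwa [pr, GradedAlgebra.proj_apply] at this
  · intro i hi
    have : DirectSum.decompose A.deg x i = 0 := by simpa using (Finset.mem_sdiff.1 hi).2
    rw [pr, GradedAlgebra.proj_apply, this]; rfl

lemma mul_mem {i j : ℕ} {a b : A.carrier} (ha : a ∈ A.deg i) (hb : b ∈ A.deg j) :
    a * b ∈ A.deg (i + j) := SetLike.GradedMul.mul_mem ha hb

lemma one_mem : (1 : A.carrier) ∈ A.deg 0 := SetLike.GradedOne.one_mem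

lemma algebraMap_mem (q : ℚ) : algebraMap ℚ A.carrier q ∈ A.deg 0 := by
  rw [Algebra.algebraMap_eq_smul_one]; exact Submodule.smul_mem _ _ A.one_mem

@[elab_as_elim]
lemma hom_induction {P : A.carrier → Prop} (zero : P 0)
    (homog : ∀ (i : ℕ) (a : A.carrier), a ∈ A.deg i → P a)
    (add : ∀ a b, P a → P b → P (a + b)) (x : A.carrier) : P x := by
  obtain ⟨N, hN⟩ := A.exists_bound x
  rw [A.sum_pr x hN]
  exact Finset.sum_induction _ P add zero fun i _ => homog i _ (A.pr_mem i x)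

lemma pr_d (i : ℕ) (x : A.carrier) : A.pr i (A.d x) = A.d (A.pr (i + 1) x) := by
  induction x using A.hom_induction with
  | zero => simp
  | add a b ha hb => simp [ha, hb]
  | homog j a ha =>
    cases j with
    | zero => rw [A.d_zero ha, map_zero, A.pr_of_mem_ne ha (by omega), map_zero]
    | succ j =>
      by_cases h : j = i
      · subst h; rw [A.pr_of_mem ha, A.pr_of_mem (A.d_mem ha)]
      · rw [A.pr_of_mem_ne ha (by omega), A.pr_of_mem_ne (A.d_mem ha) h, map_zero]

lemma pr_pr (i j : ℕ) (x : A.carrier) : A.pr i (A.pr j x) = if i = j then A.pr j x else 0 := by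
  split_ifs with h
  · subst h; exact A.pr_of_mem (A.pr_mem _ _)
  · exact A.pr_of_mem_ne (A.pr_mem _ _) (Ne.symm h)

end CDGA

/-- Projections onto homogeneous components, for a grading of an algebra. -/
structure ProjGrading (R : Type u) [Ring R] [Algebra ℚ R] where
  pr : ℕ → R →ₗ[ℚ] R
  pr_pr : ∀ i j x, pr i (pr j x) = if i = j then pr j x else 0
  bound : ∀ x, ∃ N, x = ∑ i ∈ Finset.range N, pr i x
  one : pr 0 1 = 1
  mul : ∀ i j x y, pr i x = x → pr j y = y → pr (i + j) (x * y) = x * y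

namespace ProjGrading

variable {R : Type u} [Ring R] [Algebra ℚ R] (G : ProjGrading R)

def deg (i : ℕ) : Submodule ℚ R := LinearMap.eqLocus (G.pr i) LinearMap.id

lemma mem_deg {i : ℕ} {x : R} : x ∈ G.deg i ↔ G.pr i x = x := Iff.rfl

lemma pr_mem (i : ℕ) (x : R) : G.pr i x ∈ G.deg i := by
  rw [mem_deg, G.pr_pr, if_pos rfl]

lemma coe_apply (y : DirectSum ℕ fun i => G.deg i) (i : ℕ) :
    (y i : R) = G.pr i (DirectSum.coeAddMonoidHom G.deg y) := by
  induction y using DirectSum.induction_on with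
  | zero => simp
  | of j y =>
    rw [DirectSum.coeAddMonoidHom_of]
    by_cases h : j = i
    · subst h; rw [DirectSum.of_eq_same]; exact y.2.symm
    · rw [DirectSum.of_eq_of_ne _ _ _ (Ne.symm h)]
      have hy : G.pr j y = y := y.2
      rw [← hy, G.pr_pr, if_neg (Ne.symm h)]; rfl
  | add x y hx hy => rw [DirectSum.add_apply, map_add, map_add, ← hx, ← hy]; rfl

lemma bijective : Function.Bijective (DirectSum.coeAddMonoidHom G.deg) := by
  constructor
  · intro x y h
    refine DFinsupp.ext fun i => Subtype.ext ?_
    rw [G.coe_apply, G.coe_apply, h]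
  · intro x
    obtain ⟨N, hN⟩ := G.bound x
    refine ⟨∑ i ∈ Finset.range N, DirectSum.of (fun i => G.deg i) i ⟨G.pr i x, G.pr_mem i x⟩, ?_⟩
    rw [map_sum]
    simp only [DirectSum.coeAddMonoidHom_of]
    exact hN.symm

instance gradedAlgebra : GradedAlgebra G.deg where
  one_mem := G.one
  mul_mem _ _ _ _ ha hb := G.mul _ _ _ _ ha hb
  toDecomposition := DirectSum.IsInternal.chooseDecomposition _ G.bijective

end ProjGrading

namespace TDGA

lemma map_pr {A B : TDGA T} (f : A ⟶ B) (i : ℕ) (x : A.carrier) :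
    f (A.pr i x) = B.pr i (f x) := by
  induction x using A.hom_induction with
  | zero => simp
  | add a b ha hb => simp [ha, hb]
  | homog j a ha =>
    by_cases h : j = i
    · subst h; rw [A.pr_of_mem ha, B.pr_of_mem (f.map_deg ha)]
    · rw [A.pr_of_mem_ne ha h, B.pr_of_mem_ne (f.map_deg ha) h, map_zero]

@[simp] lemma comp_apply {A B C : TDGA T} (f : A ⟶ B) (g : B ⟶ C) (x : A.carrier) :
    (f ≫ g) x = g (f x) := rfl

@[simp] lemma id_apply {A : TDGA T} (x : A.carrier) : (𝟙 A : A ⟶ A) x = x := rfl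

/-- A graded-commutative algebra which embeds into a product of differential graded
`T`-algebras, such that the image is closed under all operations. -/
structure Emb {K : Type w} (M : K → TDGA T) where
  R : Type u
  [ring : Ring R]
  [algebra : Algebra ℚ R]
  v : ∀ k, R →ₐ[ℚ] (M k).carrier
  inj : ∀ {x y : R}, (∀ k, v k x = v k y) → x = y
  d_cl : ∀ x, ∃ y, ∀ k, v k y = (M k).d (v k x)
  pr_cl : ∀ i x, ∃ y, ∀ k, v k y = (M k).pr i (v k x)
  bdd : ∀ x, ∃ N, ∀ i, N ≤ i → ∀ k, (M k).pr i (v k x) = 0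
  op_cl : ∀ {n : ℕ} (φ : T.Op n) (a : Fin n → R) (ha : ∀ j k, v k (a j) ∈ (M k).deg 0),
    ∃ y, ∀ k, v k y = (M k).str.op φ (fun j => ⟨v k (a j), ha j k⟩)

namespace Emb

variable {K : Type w} {M : K → TDGA T} (S : Emb M)

instance : Ring S.R := S.ring
instance : Algebra ℚ S.R := S.algebra

def d : S.R →ₗ[ℚ] S.R where
  toFun x := (S.d_cl x).choose
  map_add' x y := S.inj fun k => by
    rw [map_add, (S.d_cl _).choose_spec, (S.d_cl _).choose_spec, (S.d_cl _).choose_spec,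
      map_add, map_add]
  map_smul' q x := S.inj fun k => by
    rw [(S.d_cl _).choose_spec, map_smul, map_smul, map_smul, (S.d_cl _).choose_spec]; rfl

lemma v_d (k : K) (x : S.R) : S.v k (S.d x) = (M k).d (S.v k x) := (S.d_cl x).choose_spec k

def pr (i : ℕ) : S.R →ₗ[ℚ] S.R where
  toFun x := (S.pr_cl i x).choose
  map_add' x y := S.inj fun k => by
    rw [map_add, (S.pr_cl _ _).choose_spec, (S.pr_cl _ _).choose_spec, (S.pr_cl _ _).choose_spec,
      map_add, map_add]
  map_smul' q x := S.inj fun k => by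
    rw [(S.pr_cl _ _).choose_spec, map_smul, map_smul, map_smul, (S.pr_cl _ _).choose_spec]; rfl

lemma v_pr (k : K) (i : ℕ) (x : S.R) : S.v k (S.pr i x) = (M k).pr i (S.v k x) :=
  (S.pr_cl i x).choose_spec k

def grading : ProjGrading S.R where
  pr := S.pr
  pr_pr i j x := S.inj fun k => by
    rw [v_pr, v_pr, CDGA.pr_pr]
    split_ifs
    · rw [v_pr]
    · rw [map_zero]
  bound x := by
    obtain ⟨N, hN⟩ := S.bdd x
    refine ⟨N, S.inj fun k => ?_⟩
    rw [map_sum]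
    simp only [v_pr]
    exact (M k).sum_pr _ fun i hi => hN i hi k
  one := S.inj fun k => by rw [v_pr, map_one]; exact (M k).pr_of_mem (M k).one_mem
  mul i j x y hx hy := S.inj fun k => by
    rw [v_pr, map_mul]
    refine (M k).pr_of_mem ((M k).mul_mem ?_ ?_)
    · rw [CDGA.mem_deg_iff, ← v_pr, hx]
    · rw [CDGA.mem_deg_iff, ← v_pr, hy]

lemma mem_deg {i : ℕ} {x : S.R} : x ∈ S.grading.deg i ↔ ∀ k, S.v k x ∈ (M k).deg i := by
  rw [ProjGrading.mem_deg]
  constructor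
  · intro h k
    rw [CDGA.mem_deg_iff, ← v_pr]
    exact congrArg _ h
  · intro h
    exact S.inj fun k => (S.v_pr k i x).trans ((M k).pr_of_mem (h k))

def toCDGA : CDGA.{u} where
  carrier := S.R
  deg := S.grading.deg
  graded_comm {i j a b} ha hb := S.inj fun k => by
    rw [mem_deg] at ha hb
    rw [map_mul, (M k).graded_comm (ha k) (hb k)]; simp
  d := S.d
  d_mem h := by
    rw [mem_deg] at h ⊢
    intro k; rw [v_d]; exact (M k).d_mem (h k)
  d_zero h := by
    rw [mem_deg] at h
    exact S.inj fun k => by rw [v_d, (M k).d_zero (h k), map_zero]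
  d_d x := S.inj fun k => by rw [v_d, v_d, (M k).d_d, map_zero]
  leibniz {i a} b h := by
    rw [mem_deg] at h
    exact S.inj fun k => by rw [v_d, map_mul, (M k).leibniz _ (h k)]; simp [v_d]

def zero (k : K) : S.toCDGA.deg 0 →ₐ[ℚ] (M k).deg 0 where
  toFun a := ⟨S.v k a.1, S.mem_deg.1 a.2 k⟩
  map_one' := Subtype.ext (map_one (S.v k))
  map_mul' a b := Subtype.ext (map_mul (S.v k) a.1 b.1)
  map_zero' := Subtype.ext (map_zero (S.v k))
  map_add' a b := Subtype.ext (map_add (S.v k) a.1 b.1)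
  commutes' q := Subtype.ext ((S.v k).commutes q)

lemma zero_inj {a b : S.toCDGA.deg 0} (h : ∀ k, S.zero k a = S.zero k b) : a = b :=
  Subtype.ext (S.inj fun k => congrArg Subtype.val (h k))

lemma exists_op {n : ℕ} (φ : T.Op n) (a : Fin n → S.toCDGA.deg 0) :
    ∃ y : S.toCDGA.deg 0, ∀ k, S.zero k y = (M k).str.op φ (fun j => S.zero k (a j)) := by
  obtain ⟨y, hy⟩ := S.op_cl φ (fun j => (a j).1) (fun j k => S.mem_deg.1 (a j).2 k)
  refine ⟨⟨y, S.mem_deg.2 fun k => ?_⟩, fun k => Subtype.ext (hy k)⟩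
  rw [hy]; exact SetLike.coe_mem _

/-- The differential graded `T`-algebra given by an embedding. -/
def toTDGA : TDGA T where
  toCDGA := S.toCDGA
  str :=
    { op := fun φ a => (S.exists_op φ a).choose
      op_var := fun i a => S.zero_inj fun k => by
        rw [(S.exists_op _ a).choose_spec, (M k).str.op_var]
      op_subst := fun f g a => S.zero_inj fun k => by
        rw [(S.exists_op _ _).choose_spec, (S.exists_op _ _).choose_spec, (M k).str.op_subst]
        congr 1
        funext i
        rw [(S.exists_op _ _).choose_spec]
      op_poly := fun p a => S.zero_inj fun k => by
        rw [(S.exists_op _ _).choose_spec, (M k).str.op_poly]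
        exact (MvPolynomial.comp_aeval_apply a (S.zero k) p).symm }

def proj (k : K) : S.toTDGA ⟶ M k where
  toAlgHom := S.v k
  map_deg h := S.mem_deg.1 h k
  map_d x := S.v_d k x
  map_op φ a := congrArg Subtype.val ((S.exists_op φ a).choose_spec k)

lemma proj_ext {x y : S.toTDGA.carrier} (h : ∀ k, (S.proj k) x = (S.proj k) y) :
    x = y := S.inj h

lemma mem_deg_iff {i : ℕ} {x : S.toTDGA.carrier} :
    x ∈ S.toTDGA.deg i ↔ ∀ k, (S.proj k) x ∈ (M k).deg i := S.mem_deg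

lemma hom_proj_ext {X : TDGA T} {f g : X ⟶ S.toTDGA} (h : ∀ k, f ≫ S.proj k = g ≫ S.proj k) :
    f = g :=
  TDGA.hom_ext fun a => S.proj_ext fun k => congr_toAlgHom (h k) a

/-- Algebra homomorphisms into the algebra given by an embedding. -/
def liftAlg {X : Type u} [Ring X] [Algebra ℚ X] (f : ∀ k, X →ₐ[ℚ] (M k).carrier)
    (h : ∀ x, ∃ y, ∀ k, S.v k y = f k x) : X →ₐ[ℚ] S.R where
  toFun x := (h x).choose
  map_one' := S.inj fun k => by rw [(h _).choose_spec, map_one, map_one]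
  map_mul' x y := S.inj fun k => by
    rw [map_mul, (h _).choose_spec, (h _).choose_spec, (h _).choose_spec, map_mul]
  map_zero' := S.inj fun k => by rw [(h _).choose_spec, map_zero, map_zero]
  map_add' x y := S.inj fun k => by
    rw [map_add, (h _).choose_spec, (h _).choose_spec, (h _).choose_spec, map_add]
  commutes' q := S.inj fun k => by
    rw [(h _).choose_spec, AlgHom.commutes]; exact ((S.v k).commutes q).symm

/-- Morphisms into the differential graded algebra given by an embedding. -/
def lift {X : TDGA T} (f : ∀ k, X ⟶ M k) (h : ∀ x, ∃ y, ∀ k, S.v k y = (f k) x) :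
    X ⟶ S.toTDGA where
  toAlgHom := S.liftAlg (fun k => (f k).toAlgHom) h
  map_deg {i x} hx := S.mem_deg.2 fun k => by
    change S.v k (h x).choose ∈ _
    rw [(h x).choose_spec]; exact (f k).map_deg hx
  map_d x := S.inj fun k => by
    change S.v k (h _).choose = S.v k (S.d (h x).choose)
    rw [(h _).choose_spec, S.v_d, (h _).choose_spec, (f k).map_d]
  map_op φ a := S.inj fun k => by
    change S.v k (h _).choose = _
    rw [(h _).choose_spec, (f k).map_op]
    refine Eq.trans ?_ ((S.proj k).map_op φ _).symm
    congr 2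
    funext j
    exact Subtype.ext ((h (a j)).choose_spec k).symm

lemma proj_lift_apply {X : TDGA T} (f : ∀ k, X ⟶ M k)
    (h : ∀ x, ∃ y, ∀ k, S.v k y = (f k) x) (k : K) (x : X.carrier) :
    (S.proj k) ((S.lift f h) x) = (f k) x := (h x).choose_spec k

@[simp]
lemma lift_proj {X : TDGA T} (f : ∀ k, X ⟶ M k)
    (h : ∀ x, ∃ y, ∀ k, S.v k y = (f k) x) (k : K) : S.lift f h ≫ S.proj k = f k :=
  TDGA.hom_ext fun x => S.proj_lift_apply f h k x

end Emb

end TDGA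

lemma CDGA.pr_mul_eq_zero (A : CDGA.{u}) {x y : A.carrier} {N N' : ℕ}
    (hx : ∀ i, N ≤ i → A.pr i x = 0) (hy : ∀ i, N' ≤ i → A.pr i y = 0) (i : ℕ)
    (hi : N + N' ≤ i) : A.pr i (x * y) = 0 := by
  rw [A.sum_pr x hx, A.sum_pr y hy, Finset.sum_mul_sum, map_sum]
  refine Finset.sum_eq_zero fun j hj => ?_
  rw [map_sum]
  refine Finset.sum_eq_zero fun k hk => ?_
  rw [Finset.mem_range] at hj hk
  exact A.pr_of_mem_ne (A.mul_mem (A.pr_mem _ _) (A.pr_mem _ _)) (by omega)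

namespace TDGA

/-- The action of a morphism of differential graded `T`-algebras on operations, on elements. -/
lemma op_congr (A : TDGA T) {n : ℕ} (φ : T.Op n) {a b : Fin n → A.deg 0}
    (h : ∀ i, (a i : A.carrier) = b i) : A.str.op φ a = A.str.op φ b :=
  congrArg _ (funext fun i => Subtype.ext (h i))

/-! ### Limits -/

/-- A family of differential graded `T`-algebras with equational constraints on families of
elements. -/
structure LimData (T : RationalFermatTheory.{u}) (K C : Type u) where
  M : K → TDGA T
  N : C → TDGA T
  a : C → K
  b : C → K
  f : ∀ c, M (a c) ⟶ N c
  g : ∀ c, M (b c) ⟶ N c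

namespace LimData

variable {K C : Type u} (D : LimData T K C)

def subalgebra : Subalgebra ℚ (∀ k, (D.M k).carrier) where
  carrier := {x | (∃ N, ∀ i, N ≤ i → ∀ k, (D.M k).pr i (x k) = 0) ∧
    ∀ c, (D.f c) (x (D.a c)) = (D.g c) (x (D.b c))}
  mul_mem' := by
    rintro x y ⟨⟨N, hN⟩, hx⟩ ⟨⟨N', hN'⟩, hy⟩
    refine ⟨⟨N + N', fun i hi k => ?_⟩, fun c => ?_⟩
    · exact (D.M k).pr_mul_eq_zero (fun i hi => hN i hi k) (fun i hi => hN' i hi k) i hi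
    · simp [hx, hy]
  add_mem' := by
    rintro x y ⟨⟨N, hN⟩, hx⟩ ⟨⟨N', hN'⟩, hy⟩
    refine ⟨⟨N + N', fun i hi k => ?_⟩, fun c => ?_⟩
    · rw [Pi.add_apply, map_add, hN i (by omega), hN' i (by omega), add_zero]
    · simp [hx, hy]
  algebraMap_mem' q := by
    refine ⟨⟨1, fun i hi k => ?_⟩, fun c => ?_⟩
    · exact (D.M k).pr_of_mem_ne ((D.M k).algebraMap_mem q) (by omega)
    · simp

def emb : Emb D.M where
  R := D.subalgebra
  v k := (Pi.evalAlgHom ℚ (fun k => (D.M k).carrier) k).comp D.subalgebra.val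
  inj h := Subtype.ext (funext h)
  d_cl := by
    rintro ⟨x, ⟨N, hN⟩, hx⟩
    refine ⟨⟨fun k => (D.M k).d (x k), ⟨N, fun i hi k => ?_⟩, fun c => ?_⟩, fun k => rfl⟩
    · rw [CDGA.pr_d, hN _ (by omega), map_zero]
    · rw [(D.f c).map_d, (D.g c).map_d, hx]
  pr_cl := by
    rintro j ⟨x, ⟨N, hN⟩, hx⟩
    refine ⟨⟨fun k => (D.M k).pr j (x k), ⟨N, fun i hi k => ?_⟩, fun c => ?_⟩, fun k => rfl⟩
    · rw [CDGA.pr_pr]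
      split_ifs with h
      · subst h; exact hN i hi k
      · rfl
    · rw [map_pr, map_pr, hx]
  bdd x := x.2.1
  op_cl {n} φ a ha := by
    refine ⟨⟨fun k => (D.M k).str.op φ fun j => ⟨(a j).1 k, ha j k⟩, ⟨1, fun i hi k => ?_⟩,
      fun c => ?_⟩, fun k => rfl⟩
    · exact (D.M k).pr_of_mem_ne (SetLike.coe_mem _) (by omega)
    · rw [(D.f c).map_op, (D.g c).map_op]
      exact congrArg _ ((D.N c).op_congr φ fun j => (a j).2.2 c)

/-- The differential graded `T`-algebra of families of elements which satisfy the constraints. -/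
def lim : TDGA T := D.emb.toTDGA

def π (k : K) : D.lim ⟶ D.M k := D.emb.proj k

lemma condition (c : C) : D.π (D.a c) ≫ D.f c = D.π (D.b c) ≫ D.g c :=
  TDGA.hom_ext fun x => (Subtype.property (p := (· ∈ D.subalgebra)) x).2 c

lemma ext {x y : D.lim.carrier} (h : ∀ k, (D.π k) x = (D.π k) y) : x = y :=
  D.emb.proj_ext h

lemma hom_ext {X : TDGA T} {f g : X ⟶ D.lim} (h : ∀ k, f ≫ D.π k = g ≫ D.π k) : f = g :=
  D.emb.hom_proj_ext h

lemma mem_deg {i : ℕ} {x : D.lim.carrier} :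
    x ∈ D.lim.deg i ↔ ∀ k, (D.π k) x ∈ (D.M k).deg i := D.emb.mem_deg_iff

lemma exists_mk (x : ∀ k, (D.M k).carrier) (hb : ∃ N, ∀ i, N ≤ i → ∀ k, (D.M k).pr i (x k) = 0)
    (hx : ∀ c, (D.f c) (x (D.a c)) = (D.g c) (x (D.b c))) :
    ∃ y : D.lim.carrier, ∀ k, (D.π k) y = x k :=
  ⟨(⟨x, hb, hx⟩ : D.subalgebra), fun _ => rfl⟩

lemma exists_mk_deg {i : ℕ} (x : ∀ k, (D.M k).carrier) (hd : ∀ k, x k ∈ (D.M k).deg i)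
    (hx : ∀ c, (D.f c) (x (D.a c)) = (D.g c) (x (D.b c))) :
    ∃ y ∈ D.lim.deg i, ∀ k, (D.π k) y = x k := by
  obtain ⟨y, hy⟩ := D.exists_mk x ⟨i + 1, fun j hj k => (D.M k).pr_of_mem_ne (hd k) (by omega)⟩ hx
  exact ⟨y, D.mem_deg.2 fun k => by rw [hy]; exact hd k, hy⟩

def lift {X : TDGA T} (h : ∀ k, X ⟶ D.M k) (hc : ∀ c, h (D.a c) ≫ D.f c = h (D.b c) ≫ D.g c) :
    X ⟶ D.lim :=
  D.emb.lift h fun x => by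
    obtain ⟨N, hN⟩ := X.exists_bound x
    exact D.exists_mk _ ⟨N, fun i hi k => by rw [← map_pr, hN i hi, map_zero]⟩ fun c =>
      congr_toAlgHom (hc c) x

@[simp]
lemma lift_π {X : TDGA T} (h : ∀ k, X ⟶ D.M k)
    (hc : ∀ c, h (D.a c) ≫ D.f c = h (D.b c) ≫ D.g c) (k : K) : D.lift h hc ≫ D.π k = h k :=
  D.emb.lift_proj _ _ _

end LimData

section Pullback

variable {X Y Z : TDGA T} (f : X ⟶ Z) (g : Y ⟶ Z)

def pbData : LimData T (ULift.{u} Bool) PUnit.{u + 1} where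
  M b := Bool.rec Y X b.down
  N _ := Z
  a _ := ⟨true⟩
  b _ := ⟨false⟩
  f _ := f
  g _ := g

/-- The fibre product of differential graded `T`-algebras. -/
def pb : TDGA T := (pbData f g).lim

def pbFst : pb f g ⟶ X := (pbData f g).π ⟨true⟩

def pbSnd : pb f g ⟶ Y := (pbData f g).π ⟨false⟩

lemma pb_condition : pbFst f g ≫ f = pbSnd f g ≫ g := (pbData f g).condition ⟨⟩

variable {f g}

lemma pb_ext {x y : (pb f g).carrier} (h : (pbFst f g) x = (pbFst f g) y)
    (h' : (pbSnd f g) x = (pbSnd f g) y) : x = y :=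
  (pbData f g).ext fun b => b.casesOn (Bool.rec h' h)

lemma pb_hom_ext {W : TDGA T} {x y : W ⟶ pb f g} (h : x ≫ pbFst f g = y ≫ pbFst f g)
    (h' : x ≫ pbSnd f g = y ≫ pbSnd f g) : x = y :=
  (pbData f g).hom_ext fun b => b.casesOn (Bool.rec h' h)

lemma pb_mk {i : ℕ} {x : X.carrier} {y : Y.carrier} (hx : x ∈ X.deg i) (hy : y ∈ Y.deg i)
    (h : f x = g y) :
    ∃ z ∈ (pb f g).deg i, (pbFst f g) z = x ∧ (pbSnd f g).toAlgHom z = y := by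
  obtain ⟨z, hz, h'⟩ := (pbData f g).exists_mk_deg (i := i)
    (fun b => Bool.rec (motive := fun b => ((pbData f g).M ⟨b⟩).carrier) y x b.down)
    (fun b => by obtain ⟨_ | _⟩ := b <;> assumption) (fun _ => h)
  exact ⟨z, hz, h' ⟨true⟩, h' ⟨false⟩⟩

def pbLift {W : TDGA T} (x : W ⟶ X) (y : W ⟶ Y) (h : x ≫ f = y ≫ g) : W ⟶ pb f g :=
  (pbData f g).lift (fun b => Bool.rec (motive := fun b => W ⟶ (pbData f g).M ⟨b⟩) y x b.down)
    fun _ => h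

@[simp]
lemma pbLift_fst {W : TDGA T} (x : W ⟶ X) (y : W ⟶ Y) (h : x ≫ f = y ≫ g) :
    pbLift x y h ≫ pbFst f g = x := (pbData f g).lift_π _ _ ⟨true⟩

@[simp]
lemma pbLift_snd {W : TDGA T} (x : W ⟶ X) (y : W ⟶ Y) (h : x ≫ f = y ≫ g) :
    pbLift x y h ≫ pbSnd f g = y := (pbData f g).lift_π _ _ ⟨false⟩

end Pullback

/-! ### Quasi-isomorphisms and trivial fibrations -/

section Homology

variable {A B C : TDGA T}

lemma d_mem_cycles {i : ℕ} {x : A.carrier} (h : x ∈ A.deg (i + 1)) : A.d x ∈ A.cycles i :=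
  ⟨A.d_mem h, A.d_d x⟩

lemma map_cycles (f : A ⟶ B) {i : ℕ} {x : A.carrier} (h : x ∈ A.cycles i) :
    f x ∈ B.cycles i := (cyclesMap f i ⟨x, h⟩).2

lemma homologyMap_comp (f : A ⟶ B) (g : B ⟶ C) (i : ℕ) :
    homologyMap (f ≫ g) i = homologyMap g i ∘ₗ homologyMap f i := by
  ext x; rfl

lemma homologyMap_id (i : ℕ) : homologyMap (𝟙 A) i = LinearMap.id := by
  ext x; rfl

lemma QuasiIso.id : QuasiIso (𝟙 A) := fun i => by
  rw [homologyMap_id]; exact Function.bijective_id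

lemma QuasiIso.comp {f : A ⟶ B} {g : B ⟶ C} (hf : QuasiIso f) (hg : QuasiIso g) :
    QuasiIso (f ≫ g) := fun i => by
  rw [homologyMap_comp, LinearMap.coe_comp]; exact (hg i).comp (hf i)

lemma QuasiIso.of_comp_left {f : A ⟶ B} {g : B ⟶ C} (hf : QuasiIso f) (h : QuasiIso (f ≫ g)) :
    QuasiIso g := fun i => by
  have := h i
  rw [homologyMap_comp, LinearMap.coe_comp] at this
  exact (Function.Bijective.of_comp_iff _ (hf i)).1 this

lemma QuasiIso.of_comp_right {f : A ⟶ B} {g : B ⟶ C} (hg : QuasiIso g) (h : QuasiIso (f ≫ g)) :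
    QuasiIso f := fun i => by
  have := h i
  rw [homologyMap_comp, LinearMap.coe_comp] at this
  exact (Function.Bijective.of_comp_iff' (hg i) _).1 this

/-- Quasi-isomorphisms are closed under retracts of the target, under the source. -/
lemma QuasiIso.of_retract {f : A ⟶ B} {g : A ⟶ C} (hg : QuasiIso g) (s : B ⟶ C) (r : C ⟶ B)
    (hs : f ≫ s = g) (hr : s ≫ r = 𝟙 B) : QuasiIso f := fun i => by
  have hsr : ∀ x, homologyMap r i (homologyMap s i x) = x := fun x => by
    have := congrArg (fun q => q x) (homologyMap_comp s r i)
    rw [hr, homologyMap_id] at this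
    exact this.symm
  have hfs : ∀ x, homologyMap s i (homologyMap f i x) = homologyMap g i x := fun x => by
    have := congrArg (fun q => q x) (homologyMap_comp f s i)
    rw [hs] at this
    exact this.symm
  constructor
  · intro x y h
    apply (hg i).1
    rw [← hfs, ← hfs, h]
  · intro y
    obtain ⟨x, hx⟩ := (hg i).2 (homologyMap s i y)
    refine ⟨x, ?_⟩
    rw [← hsr y, ← hx, ← hfs, hsr]

lemma homology_mk_eq_zero {i : ℕ} (z : A.cycles i) :
    (Submodule.Quotient.mk z : A.H i) = 0 ↔ ∃ v ∈ A.deg (i + 1), A.d v = z :=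
  Submodule.Quotient.mk_eq_zero _

lemma homology_mk_eq {i : ℕ} (z z' : A.cycles i) :
    (Submodule.Quotient.mk z : A.H i) = Submodule.Quotient.mk z' ↔
      ∃ v ∈ A.deg (i + 1), A.d v = (z : A.carrier) - z' :=
  Submodule.Quotient.eq _

lemma quasiIso_iff {f : A ⟶ B} : QuasiIso f ↔
    (∀ i, ∀ z ∈ A.cycles i, ∀ w ∈ B.deg (i + 1), B.d w = f z →
      ∃ v ∈ A.deg (i + 1), A.d v = z) ∧
    ∀ i, ∀ z ∈ B.cycles i, ∃ x ∈ A.cycles i, ∃ w ∈ B.deg (i + 1), B.d w = f x - z := by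
  constructor
  · refine fun h => ⟨fun i z hz w hw hwz => ?_, fun i z hz => ?_⟩
    · refine (homology_mk_eq_zero ⟨z, hz⟩).1 ((injective_iff_map_eq_zero (homologyMap f i)).1
        (h i).1 _ ?_)
      exact (homology_mk_eq_zero (cyclesMap f i ⟨z, hz⟩)).2 ⟨w, hw, hwz⟩
    · obtain ⟨x, hx⟩ := (h i).2 (Submodule.Quotient.mk ⟨z, hz⟩)
      obtain ⟨x, rfl⟩ := Submodule.Quotient.mk_surjective _ x
      obtain ⟨w, hw, h⟩ := (homology_mk_eq (cyclesMap f i x) ⟨z, hz⟩).1 hx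
      exact ⟨x, x.2, w, hw, h⟩
  · rintro ⟨h1, h2⟩ i
    constructor
    · rw [injective_iff_map_eq_zero]
      intro x hx
      obtain ⟨x, rfl⟩ := Submodule.Quotient.mk_surjective _ x
      obtain ⟨w, hw, h⟩ := (homology_mk_eq_zero (cyclesMap f i x)).1 hx
      exact (homology_mk_eq_zero x).2 (h1 i x x.2 w hw h)
    · intro z
      obtain ⟨z, rfl⟩ := Submodule.Quotient.mk_surjective _ z
      obtain ⟨x, hx, w, hw, h⟩ := h2 i z z.2
      exact ⟨Submodule.Quotient.mk ⟨x, hx⟩, (homology_mk_eq (cyclesMap f i ⟨x, hx⟩) z).2 ⟨w, hw, h⟩⟩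

/-- An elementwise form of trivial fibrations. -/
def IsTF (p : A ⟶ B) : Prop :=
  (∀ b ∈ B.deg 0, ∃ a ∈ A.deg 0, p a = b) ∧
  ∀ i, ∀ z ∈ A.cycles i, ∀ w ∈ B.deg (i + 1), B.d w = p z →
    ∃ v ∈ A.deg (i + 1), A.d v = z ∧ p.toAlgHom v = w

lemma IsTF.exists_cycle {p : A ⟶ B} (h : IsTF p) {i : ℕ} {z : B.carrier} (hz : z ∈ B.cycles i) :
    ∃ x ∈ A.cycles i, p x = z := by
  cases i with
  | zero =>
    obtain ⟨a, ha, rfl⟩ := h.1 z hz.1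
    exact ⟨a, ⟨ha, A.d_zero ha⟩, rfl⟩
  | succ i =>
    obtain ⟨v, hv, hv0, rfl⟩ := h.2 i 0 (zero_mem _) z hz.1 (by rw [map_zero]; exact hz.2)
    exact ⟨v, ⟨hv, hv0⟩, rfl⟩

lemma IsTF.exists_lift {p : A ⟶ B} (h : IsTF p) {i : ℕ} {b : B.carrier} (hb : b ∈ B.deg i) :
    ∃ x ∈ A.deg i, p x = b := by
  cases i with
  | zero => exact h.1 b hb
  | succ i =>
    obtain ⟨z, hz, hzb⟩ := h.exists_cycle (d_mem_cycles hb)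
    obtain ⟨v, hv, -, hv'⟩ := h.2 i z hz b hb hzb.symm
    exact ⟨v, hv, hv'⟩

lemma IsTF.isFibration {p : A ⟶ B} (h : IsTF p) : IsFibration p := fun _ _ hb => h.exists_lift hb

lemma IsTF.quasiIso {p : A ⟶ B} (h : IsTF p) : QuasiIso p := by
  refine quasiIso_iff.2 ⟨fun i z hz w hw hwz => ?_, fun i z hz => ?_⟩
  · obtain ⟨v, hv, hvz, -⟩ := h.2 i z hz w hw hwz
    exact ⟨v, hv, hvz⟩
  · obtain ⟨x, hx, rfl⟩ := h.exists_cycle hz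
    exact ⟨x, hx, 0, zero_mem _, by simp⟩

lemma isTF_of {p : A ⟶ B} (hp : IsFibration p) (hq : QuasiIso p) : IsTF p := by
  obtain ⟨h1, h2⟩ := quasiIso_iff.1 hq
  constructor
  · intro b hb
    obtain ⟨x, hx, w, hw, h⟩ := h2 0 b ⟨hb, B.d_zero hb⟩
    obtain ⟨y, hy, rfl⟩ := hp 0 w hw
    refine ⟨x - A.d y, sub_mem hx.1 (A.d_mem hy), ?_⟩
    rw [map_sub, p.map_d, h]; simp
  · intro i z hz w hw hwz
    obtain ⟨v, hv, rfl⟩ := h1 i z hz w hw hwz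
    obtain ⟨x, hx, u, hu, h⟩ := h2 (i + 1) (p v - w) ⟨sub_mem (p.map_deg hv) hw, by
      change B.d _ = 0
      rw [map_sub, ← p.map_d, hwz, sub_self]⟩
    obtain ⟨y, hy, rfl⟩ := hp (i + 1) u hu
    refine ⟨v - x + A.d y, add_mem (sub_mem hv hx.1) (A.d_mem hy), ?_, ?_⟩
    · have hx0 : A.d x = 0 := hx.2
      simp [A.d_d, hx0]
    · rw [map_add, map_sub, p.map_d, h]; abel

lemma IsTF.pb {X Y Z : TDGA T} {f : X ⟶ Z} {g : Y ⟶ Z} (hf : IsTF f) : IsTF (pbSnd f g) := by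
  have hc (x : (TDGA.pb f g).carrier) := congr_toAlgHom (pb_condition f g) x
  simp only [comp_apply] at hc
  constructor
  · intro y hy
    obtain ⟨x, hx, h⟩ := hf.1 _ (g.map_deg hy)
    obtain ⟨z, hz, -, rfl⟩ := pb_mk hx hy h
    exact ⟨z, hz, rfl⟩
  · intro i z hz w hw hwz
    obtain ⟨v, hv, h1, h2⟩ := hf.2 i _ (map_cycles (pbFst f g) hz) _ (g.map_deg hw) (by
      rw [hc, ← hwz, g.map_d])
    obtain ⟨t, ht, rfl, rfl⟩ := pb_mk hv hw h2
    exact ⟨t, ht, pb_ext (by rw [Hom.map_d, h1]) (by rw [Hom.map_d, hwz]), rfl⟩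

/-- Right properness: quasi-isomorphisms are stable under pullback along fibrations. -/
lemma QuasiIso.pb {X Y Z : TDGA T} {f : X ⟶ Z} {g : Y ⟶ Z} (hf : QuasiIso f)
    (hg : IsFibration g) : QuasiIso (pbSnd f g) := by
  have hc (x : (TDGA.pb f g).carrier) := congr_toAlgHom (pb_condition f g) x
  simp only [comp_apply] at hc
  obtain ⟨h1, h2⟩ := quasiIso_iff.1 hf
  refine quasiIso_iff.2 ⟨fun i z hz w hw hwz => ?_, fun i z hz => ?_⟩
  · obtain ⟨v, hv, hvz⟩ := h1 i _ (map_cycles (pbFst f g) hz) _ (g.map_deg hw) (by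
      rw [hc, ← hwz, g.map_d])
    obtain ⟨c, hc', u, hu, huc⟩ := h2 (i + 1) (f v - g w)
      ⟨sub_mem (f.map_deg hv) (g.map_deg hw), by
        change Z.d _ = 0
        rw [map_sub, ← f.map_d, ← g.map_d, hvz, hwz, hc, sub_self]⟩
    obtain ⟨y, hy, rfl⟩ := hg _ u hu
    obtain ⟨t, ht, ht1, ht2⟩ := pb_mk (f := f) (g := g) (x := v - c) (y := w - Y.d y)
      (sub_mem hv hc'.1) (sub_mem hw (Y.d_mem hy)) (by
        rw [map_sub, map_sub, g.map_d, huc]; abel)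
    have hc0 : X.d c = 0 := hc'.2
    refine ⟨t, ht, pb_ext ?_ ?_⟩
    · rw [Hom.map_d, ht1, map_sub, hvz, hc0, sub_zero]
    · rw [Hom.map_d, ht2, map_sub, hwz, Y.d_d, sub_zero]
  · obtain ⟨x, hx, u, hu, hux⟩ := h2 i _ (map_cycles g hz)
    obtain ⟨y, hy, rfl⟩ := hg _ u hu
    obtain ⟨t, ht, ht1, ht2⟩ := pb_mk (f := f) (g := g) (x := x) (y := z + Y.d y)
      hx.1 (add_mem hz.1 (Y.d_mem hy)) (by
        rw [map_add, g.map_d, hux]; abel)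
    have hx0 : X.d x = 0 := hx.2
    have hz0 : Y.d z = 0 := hz.2
    refine ⟨t, ⟨ht, pb_ext ?_ ?_⟩, y, hy, ?_⟩
    · rw [Hom.map_d, ht1, hx0, map_zero]
    · rw [Hom.map_d, ht2, map_add, hz0, Y.d_d, add_zero, map_zero]
    · rw [ht2]; abel

end Homology

end TDGA

namespace TDGA

/-! ### Free differential graded `T`-algebras with additional structure -/

/-- A signature for families of differential graded `T`-algebras, with distinguished homogeneous
elements, and additional unary operations on homogeneous elements. -/
structure Sig where
  ι : Type
  G : Type u
  gs : G → ι
  gd : G → ℕ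
  U : Type
  us : U → ι
  ut : U → ι
  ud : U → ℕ
  vd : U → ℕ

variable (T : RationalFermatTheory.{u}) (Γ : Sig.{u})

/-- Terms in a signature. -/
inductive Raw : Γ.ι → Type u
  | gen (g : Γ.G) : Raw (Γ.gs g)
  | one (a : Γ.ι) : Raw a
  | add {a : Γ.ι} (s t : Raw a) : Raw a
  | mul {a : Γ.ι} (s t : Raw a) : Raw a
  | smul {a : Γ.ι} (q : ℚ) (t : Raw a) : Raw a
  | d {a : Γ.ι} (t : Raw a) : Raw a
  | pr {a : Γ.ι} (i : ℕ) (t : Raw a) : Raw a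
  | op {a : Γ.ι} {n : ℕ} (φ : T.Op n) (t : Fin n → Raw a) : Raw a
  | un (f : Γ.U) (t : Raw (Γ.us f)) : Raw (Γ.ut f)

variable {T Γ}

/-- An upper bound for the degrees of the homogeneous components of a term. -/
def Raw.bd : ∀ {a : Γ.ι}, Raw T Γ a → ℕ
  | _, .gen g => Γ.gd g + 1
  | _, .one _ => 1
  | _, .add s t => s.bd + t.bd
  | _, .mul s t => s.bd + t.bd
  | _, .smul _ t => t.bd
  | _, .d t => t.bd
  | _, .pr _ t => t.bd
  | _, .op _ _ => 1
  | _, .un f _ => Γ.vd f + 1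

variable (T Γ)

/-- Structures for a signature. -/
structure Interp where
  M : Γ.ι → TDGA T
  g : ∀ g, (M (Γ.gs g)).deg (Γ.gd g)
  un : ∀ f, (M (Γ.us f)).deg (Γ.ud f) → (M (Γ.ut f)).deg (Γ.vd f)

variable {T Γ}

namespace Interp

variable (I J : Interp T Γ)

/-- The interpretation of terms. -/
def ev : ∀ {a : Γ.ι}, Raw T Γ a → (I.M a).carrier
  | _, .gen g => I.g g
  | _, .one _ => 1
  | _, .add s t => ev s + ev t
  | _, .mul s t => ev s * ev t
  | _, .smul q t => q • ev t
  | _, .d t => (I.M _).d (ev t)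
  | _, .pr i t => (I.M _).pr i (ev t)
  | _, .op φ t => (I.M _).str.op φ fun j => ⟨(I.M _).pr 0 (ev (t j)), (I.M _).pr_mem _ _⟩
  | _, .un f t => I.un f ⟨(I.M _).pr _ (ev t), (I.M _).pr_mem _ _⟩

lemma ev_bd {a : Γ.ι} (t : Raw T Γ a) : ∀ i, t.bd ≤ i → (I.M a).pr i (I.ev t) = 0 := by
  induction t with
  | gen g => exact fun i hi => (I.M _).pr_of_mem_ne (I.g g).2 (by simp only [Raw.bd] at hi; omega)
  | one a => exact fun i hi => (I.M _).pr_of_mem_ne (I.M _).one_mem (by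
      simp only [Raw.bd] at hi; omega)
  | add s t hs ht =>
    intro i hi
    simp only [Raw.bd] at hi
    rw [ev, map_add, hs i (by omega), ht i (by omega), add_zero]
  | mul s t hs ht => exact (I.M _).pr_mul_eq_zero hs ht
  | smul q t ht => exact fun i hi => by rw [ev, map_smul, ht i hi, smul_zero]
  | d t ht =>
    intro i hi
    simp only [Raw.bd] at hi
    rw [ev, CDGA.pr_d, ht _ (by omega), map_zero]
  | pr j t ht =>
    intro i hi
    rw [ev, CDGA.pr_pr]
    split_ifs with h
    · subst h; exact ht i hi
    · rfl
  | op φ t => exact fun i hi => (I.M _).pr_of_mem_ne (SetLike.coe_mem _) (by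
      simp only [Raw.bd] at hi; omega)
  | un f t => exact fun i hi => (I.M _).pr_of_mem_ne (SetLike.coe_mem _) (by
      simp only [Raw.bd] at hi; omega)

variable (P : Interp T Γ → Prop)

/-- The algebra of terms, modulo equality in all models. -/
def termAlg (a : Γ.ι) : Subalgebra ℚ (∀ I : {I // P I}, (I.1.M a).carrier) where
  carrier := {x | ∃ t, ∀ I, x I = I.1.ev t}
  mul_mem' := by
    rintro x y ⟨s, hs⟩ ⟨t, ht⟩
    exact ⟨s.mul t, fun I => by rw [Pi.mul_apply, hs, ht]; rfl⟩
  add_mem' := by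
    rintro x y ⟨s, hs⟩ ⟨t, ht⟩
    exact ⟨s.add t, fun I => by rw [Pi.add_apply, hs, ht]; rfl⟩
  algebraMap_mem' q := ⟨.smul q (.one a), fun I => Algebra.algebraMap_eq_smul_one q⟩

instance (a : Γ.ι) : Small.{u} (termAlg P a) :=
  small_of_surjective (f := fun t : Raw T Γ a => (⟨fun I => I.1.ev t, t, fun _ => rfl⟩ :
    termAlg P a)) (by
      rintro ⟨x, t, ht⟩
      exact ⟨t, Subtype.ext (funext fun I => (ht I).symm)⟩)

lemma exists_raw {a : Γ.ι} (x : Shrink.{u} (termAlg P a)) :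
    ∃ t : Raw T Γ a, ∀ I, (Shrink.algEquiv ℚ (termAlg P a) x).1 I = I.1.ev t :=
  (Shrink.algEquiv ℚ (termAlg P a) x).2

lemma exists_of_raw {a : Γ.ι} (t : Raw T Γ a) :
    ∃ x : Shrink.{u} (termAlg P a), ∀ I, (Shrink.algEquiv ℚ (termAlg P a) x).1 I = I.1.ev t :=
  ⟨(Shrink.algEquiv ℚ (termAlg P a)).symm ⟨_, t, fun _ => rfl⟩, fun I => by
    rw [AlgEquiv.apply_symm_apply]⟩

def emb (a : Γ.ι) : Emb (fun I : {I : Interp T Γ // P I} => I.1.M a) where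
  R := Shrink.{u} (termAlg P a)
  v I := ((Pi.evalAlgHom ℚ (fun I : {I : Interp T Γ // P I} => (I.1.M a).carrier) I).comp
    (termAlg P a).val).comp (Shrink.algEquiv ℚ (termAlg P a)).toAlgHom
  inj h := (Shrink.algEquiv ℚ (termAlg P a)).injective (Subtype.ext (funext h))
  d_cl x := by
    obtain ⟨t, ht⟩ := exists_raw P x
    obtain ⟨y, hy⟩ := exists_of_raw P t.d
    exact ⟨y, fun I => (hy I).trans (congrArg _ (ht I).symm)⟩
  pr_cl i x := by
    obtain ⟨t, ht⟩ := exists_raw P x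
    obtain ⟨y, hy⟩ := exists_of_raw P (t.pr i)
    exact ⟨y, fun I => (hy I).trans (congrArg _ (ht I).symm)⟩
  bdd x := by
    obtain ⟨t, ht⟩ := exists_raw P x
    exact ⟨t.bd, fun i hi I => (congrArg _ (ht I)).trans (I.1.ev_bd t i hi)⟩
  op_cl φ x hx := by
    choose t ht using fun j => exists_raw P (x j)
    obtain ⟨y, hy⟩ := exists_of_raw P (.op φ t)
    refine ⟨y, fun I => (hy I).trans (congrArg _ ((I.1.M a).op_congr φ fun j => ?_))⟩
    exact (congrArg ((I.1.M a).pr 0) (ht j I).symm).trans ((I.1.M a).pr_of_mem (hx j I))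

/-- The free structure satisfying a property (if the latter is equational). -/
def freeObj (a : Γ.ι) : TDGA T := (emb P a).toTDGA

variable {P}

def evHomAux (hI : P I) (a : Γ.ι) : freeObj P a ⟶ I.M a := (emb P a).proj ⟨I, hI⟩

lemma freeAux_ext {a : Γ.ι} {x y : (freeObj P a).carrier}
    (h : ∀ (I : Interp T Γ) (hI : P I),
      (I.evHomAux hI a) x = (I.evHomAux hI a) y) : x = y :=
  (emb P a).proj_ext fun I => h I.1 I.2

lemma freeAux_mem_deg {a : Γ.ι} {i : ℕ} {x : (freeObj P a).carrier} :
    x ∈ (freeObj P a).deg i ↔ ∀ (I : Interp T Γ) (hI : P I),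
      (I.evHomAux hI a) x ∈ (I.M a).deg i :=
  (emb P a).mem_deg_iff.trans ⟨fun h I hI => h ⟨I, hI⟩, fun h I => h I.1 I.2⟩

lemma exists_ev {a : Γ.ι} (x : (freeObj P a).carrier) :
    ∃ t : Raw T Γ a, ∀ (I : Interp T Γ) (hI : P I), (I.evHomAux hI a) x = I.ev t := by
  obtain ⟨t, ht⟩ := exists_raw P x
  exact ⟨t, fun I hI => ht ⟨I, hI⟩⟩

lemma exists_of_ev {a : Γ.ι} (t : Raw T Γ a) : ∃ x : (freeObj P a).carrier,
    ∀ (I : Interp T Γ) (hI : P I), (I.evHomAux hI a) x = I.ev t := by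
  obtain ⟨x, hx⟩ := exists_of_raw P t
  exact ⟨x, fun I hI => hx ⟨I, hI⟩⟩

variable (P)

/-- The free structure. -/
def free : Interp T Γ where
  M := freeObj P
  g g := ⟨(exists_of_ev (P := P) (.gen g)).choose, freeAux_mem_deg.2 fun I hI => by
    rw [(exists_of_ev (P := P) (.gen g)).choose_spec I hI]; exact SetLike.coe_mem _⟩
  un f x := ⟨(exists_of_ev (P := P) (.un f (exists_ev x.1).choose)).choose,
    freeAux_mem_deg.2 fun I hI => by
      rw [(exists_of_ev (P := P) _).choose_spec I hI]; exact SetLike.coe_mem _⟩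

variable {P}

/-- The morphism from the free structure to a model. -/
def evHom (hI : P I) (a : Γ.ι) : (free P).M a ⟶ I.M a := I.evHomAux hI a

lemma free_ext {a : Γ.ι} {x y : ((free P).M a).carrier}
    (h : ∀ (I : Interp T Γ) (hI : P I),
      (I.evHom hI a) x = (I.evHom hI a) y) : x = y := freeAux_ext h

lemma evHom_g (hI : P I) (g : Γ.G) : (I.evHom hI _) ((free P).g g).1 = I.g g :=
  (exists_of_ev (P := P) (.gen g)).choose_spec I hI

lemma evHom_un (hI : P I) (f : Γ.U) (x : ((free P).M (Γ.us f)).deg (Γ.ud f)) :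
    (I.evHom hI _) ((free P).un f x).1 =
      I.un f ⟨(I.evHom hI _) x.1, (I.evHom hI _).map_deg x.2⟩ := by
  refine ((exists_of_ev (P := P) (.un f (exists_ev x.1).choose)).choose_spec I hI).trans ?_
  rw [ev]
  congr 2
  refine Subtype.ext ?_
  change (I.M _).pr _ _ = _
  refine (congrArg _ ((exists_ev x.1).choose_spec I hI).symm).trans ?_
  exact (I.M _).pr_of_mem ((I.evHom hI _).map_deg x.2)

/-- Morphisms of structures commute with the interpretation of terms. -/
lemma map_ev {I J : Interp T Γ} (φ : ∀ a, I.M a ⟶ J.M a)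
    (hg : ∀ g, (φ _) (I.g g).1 = J.g g)
    (hu : ∀ f x, (φ _) (I.un f x).1 =
      J.un f ⟨(φ _) x.1, (φ _).map_deg x.2⟩) {a : Γ.ι} (t : Raw T Γ a) :
    (φ a) (I.ev t) = J.ev t := by
  induction t with
  | gen g => exact hg g
  | one a => exact map_one _
  | add s t hs ht => rw [ev, map_add, hs, ht]; rfl
  | mul s t hs ht => rw [ev, map_mul, hs, ht]; rfl
  | smul q t ht => rw [ev, map_smul, ht]; rfl
  | d t ht => rw [ev, (φ _).map_d, ht]; rfl
  | pr i t ht => rw [ev, map_pr, ht]; rfl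
  | op ψ t ht =>
    rw [ev, (φ _).map_op]
    refine congrArg _ ((J.M _).op_congr ψ fun j => ?_)
    exact (map_pr _ _ _).trans (congrArg _ (ht j))
  | un f t ht =>
    rw [ev, hu]
    refine congrArg (fun x => (J.un f x).1) (Subtype.ext ?_)
    exact (map_pr _ _ _).trans (congrArg _ ht)

lemma evHom_ev (hI : P I) {a : Γ.ι} (t : Raw T Γ a) :
    (I.evHom hI a) ((free P).ev t) = I.ev t :=
  map_ev (I := free P) (fun a => I.evHom hI a) (I.evHom_g hI) (I.evHom_un hI) t

lemma free_exists_ev {a : Γ.ι} (x : ((free P).M a).carrier) : ∃ t, (free P).ev t = x := by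
  obtain ⟨t, ht⟩ := exists_ev x
  exact ⟨t, free_ext fun I hI => (evHom_ev I hI t).trans (ht I hI).symm⟩

/-- Induction on elements of free structures. -/
lemma free_induction {Q : ∀ a, ((free P).M a).carrier → Prop}
    (gen : ∀ g, Q _ ((free P).g g).1) (one : ∀ a, Q a 1)
    (add : ∀ a x y, Q a x → Q a y → Q a (x + y)) (mul : ∀ a x y, Q a x → Q a y → Q a (x * y))
    (smul : ∀ a (q : ℚ) x, Q a x → Q a (q • x)) (d : ∀ a x, Q a x → Q a (((free P).M a).d x))
    (pr : ∀ a i x, Q a x → Q a (((free P).M a).pr i x))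
    (op : ∀ a (n : ℕ) (φ : T.Op n) (x : Fin n → ((free P).M a).deg 0), (∀ j, Q a (x j)) →
      Q a (((free P).M a).str.op φ x))
    (un : ∀ f (x : ((free P).M (Γ.us f)).deg (Γ.ud f)), Q _ x.1 → Q _ ((free P).un f x).1)
    {a : Γ.ι} (x : ((free P).M a).carrier) : Q a x := by
  obtain ⟨t, rfl⟩ := free_exists_ev x
  induction t with
  | gen g => exact gen g
  | one a => exact one a
  | add s t hs ht => exact add _ _ _ hs ht
  | mul s t hs ht => exact mul _ _ _ hs ht
  | smul q t ht => exact smul _ _ _ ht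
  | d t ht => exact d _ _ ht
  | pr i t ht => exact pr _ _ _ ht
  | op φ t ht => exact op _ _ φ _ fun j => pr _ _ _ (ht j)
  | un f t ht => exact un f _ (pr _ _ _ ht)

/-- Families of morphisms out of a free structure which agree on generators and are compatible with
the unary operations agree. -/
lemma free_hom_ext {N : Γ.ι → TDGA T} {φ ψ : ∀ a, (free P).M a ⟶ N a}
    (gen : ∀ g, (φ _) ((free P).g g).1 = (ψ _) ((free P).g g).1)
    (un : ∀ f (x : ((free P).M (Γ.us f)).deg (Γ.ud f)),
      (φ _) x.1 = (ψ _) x.1 →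
      (φ _) ((free P).un f x).1 = (ψ _) ((free P).un f x).1) (a : Γ.ι) :
    φ a = ψ a := by
  refine TDGA.hom_ext fun x => ?_
  refine free_induction (Q := fun a x => (φ a) x = (ψ a) x) gen ?_ ?_ ?_ ?_ ?_
    ?_ ?_ un x
  · intro a; rw [map_one, map_one]
  · intro a x y hx hy; rw [map_add, map_add, hx, hy]
  · intro a x y hx hy; rw [map_mul, map_mul, hx, hy]
  · intro a q x hx; rw [map_smul, map_smul, hx]
  · intro a x hx; rw [(φ a).map_d, (ψ a).map_d, hx]
  · intro a i x hx; rw [map_pr, map_pr, hx]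
  · intro a n f x hx
    rw [(φ a).map_op, (ψ a).map_op]
    exact congrArg _ ((N a).op_congr f hx)

end Interp

end TDGA

namespace TAlg

lemma map_op' {A B : TAlg T} (f : A ⟶ B) {n : ℕ} (φ : T.Op n) (a : Fin n → A.carrier) :
    f (A.str.op φ a) = B.str.op φ (fun i => f (a i)) := Hom.map_op f φ a

@[simp] lemma comp_apply {A B C : TAlg T} (f : A ⟶ B) (g : B ⟶ C) (x : A.carrier) :
    (f ≫ g) x = g (f x) := rfl

/-- The morphism out of a free algebra given by elements of the target. -/
def freeDesc {n : ℕ} (A : TAlg T) (a : Fin n → A.carrier) : free T n ⟶ A where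
  toAlgHom :=
    { toFun φ := A.str.op φ a
      map_one' := (A.str.op_poly 1 a).trans (map_one _)
      map_mul' φ ψ := A.str.op_mul φ ψ a
      map_zero' := (A.str.op_poly 0 a).trans (map_zero _)
      map_add' φ ψ := A.str.op_add φ ψ a
      commutes' q := (A.str.op_poly (.C q) a).trans (MvPolynomial.aeval_C a q) }
  map_op φ ψ := A.str.op_subst φ ψ a

lemma freeDesc_var {n : ℕ} (A : TAlg T) (a : Fin n → A.carrier) (i : Fin n) :
    (freeDesc A a) (T.var i) = a i := A.str.op_var i a

lemma free_hom_apply {n : ℕ} {A : TAlg T} (f : free T n ⟶ A) (φ : T.Op n) :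
    f φ = A.str.op φ fun i => f (T.var i) := by
  have h := map_op' f φ T.var
  rw [← h]
  exact congrArg _ (T.subst_var φ).symm

lemma free_hom_ext {n : ℕ} {A : TAlg T} {f g : free T n ⟶ A}
    (h : ∀ i, f (T.var i) = g (T.var i)) : f = g :=
  hom_ext fun φ =>
    (free_hom_apply f φ).trans ((congrArg _ (funext h)).trans (free_hom_apply g φ).symm)

end TAlg

namespace TDGA

/-- The degree `0` part of a differential graded `T`-algebra. -/
def zeroAlg (X : TDGA T) : TAlg T where
  carrier := X.deg 0
  str := X.str

/-- The restriction of a morphism to degree `0`, as a morphism of `T`-algebras. -/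
def zeroAlgMap {X Y : TDGA T} (f : X ⟶ Y) : X.zeroAlg ⟶ Y.zeroAlg where
  toAlgHom := zeroMap f
  map_op φ a := Subtype.ext (f.map_op φ a)

def toH0 (X : TDGA T) : X.zeroAlg ⟶ X.H0 where
  toAlgHom :=
    { toFun a := Ideal.Quotient.mk X.boundaryIdeal a
      map_one' := rfl
      map_mul' _ _ := rfl
      map_zero' := rfl
      map_add' _ _ := rfl
      commutes' _ := rfl }
  map_op φ a := (X.str.quotient_op_mk X.boundaryIdeal φ a).symm

lemma toH0_surjective (X : TDGA T) : Function.Surjective X.toH0.toAlgHom := fun a => by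
  obtain ⟨b, rfl⟩ := Ideal.Quotient.mk_surjective a
  exact ⟨b, rfl⟩

lemma toH0_eq_zero {X : TDGA T} {x : X.deg 0} :
    X.toH0 x = 0 ↔ ∃ y ∈ X.deg 1, X.d y = x.1 :=
  Ideal.Quotient.eq_zero_iff_mem (I := X.boundaryIdeal)

lemma toH0_naturality {X Y : TDGA T} (f : X ⟶ Y) :
    X.toH0 ≫ H0map f = zeroAlgMap f ≫ Y.toH0 := TAlg.hom_ext fun _ => rfl

/-- The morphism out of a `T`-algebra given by a morphism to the degree `0` part. -/
def ofZero {A : TAlg T} {X : TDGA T} (f : A ⟶ X.zeroAlg) : A.toTDGA ⟶ X where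
  toAlgHom := (show X.deg 0 →ₐ[ℚ] X.carrier from
    { toFun a := a.1
      map_one' := rfl
      map_mul' _ _ := rfl
      map_zero' := rfl
      map_add' _ _ := rfl
      commutes' _ := rfl }).comp f.toAlgHom
  map_deg := by
    rintro (_ | i) a ha
    · exact (f a).2
    · have ha' : a = 0 := ha
      subst ha'; rw [map_zero]; exact zero_mem _
  map_d a := (map_zero _).trans (X.d_zero (f a).2).symm
  map_op φ a := congrArg Subtype.val (TAlg.map_op' f φ _)

lemma mem_deg_zero {A : TAlg T} (a : A.carrier) : a ∈ A.toTDGA.deg 0 :=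
  Submodule.mem_top (R := ℚ) (M := A.carrier)

lemma eq_zero_of_mem_deg {A : TAlg T} {i : ℕ} {a : A.toTDGA.carrier} (h : a ∈ A.toTDGA.deg (i + 1)) :
    a = 0 := h

def unZero {A : TAlg T} {X : TDGA T} (f : A.toTDGA ⟶ X) : A ⟶ X.zeroAlg where
  toAlgHom :=
    { toFun a := ⟨f a, f.map_deg (mem_deg_zero a)⟩
      map_one' := Subtype.ext (map_one f.toAlgHom)
      map_mul' a b := Subtype.ext (map_mul f.toAlgHom a b)
      map_zero' := Subtype.ext (map_zero f.toAlgHom)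
      map_add' a b := Subtype.ext (map_add f.toAlgHom a b)
      commutes' q := Subtype.ext (f.toAlgHom.commutes q) }
  map_op φ a := Subtype.ext (f.map_op φ fun i => ⟨a i, mem_deg_zero _⟩)

lemma ofZero_unZero {A : TAlg T} {X : TDGA T} (f : A.toTDGA ⟶ X) : ofZero (unZero f) = f :=
  TDGA.hom_ext fun _ => rfl

lemma toTDGA_hom_ext {A : TAlg T} {X : TDGA T} {f g : A.toTDGA ⟶ X}
    (h : unZero f = unZero g) : f = g := by
  rw [← ofZero_unZero f, h, ofZero_unZero]

/-- The morphism out of a free algebra given by elements of degree `0`. -/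
def freeDesc {n : ℕ} {X : TDGA T} (x : Fin n → X.deg 0) : (TAlg.free T n).toTDGA ⟶ X :=
  ofZero (TAlg.freeDesc X.zeroAlg x)

lemma freeDesc_var {n : ℕ} {X : TDGA T} (x : Fin n → X.deg 0) (i : Fin n) :
    (freeDesc x) (T.var i) = x i :=
  congrArg Subtype.val (TAlg.freeDesc_var X.zeroAlg x i)

lemma free_hom_ext {n : ℕ} {X : TDGA T} {f g : (TAlg.free T n).toTDGA ⟶ X}
    (h : ∀ i : Fin n, f (T.var i) = g (T.var i)) : f = g :=
  toTDGA_hom_ext (TAlg.free_hom_ext fun i => Subtype.ext (h i))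

lemma exists_free_lift {n : ℕ} {X Y : TDGA T} {p : X ⟶ Y}
    (hp : ∀ b ∈ Y.deg 0, ∃ a ∈ X.deg 0, p a = b) (g : (TAlg.free T n).toTDGA ⟶ Y) :
    ∃ h : (TAlg.free T n).toTDGA ⟶ X, h ≫ p = g := by
  choose x hx hxg using fun i : Fin n => hp (g (T.var i)) (g.map_deg (mem_deg_zero _))
  refine ⟨freeDesc fun i => ⟨x i, hx i⟩, free_hom_ext fun i => ?_⟩
  exact (congrArg p.toAlgHom (freeDesc_var (fun i => ⟨x i, hx i⟩) i)).trans (hxg i)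

lemma isCofibrant_free (n : ℕ) : (TAlg.free T n).toTDGA.IsCofibrant :=
  fun _ hp hq g => exists_free_lift (isTF_of hp hq).1 g

/-! ### Lifting properties and the free adjunction of elements -/

/-- The left lifting property with respect to fibrations. -/
def LLPFib {A B : TDGA T} (i : A ⟶ B) : Prop :=
  ∀ {X Y : TDGA T} (p : X ⟶ Y), IsFibration p → ∀ (f : A ⟶ X) (g : B ⟶ Y), f ≫ p = i ≫ g →
    ∃ h : B ⟶ X, i ≫ h = f ∧ h ≫ p = g

/-- The left lifting property with respect to trivial fibrations. -/
def LLPTriv {A B : TDGA T} (i : A ⟶ B) : Prop :=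
  ∀ {X Y : TDGA T} (p : X ⟶ Y), IsTF p → ∀ (f : A ⟶ X) (g : B ⟶ Y), f ≫ p = i ≫ g →
    ∃ h : B ⟶ X, i ≫ h = f ∧ h ≫ p = g

lemma LLPFib.llpTriv {A B : TDGA T} {i : A ⟶ B} (h : LLPFib i) : LLPTriv i :=
  fun _ hp => h _ hp.isFibration

lemma IsCofibrant.lift {Q : TDGA T} (hQ : Q.IsCofibrant) {X Y : TDGA T} {p : X ⟶ Y} (hp : IsTF p)
    (g : Q ⟶ Y) : ∃ h : Q ⟶ X, h ≫ p = g := hQ p hp.isFibration hp.quasiIso g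

lemma LLPTriv.isCofibrant {A B : TDGA T} {i : A ⟶ B} (h : LLPTriv i) (hA : A.IsCofibrant) :
    B.IsCofibrant := fun p hp hq g => by
  obtain ⟨f, hf⟩ := hA p hp hq (i ≫ g)
  obtain ⟨k, -, hk⟩ := h p (isTF_of hp hq) f g hf
  exact ⟨k, hk⟩

namespace Interp

variable {Γ : Sig.{u}} {P : Interp T Γ → Prop}

/-- Morphisms into a free structure. -/
def freeLift {X : TDGA T} {a : Γ.ι} (f : ∀ I : Interp T Γ, P I → (X ⟶ I.M a))
    (h : ∀ i, ∀ x ∈ X.deg i, ∃ t : Raw T Γ a, ∀ I hI, I.ev t = (f I hI) x) :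
    X ⟶ (free P).M a :=
  (emb P a).lift (fun I => f I.1 I.2) fun x => by
    have H : ∃ y : ((free P).M a).carrier, ∀ I hI, (Interp.evHom I hI a) y =
        (f I hI) x := by
      induction x using X.hom_induction with
      | zero => exact ⟨0, fun I hI => by rw [map_zero, map_zero]⟩
      | add x y hx hy =>
        obtain ⟨x', hx⟩ := hx
        obtain ⟨y', hy⟩ := hy
        exact ⟨x' + y', fun I hI => by rw [map_add, map_add, hx, hy]⟩
      | homog i x hx =>
        obtain ⟨t, ht⟩ := h i x hx
        obtain ⟨y, hy⟩ := exists_of_ev (P := P) t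
        exact ⟨y, fun I hI => (hy I hI).trans (ht I hI)⟩
    obtain ⟨y, hy⟩ := H
    exact ⟨y, fun I => hy I.1 I.2⟩

@[simp]
lemma freeLift_evHom {X : TDGA T} {a : Γ.ι} (f : ∀ I : Interp T Γ, P I → (X ⟶ I.M a))
    (h : ∀ i, ∀ x ∈ X.deg i, ∃ t : Raw T Γ a, ∀ I hI, I.ev t = (f I hI) x)
    (I : Interp T Γ) (hI : P I) : freeLift f h ≫ I.evHom hI a = f I hI :=
  (emb P a).lift_proj _ _ ⟨I, hI⟩

end Interp

section Adj

variable (X : TDGA T) {S : Type u} (e : S → ℕ)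

abbrev adjSig : Sig.{u} where
  ι := Unit
  G := (Σ i, X.deg i) ⊕ S
  gs _ := ()
  gd := Sum.elim (fun x => x.1) e
  U := Empty
  us := Empty.elim
  ut := Empty.elim
  ud := Empty.elim
  vd := Empty.elim

abbrev AdjModel (I : Interp T (adjSig X e)) : Prop :=
  ∃ u : X ⟶ I.M (), ∀ x : Σ i, X.deg i, (I.g (.inl x)).1 = u x.2

/-- The differential graded `T`-algebra obtained by freely adjoining homogeneous elements. -/
abbrev adj : TDGA T := (Interp.free (AdjModel X e)).M ()

namespace adj

def of : X ⟶ adj X e :=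
  Interp.freeLift (P := AdjModel X e) (a := ()) (fun _ hI => hI.choose) fun i x hx =>
    ⟨.gen (Γ := adjSig X e) (.inl ⟨i, x, hx⟩), fun _ hI => hI.choose_spec ⟨i, x, hx⟩⟩

def gen (s : S) : (adj X e).deg (e s) := (Interp.free (AdjModel X e)).g (.inr s)

variable {X e} {Z : TDGA T}

def model (f : X ⟶ Z) (z : ∀ s, Z.deg (e s)) : Interp T (adjSig X e) where
  M _ := Z
  g := fun s => match s with
    | .inl x => ⟨f x.2, f.map_deg x.2.2⟩
    | .inr s => z s
  un f := f.elim

lemma model_spec (f : X ⟶ Z) (z : ∀ s, Z.deg (e s)) : AdjModel X e (model f z) := ⟨f, fun _ => rfl⟩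

def desc (f : X ⟶ Z) (z : ∀ s, Z.deg (e s)) : adj X e ⟶ Z :=
  (model f z).evHom (model_spec f z) ()

lemma of_hom {I : Interp T (adjSig X e)} (hI : AdjModel X e I) (x : Σ i, X.deg i) :
    (of X e ≫ I.evHom hI ()) x.2.1 = I.g (.inl x) := by
  rw [of, Interp.freeLift_evHom]
  exact (hI.choose_spec x).symm

lemma of_apply (x : Σ i, X.deg i) :
    (of X e) x.2.1 = ((Interp.free (AdjModel X e)).g (.inl x)).1 :=
  Interp.free_ext fun I hI => (of_hom hI x).trans (Interp.evHom_g I hI _).symm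

@[simp]
lemma of_desc (f : X ⟶ Z) (z : ∀ s, Z.deg (e s)) : of X e ≫ desc f z = f := by
  refine TDGA.hom_ext fun x => ?_
  induction x using X.hom_induction with
  | zero => rw [map_zero, map_zero]
  | add x y hx hy => rw [map_add, map_add, hx, hy]
  | homog i x hx => exact of_hom (model_spec f z) ⟨i, x, hx⟩

@[simp]
lemma desc_gen (f : X ⟶ Z) (z : ∀ s, Z.deg (e s)) (s : S) :
    (desc f z) (gen X e s).1 = z s :=
  Interp.evHom_g (model f z) (model_spec f z) (.inr s)

lemma hom_ext {f g : adj X e ⟶ Z} (h : of X e ≫ f = of X e ≫ g)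
    (h' : ∀ s, f (gen X e s).1 = g (gen X e s).1) : f = g := by
  refine Interp.free_hom_ext (P := AdjModel X e) (N := fun _ => Z) (φ := fun _ => f)
    (ψ := fun _ => g) ?_ (fun f => f.elim) ()
  rintro (x | s)
  · rw [← of_apply]
    exact congr_toAlgHom h x.2.1
  · exact h' s

/-- Every element of a subset closed under all operations. -/
lemma induction {Q : (adj X e).carrier → Prop}
    (of : ∀ x, Q ((of X e) x)) (gen : ∀ s, Q (gen X e s).1)
    (add : ∀ x y, Q x → Q y → Q (x + y)) (mul : ∀ x y, Q x → Q y → Q (x * y))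
    (smul : ∀ (q : ℚ) x, Q x → Q (q • x)) (d : ∀ x, Q x → Q ((adj X e).d x))
    (pr : ∀ i x, Q x → Q ((adj X e).pr i x))
    (op : ∀ (n : ℕ) (φ : T.Op n) (x : Fin n → (adj X e).deg 0), (∀ j, Q (x j)) →
      Q ((adj X e).str.op φ x)) (x : (adj X e).carrier) : Q x := by
  refine Interp.free_induction (P := AdjModel X e) (Q := fun _ => Q) (a := ()) ?_ (fun _ => ?_)
    (fun _ => add) (fun _ => mul) (fun _ => smul) (fun _ => d) (fun _ => pr) (fun _ => op)
    (fun f => f.elim) x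
  · rintro (x | s)
    · rw [← of_apply]; exact of _
    · exact gen s
  · have := of 1
    rwa [map_one] at this

lemma of_llpFib (h : ∀ s, e s ≠ 0) : LLPFib (of X e) := by
  intro Z W p hp f g hfg
  have H : ∀ s, ∃ z ∈ Z.deg (e s), p z = g (gen X e s).1 := fun s => by
    obtain ⟨i, hi⟩ := Nat.exists_eq_succ_of_ne_zero (h s)
    have := hp i (g (gen X e s).1) (by rw [← Nat.succ_eq_add_one, ← hi]; exact g.map_deg (gen X e s).2)
    rwa [← Nat.succ_eq_add_one, ← hi] at this
  choose z hz hzg using H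
  refine ⟨desc f fun s => ⟨z s, hz s⟩, of_desc _ _, hom_ext ?_ fun s => ?_⟩
  · rw [← assoc, of_desc, hfg]
  · rw [comp_apply, desc_gen, hzg]

end adj

end Adj

/-! ### Relative cofibrant replacements of discrete algebras -/

section Repl

variable {U : TDGA T} {A : TAlg T} (c : U ⟶ A.toTDGA)

lemma isTF_of_discrete {X : TDGA T} {p : X ⟶ A.toTDGA} (h : QuasiIso p) : IsTF p :=
  isTF_of (fun _ _ hb => ⟨0, zero_mem _, (map_zero _).trans (eq_zero_of_mem_deg hb).symm⟩) h

variable (U A) in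
abbrev replSig : Sig.{u} where
  ι := Unit
  G := (Σ i, U.deg i) ⊕ A.carrier
  gs _ := ()
  gd := Sum.elim (fun x => x.1) fun _ => 0
  U := ℕ
  us _ := ()
  ut _ := ()
  ud j := j
  vd j := j + 1

structure IsReplModel (I : Interp T (replSig U A)) (u : U ⟶ I.M ()) (π : I.M () ⟶ A.toTDGA) :
    Prop where
  inl : ∀ x : Σ i, U.deg i, (I.g (.inl x)).1 = u x.2
  comp : u ≫ π = c
  inr : ∀ a, π (I.g (.inr a)).1 = a
  inr_zero : (I.g (.inr 0)).1 = 0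
  un_zero : ∀ j : ℕ, (I.un j 0).1 = 0
  d_un_zero : ∀ x, (I.M ()).d (I.un (0 : ℕ) x).1 = x.1 - I.g (.inr (π x.1))
  d_un_succ : ∀ j : ℕ, ∀ x : (I.M ()).deg (j + 1), (I.M ()).d (I.un (j + 1 : ℕ) x).1 =
    x.1 - I.un j ⟨(I.M ()).d x.1, (I.M ()).d_mem x.2⟩

abbrev ReplModel (I : Interp T (replSig U A)) : Prop := ∃ u π, IsReplModel c I u π

abbrev repl : TDGA T := (Interp.free (ReplModel c)).M ()

namespace repl

def of : U ⟶ repl c :=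
  Interp.freeLift (P := ReplModel c) (a := ()) (fun _ hI => hI.choose) fun i x hx =>
    ⟨.gen (Γ := replSig U A) (.inl ⟨i, x, hx⟩), fun _ hI =>
      hI.choose_spec.choose_spec.inl ⟨i, x, hx⟩⟩

def discModel : Interp T (replSig U A) where
  M _ := A.toTDGA
  g := fun s => match s with
    | .inl x => ⟨c x.2, c.map_deg x.2.2⟩
    | .inr a => ⟨a, mem_deg_zero a⟩
  un _ _ := 0

lemma discModel_spec : IsReplModel c (discModel c) c (𝟙 _) where
  inl _ := rfl
  comp := comp_id _
  inr _ := rfl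
  inr_zero := rfl
  un_zero _ := rfl
  d_un_zero x := (sub_self x.1).symm
  d_un_succ _ x := (map_zero (A.toTDGA.d)).trans ((sub_zero x.1).trans
    (eq_zero_of_mem_deg x.2)).symm

def π : repl c ⟶ A.toTDGA := (discModel c).evHom (P := ReplModel c) ⟨_, _, discModel_spec c⟩ ()

variable {c}

lemma evHom_π {I : Interp T (replSig U A)} {u : U ⟶ I.M ()} {p : I.M () ⟶ A.toTDGA}
    (h : IsReplModel c I u p) : I.evHom (P := ReplModel c) ⟨u, p, h⟩ () ≫ p = π c := by
  refine Interp.free_hom_ext (P := ReplModel c) (N := fun _ => A.toTDGA)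
    (φ := fun _ => I.evHom ⟨u, p, h⟩ () ≫ p) (ψ := fun _ => π c) ?_ ?_ ()
  · intro g
    have hπ := Interp.evHom_g (discModel c) (P := ReplModel c) ⟨_, _, discModel_spec c⟩ g
    rw [comp_apply, Interp.evHom_g I (P := ReplModel c) ⟨u, p, h⟩ g]
    refine Eq.trans ?_ hπ.symm
    cases g with
    | inl x =>
      rw [h.inl]
      exact congr_toAlgHom h.comp x.2.1
    | inr a => exact h.inr a
  · intro j x _
    have h1 := ((I.evHom (P := ReplModel c) ⟨u, p, h⟩ () ≫ p).map_deg
      ((Interp.free (ReplModel c)).un j x).2)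
    have h2 := (π c).map_deg ((Interp.free (ReplModel c)).un j x).2
    exact (eq_zero_of_mem_deg (i := j) h1).trans (eq_zero_of_mem_deg (i := j) h2).symm

lemma of_evHom {I : Interp T (replSig U A)} {u : U ⟶ I.M ()} {p : I.M () ⟶ A.toTDGA}
    (h : IsReplModel c I u p) : of c ≫ I.evHom (P := ReplModel c) ⟨u, p, h⟩ () = u := by
  rw [of, Interp.freeLift_evHom]
  have h' : ReplModel c I := ⟨u, p, h⟩
  refine TDGA.hom_ext fun x => ?_
  induction x using U.hom_induction with
  | zero => rw [map_zero, map_zero]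
  | add x y hx hy => rw [map_add, map_add, hx, hy]
  | homog i x hx =>
    exact (h'.choose_spec.choose_spec.inl ⟨i, x, hx⟩).symm.trans (h.inl ⟨i, x, hx⟩)

lemma free_spec : IsReplModel c (Interp.free (ReplModel c)) (of c) (π c) where
  inl x := Interp.free_ext fun I hI => by
    obtain ⟨u, p, h⟩ := hI
    rw [Interp.evHom_g, ← comp_apply]
    refine (h.inl x).trans ?_
    exact congr_toAlgHom (of_evHom h).symm x.2.1
  comp := of_evHom (discModel_spec c)
  inr a := Interp.evHom_g (discModel c) (P := ReplModel c) ⟨_, _, discModel_spec c⟩ (.inr a)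
  inr_zero := Interp.free_ext fun I hI => by
    obtain ⟨u, p, h⟩ := hI
    rw [Interp.evHom_g, map_zero]
    exact h.inr_zero
  un_zero j := Interp.free_ext fun I hI => by
    obtain ⟨u, p, h⟩ := hI
    rw [Interp.evHom_un, map_zero]
    refine Eq.trans ?_ (h.un_zero j)
    congr 2
    exact Subtype.ext (map_zero _)
  d_un_zero x := Interp.free_ext fun I hI => by
    obtain ⟨u, p, h⟩ := hI
    rw [Hom.map_d, map_sub]
    refine Eq.trans ?_ (congrArg₂ (· - ·) rfl (Interp.evHom_g I (P := ReplModel c) ⟨u, p, h⟩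
      (.inr ((π c) x.1))).symm)
    have h1 := Interp.evHom_un I (P := ReplModel c) ⟨u, p, h⟩ 0 x
    refine (congrArg (I.M ()).d h1).trans ((h.d_un_zero _).trans ?_)
    congr 4
    exact congr_toAlgHom (evHom_π h) x.1
  d_un_succ j x := Interp.free_ext fun I hI => by
    obtain ⟨u, p, h⟩ := hI
    rw [Hom.map_d, map_sub]
    have h1 := Interp.evHom_un I (P := ReplModel c) ⟨u, p, h⟩ (j + 1 : ℕ) x
    have h2 := Interp.evHom_un I (P := ReplModel c) ⟨u, p, h⟩ j
      ⟨((Interp.free (ReplModel c)).M ()).d x.1, CDGA.d_mem _ x.2⟩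
    refine (congrArg (I.M ()).d h1).trans ((h.d_un_succ j _).trans ?_)
    refine congrArg₂ (· - ·) rfl (Eq.trans ?_ h2.symm)
    congr 2
    exact Subtype.ext ((I.evHom (P := ReplModel c) ⟨u, p, h⟩ ()).map_d x.1).symm

lemma quasiIso_π : QuasiIso (π c) := by
  have h := free_spec (c := c)
  refine quasiIso_iff.2 ⟨fun i z hz w hw hwz => ?_, fun i z hz => ?_⟩
  · have hz0 : (repl c).d z = 0 := hz.2
    cases i with
    | zero =>
      refine ⟨_, ((Interp.free (ReplModel c)).un (0 : ℕ) ⟨z, hz.1⟩).2, (h.d_un_zero _).trans ?_⟩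
      have h0 : (π c) z = 0 := hwz.symm
      have h1 : ∀ a : A.carrier, a = 0 → ((Interp.free (ReplModel c)).g (.inr a)).1 = 0 := by
        rintro a rfl; exact h.inr_zero
      exact (congrArg (z - ·) (h1 _ h0)).trans (sub_zero z)
    | succ j =>
      refine ⟨_, ((Interp.free (ReplModel c)).un (j + 1 : ℕ) ⟨z, hz.1⟩).2,
        (h.d_un_succ j _).trans ?_⟩
      refine (congrArg₂ (· - ·) rfl (Eq.trans ?_ (h.un_zero j))).trans (sub_zero z)
      congr 2
      exact Subtype.ext hz0
  · cases i with
    | zero =>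
      refine ⟨((Interp.free (ReplModel c)).g (.inr z)).1,
        ⟨((Interp.free (ReplModel c)).g (.inr z)).2, CDGA.d_zero _
          ((Interp.free (ReplModel c)).g (.inr z)).2⟩, 0, zero_mem _, ?_⟩
      rw [map_zero]
      exact ((sub_eq_zero_of_eq (h.inr z))).symm
    | succ i =>
      refine ⟨0, zero_mem _, 0, zero_mem _, ?_⟩
      rw [eq_zero_of_mem_deg hz.1]; simp

section Lift

variable {W : TDGA T} {q : W ⟶ repl c}

lemma exists_homotopy (hq : IsTF q) (j : ℕ) (r : W.deg j → W.carrier) (hr : ∀ x, r x ∈ W.cycles j)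
    (h0 : r 0 = 0)
    (hqr : ∀ x, q (r x) = (repl c).d ((Interp.free (ReplModel c)).un j
      ⟨q x.1, q.map_deg x.2⟩).1) :
    ∃ h : W.deg j → W.deg (j + 1), h 0 = 0 ∧ ∀ x, W.d (h x).1 = r x ∧ q.toAlgHom (h x).1 =
      ((Interp.free (ReplModel c)).un j ⟨q x.1, q.map_deg x.2⟩).1 := by
  classical
  choose v hv hv' using fun x => hq.2 j (r x) (hr x) _ ((Interp.free (ReplModel c)).un j
    ⟨q x.1, q.map_deg x.2⟩).2 (hqr x).symm
  refine ⟨fun x => if x = 0 then 0 else ⟨v x, hv x⟩, if_pos rfl, fun x => ?_⟩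
  by_cases hx : x = 0
  · subst hx
    simp only [if_pos]
    refine ⟨(map_zero _).trans h0.symm, (map_zero _).trans ?_⟩
    refine (free_spec.un_zero j).symm.trans ?_
    congr 2
    exact Subtype.ext (map_zero _).symm
  · simp only [if_neg hx]; exact hv' x

/-- The data of a contracting homotopy in one degree, compatible with that of the free model. -/
def StepSpec (q : W ⟶ repl c) (j : ℕ) (h : W.deg j → W.deg (j + 1)) : Prop :=
  h 0 = 0 ∧ (∀ x, q (h x).1 =
    ((Interp.free (ReplModel c)).un j ⟨q x.1, q.map_deg x.2⟩).1) ∧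
  ∀ y : W.deg (j + 1), W.d (h ⟨W.d y.1, W.d_mem y.2⟩).1 = W.d y.1

lemma exists_step (hq : IsTF q) (j : ℕ) (h : W.deg j → W.deg (j + 1)) (hh : StepSpec q j h) :
    ∃ h' : W.deg (j + 1) → W.deg (j + 1 + 1), StepSpec q (j + 1) h' ∧
      ∀ x, W.d (h' x).1 = x.1 - (h ⟨W.d x.1, W.d_mem x.2⟩).1 := by
  have hd0 : ∀ x : W.deg (j + 1), W.d x.1 = 0 → (h ⟨W.d x.1, W.d_mem x.2⟩).1 = 0 :=
    fun x hx => by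
      have : (⟨W.d x.1, W.d_mem x.2⟩ : W.deg j) = 0 := Subtype.ext hx
      rw [this, hh.1]; rfl
  obtain ⟨h', h0, H⟩ := exists_homotopy hq (j + 1)
    (fun x => x.1 - (h ⟨W.d x.1, W.d_mem x.2⟩).1) (fun x => ⟨sub_mem x.2 (SetLike.coe_mem _), by
      change W.d _ = 0
      rw [map_sub, hh.2.2 x, sub_self]⟩)
    (by
      have := hd0 0 (map_zero _)
      simp only [this]; simp) (fun x => by
      refine Eq.trans ?_ (free_spec.d_un_succ j ⟨q x.1, q.map_deg x.2⟩).symm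
      rw [map_sub, hh.2.1]
      congr 4
      exact q.map_d x.1)
  refine ⟨h', ⟨h0, fun x => (H x).2, fun y => ?_⟩, fun x => (H x).1⟩
  refine (H _).1.trans ?_
  have := hd0 ⟨W.d y.1, W.d_mem y.2⟩ (W.d_d _)
  change W.d y.1 - _ = W.d y.1
  rw [this, sub_zero]

lemma exists_section (hq : IsTF q) (u : U ⟶ W) (hu : u ≫ q = of c) :
    ∃ s : repl c ⟶ W, s ≫ q = 𝟙 _ ∧ of c ≫ s = u := by
  classical
  choose g hg hg' using fun a : A.carrier => hq.1 _ ((Interp.free (ReplModel c)).g (.inr a)).2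
  let G : A.carrier → W.deg 0 := fun a => if a = 0 then 0 else ⟨g a, hg a⟩
  have hG0 : G 0 = 0 := if_pos rfl
  have hG : ∀ a, q (G a).1 = ((Interp.free (ReplModel c)).g (.inr a)).1 := fun a => by
    by_cases ha : a = 0
    · subst ha
      rw [hG0]; exact (map_zero _).trans free_spec.inr_zero.symm
    · simp only [G, if_neg ha]; exact hg' a
  have hπd : ∀ y : W.deg 1, (π c) (q (W.d y.1)) = (0 : A.carrier) := fun y => by
    rw [q.map_d, (π c).map_d]; rfl
  have hGz : ∀ a : A.carrier, a = 0 → (G a).1 = 0 := by rintro a rfl; rw [hG0]; rfl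
  obtain ⟨h0, h00, H0⟩ := exists_homotopy hq 0
    (fun x => x.1 - (G ((π c) (q x.1))).1)
    (fun x => ⟨sub_mem x.2 (SetLike.coe_mem _), W.d_zero (sub_mem x.2 (SetLike.coe_mem _))⟩)
    (by
      have : (G ((π c) (q ((0 : W.deg 0) : W.carrier)))).1 = 0 :=
        hGz _ (by rw [ZeroMemClass.coe_zero, map_zero, map_zero]; rfl)
      rw [this]; simp)
    (fun x => by
      refine Eq.trans ?_ (free_spec.d_un_zero ⟨q x.1, q.map_deg x.2⟩).symm
      exact (map_sub _ _ _).trans (congrArg _ (hG _)))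
  have hs0 : StepSpec q 0 h0 := ⟨h00, fun x => (H0 x).2, fun y => (H0 _).1.trans (by
    change W.d y.1 - _ = W.d y.1
    rw [hGz _ (hπd y), sub_zero])⟩
  let hs : ∀ j : ℕ, {h : W.deg j → W.deg (j + 1) // StepSpec q j h} := fun j =>
    Nat.rec ⟨h0, hs0⟩ (fun j h => ⟨(exists_step hq j h.1 h.2).choose,
      (exists_step hq j h.1 h.2).choose_spec.1⟩) j
  let I : Interp T (replSig U A) :=
    { M := fun _ => W
      g := fun s => match s with
        | .inl x => ⟨u x.2, u.map_deg x.2.2⟩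
        | .inr a => G a
      un := fun j => (hs j).1 }
  have hI : IsReplModel c I u (q ≫ π c) :=
    { inl := fun _ => rfl
      comp := by rw [← assoc, hu]; exact free_spec.comp
      inr := fun a => (congrArg (π c).toAlgHom (hG a)).trans (free_spec.inr a)
      inr_zero := congrArg Subtype.val hG0
      un_zero := fun j => congrArg Subtype.val (hs j).2.1
      d_un_zero := fun x => (H0 x).1
      d_un_succ := fun j x => (exists_step hq j (hs j).1 (hs j).2).choose_spec.2 x }
  refine ⟨I.evHom (P := ReplModel c) ⟨_, _, hI⟩ (), ?_, of_evHom hI⟩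
  refine Interp.free_hom_ext (P := ReplModel c) (N := fun _ => repl c)
    (φ := fun _ => I.evHom (P := ReplModel c) ⟨_, _, hI⟩ () ≫ q) (ψ := fun _ => 𝟙 _) ?_ ?_ ()
  · intro s
    refine (congrArg q.toAlgHom (Interp.evHom_g I (P := ReplModel c) ⟨_, _, hI⟩ s)).trans ?_
    cases s with
    | inl x =>
      refine Eq.trans ?_ (free_spec.inl x).symm
      exact congr_toAlgHom hu x.2.1
    | inr a => exact hG a
  · intro j x hx
    refine (congrArg q.toAlgHom (Interp.evHom_un I (P := ReplModel c) ⟨_, _, hI⟩ j x)).trans ?_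
    refine ((hs j).2.2.1 _).trans ?_
    exact congrArg (fun y => ((Interp.free (ReplModel c)).un j y).1) (Subtype.ext hx)

end Lift

lemma of_llpTriv : LLPTriv (of c) := by
  intro X Y p hp f g hfg
  obtain ⟨s, hs, hs'⟩ := exists_section (q := pbSnd p g) hp.pb (pbLift f (of c) hfg)
    (pbLift_snd _ _ _)
  refine ⟨s ≫ pbFst p g, ?_, ?_⟩
  · rw [← assoc, hs', pbLift_fst]
  · rw [assoc, pb_condition, ← assoc, hs, id_comp]

lemma of_π : of c ≫ π c = c := free_spec.comp

end repl

end Repl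

end TDGA

namespace CDGA

variable (A : CDGA.{u})

/-- The sign automorphism, which is `(-1) ^ i` in degree `i`. -/
def sgnLin : A.carrier →ₗ[ℚ] A.carrier :=
  DirectSum.toModule ℚ ℕ A.carrier (fun i => ((-1 : ℚ) ^ i) • (A.deg i).subtype) ∘ₗ
    (DirectSum.decomposeLinearEquiv A.deg).toLinearMap

lemma sgnLin_of_mem {i : ℕ} {x : A.carrier} (hx : x ∈ A.deg i) :
    A.sgnLin x = (-1 : ℚ) ^ i • x := by
  have : DirectSum.decomposeLinearEquiv A.deg x = DirectSum.lof ℚ ℕ (fun i => A.deg i) i ⟨x, hx⟩ :=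
    DirectSum.decompose_of_mem A.deg hx
  rw [sgnLin, LinearMap.comp_apply, LinearEquiv.coe_coe, this, DirectSum.toModule_lof]
  rfl

lemma hom_induction₂ {P : A.carrier → A.carrier → Prop}
    (homog : ∀ i j a b, a ∈ A.deg i → b ∈ A.deg j → P a b)
    (add_left : ∀ a a' b, P a b → P a' b → P (a + a') b)
    (add_right : ∀ a b b', P a b → P a b' → P a (b + b')) (a b : A.carrier) : P a b := by
  induction a using A.hom_induction with
  | zero =>
    induction b using A.hom_induction with
    | zero => exact homog 0 0 _ _ (zero_mem _) (zero_mem _)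
    | homog j b hb => exact homog 0 j _ _ (zero_mem _) hb
    | add b b' hb hb' => exact add_right _ _ _ hb hb'
  | homog i a ha =>
    induction b using A.hom_induction with
    | zero => exact homog i 0 _ _ ha (zero_mem _)
    | homog j b hb => exact homog i j _ _ ha hb
    | add b b' hb hb' => exact add_right _ _ _ hb hb'
  | add a a' ha ha' => exact add_left _ _ _ ha ha'

def sgn : A.carrier →ₐ[ℚ] A.carrier :=
  AlgHom.ofLinearMap A.sgnLin (by rw [A.sgnLin_of_mem A.one_mem]; simp) fun a b => by
    induction a, b using A.hom_induction₂ with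
    | homog i j a b ha hb =>
      rw [A.sgnLin_of_mem ha, A.sgnLin_of_mem hb, A.sgnLin_of_mem (A.mul_mem ha hb), pow_add,
        smul_mul_smul_comm]
    | add_left a a' b h h' => rw [add_mul, map_add, map_add, h, h', add_mul]
    | add_right a b b' h h' => rw [mul_add, map_add, map_add, h, h', mul_add]

lemma sgn_of_mem {i : ℕ} {x : A.carrier} (hx : x ∈ A.deg i) : A.sgn x = (-1 : ℚ) ^ i • x :=
  A.sgnLin_of_mem hx

lemma sgn_sgn (x : A.carrier) : A.sgn (A.sgn x) = x := by
  induction x using A.hom_induction with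
  | zero => simp
  | homog i x hx =>
    rw [A.sgn_of_mem hx, map_smul, A.sgn_of_mem hx, smul_smul, ← mul_pow]; simp
  | add x y hx hy => rw [map_add, map_add, hx, hy]

lemma pr_sgn (i : ℕ) (x : A.carrier) : A.pr i (A.sgn x) = A.sgn (A.pr i x) := by
  induction x using A.hom_induction with
  | zero => simp
  | homog j x hx =>
    rw [A.sgn_of_mem hx, map_smul]
    by_cases h : j = i
    · subst h; rw [A.pr_of_mem hx, A.sgn_of_mem hx]
    · rw [A.pr_of_mem_ne hx h]; simp
  | add x y hx hy => simp only [map_add, hx, hy]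

lemma sgn_mem {i : ℕ} {x : A.carrier} (hx : x ∈ A.deg i) : A.sgn x ∈ A.deg i := by
  rw [A.sgn_of_mem hx]; exact Submodule.smul_mem _ _ hx

lemma d_sgn (x : A.carrier) : A.d (A.sgn x) = -A.sgn (A.d x) := by
  induction x using A.hom_induction with
  | zero => simp
  | homog i x hx =>
    cases i with
    | zero => rw [A.sgn_of_mem hx, map_smul, A.d_zero hx]; simp
    | succ i =>
      rw [A.sgn_of_mem hx, map_smul, A.sgn_of_mem (A.d_mem hx), pow_succ]; simp
  | add x y hx hy => simp only [map_add, hx, hy]; abel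

lemma neg_one_pow_mul (n : ℕ) (x : A.carrier) : (-1) ^ n * x = (-1 : ℚ) ^ n • x := by
  rw [Algebra.smul_def]; simp

lemma leibniz' (x y : A.carrier) : A.d (x * y) = A.d x * y + A.sgn x * A.d y := by
  induction x using A.hom_induction with
  | zero => simp
  | homog i x hx => rw [A.leibniz y hx, A.sgn_of_mem hx, neg_one_pow_mul, smul_mul_assoc]
  | add x x' hx hx' => rw [add_mul, map_add, hx, hx', map_add, map_add, add_mul, add_mul]; abel

lemma comm' {i j : ℕ} {x y : A.carrier} (hx : x ∈ A.deg i) (hy : y ∈ A.deg j) :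
    x * y = (-1 : ℚ) ^ (i * j) • (y * x) := by
  rw [A.graded_comm hx hy, neg_one_pow_mul]

/-- Elements of degree `0` are central. -/
lemma central {q : A.carrier} (hq : q ∈ A.deg 0) (x : A.carrier) : q * x = x * q := by
  induction x using A.hom_induction with
  | zero => simp
  | homog i x hx => rw [A.comm' hq hx]; simp
  | add x x' hx hx' => rw [mul_add, hx, hx', add_mul]

end CDGA

/-! ### The Hadamard quotient of operations -/

namespace RationalFermatTheory

lemma subst_add {n m : ℕ} (f g : T.Op n) (a : Fin n → T.Op m) :
    T.subst (f + g) a = T.subst f a + T.subst g a := (TAlg.free T m).str.op_add f g a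

lemma subst_mul {n m : ℕ} (f g : T.Op n) (a : Fin n → T.Op m) :
    T.subst (f * g) a = T.subst f a * T.subst g a := (TAlg.free T m).str.op_mul f g a

lemma subst_sub {n m : ℕ} (f g : T.Op n) (a : Fin n → T.Op m) :
    T.subst (f - g) a = T.subst f a - T.subst g a := (TAlg.free T m).str.op_sub f g a

lemma subst_poly {n m : ℕ} (p : MvPolynomial (Fin n) ℚ) (a : Fin n → T.Op m) :
    T.subst (T.poly p) a = MvPolynomial.aeval a p := RationalTheory.ev_eq_aeval p a

/-- Uniqueness in the Fermat property. -/
lemma sub_mul_cancel {n : ℕ} (g : T.Op (n + 2)) (h : (T.var 0 - T.var 1) * g = 0) : g = 0 := by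
  obtain ⟨k, -, hk⟩ := T.fermat n 0
  have h0 : ∀ a : Fin (n + 1) → T.Op (n + 2), T.subst (0 : T.Op (n + 1)) a = 0 := fun a =>
    ((TAlg.free T (n + 2)).str.op_poly 0 a).trans (map_zero _)
  rw [hk g (by simp only [h0, h, sub_zero]), hk 0 (by simp only [h0, mul_zero, sub_zero])]

/-- Variables are nonzerodivisors. -/
lemma var_mul_cancel {n : ℕ} (u : T.Op (n + 1)) (h : T.var 0 * u = 0) : u = 0 := by
  let s : Fin (n + 1) → T.Op (n + 2) :=
    Fin.cons (T.var 0 - T.var 1) fun i : Fin n => T.var i.succ.succ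
  have h1 : T.subst u s = 0 := by
    apply sub_mul_cancel
    have := congrArg (fun e => T.subst e s) h
    simp only [subst_mul, T.var_subst] at this
    refine this.trans (((TAlg.free T (n + 2)).str.op_poly 0 s).trans (map_zero _))
  let r : Fin (n + 2) → T.Op (n + 1) :=
    Fin.cons (T.var 0) (Fin.cons 0 fun i : Fin n => T.var i.succ)
  have h2 := congrArg (fun e => T.subst e r) h1
  simp only [T.subst_subst] at h2
  have h3 : (fun i => T.subst (s i) r) = T.var := by
    funext i
    refine Fin.cases ?_ (fun i => ?_) i
    · simp only [s, Fin.cons_zero, subst_sub, T.var_subst]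
      simp only [r, Fin.cons_zero]
      exact sub_zero _
    · simp only [s, Fin.cons_succ, T.var_subst]
      simp only [r, Fin.cons_succ]
  rw [h3, T.subst_var] at h2
  exact h2.trans (((TAlg.free T (n + 1)).str.op_poly 0 r).trans (map_zero _))

/-- Variables for a universal Hadamard quotient: a scalar `y`, a point and a direction. -/
abbrev hY (n : ℕ) : T.Op (n + n + 1) := T.var 0
abbrev hW {n : ℕ} (i : Fin n) : T.Op (n + n + 1) := T.var (Fin.castAdd n i).succ
abbrev hD {n : ℕ} (i : Fin n) : T.Op (n + n + 1) := T.var (Fin.natAdd n i).succ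

lemma exists_hadamard {n : ℕ} (φ : T.Op n) : ∃ G : T.Op (n + n + 1),
    T.subst φ (fun i => hW i + hY n * hD i) - T.subst φ hW = hY n * G := by
  let f : T.Op (n + n + 1) := T.subst φ fun i => hW i + hY n * hD i
  obtain ⟨g, hg, -⟩ := T.fermat (n + n) f
  let r : Fin (n + n + 2) → T.Op (n + n + 1) :=
    Fin.cons (T.var 0) (Fin.cons 0 fun i : Fin (n + n) => T.var i.succ)
  refine ⟨T.subst g r, ?_⟩
  have h := congrArg (fun e => T.subst e r) hg
  simp only [subst_sub, subst_mul, T.var_subst, T.subst_subst, f, subst_add, Fin.cons_zero,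
    Fin.cons_succ] at h
  have r0 : r 0 = T.var 0 := rfl
  have r1 : r 1 = 0 := rfl
  have r2 : ∀ i : Fin (n + n), r i.succ.succ = T.var i.succ := fun _ => rfl
  simp only [r0, r1, r2, zero_mul, add_zero, sub_zero] at h
  exact h

def hadamard {n : ℕ} (φ : T.Op n) : T.Op (n + n + 1) := (exists_hadamard φ).choose

lemma hadamard_spec {n : ℕ} (φ : T.Op n) :
    T.subst φ (fun i => hW i + hY n * hD i) - T.subst φ hW = hY n * hadamard φ :=
  (exists_hadamard φ).choose_spec

lemma hadamard_unique {n : ℕ} (φ : T.Op n) (G : T.Op (n + n + 1))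
    (h : T.subst φ (fun i => hW i + hY n * hD i) - T.subst φ hW = hY n * G) : G = hadamard φ := by
  refine sub_eq_zero.1 (var_mul_cancel _ ?_)
  rw [mul_sub, sub_eq_zero]
  exact h.symm.trans (hadamard_spec φ)

end RationalFermatTheory

open RationalFermatTheory

/-- A criterion for `T`-algebra structures: the compatibility with polynomials follows from that
with sums, products and constants. -/
lemma op_poly_of {R : Type u} [CommRing R] [Algebra ℚ R]
    (op : ∀ {n : ℕ}, T.Op n → (Fin n → R) → R)
    (op_var : ∀ {n : ℕ} (i : Fin n) (a : Fin n → R), op (T.var i) a = a i)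
    (op_subst : ∀ {n m : ℕ} (f : T.Op n) (g : Fin n → T.Op m) (a : Fin m → R),
      op (T.subst f g) a = op f (fun i => op (g i) a))
    (hadd : ∀ a : Fin 2 → R, op (T.poly (.X 0 + .X 1)) a = a 0 + a 1)
    (hmul : ∀ a : Fin 2 → R, op (T.poly (.X 0 * .X 1)) a = a 0 * a 1)
    (hC : ∀ (n : ℕ) (q : ℚ) (a : Fin n → R), op (T.poly (.C q)) a = algebraMap ℚ R q)
    {n : ℕ} (p : MvPolynomial (Fin n) ℚ) (a : Fin n → R) :
    op (T.poly p) a = MvPolynomial.aeval a p := by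
  induction p using MvPolynomial.induction_on with
  | C q => rw [hC, MvPolynomial.aeval_C]
  | add p q hp hq =>
    rw [map_add, ← hp, ← hq]
    have h : p + q = MvPolynomial.bind₁ ![p, q] (.X 0 + .X 1) := by simp
    rw [h, RationalTheory.poly_bind, op_subst, hadd]; rfl
  | mul_X p i hp =>
    rw [map_mul, ← hp, MvPolynomial.aeval_X, ← op_var i a]
    have h : p * .X i = MvPolynomial.bind₁ ![p, .X i] (.X 0 * .X 1) := by simp
    rw [h, RationalTheory.poly_bind, op_subst, hmul, ← RationalTheory.poly_X]; rfl

namespace TStructure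

variable {R : Type u} [CommRing R] [Algebra ℚ R] (S : TStructure T R)

/-- The substitution used to evaluate the Hadamard quotient. -/
def hval {n : ℕ} (y : R) (c δ : Fin n → R) : Fin (n + n + 1) → R := Fin.cons y (Fin.append c δ)

lemma op_hval_W {n : ℕ} (y : R) (c δ : Fin n → R) (i : Fin n) :
    S.op (hW i) (hval y c δ) = c i := by
  rw [S.op_var, hval, Fin.cons_succ, Fin.append_left]

lemma op_hval_D {n : ℕ} (y : R) (c δ : Fin n → R) (i : Fin n) :
    S.op (hD i) (hval y c δ) = δ i := by
  rw [S.op_var, hval, Fin.cons_succ, Fin.append_right]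

lemma op_hval_Y {n : ℕ} (y : R) (c δ : Fin n → R) : S.op (hY n) (hval y c δ) = y := by
  rw [S.op_var, hval, Fin.cons_zero]

/-- The second component of the operations on `R ⊕ R τ`, where `τ ^ 2 = y τ`. -/
def hop {n : ℕ} (y : R) (φ : T.Op n) (c δ : Fin n → R) : R := S.op (hadamard φ) (hval y c δ)

lemma hop_of {n : ℕ} (y : R) (φ : T.Op n) (c δ : Fin n → R) (G : T.Op (n + n + 1))
    (h : T.subst φ (fun i => hW i + hY n * hD i) - T.subst φ hW = hY n * G) :
    S.hop y φ c δ = S.op G (hval y c δ) := by rw [hop, ← hadamard_unique φ G h]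

lemma hop_spec {n : ℕ} (y : R) (φ : T.Op n) (c δ : Fin n → R) :
    S.op φ (fun i => c i + y * δ i) = S.op φ c + y * S.hop y φ c δ := by
  have h := congrArg (fun e => S.op e (hval y c δ)) (hadamard_spec φ)
  simp only [S.op_sub, S.op_subst, S.op_add, S.op_mul, op_hval_W, op_hval_D, op_hval_Y] at h
  rw [hop, ← h]; abel

lemma hop_var {n : ℕ} (y : R) (i : Fin n) (c δ : Fin n → R) : S.hop y (T.var i) c δ = δ i := by
  rw [S.hop_of y _ c δ (hD i) (by rw [T.var_subst, T.var_subst]; ring), op_hval_D]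

lemma hop_subst {n m : ℕ} (y : R) (f : T.Op n) (g : Fin n → T.Op m) (c δ : Fin m → R) :
    S.hop y (T.subst f g) c δ =
      S.hop y f (fun i => S.op (g i) c) (fun i => S.hop y (g i) c δ) := by
  let s : Fin (n + n + 1) → T.Op (m + m + 1) :=
    Fin.cons (hY m) (Fin.append (fun i => T.subst (g i) hW) (fun i => hadamard (g i)))
  have sY : s 0 = hY m := rfl
  have sW : ∀ i : Fin n, s (Fin.castAdd n i).succ = T.subst (g i) hW := fun i => by
    simp only [s, Fin.cons_succ, Fin.append_left]
  have sD : ∀ i : Fin n, s (Fin.natAdd n i).succ = hadamard (g i) := fun i => by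
    simp only [s, Fin.cons_succ, Fin.append_right]
  rw [S.hop_of y _ c δ (T.subst (hadamard f) s), S.op_subst, hop]
  · congr 1
    funext j
    refine Fin.cases ?_ (fun j => ?_) j
    · rw [sY, op_hval_Y]; rfl
    · refine Fin.addCases (fun i => ?_) (fun i => ?_) j
      · rw [sW, S.op_subst]
        simp only [op_hval_W]
        rw [hval, Fin.cons_succ, Fin.append_left]
      · rw [sD]
        change S.hop y (g i) c δ = _
        rw [hval, Fin.cons_succ, Fin.append_right]
  · have h := congrArg (fun e => T.subst e s) (hadamard_spec f)
    simp only [subst_sub, subst_mul, subst_add, T.subst_subst, T.var_subst, sW, sD, sY] at h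
    rw [← h, T.subst_subst, T.subst_subst]
    congr 2
    funext i
    rw [← hadamard_spec]; abel

lemma hop_add (y : R) (c δ : Fin 2 → R) :
    S.hop y (T.poly (.X 0 + .X 1)) c δ = δ 0 + δ 1 := by
  have e : ∀ a : Fin 2 → T.Op (2 + 2 + 1), T.subst (T.poly (.X 0 + .X 1)) a = a 0 + a 1 :=
    fun a => (subst_poly _ a).trans (by simp)
  rw [S.hop_of y _ c δ (hD 0 + hD 1) (by rw [e, e]; ring), S.op_add, op_hval_D, op_hval_D]

lemma hop_mul (y : R) (c δ : Fin 2 → R) :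
    S.hop y (T.poly (.X 0 * .X 1)) c δ = c 0 * δ 1 + δ 0 * c 1 + δ 0 * δ 1 * y := by
  have e : ∀ a : Fin 2 → T.Op (2 + 2 + 1), T.subst (T.poly (.X 0 * .X 1)) a = a 0 * a 1 :=
    fun a => (subst_poly _ a).trans (by simp)
  rw [S.hop_of y _ c δ (hW 0 * hD 1 + hD 0 * hW 1 + hD 0 * hD 1 * hY 2) (by rw [e, e]; ring)]
  simp only [S.op_add, S.op_mul, op_hval_D, op_hval_W, op_hval_Y]

lemma hop_C (y : R) {n : ℕ} (q : ℚ) (c δ : Fin n → R) : S.hop y (T.poly (.C q)) c δ = 0 := by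
  have e : ∀ a : Fin n → T.Op (n + n + 1), T.subst (T.poly (.C q)) a = T.poly (.C q) :=
    fun a => (subst_poly _ a).trans (MvPolynomial.aeval_C _ _)
  rw [S.hop_of y _ c δ 0 (by rw [e, e]; ring)]
  exact (S.op_poly 0 _).trans (map_zero _)

end TStructure

namespace TDGA

/-! ### The algebra `A ⊕ A τ` with `τ ^ 2 = y τ` -/

/-- The underlying set of `A ⊕ A τ`. -/
def EY (A : TDGA T) (_ : A.deg 0) : Type u := A.carrier × A.carrier

namespace EY

variable {A : TDGA T} {y : A.deg 0}

instance : AddCommGroup (EY A y) := inferInstanceAs (AddCommGroup (A.carrier × A.carrier))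
instance : Module ℚ (EY A y) := inferInstanceAs (Module ℚ (A.carrier × A.carrier))

@[ext] lemma ext {x z : EY A y} (h : x.1 = z.1) (h' : x.2 = z.2) : x = z := Prod.ext h h'

def mk (a b : A.carrier) : EY A y := (a, b)

@[simp] lemma mk_fst (a b : A.carrier) : (mk a b : EY A y).1 = a := rfl
@[simp] lemma mk_snd (a b : A.carrier) : (mk a b : EY A y).2 = b := rfl

def fstL : EY A y →ₗ[ℚ] A.carrier := LinearMap.fst ℚ _ _
def sndL : EY A y →ₗ[ℚ] A.carrier := LinearMap.snd ℚ _ _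

lemma sum_fst (s : Finset ℕ) (f : ℕ → EY A y) : (∑ i ∈ s, f i).1 = ∑ i ∈ s, (f i).1 :=
  map_sum fstL f s

lemma sum_snd (s : Finset ℕ) (f : ℕ → EY A y) : (∑ i ∈ s, f i).2 = ∑ i ∈ s, (f i).2 :=
  map_sum sndL f s

lemma ext_iff' {x z : EY A y} : x = z ↔ x.1 = z.1 ∧ x.2 = z.2 :=
  ⟨fun h => h ▸ ⟨rfl, rfl⟩, fun h => ext h.1 h.2⟩

/-- The linear endomorphism given by endomorphisms of the components. -/
def map (f g : A.carrier →ₗ[ℚ] A.carrier) : EY A y →ₗ[ℚ] EY A y := LinearMap.prodMap f g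

@[simp] lemma map_fst (f g : A.carrier →ₗ[ℚ] A.carrier) (x : EY A y) : (map f g x).1 = f x.1 := rfl
@[simp] lemma map_snd (f g : A.carrier →ₗ[ℚ] A.carrier) (x : EY A y) : (map f g x).2 = g x.2 := rfl

lemma y_comm (x : A.carrier) : (y : A.carrier) * x = x * y := A.central y.2 x

instance : Mul (EY A y) := ⟨fun x z => mk (x.1 * z.1) (x.1 * z.2 + x.2 * z.1 + x.2 * z.2 * y)⟩
instance : One (EY A y) := ⟨mk 1 0⟩

@[simp] lemma mul_fst (x z : EY A y) : (x * z).1 = x.1 * z.1 := rfl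
@[simp] lemma mul_snd (x z : EY A y) : (x * z).2 = x.1 * z.2 + x.2 * z.1 + x.2 * z.2 * y := rfl
@[simp] lemma one_fst : (1 : EY A y).1 = 1 := rfl
@[simp] lemma one_snd : (1 : EY A y).2 = 0 := rfl
@[simp] lemma add_fst (x z : EY A y) : (x + z).1 = x.1 + z.1 := rfl
@[simp] lemma add_snd (x z : EY A y) : (x + z).2 = x.2 + z.2 := rfl
@[simp] lemma zero_fst : (0 : EY A y).1 = 0 := rfl
@[simp] lemma zero_snd : (0 : EY A y).2 = 0 := rfl
@[simp] lemma smul_fst (q : ℚ) (x : EY A y) : (q • x).1 = q • x.1 := rfl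
@[simp] lemma smul_snd (q : ℚ) (x : EY A y) : (q • x).2 = q • x.2 := rfl

instance : Ring (EY A y) :=
  { (inferInstance : AddCommGroup (EY A y)) with
    mul_assoc := fun a b c => by
      ext
      · simp [mul_assoc]
      · have h1 := y_comm (y := y) c.1
        have h2 := y_comm (y := y) c.2
        simp only [mul_snd, mul_fst, mul_add, add_mul, mul_assoc, h1, h2]
        abel
    one_mul := fun a => by ext <;> simp
    mul_one := fun a => by ext <;> simp
    left_distrib := fun a b c => by
      ext
      · simp [mul_add]
      · simp only [mul_snd, add_fst, add_snd, mul_add, add_mul]; abel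
    right_distrib := fun a b c => by
      ext
      · simp [add_mul]
      · simp only [mul_snd, add_fst, add_snd, add_mul]; abel
    zero_mul := fun a => by ext <;> simp
    mul_zero := fun a => by ext <;> simp }

instance : Algebra ℚ (EY A y) := Algebra.ofModule
  (fun q a b => by ext <;> simp [smul_add])
  (fun q a b => by ext <;> simp [smul_add])

variable (A y)

def grading : ProjGrading (EY A y) where
  pr i := map (A.pr i) (A.pr i)
  pr_pr i j x := by
    split_ifs with h <;> ext <;> simp [CDGA.pr_pr, h]
  bound x := by
    obtain ⟨N, hN⟩ := A.exists_bound x.1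
    obtain ⟨N', hN'⟩ := A.exists_bound x.2
    refine ⟨N + N', ext ?_ ?_⟩
    · rw [sum_fst]; exact A.sum_pr x.1 (N := N + N') fun i hi => hN i (by omega)
    · rw [sum_snd]; exact A.sum_pr x.2 (N := N + N') fun i hi => hN' i (by omega)
  one := ext (A.pr_of_mem A.one_mem) (map_zero (A.pr 0))
  mul i j x z hx hz := by
    have hx1 : x.1 ∈ A.deg i := A.mem_deg_iff.2 (congrArg fstL hx)
    have hx2 : x.2 ∈ A.deg i := A.mem_deg_iff.2 (congrArg sndL hx)
    have hz1 : z.1 ∈ A.deg j := A.mem_deg_iff.2 (congrArg fstL hz)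
    have hz2 : z.2 ∈ A.deg j := A.mem_deg_iff.2 (congrArg sndL hz)
    have h := A.mul_mem (A.mul_mem hx2 hz2) y.2
    rw [add_zero] at h
    exact ext (A.pr_of_mem (A.mul_mem hx1 hz1)) (A.pr_of_mem
      (add_mem (add_mem (A.mul_mem hx1 hz2) (A.mul_mem hx2 hz1)) h))

variable {A y}

lemma mem_deg {i : ℕ} {x : EY A y} : x ∈ (grading A y).deg i ↔ x.1 ∈ A.deg i ∧ x.2 ∈ A.deg i := by
  rw [ProjGrading.mem_deg, A.mem_deg_iff, A.mem_deg_iff]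
  exact ext_iff'

variable (A y) in
def toCDGA : CDGA.{u} where
  carrier := EY A y
  deg := (grading A y).deg
  graded_comm {i j a b} ha hb := by
    rw [mem_deg] at ha hb
    have e : (-1 : EY A y) ^ (i * j) * (b * a) = (-1 : ℚ) ^ (i * j) • (b * a) := by
      rw [Algebra.smul_def]; simp
    rw [e]
    ext
    · exact A.comm' ha.1 hb.1
    · simp only [mul_snd, smul_snd, A.comm' ha.1 hb.2, A.comm' ha.2 hb.1, A.comm' ha.2 hb.2,
        smul_add, smul_mul_assoc]
      abel
  d := map A.d A.d
  d_mem h := mem_deg.2 ⟨A.d_mem (mem_deg.1 h).1, A.d_mem (mem_deg.1 h).2⟩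
  d_zero h := ext (A.d_zero (mem_deg.1 h).1) (A.d_zero (mem_deg.1 h).2)
  d_d x := ext (A.d_d x.1) (A.d_d x.2)
  leibniz {i a} b ha := by
    rw [mem_deg] at ha
    have e : ∀ z : EY A y, (-1 : EY A y) ^ i * z = (-1 : ℚ) ^ i • z := fun z => by
      rw [Algebra.smul_def]; simp
    rw [e]
    have h1 : ∀ z, A.d (a.1 * z) = A.d a.1 * z + (-1 : ℚ) ^ i • (a.1 * A.d z) := fun z => by
      rw [A.leibniz z ha.1, A.neg_one_pow_mul]
    have h2 : ∀ z, A.d (a.2 * z) = A.d a.2 * z + (-1 : ℚ) ^ i • (a.2 * A.d z) := fun z => by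
      rw [A.leibniz z ha.2, A.neg_one_pow_mul]
    have h3 : A.d (b.2 * (y : A.carrier)) = A.d b.2 * y := by
      rw [← y_comm, A.leibniz _ y.2, A.d_zero y.2, ← y_comm]; simp
    ext
    · exact h1 b.1
    · simp only [map_snd, map_fst, mul_snd, add_snd, smul_snd, map_add, h1, h2, h3, mul_assoc,
        smul_add]
      abel

def fst : (toCDGA A y).deg 0 →ₐ[ℚ] A.deg 0 where
  toFun x := ⟨x.1.1, (mem_deg.1 x.2).1⟩
  map_one' := rfl
  map_mul' _ _ := rfl
  map_zero' := rfl
  map_add' _ _ := rfl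
  commutes' q := Subtype.ext (by
    change q • (1 : A.carrier) = _
    exact (Algebra.algebraMap_eq_smul_one (A := A.carrier) q).symm)

def snd : (toCDGA A y).deg 0 →ₗ[ℚ] A.deg 0 where
  toFun x := ⟨x.1.2, (mem_deg.1 x.2).2⟩
  map_smul' _ _ := rfl
  map_add' _ _ := rfl

lemma zero_ext {x z : (toCDGA A y).deg 0} (h : fst x = fst z) (h' : snd x = snd z) : x = z :=
  Subtype.ext (EY.ext (y := y) (congrArg Subtype.val h) (congrArg Subtype.val h'))

lemma snd_mul (x z : (toCDGA A y).deg 0) :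
    snd (x * z) = fst x * snd z + snd x * fst z + snd x * snd z * y := Subtype.ext rfl

def op {n : ℕ} (φ : T.Op n) (x : Fin n → (toCDGA A y).deg 0) : (toCDGA A y).deg 0 :=
  ⟨((A.str.op φ fun i => fst (x i)).1, (A.str.hop y φ (fun i => fst (x i)) fun i => snd (x i)).1),
    mem_deg.2 ⟨SetLike.coe_mem _, SetLike.coe_mem _⟩⟩

lemma fst_op {n : ℕ} (φ : T.Op n) (x : Fin n → (toCDGA A y).deg 0) :
    fst (op φ x) = A.str.op φ fun i => fst (x i) := rfl

lemma snd_op {n : ℕ} (φ : T.Op n) (x : Fin n → (toCDGA A y).deg 0) :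
    snd (op φ x) = A.str.hop y φ (fun i => fst (x i)) fun i => snd (x i) := rfl

end EY

variable (A : TDGA T) (y : A.deg 0)

/-- The differential graded `T`-algebra `A ⊕ A τ`, where `τ ^ 2 = y τ`. -/
def extY : TDGA T where
  toCDGA := EY.toCDGA A y
  str :=
    { op := EY.op
      op_var := fun i a => EY.zero_ext (by rw [EY.fst_op, A.str.op_var])
        (by rw [EY.snd_op, A.str.hop_var])
      op_subst := fun f g a => EY.zero_ext
        (by simp only [EY.fst_op, A.str.op_subst])
        (by simp only [EY.fst_op, EY.snd_op, A.str.hop_subst])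
      op_poly := fun p a => by
        refine op_poly_of EY.op (fun i a => EY.zero_ext (by rw [EY.fst_op, A.str.op_var])
          (by rw [EY.snd_op, A.str.hop_var])) (fun f g a => EY.zero_ext
          (by simp only [EY.fst_op, A.str.op_subst])
          (by simp only [EY.fst_op, EY.snd_op, A.str.hop_subst])) (fun a => EY.zero_ext ?_ ?_)
          (fun a => EY.zero_ext ?_ ?_) (fun n q a => EY.zero_ext ?_ ?_) p a
        · rw [EY.fst_op, A.str.op_poly, map_add]; simp
        · rw [EY.snd_op, A.str.hop_add, map_add]
        · rw [EY.fst_op, A.str.op_poly, map_mul]; simp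
        · rw [EY.snd_op, A.str.hop_mul, EY.snd_mul]
        · rw [EY.fst_op, A.str.op_poly, AlgHom.commutes, MvPolynomial.aeval_C]
        · rw [EY.snd_op, A.str.hop_C]
          exact Subtype.ext (smul_zero q).symm }

variable {A y}

namespace extY

lemma mem_deg {i : ℕ} {x : EY A y} : x ∈ (extY A y).deg i ↔ x.1 ∈ A.deg i ∧ x.2 ∈ A.deg i :=
  EY.mem_deg

/-- The projection with `τ ↦ 0`. -/
def fst : extY A y ⟶ A where
  toAlgHom :=
    { toFun x := x.1
      map_one' := rfl
      map_mul' _ _ := rfl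
      map_zero' := rfl
      map_add' _ _ := rfl
      commutes' q := (Algebra.algebraMap_eq_smul_one (A := A.carrier) q).symm }
  map_deg h := (mem_deg.1 h).1
  map_d _ := rfl
  map_op _ _ := rfl

/-- The morphism with `τ ↦ y`. -/
def eval : extY A y ⟶ A where
  toAlgHom :=
    { toFun x := x.1 + y * x.2
      map_one' := by change (1 : A.carrier) + y * 0 = 1; rw [mul_zero, add_zero]
      map_mul' x z := by
        change x.1 * z.1 + y * (x.1 * z.2 + x.2 * z.1 + x.2 * z.2 * y) = _
        have h1 := EY.y_comm (y := y)
        simp only [mul_add, add_mul, h1, mul_assoc]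
        abel
      map_zero' := by change (0 : A.carrier) + y * 0 = 0; rw [mul_zero, add_zero]
      map_add' x z := by
        change x.1 + z.1 + y * (x.2 + z.2) = x.1 + y * x.2 + (z.1 + y * z.2)
        rw [mul_add]; abel
      commutes' q := by
        change q • (1 : A.carrier) + y * (q • (0 : A.carrier)) = _
        rw [smul_zero, mul_zero, add_zero, Algebra.algebraMap_eq_smul_one] }
  map_deg {i x} h := by
    refine add_mem (mem_deg.1 h).1 ?_
    have := A.mul_mem y.2 (mem_deg.1 h).2
    rwa [zero_add] at this
  map_d x := by
    change A.d x.1 + y * A.d x.2 = A.d (x.1 + y * x.2)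
    rw [map_add, A.leibniz _ y.2, A.d_zero y.2]; simp
  map_op φ a := congrArg Subtype.val (A.str.hop_spec y φ _ _).symm

end extY

/-! ### The algebra `A ⊕ A v` with `v` of degree `1` and `d v = y` -/

/-- The underlying set of `A ⊕ A v`. -/
def Odd (A : TDGA T) (_ : A.deg 0) : Type u := A.carrier × A.carrier

namespace Odd

instance : AddCommGroup (Odd A y) := inferInstanceAs (AddCommGroup (A.carrier × A.carrier))
instance : Module ℚ (Odd A y) := inferInstanceAs (Module ℚ (A.carrier × A.carrier))

@[ext] lemma ext {x z : Odd A y} (h : x.1 = z.1) (h' : x.2 = z.2) : x = z := Prod.ext h h'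

def mk (a b : A.carrier) : Odd A y := (a, b)

@[simp] lemma mk_fst (a b : A.carrier) : (mk a b : Odd A y).1 = a := rfl
@[simp] lemma mk_snd (a b : A.carrier) : (mk a b : Odd A y).2 = b := rfl

def fstL : Odd A y →ₗ[ℚ] A.carrier := LinearMap.fst ℚ _ _
def sndL : Odd A y →ₗ[ℚ] A.carrier := LinearMap.snd ℚ _ _

lemma sum_fst (s : Finset ℕ) (f : ℕ → Odd A y) : (∑ i ∈ s, f i).1 = ∑ i ∈ s, (f i).1 :=
  map_sum fstL f s

lemma sum_snd (s : Finset ℕ) (f : ℕ → Odd A y) : (∑ i ∈ s, f i).2 = ∑ i ∈ s, (f i).2 :=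
  map_sum sndL f s

lemma ext_iff' {x z : Odd A y} : x = z ↔ x.1 = z.1 ∧ x.2 = z.2 :=
  ⟨fun h => h ▸ ⟨rfl, rfl⟩, fun h => ext h.1 h.2⟩

/-- The linear endomorphism given by endomorphisms of the components. -/
def map (f g : A.carrier →ₗ[ℚ] A.carrier) : Odd A y →ₗ[ℚ] Odd A y := LinearMap.prodMap f g

@[simp] lemma map_fst (f g : A.carrier →ₗ[ℚ] A.carrier) (x : Odd A y) : (map f g x).1 = f x.1 := rfl
@[simp] lemma map_snd (f g : A.carrier →ₗ[ℚ] A.carrier) (x : Odd A y) : (map f g x).2 = g x.2 := rfl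

instance : Mul (Odd A y) := ⟨fun x z => mk (x.1 * z.1) (x.1 * z.2 + x.2 * A.sgn z.1)⟩
instance : One (Odd A y) := ⟨mk 1 0⟩

@[simp] lemma mul_fst (x z : Odd A y) : (x * z).1 = x.1 * z.1 := rfl
@[simp] lemma mul_snd (x z : Odd A y) : (x * z).2 = x.1 * z.2 + x.2 * A.sgn z.1 := rfl
@[simp] lemma one_fst : (1 : Odd A y).1 = 1 := rfl
@[simp] lemma one_snd : (1 : Odd A y).2 = 0 := rfl
@[simp] lemma add_fst (x z : Odd A y) : (x + z).1 = x.1 + z.1 := rfl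
@[simp] lemma add_snd (x z : Odd A y) : (x + z).2 = x.2 + z.2 := rfl
@[simp] lemma zero_fst : (0 : Odd A y).1 = 0 := rfl
@[simp] lemma zero_snd : (0 : Odd A y).2 = 0 := rfl
@[simp] lemma smul_fst (q : ℚ) (x : Odd A y) : (q • x).1 = q • x.1 := rfl
@[simp] lemma smul_snd (q : ℚ) (x : Odd A y) : (q • x).2 = q • x.2 := rfl

instance : Ring (Odd A y) :=
  { (inferInstance : AddCommGroup (Odd A y)) with
    mul_assoc := fun a b c => by
      ext
      · simp [mul_assoc]
      · simp [mul_assoc, mul_add, add_mul, add_assoc]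
    one_mul := fun a => by ext <;> simp
    mul_one := fun a => by ext <;> simp
    left_distrib := fun a b c => by
      ext
      · simp [mul_add]
      · simp only [mul_snd, add_fst, add_snd, mul_add, map_add]; abel
    right_distrib := fun a b c => by
      ext
      · simp [add_mul]
      · simp only [mul_snd, add_fst, add_snd, add_mul]; abel
    zero_mul := fun a => by ext <;> simp
    mul_zero := fun a => by ext <;> simp }

instance : Algebra ℚ (Odd A y) := Algebra.ofModule
  (fun q a b => by ext <;> simp [smul_add])
  (fun q a b => by ext <;> simp [smul_add])

/-- The homogeneous components shifted by one. -/
def prShift (A : TDGA T) : ℕ → A.carrier →ₗ[ℚ] A.carrier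
  | 0 => 0
  | i + 1 => A.pr i

variable (A y)

def grading : ProjGrading (Odd A y) where
  pr i := map (A.pr i) (prShift A i)
  pr_pr i j x := by
    split_ifs with h
    · subst h
      ext
      · simp [CDGA.pr_pr]
      · cases i <;> simp [prShift, CDGA.pr_pr]
    · ext
      · simp [CDGA.pr_pr, h]
      · cases i <;> cases j <;> simp_all [prShift, CDGA.pr_pr]
  bound x := by
    obtain ⟨N, hN⟩ := A.exists_bound x.1
    obtain ⟨N', hN'⟩ := A.exists_bound x.2
    refine ⟨N + N' + 1, ext ?_ ?_⟩
    · rw [sum_fst]; exact A.sum_pr x.1 (N := N + N' + 1) fun i hi => hN i (by omega)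
    · rw [sum_snd, Finset.sum_range_succ']
      exact (A.sum_pr x.2 (N := N + N') fun i hi => hN' i (by omega)).trans (add_zero _).symm
  one := ext (A.pr_of_mem A.one_mem) (map_zero (prShift A 0))
  mul i j x z hx hz := by
    have hx1 : x.1 ∈ A.deg i := A.mem_deg_iff.2 (congrArg fstL hx)
    have hx2 : prShift A i x.2 = x.2 := congrArg sndL hx
    have hz1 : z.1 ∈ A.deg j := A.mem_deg_iff.2 (congrArg fstL hz)
    have hz2 : prShift A j z.2 = z.2 := congrArg sndL hz
    refine ext (A.pr_of_mem (A.mul_mem hx1 hz1)) ?_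
    change prShift A (i + j) (x.1 * z.2 + x.2 * A.sgn z.1) = _
    have h1 : prShift A (i + j) (x.1 * z.2) = x.1 * z.2 := by
      cases j with
      | zero => have h : z.2 = 0 := hz2.symm; rw [h]; simp
      | succ j => exact A.pr_of_mem (A.mul_mem hx1 (A.mem_deg_iff.2 hz2))
    have h2 : prShift A (i + j) (x.2 * A.sgn z.1) = x.2 * A.sgn z.1 := by
      cases i with
      | zero => have h : x.2 = 0 := hx2.symm; rw [h]; simp
      | succ i =>
        rw [Nat.succ_add]
        exact A.pr_of_mem (A.mul_mem (A.mem_deg_iff.2 hx2) (A.sgn_mem hz1))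
    rw [map_add, h1, h2]; rfl

variable {A y}

lemma mem_deg_zero {x : Odd A y} : x ∈ (grading A y).deg 0 ↔ x.1 ∈ A.deg 0 ∧ x.2 = 0 := by
  rw [ProjGrading.mem_deg, A.mem_deg_iff]
  exact ext_iff'.trans (and_congr Iff.rfl eq_comm)

lemma mem_deg_succ {i : ℕ} {x : Odd A y} :
    x ∈ (grading A y).deg (i + 1) ↔ x.1 ∈ A.deg (i + 1) ∧ x.2 ∈ A.deg i := by
  rw [ProjGrading.mem_deg, A.mem_deg_iff, A.mem_deg_iff]
  exact ext_iff'

/-- Homogeneous elements, with a sign rule for the second component. -/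
lemma sgn_of_mem {i : ℕ} {x : Odd A y} (hx : x ∈ (grading A y).deg i) :
    x.1 ∈ A.deg i ∧ A.sgn x.2 = -(-1 : ℚ) ^ i • x.2 := by
  cases i with
  | zero => rw [mem_deg_zero] at hx; exact ⟨hx.1, by rw [hx.2]; simp⟩
  | succ i =>
    rw [mem_deg_succ] at hx
    exact ⟨hx.1, by rw [A.sgn_of_mem hx.2, pow_succ]; simp⟩

lemma comm_snd {i j : ℕ} {a b : Odd A y} (ha : a ∈ (grading A y).deg i)
    (hb : b ∈ (grading A y).deg j) :
    a.1 * b.2 = (-1 : ℚ) ^ (i * j) • (b.2 * A.sgn a.1) := by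
  cases j with
  | zero => rw [mem_deg_zero] at hb; rw [hb.2]; simp
  | succ j =>
    rw [mem_deg_succ] at hb
    have h1 := (sgn_of_mem ha).1
    rw [A.sgn_of_mem h1, A.comm' h1 hb.2, mul_smul_comm, smul_smul, mul_add, pow_add, mul_one,
      mul_assoc, ← pow_add, ← two_mul, pow_mul (-1 : ℚ) 2]
    simp

lemma comm_fst {i j : ℕ} {a b : Odd A y} (ha : a ∈ (grading A y).deg i)
    (hb : b ∈ (grading A y).deg j) :
    a.2 * A.sgn b.1 = (-1 : ℚ) ^ (i * j) • (b.1 * a.2) := by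
  rw [comm_snd hb ha, smul_smul, ← pow_add, mul_comm j i, ← two_mul, pow_mul]; simp

variable (A y) in
def d : Odd A y →ₗ[ℚ] Odd A y where
  toFun x := mk (A.d x.1 + A.sgn x.2 * y) (A.d x.2)
  map_add' x z := by
    ext
    · simp only [mk_fst, add_fst, add_snd, map_add, add_mul]; abel
    · simp
  map_smul' q x := by
    ext
    · simp [smul_add]
    · simp

@[simp] lemma d_fst (x : Odd A y) : (d A y x).1 = A.d x.1 + A.sgn x.2 * y := rfl
@[simp] lemma d_snd (x : Odd A y) : (d A y x).2 = A.d x.2 := rfl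

lemma d_mul_y (x : A.carrier) : A.d (x * y) = A.d x * y := by
  rw [← EY.y_comm, A.leibniz _ y.2, A.d_zero y.2, ← EY.y_comm]; simp

variable (A y) in
def toCDGA : CDGA.{u} where
  carrier := Odd A y
  deg := (grading A y).deg
  graded_comm {i j a b} ha hb := by
    have e : (-1 : Odd A y) ^ (i * j) * (b * a) = (-1 : ℚ) ^ (i * j) • (b * a) := by
      rw [Algebra.smul_def]; simp
    rw [e]
    ext
    · exact A.comm' (sgn_of_mem ha).1 (sgn_of_mem hb).1
    · simp only [mul_snd, smul_snd, smul_add, comm_snd ha hb, comm_fst ha hb]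
      abel
  d := d A y
  d_mem {i a} h := by
    rw [mem_deg_succ] at h
    have h1 : A.d a.1 + A.sgn a.2 * y ∈ A.deg i := add_mem (A.d_mem h.1)
      (A.mul_mem (A.sgn_mem h.2) y.2)
    cases i with
    | zero => exact mem_deg_zero.2 ⟨h1, A.d_zero h.2⟩
    | succ i => exact mem_deg_succ.2 ⟨h1, A.d_mem h.2⟩
  d_zero {a} h := by
    rw [mem_deg_zero] at h
    ext
    · rw [d_fst, h.2, A.d_zero h.1]; simp
    · rw [d_snd, h.2]; simp
  d_d x := by
    ext
    · rw [d_fst, d_snd, d_fst, map_add, A.d_d, d_mul_y, A.d_sgn]; simp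
    · exact A.d_d x.2
  leibniz {i a} b ha := by
    have e : ∀ z : Odd A y, (-1 : Odd A y) ^ i * z = (-1 : ℚ) ^ i • z := fun z => by
      rw [Algebra.smul_def]; simp
    obtain ⟨h1, h2⟩ := sgn_of_mem ha
    have hy : A.sgn y = y := by rw [A.sgn_of_mem y.2]; simp
    rw [e]
    ext
    · simp only [d_fst, mul_fst, mul_snd, add_fst, smul_fst, A.leibniz', map_add, map_mul,
        A.sgn_sgn, h2, A.sgn_of_mem h1]
      simp only [add_mul, mul_add, smul_mul_assoc, mul_assoc, smul_add, EY.y_comm, neg_smul,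
        neg_mul]
      abel
    · simp only [d_fst, d_snd, mul_snd, add_snd, smul_snd, A.leibniz', map_add, map_mul,
        A.sgn_sgn, h2, A.sgn_of_mem h1, A.d_sgn, hy]
      simp only [add_mul, mul_add, smul_mul_assoc, mul_assoc, smul_add, EY.y_comm, neg_smul,
        neg_mul, mul_neg]
      abel

def zeroEquiv : (toCDGA A y).deg 0 →ₐ[ℚ] A.deg 0 where
  toFun x := ⟨x.1.1, (mem_deg_zero.1 x.2).1⟩
  map_one' := rfl
  map_mul' _ _ := rfl
  map_zero' := rfl
  map_add' _ _ := rfl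
  commutes' q := Subtype.ext (by
    change q • (1 : A.carrier) = _
    exact (Algebra.algebraMap_eq_smul_one (A := A.carrier) q).symm)

lemma zeroEquiv_inj {x z : (toCDGA A y).deg 0} (h : zeroEquiv x = zeroEquiv z) : x = z :=
  Subtype.ext (Odd.ext (y := y) (congrArg Subtype.val h)
    ((mem_deg_zero.1 x.2).2.trans (mem_deg_zero.1 z.2).2.symm))

end Odd

variable (A y)

/-- The differential graded `T`-algebra `A ⊕ A v`, with `v` of degree `1` and `d v = y`. -/
def odd : TDGA T where
  toCDGA := Odd.toCDGA A y
  str :=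
    { op := fun φ x => ⟨((A.str.op φ fun i => Odd.zeroEquiv (x i)).1, 0),
        Odd.mem_deg_zero.2 ⟨SetLike.coe_mem _, rfl⟩⟩
      op_var := fun i _ => Odd.zeroEquiv_inj (A.str.op_var i _)
      op_subst := fun f g _ => Odd.zeroEquiv_inj (A.str.op_subst f g _)
      op_poly := fun p a => Odd.zeroEquiv_inj ((A.str.op_poly p _).trans
        (MvPolynomial.comp_aeval_apply a Odd.zeroEquiv p).symm) }

variable {A y}

namespace odd

def of : A ⟶ odd A y where
  toAlgHom :=
    { toFun x := (Odd.mk x 0 : Odd A y)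
      map_one' := rfl
      map_mul' x z := Odd.ext rfl (((Odd.mul_snd (Odd.mk x 0) (Odd.mk z 0)).trans (by simp)).symm)
      map_zero' := rfl
      map_add' x z := Odd.ext rfl (add_zero _).symm
      commutes' q := Odd.ext (Algebra.algebraMap_eq_smul_one (A := A.carrier) q)
        (smul_zero q).symm }
  map_deg {i x} h := by
    cases i with
    | zero => exact (Odd.mem_deg_zero (x := Odd.mk x 0)).2 ⟨h, rfl⟩
    | succ i => exact (Odd.mem_deg_succ (x := Odd.mk x 0)).2 ⟨h, zero_mem _⟩
  map_d x := Odd.ext (y := y) (by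
    change A.d x = A.d x + A.sgn 0 * y
    simp) (map_zero _).symm
  map_op _ _ := rfl

variable (A y) in
def v : (odd A y).deg 1 := ⟨(Odd.mk 0 1 : Odd A y), Odd.mem_deg_succ.2 ⟨zero_mem _, A.one_mem⟩⟩

variable {Z : TDGA T}

lemma sgn_mul_comm {z : Z.carrier} (hz : z ∈ Z.deg 1) (x : Z.carrier) : z * x = Z.sgn x * z := by
  induction x using Z.hom_induction with
  | zero => simp
  | homog i x hx => rw [Z.comm' hz hx, Z.sgn_of_mem hx, one_mul, smul_mul_assoc]
  | add x x' h h' => rw [mul_add, h, h', map_add, add_mul]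

lemma sq_eq_zero {z : Z.carrier} (hz : z ∈ Z.deg 1) : z * z = 0 := by
  have h := Z.comm' hz hz
  rw [mul_one, pow_one, neg_smul, one_smul, eq_neg_iff_add_eq_zero, ← two_smul ℚ] at h
  exact (smul_eq_zero.1 h).resolve_left two_ne_zero

lemma map_sgn (f : A ⟶ Z) (x : A.carrier) : f (A.sgn x) = Z.sgn (f x) := by
  induction x using A.hom_induction with
  | zero => simp
  | homog i x hx => rw [A.sgn_of_mem hx, map_smul, Z.sgn_of_mem (f.map_deg hx)]
  | add x x' h h' => rw [map_add, map_add, h, h', map_add, map_add]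

/-- The universal property of `A ⊕ A v`. -/
def desc (f : A ⟶ Z) (z : Z.deg 1) (hz : Z.d z = f y) : odd A y ⟶ Z where
  toAlgHom :=
    { toFun x := f x.1 + f x.2 * z
      map_one' := by
        change f 1 + f 0 * z = 1
        rw [map_one, map_zero, zero_mul, add_zero]
      map_mul' x x' := by
        change f (x.1 * x'.1) + f (x.1 * x'.2 + x.2 * A.sgn x'.1) * z = _
        have h1 : ∀ t t' : Z.carrier, t * z * (t' * z) = 0 := fun t t' => by
          rw [mul_assoc, ← mul_assoc (z : Z.carrier), sgn_mul_comm z.2, mul_assoc (Z.sgn t'),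
            sq_eq_zero z.2, mul_zero, mul_zero]
        have h2 := sgn_mul_comm z.2 (f x'.1)
        rw [add_mul, mul_add, mul_add, h1, add_zero, mul_assoc _ (z : Z.carrier), h2]
        simp only [map_mul, map_add, map_sgn, add_mul, mul_assoc]
        abel
      map_zero' := by
        change f 0 + f 0 * z = 0
        rw [map_zero, zero_mul, add_zero]
      map_add' x x' := by
        change f (x.1 + x'.1) + f (x.2 + x'.2) * z =
          f x.1 + f x.2 * z + (f x'.1 + f x'.2 * z)
        rw [map_add, map_add, add_mul]; abel
      commutes' q := by
        change f (q • (1 : A.carrier)) + f (q • (0 : A.carrier)) * z = _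
        rw [smul_zero, map_zero, zero_mul, add_zero, map_smul, map_one,
          Algebra.algebraMap_eq_smul_one] }
  map_deg {i x} h := by
    cases i with
    | zero =>
      have h' := Odd.mem_deg_zero.1 h
      change f x.1 + f x.2 * z ∈ _
      rw [h'.2, map_zero, zero_mul, add_zero]
      exact f.map_deg h'.1
    | succ i =>
      have h' := Odd.mem_deg_succ.1 h
      exact add_mem (f.map_deg h'.1) (Z.mul_mem (f.map_deg h'.2) z.2)
  map_d x := by
    change f (A.d x.1 + A.sgn x.2 * y) + f (A.d x.2) * z =
      Z.d (f x.1 + f x.2 * z)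
    rw [map_add, map_add, Z.leibniz', hz, map_mul, f.map_d, f.map_d, map_sgn]; abel
  map_op φ a := by
    have h0 : f 0 * (z : Z.carrier) = 0 := by rw [map_zero, zero_mul]
    refine (congrArg (f (A.str.op φ fun i => Odd.zeroEquiv (a i)).1 + ·) h0).trans
      ((add_zero _).trans ((f.map_op φ _).trans ?_))
    refine congrArg Subtype.val (congrArg _ (funext fun i => Subtype.ext ?_))
    change f (a i).1.1 = f (a i).1.1 + f (a i).1.2 * z
    rw [(Odd.mem_deg_zero.1 (a i).2).2, map_zero, zero_mul, add_zero]

lemma of_desc (f : A ⟶ Z) (z : Z.deg 1) (hz : Z.d z = f y) : of ≫ desc f z hz = f :=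
  TDGA.hom_ext fun x => by
    change f x + f 0 * z = _
    simp

lemma desc_v (f : A ⟶ Z) (z : Z.deg 1) (hz : Z.d z = f y) :
    (desc f z hz) (v A y).1 = z := by
  change f 0 + f 1 * z = _
  simp

end odd

end TDGA

open RationalFermatTheory in
lemma TStructure.hop_zero {R : Type u} [CommRing R] [Algebra ℚ R] (S : TStructure T R)
    {n : ℕ} (y : R) (φ : T.Op n) (c : Fin n → R) : S.hop y φ c 0 = 0 := by
  let s : Fin (n + n + 1) → T.Op (n + n + 1) :=
    Fin.cons (hY n) (Fin.append (fun i => hW i) (fun _ => 0))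
  have sY : s 0 = hY n := rfl
  have sW : ∀ i : Fin n, s (Fin.castAdd n i).succ = hW i := fun i => by
    simp only [s, Fin.cons_succ, Fin.append_left]
  have sD : ∀ i : Fin n, s (Fin.natAdd n i).succ = 0 := fun i => by
    simp only [s, Fin.cons_succ, Fin.append_right]
  have h := congrArg (fun e => T.subst e s) (hadamard_spec φ)
  simp only [subst_sub, subst_mul, subst_add, T.subst_subst, T.var_subst, sW, sD, sY, mul_zero,
    add_zero, sub_self] at h
  have h' := congrArg (fun e => S.op e (hval y c 0)) (var_mul_cancel _ h.symm)
  simp only [S.op_subst] at h'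
  refine Eq.trans ?_ (h'.trans ((S.op_poly 0 _).trans (map_zero _)))
  rw [hop]
  congr 1
  funext j
  refine Fin.cases ?_ (fun j => ?_) j
  · rw [sY, op_hval_Y]; rfl
  · refine Fin.addCases (fun i => ?_) (fun i => ?_) j
    · rw [sW, op_hval_W, hval, Fin.cons_succ, Fin.append_left]
    · rw [sD, hval, Fin.cons_succ, Fin.append_right]
      exact ((S.op_poly 0 _).trans (map_zero _)).symm

namespace TDGA

variable {X Y Z : TDGA T}

namespace extY

variable {A : TDGA T} {y : A.deg 0}

/-- The inclusion of `A` in `A ⊕ A τ`. -/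
def of : A ⟶ extY A y where
  toAlgHom :=
    { toFun x := (EY.mk x 0 : EY A y)
      map_one' := rfl
      map_mul' x z := EY.ext rfl (((EY.mul_snd (EY.mk x 0) (EY.mk z 0)).trans (by simp)).symm)
      map_zero' := rfl
      map_add' x z := EY.ext rfl (add_zero _).symm
      commutes' q := EY.ext (Algebra.algebraMap_eq_smul_one (A := A.carrier) q)
        (smul_zero q).symm }
  map_deg h := (mem_deg (x := EY.mk _ 0)).2 ⟨h, zero_mem _⟩
  map_d x := EY.ext (y := y) rfl (map_zero A.d).symm
  map_op φ a := EY.ext (y := y) rfl (congrArg Subtype.val (A.str.hop_zero (y : A.deg 0) φ a)).symm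

end extY

lemma quasiIso_of_retraction (i : X ⟶ Z) (r : Z ⟶ X) (hr : i ≫ r = 𝟙 X)
    (h : ∀ n, ∀ z ∈ Z.cycles n, ∃ w ∈ Z.deg (n + 1), Z.d w = i (r z) - z) :
    QuasiIso i := by
  have hr' : ∀ x, r (i x) = x := fun x =>
    congr_toAlgHom hr x
  refine quasiIso_iff.2 ⟨fun n z _ w hw hwz => ⟨r w, r.map_deg hw, ?_⟩, fun n z hz => ?_⟩
  · rw [← r.map_d, hwz, hr']
  · obtain ⟨w, hw, h⟩ := h n z hz
    exact ⟨r z, map_cycles r hz, w, hw, h⟩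

section Cell

variable (X)

/-- The algebra obtained from `X` by freely adjoining an element `y` of degree `0`. -/
abbrev line : TDGA T := adj X (fun _ : PUnit.{u + 1} => 0)

abbrev lineGen : (line X).deg 0 := adj.gen X (fun _ : PUnit.{u + 1} => 0) ⟨⟩

def lineRetr : line X ⟶ X := adj.desc (𝟙 X) fun _ => 0

def lineSplit : line X ⟶ extY (line X) (lineGen X) :=
  adj.desc (adj.of X _ ≫ extY.of) fun _ =>
    ⟨(EY.mk 0 1 : EY (line X) (lineGen X)), extY.mem_deg.2 ⟨zero_mem _, (line X).one_mem⟩⟩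

lemma lineSplit_fst : lineSplit X ≫ extY.fst = lineRetr X ≫ adj.of X _ := by
  refine adj.hom_ext ?_ fun s => ?_
  · rw [lineSplit, lineRetr, ← assoc, adj.of_desc, ← assoc, adj.of_desc]
    rfl
  · rw [comp_apply, comp_apply, lineSplit, lineRetr, adj.desc_gen, adj.desc_gen]
    exact (map_zero _).symm

lemma lineSplit_eval : lineSplit X ≫ extY.eval = 𝟙 _ := by
  refine adj.hom_ext ?_ fun s => ?_
  · rw [lineSplit, ← assoc, adj.of_desc, comp_id]
    refine TDGA.hom_ext fun x => ?_
    change (adj.of X _) x + (lineGen X : (line X).carrier) * 0 = _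
    rw [mul_zero, add_zero]
  · rw [comp_apply, lineSplit, adj.desc_gen, id_apply]
    change 0 + (lineGen X : (line X).carrier) * 1 = _
    rw [zero_add, mul_one]

/-- The quotient of `a - a(0)` by `y`. -/
def δ : (line X).carrier →ₗ[ℚ] (line X).carrier :=
  EY.sndL ∘ₗ (lineSplit X).toAlgHom.toLinearMap

lemma eq_add_δ (a : (line X).carrier) :
    a = (adj.of X _) ((lineRetr X) a) + (lineGen X).1 * δ X a := by
  have h1 := congr_toAlgHom (lineSplit_eval X) a
  have h2 := congr_toAlgHom (lineSplit_fst X) a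
  exact h1.symm.trans (congrArg (· + (lineGen X : (line X).carrier) * δ X a) h2)

lemma δ_mul (a : (line X).carrier) : δ X ((lineGen X).1 * a) = a := by
  have h2 := congr_toAlgHom (lineSplit_fst X) a
  have h3 : (lineSplit X) (lineGen X) = (EY.mk 0 1 : EY (line X) (lineGen X)) :=
    adj.desc_gen _ _ _
  change ((lineSplit X) ((lineGen X : (line X).carrier) * a) :
    EY (line X) (lineGen X)).2 = a
  rw [map_mul, h3]
  refine (EY.mul_snd _ _).trans ?_
  rw [EY.mk_fst, EY.mk_snd, zero_mul, zero_add, one_mul, one_mul, ← EY.y_comm]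
  exact (congrArg (· + (lineGen X : (line X).carrier) * δ X a) h2).trans (eq_add_δ X a).symm

lemma d_δ (a : (line X).carrier) : (line X).d (δ X a) = δ X ((line X).d a) :=
  (congrArg (fun x : EY (line X) (lineGen X) => x.2) ((lineSplit X).map_d a)).symm

lemma δ_mem {i : ℕ} {a : (line X).carrier} (h : a ∈ (line X).deg i) : δ X a ∈ (line X).deg i :=
  (extY.mem_deg.1 ((lineSplit X).map_deg h)).2

/-- The algebra obtained from `X` by adjoining an element of degree `1` and its differential. -/
abbrev disk : TDGA T := odd (line X) (lineGen X)

lemma quasiIso_disk : QuasiIso (adj.of X _ ≫ odd.of : X ⟶ disk X) := by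
  have hr0 : (lineRetr X) (lineGen X) = 0 := adj.desc_gen _ _ _
  let r : disk X ⟶ X := odd.desc (lineRetr X) 0 (by
    rw [hr0]; exact map_zero _)
  refine quasiIso_of_retraction _ r ?_ fun n z hz => ?_
  · rw [assoc, odd.of_desc, lineRetr, adj.of_desc]
  · let a : (line X).carrier := (z : Odd (line X) (lineGen X)).1
    let b : (line X).carrier := (z : Odd (line X) (lineGen X)).2
    have hz0 : (line X).d a + (line X).sgn b * lineGen X = 0 :=
      congrArg (fun x : Odd (line X) (lineGen X) => x.1) hz.2
    have ha : a ∈ (line X).deg n := (Odd.sgn_of_mem hz.1).1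
    have hw : (line X).sgn (δ X a) ∈ (line X).deg n := (line X).sgn_mem (δ_mem X ha)
    refine ⟨(Odd.mk 0 (-(line X).sgn (δ X a)) : Odd (line X) (lineGen X)),
      Odd.mem_deg_succ.2 ⟨zero_mem _, neg_mem hw⟩, ?_⟩
    have hrz : r z = (lineRetr X) a := by
      change (lineRetr X) a + (lineRetr X) b * 0 = _
      rw [mul_zero, add_zero]
    rw [hrz]
    refine Odd.ext (y := lineGen X) ?_ ?_
    · change (line X).d 0 + (line X).sgn (-(line X).sgn (δ X a)) * (lineGen X).1 =
        (adj.of X _) ((lineRetr X) a) - a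
      rw [map_zero, zero_add, map_neg, CDGA.sgn_sgn, neg_mul, ← EY.y_comm, neg_eq_iff_eq_neg,
        neg_sub]
      exact (sub_eq_of_eq_add' (eq_add_δ X a)).symm
    · change (line X).d (-(line X).sgn (δ X a)) = 0 - b
      rw [map_neg, CDGA.d_sgn, d_δ, eq_neg_of_add_eq_zero_left hz0, ← EY.y_comm, map_neg, δ_mul,
        map_neg, neg_neg, CDGA.sgn_sgn, zero_sub]

variable {X}

/-- The universal property of adjoining an element of degree `1`. -/
structure IsCell (i : X ⟶ Z) (v : Z.deg 1) : Prop where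
  exists_desc : ∀ {W : TDGA T} (f : X ⟶ W) (w : W.deg 1),
    ∃ g : Z ⟶ W, i ≫ g = f ∧ g.toAlgHom v = w
  hom_ext : ∀ {W : TDGA T} (f g : Z ⟶ W), i ≫ f = i ≫ g → f v = g v → f = g

lemma IsCell.quasiIso {i : X ⟶ Z} {v : Z.deg 1} (h : IsCell i v) : QuasiIso i := by
  obtain ⟨s, hs, hsv⟩ := h.exists_desc (adj.of X _ ≫ odd.of : X ⟶ disk X) (odd.v _ _)
  let r0 : line X ⟶ Z := adj.desc i fun _ => ⟨Z.d v, Z.d_mem v.2⟩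
  have hr0 : r0 (lineGen X) = Z.d v := adj.desc_gen _ _ _
  refine (quasiIso_disk X).of_retract s (odd.desc r0 v hr0.symm) hs (h.hom_ext _ _ ?_ ?_)
  · rw [← assoc, hs, assoc, odd.of_desc, adj.of_desc, comp_id]
  · rw [comp_apply, hsv, odd.desc_v, id_apply]

end Cell

section Directed

variable (X) {S : Type u} (e : S → ℕ)

/-- The algebra obtained by adjoining finitely many of the elements. -/
abbrev adjFin (F : Finset S) : TDGA T := adj X (fun s : {s // s ∈ F} => e s)

def adjFinMap (F : Finset S) : adjFin X e F ⟶ adj X e :=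
  adj.desc (adj.of X e) fun s => adj.gen X e s.1

open Classical in
def adjFinRetr (F : Finset S) : adj X e ⟶ adjFin X e F :=
  adj.desc (adj.of X _) fun s => if h : s ∈ F then adj.gen X (fun s : {s // s ∈ F} => e s) ⟨s, h⟩
    else 0

lemma adjFinRetr_gen {F : Finset S} {s : S} (hs : s ∈ F) :
    (adjFinRetr X e F ≫ adjFinMap X e F) (adj.gen X e s) = adj.gen X e s := by
  rw [comp_apply, adjFinRetr, adj.desc_gen, dif_pos hs]
  exact adj.desc_gen _ _ _

lemma of_adjFinMap (F : Finset S) : adj.of X _ ≫ adjFinMap X e F = adj.of X e := adj.of_desc _ _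

lemma of_adjFinRetr (F : Finset S) : adj.of X e ≫ adjFinRetr X e F = adj.of X _ := adj.of_desc _ _

lemma exists_finset (z : (adj X e).carrier) : ∃ F : Finset S, ∀ F', F ⊆ F' →
    (adjFinRetr X e F' ≫ adjFinMap X e F') z = z := by
  classical
  induction z using adj.induction with
  | of x =>
    refine ⟨∅, fun F _ => ?_⟩
    have : adj.of X e ≫ adjFinRetr X e F ≫ adjFinMap X e F = adj.of X e := by
      rw [← assoc, of_adjFinRetr, of_adjFinMap]
    exact congr_toAlgHom this x
  | gen s => exact ⟨{s}, fun F h => adjFinRetr_gen X e (h (Finset.mem_singleton_self s))⟩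
  | add x y hx hy =>
    obtain ⟨F, hF⟩ := hx
    obtain ⟨G, hG⟩ := hy
    exact ⟨F ∪ G, fun F' h => by
      rw [map_add, hF F' (Finset.union_subset_left h), hG F' (Finset.union_subset_right h)]⟩
  | mul x y hx hy =>
    obtain ⟨F, hF⟩ := hx
    obtain ⟨G, hG⟩ := hy
    exact ⟨F ∪ G, fun F' h => by
      rw [map_mul, hF F' (Finset.union_subset_left h), hG F' (Finset.union_subset_right h)]⟩
  | smul q x hx =>
    obtain ⟨F, hF⟩ := hx
    exact ⟨F, fun F' h => by rw [map_smul, hF F' h]⟩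
  | d x hx =>
    obtain ⟨F, hF⟩ := hx
    exact ⟨F, fun F' h => by rw [Hom.map_d, hF F' h]⟩
  | pr i x hx =>
    obtain ⟨F, hF⟩ := hx
    exact ⟨F, fun F' h => by rw [map_pr, hF F' h]⟩
  | op n φ x hx =>
    choose F hF using hx
    refine ⟨Finset.univ.biUnion F, fun F' h => ?_⟩
    rw [Hom.map_op]
    exact congrArg _ (op_congr _ φ fun j =>
      hF j F' ((Finset.subset_biUnion_of_mem F (Finset.mem_univ j)).trans h))

lemma quasiIso_adj_of_finite (h : ∀ F : Finset S, QuasiIso (adj.of X fun s : {s // s ∈ F} => e s)) :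
    QuasiIso (adj.of X e) := by
  refine quasiIso_iff.2 ⟨fun n z hz w hw hwz => ?_, fun n z hz => ?_⟩
  · refine ⟨(adj.desc (𝟙 X) fun _ => 0 : adj X e ⟶ X) w, Hom.map_deg _ hw, ?_⟩
    rw [← Hom.map_d, hwz, ← comp_apply, adj.of_desc, id_apply]
  · obtain ⟨F, hF⟩ := exists_finset X e z
    have hF := hF F subset_rfl
    obtain ⟨x, hx, w, hw, hwz⟩ := (quasiIso_iff.1 (h F)).2 n _ (map_cycles (adjFinRetr X e F) hz)
    refine ⟨x, hx, (adjFinMap X e F) w, Hom.map_deg _ hw, ?_⟩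
    rw [← Hom.map_d, hwz, map_sub, ← comp_apply, of_adjFinMap, ← comp_apply, hF]

lemma quasiIso_adj_one : QuasiIso (adj.of X fun _ : S => 1) := by
  classical
  refine quasiIso_adj_of_finite X _ fun F => ?_
  induction F using Finset.induction_on with
  | empty =>
    refine quasiIso_of_retraction _ (adj.desc (𝟙 X) fun _ => 0) (adj.of_desc _ _) fun n z hz => ?_
    refine ⟨0, zero_mem _, ?_⟩
    have : (adj.desc (𝟙 X) fun _ => 0) ≫ (adj.of X fun _ : {s : S // s ∈ (∅ : Finset S)} => 1) =
        𝟙 _ := adj.hom_ext (by rw [← assoc, adj.of_desc, id_comp,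
          comp_id]) fun s => absurd s.2 (Finset.notMem_empty _)
    have h := congrArg (fun q : _ ⟶ _ => Hom.toAlgHom q z) this
    exact (map_zero _).trans (sub_eq_zero_of_eq h).symm
  | insert a F ha ih =>
    let c : adjFin X (fun _ : S => 1) F ⟶ adjFin X (fun _ : S => 1) (insert a F) :=
      adj.desc (adj.of X _) fun s => adj.gen X (fun _ : {s : S // s ∈ insert a F} => 1)
        ⟨s.1, Finset.mem_insert_of_mem s.2⟩
    have hc : adj.of X _ ≫ c = adj.of X _ := adj.of_desc _ _
    have hcg : ∀ s : {s // s ∈ F}, c (adj.gen X (fun _ : {s : S // s ∈ F} => 1) s) =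
        adj.gen X (fun _ : {s : S // s ∈ insert a F} => 1) ⟨s.1, Finset.mem_insert_of_mem s.2⟩ :=
      fun s => adj.desc_gen _ _ s
    have hcell : IsCell c (adj.gen X (fun _ : {s : S // s ∈ insert a F} => 1)
        ⟨a, Finset.mem_insert_self a F⟩) := by
      constructor
      · intro W f w
        let g : adjFin X (fun _ : S => 1) (insert a F) ⟶ W := adj.desc (adj.of X _ ≫ f) fun s =>
          if h : s.1 ∈ F then ⟨f (adj.gen X (fun _ : {s : S // s ∈ F} => 1) ⟨s.1, h⟩),
            f.map_deg (adj.gen X (fun _ : {s : S // s ∈ F} => 1) ⟨s.1, h⟩).2⟩ else w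
        refine ⟨g, adj.hom_ext ?_ fun s => ?_, ?_⟩
        · rw [← assoc, hc, adj.of_desc]
        · rw [comp_apply, hcg, adj.desc_gen, dif_pos s.2]
        · rw [adj.desc_gen, dif_neg ha]
      · intro W f g hfg hv
        refine adj.hom_ext ?_ fun s => ?_
        · rw [← hc, assoc, hfg, assoc]
        · obtain ⟨s, hs⟩ := s
          obtain rfl | hs' := Finset.mem_insert.1 hs
          · exact hv
          · have h := congrArg (fun q : _ ⟶ W => Hom.toAlgHom q
              (adj.gen X (fun _ : {s : S // s ∈ F} => 1) ⟨s, hs'⟩).1) hfg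
            simp only [comp_apply, hcg] at h
            exact h
    have := QuasiIso.comp ih hcell.quasiIso
    rwa [hc] at this

end Directed

end TDGA

lemma CDGA.pr_mul (A : CDGA.{u}) (n : ℕ) (a b : A.carrier) :
    A.pr n (a * b) = ∑ p ∈ Finset.HasAntidiagonal.antidiagonal n, A.pr p.1 a * A.pr p.2 b := by
  induction a, b using A.hom_induction₂ with
  | homog i j a b ha hb =>
    by_cases h : i + j = n
    · rw [Finset.sum_eq_single (i, j), A.pr_of_mem ha, A.pr_of_mem hb,
        A.pr_of_mem (h ▸ A.mul_mem ha hb)]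
      · rintro ⟨k, l⟩ hkl hne
        by_cases hk : i = k
        · rw [A.pr_of_mem_ne hb, mul_zero]
          rintro rfl
          exact hne (by rw [hk])
        · rw [A.pr_of_mem_ne ha hk, zero_mul]
      · intro h'
        exact absurd (Finset.HasAntidiagonal.mem_antidiagonal.2 h) h'
    · rw [A.pr_of_mem_ne (A.mul_mem ha hb) h, Finset.sum_eq_zero]
      rintro ⟨k, l⟩ hkl
      by_cases hk : i = k
      · rw [A.pr_of_mem_ne hb, mul_zero]
        rintro rfl
        exact h (by rw [hk]; exact Finset.HasAntidiagonal.mem_antidiagonal.1 hkl)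
      · rw [A.pr_of_mem_ne ha hk, zero_mul]
  | add_left a a' b h h' => simp only [add_mul, map_add, h, h', Finset.sum_add_distrib]
  | add_right a b b' h h' => simp only [mul_add, map_add, h, h', Finset.sum_add_distrib]

namespace TDGA

variable {X Y Z : TDGA T}

/-- Triples `a + w ε + u η` with `ε` of degree `-1`, `η` of degree `0`, `d η = ε`, and
`ε² = ε η = η² = 0`. -/
@[ext]
structure Tri (A : TDGA T) where
  a : A.carrier
  w : A.carrier
  u : A.carrier

namespace Tri

variable {A : TDGA T}

def equiv : Tri A ≃ A.carrier × A.carrier × A.carrier where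
  toFun x := (x.a, x.w, x.u)
  invFun x := ⟨x.1, x.2.1, x.2.2⟩

instance : AddCommGroup (Tri A) := equiv.addCommGroup
instance : Module ℚ (Tri A) := equiv.module ℚ
instance : Mul (Tri A) := ⟨fun x z => ⟨x.a * z.a, x.w * z.a + A.sgn x.a * z.w,
  x.u * z.a + x.a * z.u⟩⟩
instance : One (Tri A) := ⟨⟨1, 0, 0⟩⟩

@[simp] lemma mul_a (x z : Tri A) : (x * z).a = x.a * z.a := rfl
@[simp] lemma mul_w (x z : Tri A) : (x * z).w = x.w * z.a + A.sgn x.a * z.w := rfl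
@[simp] lemma mul_u (x z : Tri A) : (x * z).u = x.u * z.a + x.a * z.u := rfl
@[simp] lemma one_a : (1 : Tri A).a = 1 := rfl
@[simp] lemma one_w : (1 : Tri A).w = 0 := rfl
@[simp] lemma one_u : (1 : Tri A).u = 0 := rfl
@[simp] lemma add_a (x z : Tri A) : (x + z).a = x.a + z.a := rfl
@[simp] lemma add_w (x z : Tri A) : (x + z).w = x.w + z.w := rfl
@[simp] lemma add_u (x z : Tri A) : (x + z).u = x.u + z.u := rfl
@[simp] lemma zero_a : (0 : Tri A).a = 0 := rfl
@[simp] lemma zero_w : (0 : Tri A).w = 0 := rfl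
@[simp] lemma zero_u : (0 : Tri A).u = 0 := rfl
@[simp] lemma smul_a (q : ℚ) (x : Tri A) : (q • x).a = q • x.a := rfl
@[simp] lemma smul_w (q : ℚ) (x : Tri A) : (q • x).w = q • x.w := rfl
@[simp] lemma smul_u (q : ℚ) (x : Tri A) : (q • x).u = q • x.u := rfl

instance : Ring (Tri A) :=
  { (inferInstance : AddCommGroup (Tri A)) with
    mul_assoc := fun a b c => by
      ext <;> simp [mul_assoc, mul_add, add_mul, add_assoc]
    one_mul := fun a => by ext <;> simp
    mul_one := fun a => by ext <;> simp
    left_distrib := fun a b c => by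
      ext
      · simp [mul_add]
      · simp only [mul_w, add_a, add_w, mul_add]; abel
      · simp only [mul_u, add_a, add_u, mul_add]; abel
    right_distrib := fun a b c => by
      ext
      · simp [add_mul]
      · simp only [mul_w, add_a, add_w, add_mul, map_add]; abel
      · simp only [mul_u, add_a, add_u, add_mul]; abel
    zero_mul := fun a => by ext <;> simp
    mul_zero := fun a => by ext <;> simp }

instance : Algebra ℚ (Tri A) := Algebra.ofModule
  (fun q a b => by ext <;> simp [smul_add])
  (fun q a b => by ext <;> simp [smul_add])

lemma algebraMap_eq (q : ℚ) : algebraMap ℚ (Tri A) q = ⟨algebraMap ℚ _ q, 0, 0⟩ := by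
  rw [Algebra.algebraMap_eq_smul_one]
  ext <;> simp [Algebra.algebraMap_eq_smul_one]

def aL : Tri A →ₗ[ℚ] A.carrier := ⟨⟨a, fun _ _ => rfl⟩, fun _ _ => rfl⟩
def wL : Tri A →ₗ[ℚ] A.carrier := ⟨⟨w, fun _ _ => rfl⟩, fun _ _ => rfl⟩
def uL : Tri A →ₗ[ℚ] A.carrier := ⟨⟨u, fun _ _ => rfl⟩, fun _ _ => rfl⟩

def pr (A : TDGA T) (i : ℕ) : Tri A →ₗ[ℚ] Tri A where
  toFun x := ⟨A.pr i x.a, A.pr (i + 1) x.w, A.pr i x.u⟩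
  map_add' x z := by ext <;> simp
  map_smul' q x := by ext <;> simp

def d (A : TDGA T) : Tri A →ₗ[ℚ] Tri A where
  toFun x := ⟨A.d x.a, x.u - A.d x.w, A.d x.u⟩
  map_add' x z := by ext <;> simp; abel
  map_smul' q x := by ext <;> simp [smul_sub]

/-- The elements which are constant in degree `0`, and cycles relative to `A` in degree `1`. -/
structure Good (x : Tri A) : Prop where
  w0 : A.pr 0 x.w = 0
  w1 : A.pr 1 x.w = 0
  u0 : A.pr 0 x.u = 0
  u1 : A.pr 1 x.u = A.d (A.pr 2 x.w)

lemma Good.mul {x z : Tri A} (hx : Good x) (hz : Good z) : Good (x * z) := by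
  have e0 : Finset.HasAntidiagonal.antidiagonal (0 : ℕ) = {(0, 0)} := rfl
  have e1 : Finset.HasAntidiagonal.antidiagonal (1 : ℕ) = {(0, 1), (1, 0)} := rfl
  have e2 : Finset.HasAntidiagonal.antidiagonal (2 : ℕ) = {(0, 2), (1, 1), (2, 0)} := rfl
  have s0 : A.sgn (A.pr 0 x.a) = A.pr 0 x.a := by simp [A.sgn_of_mem (A.pr_mem 0 x.a)]
  constructor
  · simp [CDGA.pr_mul, e0, hx.w0, hz.w0]
  · simp [CDGA.pr_mul, e1, hx.w0, hz.w0, hx.w1, hz.w1]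
  · simp [CDGA.pr_mul, e0, hx.u0, hz.u0]
  · simp [CDGA.pr_mul, e1, e2, hx.w0, hz.w0, hx.w1, hz.w1, hx.u0, hz.u0, hx.u1, hz.u1,
      CDGA.pr_sgn, A.leibniz', s0, A.d_zero (A.pr_mem 0 _)]

def sub (A : TDGA T) : Subalgebra ℚ (Tri A) where
  carrier := {x | Good x}
  mul_mem' := Good.mul
  add_mem' {x z} hx hz := ⟨by simp [hx.w0, hz.w0], by simp [hx.w1, hz.w1], by simp [hx.u0, hz.u0],
    by simp [hx.u1, hz.u1]⟩
  algebraMap_mem' q := by rw [algebraMap_eq]; constructor <;> simp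

lemma Good.pr {x : Tri A} (hx : Good x) (i : ℕ) : Good (pr A i x) := by
  have h : ∀ j y, A.pr j y = 0 → ∀ i, A.pr j (A.pr i y) = 0 := fun j y h i => by
    rw [A.pr_pr]; split_ifs with hij
    · rw [← hij]; exact h
    · rfl
  refine ⟨h _ _ hx.w0 _, h _ _ hx.w1 _, h _ _ hx.u0 _, ?_⟩
  change A.pr 1 (A.pr i x.u) = A.d (A.pr 2 (A.pr (i + 1) x.w))
  rw [A.pr_pr, A.pr_pr]
  by_cases hi : 1 = i
  · subst hi; simpa using hx.u1
  · rw [if_neg hi, if_neg (by omega), map_zero]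

lemma Good.d {x : Tri A} (hx : Good x) : Good (d A x) := by
  refine ⟨?_, ?_, ?_, ?_⟩
  · change A.pr 0 (x.u - A.d x.w) = 0
    rw [map_sub, hx.u0, A.pr_d, hx.w1]; simp
  · change A.pr 1 (x.u - A.d x.w) = 0
    rw [map_sub, hx.u1, A.pr_d, sub_self]
  · change A.pr 0 (A.d x.u) = 0
    rw [A.pr_d, hx.u1, A.d_d]
  · change A.pr 1 (A.d x.u) = A.d (A.pr 2 (x.u - A.d x.w))
    rw [A.pr_d, map_sub, A.pr_d, map_sub, A.d_d, sub_zero]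

def prSub (A : TDGA T) (i : ℕ) : sub A →ₗ[ℚ] sub A where
  toFun x := ⟨pr A i x.1, Good.pr x.2 i⟩
  map_add' _ _ := Subtype.ext (map_add _ _ _)
  map_smul' _ _ := Subtype.ext (map_smul _ _ _)

def dSub (A : TDGA T) : sub A →ₗ[ℚ] sub A where
  toFun x := ⟨d A x.1, Good.d x.2⟩
  map_add' _ _ := Subtype.ext (map_add _ _ _)
  map_smul' _ _ := Subtype.ext (map_smul _ _ _)

def grading (A : TDGA T) : ProjGrading (sub A) where
  pr i := prSub A i
  pr_pr i j x := by
    split_ifs with h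
    · subst h
      exact Subtype.ext (Tri.ext (by simp [prSub, pr, CDGA.pr_pr])
        (by simp [prSub, pr, CDGA.pr_pr]) (by simp [prSub, pr, CDGA.pr_pr]))
    · exact Subtype.ext (Tri.ext (by simp [prSub, pr, CDGA.pr_pr, h])
        (by simp [prSub, pr, CDGA.pr_pr, h]) (by simp [prSub, pr, CDGA.pr_pr, h]))
  bound x := by
    obtain ⟨N, hN⟩ := A.exists_bound x.1.a
    obtain ⟨N', hN'⟩ := A.exists_bound x.1.w
    obtain ⟨M, hM⟩ := A.exists_bound x.1.u
    refine ⟨N + N' + M, Subtype.ext (Tri.ext ?_ ?_ ?_)⟩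
    · refine Eq.trans ?_ (map_sum (aL ∘ₗ (sub A).val.toLinearMap) _ _).symm
      exact A.sum_pr _ fun i hi => hN i (by omega)
    · refine Eq.trans ?_ (map_sum (wL ∘ₗ (sub A).val.toLinearMap) _ _).symm
      refine (A.sum_pr x.1.w (N := N + N' + M + 1) fun i hi => hN' i (by omega)).trans ?_
      rw [Finset.sum_range_succ', x.2.w0, add_zero]
      rfl
    · refine Eq.trans ?_ (map_sum (uL ∘ₗ (sub A).val.toLinearMap) _ _).symm
      exact A.sum_pr _ fun i hi => hM i (by omega)
  one := Subtype.ext (Tri.ext (A.pr_of_mem A.one_mem) (map_zero _) (map_zero _))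
  mul i j x z hx hz := by
    have hxa : x.1.a ∈ A.deg i := A.mem_deg_iff.2 (congrArg (fun x => x.1.a) hx)
    have hxw : x.1.w ∈ A.deg (i + 1) := A.mem_deg_iff.2 (congrArg (fun x => x.1.w) hx)
    have hxu : x.1.u ∈ A.deg i := A.mem_deg_iff.2 (congrArg (fun x => x.1.u) hx)
    have hza : z.1.a ∈ A.deg j := A.mem_deg_iff.2 (congrArg (fun x => x.1.a) hz)
    have hzw : z.1.w ∈ A.deg (j + 1) := A.mem_deg_iff.2 (congrArg (fun x => x.1.w) hz)
    have hzu : z.1.u ∈ A.deg j := A.mem_deg_iff.2 (congrArg (fun x => x.1.u) hz)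
    refine Subtype.ext (Tri.ext (A.pr_of_mem (A.mul_mem hxa hza)) (A.pr_of_mem (add_mem ?_ ?_))
      (A.pr_of_mem (add_mem (A.mul_mem hxu hza) (A.mul_mem hxa hzu))))
    · have := A.mul_mem hxw hza
      rwa [show i + 1 + j = i + j + 1 by omega] at this
    · exact (A.mul_mem (A.sgn_mem hxa) hzw :)

lemma mem_deg {i : ℕ} {x : sub A} : x ∈ (grading A).deg i ↔
    x.1.a ∈ A.deg i ∧ x.1.w ∈ A.deg (i + 1) ∧ x.1.u ∈ A.deg i := by
  rw [ProjGrading.mem_deg, A.mem_deg_iff, A.mem_deg_iff, A.mem_deg_iff]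
  exact Subtype.ext_iff.trans (Tri.ext_iff)

lemma mem_deg_zero {x : sub A} : x ∈ (grading A).deg 0 ↔
    x.1.a ∈ A.deg 0 ∧ x.1.w = 0 ∧ x.1.u = 0 := by
  rw [mem_deg]
  refine and_congr Iff.rfl ⟨fun h => ⟨?_, ?_⟩, fun h => ?_⟩
  · rw [← A.pr_of_mem h.1, x.2.w1]
  · rw [← A.pr_of_mem h.2, x.2.u0]
  · rw [h.1, h.2]; exact ⟨zero_mem _, zero_mem _⟩

def toCDGA (A : TDGA T) : CDGA.{u} where
  carrier := sub A
  deg := (grading A).deg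
  graded_comm {i j a b} ha hb := by
    have e : (-1 : sub A) ^ (i * j) * (b * a) = (-1 : ℚ) ^ (i * j) • (b * a) := by
      rw [Algebra.smul_def]; simp
    obtain ⟨ha1, ha2, ha3⟩ := mem_deg.1 ha
    obtain ⟨hb1, hb2, hb3⟩ := mem_deg.1 hb
    rw [e]
    refine Subtype.ext (Tri.ext (A.comm' ha1 hb1) ?_ ?_)
    · change a.1.w * b.1.a + A.sgn a.1.a * b.1.w =
        (-1 : ℚ) ^ (i * j) • (b.1.w * a.1.a + A.sgn b.1.a * a.1.w)
      rw [A.sgn_of_mem ha1, A.sgn_of_mem hb1, A.comm' ha2 hb1, smul_mul_assoc, A.comm' ha1 hb2,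
        smul_mul_assoc, smul_add, smul_smul, smul_smul, add_mul, pow_add, one_mul, mul_add,
        mul_one, pow_add]
      have h : (-1 : ℚ) ^ i * (-1) ^ i = 1 := by rw [← mul_pow]; simp
      rw [mul_left_comm, h, mul_one]
      abel
    · change a.1.u * b.1.a + a.1.a * b.1.u = (-1 : ℚ) ^ (i * j) • (b.1.u * a.1.a + b.1.a * a.1.u)
      rw [A.comm' ha3 hb1, A.comm' ha1 hb3, ← smul_add, add_comm]
  d := dSub A
  d_mem {i x} h := by
    obtain ⟨h1, h2, h3⟩ := mem_deg.1 h
    exact mem_deg.2 ⟨A.d_mem h1, sub_mem h3 (A.d_mem h2), A.d_mem h3⟩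
  d_zero {x} h := by
    obtain ⟨h1, h2, h3⟩ := mem_deg_zero.1 h
    refine Subtype.ext (Tri.ext (A.d_zero h1) ?_ ?_)
    · change x.1.u - A.d x.1.w = 0
      rw [h2, h3, map_zero, sub_zero]
    · change A.d x.1.u = 0
      rw [h3, map_zero]
  d_d x := by
    refine Subtype.ext (Tri.ext (A.d_d _) ?_ (A.d_d _))
    change A.d x.1.u - A.d (x.1.u - A.d x.1.w) = 0
    rw [map_sub, A.d_d, sub_zero, sub_self]
  leibniz {i a} b ha := by
    have e : ∀ z : sub A, (-1 : sub A) ^ i * z = (-1 : ℚ) ^ i • z := fun z => by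
      rw [Algebra.smul_def]; simp
    obtain ⟨h1, h2, h3⟩ := mem_deg.1 ha
    have s2 : A.sgn a.1.w = - (-1 : ℚ) ^ i • a.1.w := by rw [A.sgn_of_mem h2, pow_succ]; simp
    have s1 := A.sgn_of_mem h1
    have s3 := A.sgn_of_mem h3
    rw [e]
    refine Subtype.ext (Tri.ext ?_ ?_ ?_)
    · change A.d (a.1.a * b.1.a) = A.d a.1.a * b.1.a + (-1 : ℚ) ^ i • (a.1.a * A.d b.1.a)
      rw [A.leibniz', s1, smul_mul_assoc]
    · change (a.1.u * b.1.a + a.1.a * b.1.u) - A.d (a.1.w * b.1.a + A.sgn a.1.a * b.1.w) =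
        (a.1.u - A.d a.1.w) * b.1.a + A.sgn (A.d a.1.a) * b.1.w +
        (-1 : ℚ) ^ i • (a.1.w * A.d b.1.a + A.sgn a.1.a * (b.1.u - A.d b.1.w))
      have s1' : (-1 : ℚ) ^ i • A.sgn a.1.a = a.1.a := by
        rw [s1, smul_smul, ← mul_pow]; simp
      rw [map_add, A.leibniz', A.leibniz', s2, A.d_sgn, A.sgn_sgn, smul_add, ← smul_mul_assoc,
        ← smul_mul_assoc, s1', sub_mul, mul_sub, neg_smul, neg_mul, neg_mul]
      abel
    · change A.d (a.1.u * b.1.a + a.1.a * b.1.u) = A.d a.1.u * b.1.a + A.d a.1.a * b.1.u +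
        (-1 : ℚ) ^ i • (a.1.u * A.d b.1.a + a.1.a * A.d b.1.u)
      rw [map_add, A.leibniz', A.leibniz', s1, s3, smul_add, smul_mul_assoc, smul_mul_assoc]
      abel

def zeroEquiv : (toCDGA A).deg 0 →ₐ[ℚ] A.deg 0 where
  toFun x := ⟨(x.1 : sub A).1.a, (mem_deg_zero.1 x.2).1⟩
  map_one' := rfl
  map_mul' _ _ := rfl
  map_zero' := rfl
  map_add' _ _ := rfl
  commutes' q := Subtype.ext (by
    change (algebraMap ℚ (Tri A) q).a = _
    rw [algebraMap_eq]; rfl)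

lemma zeroEquiv_inj {x z : (toCDGA A).deg 0} (h : zeroEquiv x = zeroEquiv z) : x = z :=
  Subtype.ext (Subtype.ext (p := (· ∈ sub A)) (Tri.ext (congrArg Subtype.val h)
    ((mem_deg_zero.1 x.2).2.1.trans (mem_deg_zero.1 z.2).2.1.symm)
    ((mem_deg_zero.1 x.2).2.2.trans (mem_deg_zero.1 z.2).2.2.symm)))

lemma good_mk {a : A.carrier} : Good (⟨a, 0, 0⟩ : Tri A) := by constructor <;> simp

end Tri

/-- The differential graded `T`-algebra of triples. -/
def tri (A : TDGA T) : TDGA T where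
  toCDGA := Tri.toCDGA A
  str :=
    { op := fun φ x => ⟨(⟨⟨(A.str.op φ fun i => Tri.zeroEquiv (x i)).1, 0, 0⟩, Tri.good_mk⟩ :
          Tri.sub A),
        Tri.mem_deg_zero.2 ⟨SetLike.coe_mem _, rfl, rfl⟩⟩
      op_var := fun i _ => Tri.zeroEquiv_inj (A.str.op_var i _)
      op_subst := fun f g _ => Tri.zeroEquiv_inj (A.str.op_subst f g _)
      op_poly := fun p a => Tri.zeroEquiv_inj ((A.str.op_poly p _).trans
        (MvPolynomial.comp_aeval_apply a Tri.zeroEquiv p).symm) }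

namespace tri

variable {A : TDGA T}

def ofFun (x : A.carrier) : Tri.sub A := ⟨⟨x, 0, 0⟩, Tri.good_mk⟩

def of : A ⟶ tri A where
  toAlgHom :=
    { toFun x := ofFun x
      map_one' := rfl
      map_mul' x z := Subtype.ext (p := (· ∈ Tri.sub A)) (Tri.ext rfl
        (by change (0 : A.carrier) = 0 * z + A.sgn x * 0; simp)
        (by change (0 : A.carrier) = 0 * z + x * 0; simp))
      map_zero' := rfl
      map_add' x z := Subtype.ext (p := (· ∈ Tri.sub A)) (Tri.ext rfl (add_zero (0 : A.carrier)).symm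
        (add_zero (0 : A.carrier)).symm)
      commutes' q := Subtype.ext (p := (· ∈ Tri.sub A)) (Tri.algebraMap_eq q).symm }
  map_deg {i x} h := (Tri.mem_deg (x := ofFun x)).2 ⟨h, zero_mem _, zero_mem _⟩
  map_d x := Subtype.ext (p := (· ∈ Tri.sub A)) (Tri.ext rfl
    (by change (0 : A.carrier) = 0 - A.d 0; simp) (map_zero A.d).symm)
  map_op _ _ := rfl

def val : tri A ⟶ A where
  toAlgHom :=
    { toFun x := (x : Tri.sub A).1.a
      map_one' := rfl
      map_mul' _ _ := rfl
      map_zero' := rfl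
      map_add' _ _ := rfl
      commutes' q := congrArg Tri.a (Tri.algebraMap_eq q) }
  map_deg h := (Tri.mem_deg.1 h).1
  map_d _ := rfl
  map_op _ _ := rfl

def dblFun {i : ℕ} (v : A.deg (i + 2)) : Tri.sub A :=
  ⟨⟨v, 0, v⟩, ⟨map_zero _, map_zero _, A.pr_of_mem_ne v.2 (by omega),
    (A.pr_of_mem_ne v.2 (by omega)).trans (by simp)⟩⟩

/-- The element `v + v η`. -/
def dbl {i : ℕ} (v : A.deg (i + 2)) : (tri A).deg (i + 2) :=
  ⟨dblFun v, (Tri.mem_deg (x := dblFun v)).2 ⟨v.2, zero_mem _, v.2⟩⟩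

end tri

end TDGA

namespace TDGA

variable {X Y Z : TDGA T}

namespace adj

variable (X) {S : Type u} (e : S → ℕ)

/-- The morphism which multiplies generators of degree at least `2` by `1 + η`. -/
def weightMap : adj X (fun s => e s + 2) ⟶ tri (adj X fun s => e s + 2) :=
  desc (of X _ ≫ tri.of) fun s => tri.dbl (gen X _ s)

lemma weightMap_val : weightMap X e ≫ tri.val = 𝟙 _ := by
  refine hom_ext ?_ fun s => ?_
  · rw [weightMap, ← assoc, of_desc]; rfl
  · rw [comp_apply, weightMap, desc_gen]; rfl

def weightTri (z : (adj X fun s => e s + 2).carrier) : Tri.sub (adj X fun s => e s + 2) :=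
  (weightMap X e) z

/-- The derivation of degree `0` which counts generators. -/
def wt : (adj X fun s => e s + 2).carrier →ₗ[ℚ] (adj X fun s => e s + 2).carrier :=
  Tri.uL ∘ₗ (Tri.sub _).val.toLinearMap ∘ₗ (weightMap X e).toAlgHom.toLinearMap

/-- The contracting derivation of degree `1`. -/
def ctr : (adj X fun s => e s + 2).carrier →ₗ[ℚ] (adj X fun s => e s + 2).carrier :=
  Tri.wL ∘ₗ (Tri.sub _).val.toLinearMap ∘ₗ (weightMap X e).toAlgHom.toLinearMap

lemma weightTri_a (z : (adj X fun s => e s + 2).carrier) : (weightTri X e z).1.a = z :=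
  congrArg (fun q : adj X (fun s => e s + 2) ⟶ adj X (fun s => e s + 2) => q z)
    (weightMap_val X e)

lemma wt_of (x : X.carrier) : wt X e ((of X _) x) = 0 := by
  have h : of X _ ≫ weightMap X e = of X _ ≫ tri.of := of_desc _ _
  exact congrArg (fun q : X ⟶ tri (adj X fun s => e s + 2) => (q x : Tri.sub _).1.u) h

lemma wt_gen (s : S) : wt X e (gen X (fun s => e s + 2) s).1 = gen X (fun s => e s + 2) s := by
  have h : weightTri X e (gen X (fun s => e s + 2) s).1 =
      tri.dblFun (A := adj X fun s => e s + 2) (gen X (fun s => e s + 2) s) := desc_gen _ _ s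
  change (weightTri X e (gen X (fun s => e s + 2) s).1).1.u = _
  rw [h]
  rfl

lemma wt_mul (x y : (adj X fun s => e s + 2).carrier) :
    wt X e (x * y) = wt X e x * y + x * wt X e y := by
  have h := congrArg (fun z : Tri.sub (adj X fun s => e s + 2) => z.1.u)
    (map_mul (weightMap X e).toAlgHom x y)
  refine h.trans ?_
  change _ * (weightTri X e y).1.a + (weightTri X e x).1.a * _ = _
  rw [weightTri_a, weightTri_a]; rfl

lemma wt_d (x : (adj X fun s => e s + 2).carrier) :
    wt X e ((adj X fun s => e s + 2).d x) = (adj X fun s => e s + 2).d (wt X e x) :=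
  congrArg (fun z : Tri.sub (adj X fun s => e s + 2) => z.1.u) ((weightMap X e).map_d x)

lemma wt_eq (x : (adj X fun s => e s + 2).carrier) : wt X e x =
    (adj X fun s => e s + 2).d (ctr X e x) + ctr X e ((adj X fun s => e s + 2).d x) := by
  have h : ctr X e ((adj X fun s => e s + 2).d x) =
      wt X e x - (adj X fun s => e s + 2).d (ctr X e x) :=
    congrArg (fun z : Tri.sub (adj X fun s => e s + 2) => z.1.w) ((weightMap X e).map_d x)
  rw [h, add_sub_cancel]

lemma wt_mem {i : ℕ} {x : (adj X fun s => e s + 2).carrier}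
    (h : x ∈ (adj X fun s => e s + 2).deg i) : wt X e x ∈ (adj X fun s => e s + 2).deg i :=
  (Tri.mem_deg.1 ((weightMap X e).map_deg h)).2.2

lemma wt_pr (i : ℕ) (x : (adj X fun s => e s + 2).carrier) :
    wt X e ((adj X fun s => e s + 2).pr i x) = (adj X fun s => e s + 2).pr i (wt X e x) := by
  induction x using CDGA.hom_induction with
  | zero => simp
  | homog j x hx =>
    by_cases h : j = i
    · subst h; rw [CDGA.pr_of_mem _ hx, CDGA.pr_of_mem _ (wt_mem X e hx)]
    · rw [CDGA.pr_of_mem_ne _ hx h, CDGA.pr_of_mem_ne _ (wt_mem X e hx) h, map_zero]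
  | add x y hx hy => simp only [map_add, hx, hy]

/-- The span of the elements of positive weight. -/
def posPart : Submodule ℚ (adj X fun s => e s + 2).carrier :=
  Submodule.span ℚ {x | ∃ k : ℕ, wt X e x = ((k : ℚ) + 1) • x}

lemma posPart_map (f : (adj X fun s => e s + 2).carrier →ₗ[ℚ] (adj X fun s => e s + 2).carrier)
    (hf : ∀ x, wt X e (f x) = f (wt X e x)) {x : (adj X fun s => e s + 2).carrier}
    (hx : x ∈ posPart X e) : f x ∈ posPart X e := by
  induction hx using Submodule.span_induction with
  | mem x h =>
    obtain ⟨k, hk⟩ := h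
    exact Submodule.subset_span ⟨k, by rw [hf, hk, map_smul]⟩
  | zero => rw [map_zero]; exact zero_mem _
  | add x y _ _ hx hy => rw [map_add]; exact add_mem hx hy
  | smul q x _ hx => rw [map_smul]; exact Submodule.smul_mem _ _ hx

lemma posPart_mul {x y : (adj X fun s => e s + 2).carrier} (hx : x ∈ posPart X e)
    (hy : y ∈ posPart X e) : x * y ∈ posPart X e := by
  induction hx using Submodule.span_induction with
  | mem x h =>
    obtain ⟨k, hk⟩ := h
    induction hy using Submodule.span_induction with
    | mem y h =>
      obtain ⟨l, hl⟩ := h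
      refine Submodule.subset_span ⟨k + l + 1, ?_⟩
      rw [wt_mul, hk, hl, smul_mul_assoc, mul_smul_comm, ← add_smul]
      congr 1; push_cast; ring
    | zero => rw [mul_zero]; exact zero_mem _
    | add y z _ _ hy hz => rw [mul_add]; exact add_mem hy hz
    | smul q y _ hy => rw [mul_smul_comm]; exact Submodule.smul_mem _ _ hy
  | zero => rw [zero_mul]; exact zero_mem _
  | add x z _ _ hx hz => rw [add_mul]; exact add_mem hx hz
  | smul q x _ hx => rw [smul_mul_assoc]; exact Submodule.smul_mem _ _ hx

lemma of_mul_posPart (x : X.carrier) {y : (adj X fun s => e s + 2).carrier}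
    (hy : y ∈ posPart X e) : (of X _) x * y ∈ posPart X e := by
  refine posPart_map X e (LinearMap.mulLeft ℚ ((of X _) x)) (fun z => ?_) hy
  rw [LinearMap.mulLeft_apply, wt_mul, wt_of, zero_mul, zero_add, LinearMap.mulLeft_apply]

lemma posPart_mul_of (x : X.carrier) {y : (adj X fun s => e s + 2).carrier}
    (hy : y ∈ posPart X e) : y * (of X _) x ∈ posPart X e := by
  refine posPart_map X e (LinearMap.mulRight ℚ ((of X _) x)) (fun z => ?_) hy
  rw [LinearMap.mulRight_apply, wt_mul, wt_of, mul_zero, add_zero, LinearMap.mulRight_apply]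

lemma exists_eq_add (z : (adj X fun s => e s + 2).carrier) :
    (∃ x, ∃ n ∈ posPart X e, z = (of X _) x + n) ∧
    (∃ x, (adj X fun s => e s + 2).pr 0 z = (of X _) x) ∧
    ∃ x, (adj X fun s => e s + 2).d ((adj X fun s => e s + 2).pr 1 z) = (of X _) x := by
  induction z using adj.induction with
  | of x =>
    refine ⟨⟨x, 0, zero_mem _, (add_zero _).symm⟩, ⟨X.pr 0 x, (map_pr _ _ _).symm⟩,
      X.d (X.pr 1 x), ?_⟩
    rw [Hom.map_d, map_pr]
  | gen s =>
    refine ⟨⟨0, (gen X (fun s => e s + 2) s).1, Submodule.subset_span ⟨0, ?_⟩, by rw [map_zero, zero_add]⟩, ⟨0, ?_⟩,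
      0, ?_⟩
    · rw [wt_gen]; simp
    · rw [CDGA.pr_of_mem_ne _ (gen X (fun s => e s + 2) s).2 (by simp), map_zero]
    · rw [CDGA.pr_of_mem_ne _ (gen X (fun s => e s + 2) s).2 (by simp), map_zero, map_zero]
  | add z z' hz hz' =>
    obtain ⟨⟨x, n, hn, h⟩, ⟨x0, h0⟩, x1, h1⟩ := hz
    obtain ⟨⟨x', n', hn', h'⟩, ⟨x0', h0'⟩, x1', h1'⟩ := hz'
    refine ⟨⟨x + x', n + n', add_mem hn hn', by rw [h, h', map_add]; abel⟩, ⟨x0 + x0', ?_⟩,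
      x1 + x1', ?_⟩
    · rw [map_add, h0, h0', map_add]
    · rw [map_add, map_add, h1, h1', map_add]
  | mul z z' hz hz' =>
    obtain ⟨⟨x, n, hn, h⟩, ⟨x0, h0⟩, x1, h1⟩ := hz
    obtain ⟨⟨x', n', hn', h'⟩, ⟨x0', h0'⟩, x1', h1'⟩ := hz'
    have e0 : Finset.HasAntidiagonal.antidiagonal (0 : ℕ) = {(0, 0)} := rfl
    have e1 : Finset.HasAntidiagonal.antidiagonal (1 : ℕ) = {(0, 1), (1, 0)} := rfl
    refine ⟨⟨x * x', (of X _) x * n' + n * (of X _) x' + n * n',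
      add_mem (add_mem (of_mul_posPart X e x hn') (posPart_mul_of X e x' hn))
        (posPart_mul X e hn hn'), ?_⟩, ⟨x0 * x0', ?_⟩, x0 * x1' + x1 * x0', ?_⟩
    · rw [h, h', map_mul, add_mul, mul_add, mul_add]; abel
    · simp [CDGA.pr_mul, e0, h0, h0']
    · have d0 : ∀ x : X.carrier, ∀ z, (adj X fun s => e s + 2).pr 0 z = (of X _) x →
          (adj X fun s => e s + 2).d ((of X (fun s => e s + 2)) x) = 0 ∧
          (adj X fun s => e s + 2).sgn ((of X (fun s => e s + 2)) x) =
            (of X (fun s => e s + 2)) x := by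
        intro x z h
        rw [← h]
        refine ⟨CDGA.d_zero _ (CDGA.pr_mem _ 0 z), ?_⟩
        rw [CDGA.sgn_of_mem _ (CDGA.pr_mem _ 0 z)]; simp
      rw [CDGA.pr_mul, e1]
      simp [h0, h0', CDGA.leibniz', h1, h1', (d0 _ _ h0).1, (d0 _ _ h0').1, (d0 _ _ h0).2]
  | smul q z hz =>
    obtain ⟨⟨x, n, hn, h⟩, ⟨x0, h0⟩, x1, h1⟩ := hz
    refine ⟨⟨q • x, q • n, Submodule.smul_mem _ _ hn, by rw [h, map_smul, smul_add]⟩,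
      ⟨q • x0, by rw [map_smul, h0, map_smul]⟩, q • x1, by rw [map_smul, map_smul, h1, map_smul]⟩
  | d z hz =>
    obtain ⟨⟨x, n, hn, h⟩, ⟨x0, h0⟩, x1, h1⟩ := hz
    refine ⟨⟨X.d x, _, posPart_map X e (adj X fun s => e s + 2).d (wt_d X e) hn, ?_⟩, ⟨x1, ?_⟩,
      0, ?_⟩
    · rw [h, map_add, Hom.map_d]
    · rw [CDGA.pr_d, h1]
    · rw [CDGA.pr_d, CDGA.d_d, map_zero]
  | pr i z hz =>
    obtain ⟨⟨x, n, hn, h⟩, ⟨x0, h0⟩, x1, h1⟩ := hz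
    refine ⟨⟨X.pr i x, _, posPart_map X e ((adj X fun s => e s + 2).pr i) (wt_pr X e i) hn, ?_⟩,
      ?_, ?_⟩
    · rw [h, map_add, map_pr]
    · rw [CDGA.pr_pr]
      split_ifs with h'
      · exact ⟨x0, by rw [← h', h0]⟩
      · exact ⟨0, (map_zero _).symm⟩
    · rw [CDGA.pr_pr]
      split_ifs with h'
      · exact ⟨x1, by rw [← h', h1]⟩
      · exact ⟨0, by rw [map_zero, map_zero]⟩
  | op n φ z hz =>
    choose x hx using fun i => (hz i).2.1
    have e1 : ((adj X fun s => e s + 2).str.op φ z).1 =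
        (of X (fun s => e s + 2)) (X.str.op φ fun i => ⟨X.pr 0 (x i), X.pr_mem _ _⟩) := by
      rw [Hom.map_op]
      refine congrArg Subtype.val (op_congr (adj X fun s => e s + 2) φ fun i => ?_)
      change _ = (of X (fun s => e s + 2)) (X.pr 0 (x i))
      rw [map_pr, ← hx, CDGA.pr_pr, if_pos rfl, CDGA.pr_of_mem _ (z i).2]
    refine ⟨⟨_, 0, zero_mem _, e1.trans (add_zero _).symm⟩,
      ⟨_, (CDGA.pr_of_mem _ (SetLike.coe_mem _)).trans e1⟩, 0, ?_⟩
    rw [CDGA.pr_of_mem_ne _ (SetLike.coe_mem _) zero_ne_one, map_zero, map_zero]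

lemma exists_inverse {x : (adj X fun s => e s + 2).carrier} (hx : x ∈ posPart X e) :
    ∃ f : (adj X fun s => e s + 2).carrier →ₗ[ℚ] (adj X fun s => e s + 2).carrier,
      x = f (wt X e x) ∧ ∀ g : (adj X fun s => e s + 2).carrier →ₗ[ℚ] (adj X fun s => e s + 2).carrier,
        (∀ y, g (wt X e y) = wt X e (g y)) → ∀ y, g (f y) = f (g y) := by
  suffices h : ∃ p : Polynomial ℚ, p.coeff 0 = 1 ∧ Polynomial.aeval (wt X e) p x = 0 by
    obtain ⟨p, hp, h⟩ := h
    obtain ⟨q, hq⟩ : ∃ q : Polynomial ℚ, p = 1 - q * Polynomial.X := by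
      obtain ⟨q, hq⟩ : (Polynomial.X : Polynomial ℚ) ∣ 1 - p := by
        rw [Polynomial.X_dvd_iff, Polynomial.coeff_sub, hp]; simp
      exact ⟨q, by rw [mul_comm, ← hq]; ring⟩
    refine ⟨Polynomial.aeval (wt X e) q, ?_, fun g hg y => ?_⟩
    · rw [hq, map_sub, map_one, map_mul, Polynomial.aeval_X, LinearMap.sub_apply, sub_eq_zero] at h
      exact h
    · have hc : Commute g (wt X e) := LinearMap.ext hg
      clear hq
      have : Commute g (Polynomial.aeval (wt X e) q) := by
        induction q using Polynomial.induction_on' with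
        | add p q hp hq => rw [map_add]; exact hp.add_right hq
        | monomial n a =>
          rw [Polynomial.aeval_monomial]
          exact (show Commute g _ from (Algebra.commutes a g).symm).mul_right (hc.pow_right n)
      exact LinearMap.congr_fun this y
  induction hx using Submodule.span_induction with
  | mem x h =>
    obtain ⟨k, hk⟩ := h
    refine ⟨1 - Polynomial.C (((k : ℚ) + 1)⁻¹) * Polynomial.X, by simp, ?_⟩
    have : (k : ℚ) + 1 ≠ 0 := by positivity
    simp [hk, smul_smul, this, Algebra.algebraMap_eq_smul_one]
  | zero => exact ⟨1, by simp, map_zero _⟩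
  | add x y _ _ hx hy =>
    obtain ⟨p, hp, h⟩ := hx
    obtain ⟨q, hq, h'⟩ := hy
    refine ⟨p * q, by simp [Polynomial.mul_coeff_zero, hp, hq], ?_⟩
    rw [map_add, map_mul, Module.End.mul_apply _ _ y, h', map_zero, add_zero, ← map_mul,
      mul_comm, map_mul, Module.End.mul_apply, h, map_zero]
  | smul q x _ hx =>
    obtain ⟨p, hp, h⟩ := hx
    exact ⟨p, hp, by rw [map_smul, h, smul_zero]⟩

lemma quasiIso_of_add_two : QuasiIso (of X fun s => e s + 2) := by
  have hr : of X (fun s => e s + 2) ≫ desc (𝟙 X) (fun _ => 0) = 𝟙 X := of_desc _ _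
  have inj : ∀ x, (of X fun s => e s + 2) x = 0 → x = 0 := fun x hx => by
    have := congr_toAlgHom hr x
    change (desc (𝟙 X) (fun _ => 0)) ((of X fun s => e s + 2) x) = x at this
    rw [← this, hx, map_zero]
  refine quasiIso_iff.2 ⟨fun n z hz w hw hwz => ?_, fun n z hz => ?_⟩
  · refine ⟨(desc (𝟙 X) fun _ => 0 : adj X _ ⟶ X) w, Hom.map_deg _ hw, ?_⟩
    rw [← Hom.map_d, hwz, ← comp_apply, hr, id_apply]
  · obtain ⟨x, m, hm, h⟩ := (exists_eq_add X e z).1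
    have hdz : (adj X fun s => e s + 2).d z = 0 := hz.2
    have hdm : (adj X fun s => e s + 2).d m = 0 := by
      obtain ⟨f, hf, -⟩ := exists_inverse X e (posPart_map X e (adj X fun s => e s + 2).d
        (wt_d X e) hm)
      have h1 : (adj X fun s => e s + 2).d m = -(of X _) (X.d x) := by
        have := hdz
        rw [h, map_add, ← Hom.map_d] at this
        exact eq_neg_of_add_eq_zero_right this
      rw [hf, h1, map_neg, wt_of, neg_zero, map_zero]
    have hdx : X.d x = 0 := inj _ (by
      have := hdz
      rwa [h, map_add, hdm, add_zero, ← Hom.map_d] at this)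
    obtain ⟨f, hf, hc⟩ := exists_inverse X e hm
    have hm' : m = (adj X fun s => e s + 2).d (f (ctr X e m)) := by
      rw [hc _ fun y => (wt_d X e y).symm]
      conv_lhs => rw [hf, wt_eq, hdm, map_zero, add_zero]
    have hd : X.d (X.pr n x) = 0 := by
      cases n with
      | zero => exact X.d_zero (X.pr_mem _ _)
      | succ n => rw [← X.pr_d, hdx, map_zero]
    refine ⟨X.pr n x, ⟨X.pr_mem _ _, hd⟩,
      -(adj X fun s => e s + 2).pr (n + 1) (f (ctr X e m)), neg_mem (CDGA.pr_mem _ _ _), ?_⟩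
    rw [map_neg, ← CDGA.pr_d, ← hm', map_pr, neg_eq_iff_eq_neg, neg_sub, eq_sub_iff_add_eq',
      ← map_add, ← h, CDGA.pr_of_mem _ hz.1]

end adj

lemma LLPFib.comp {i : X ⟶ Y} {j : Y ⟶ Z} (hi : LLPFib i) (hj : LLPFib j) : LLPFib (i ≫ j) := by
  intro A B p hp f g h
  obtain ⟨k, hk, hk'⟩ := hi p hp f (j ≫ g) (by rw [h, assoc])
  obtain ⟨l, hl, hl'⟩ := hj p hp k g hk'
  exact ⟨l, by rw [assoc, hl, hk], hl'⟩

/-- Every morphism is a weak equivalence with the left lifting property with respect to fibrations,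
followed by a fibration. -/
lemma exists_factor (g : X ⟶ Y) : ∃ (C : TDGA T) (i : X ⟶ C) (p : C ⟶ Y),
    i ≫ p = g ∧ IsFibration p ∧ LLPFib i ∧ QuasiIso i := by
  let p₁ : adj X (fun _ : Y.deg 1 => 1) ⟶ Y := adj.desc g fun s => s
  let p : adj (adj X fun _ : Y.deg 1 => 1) (fun s : Σ i, Y.deg (i + 2) => s.1 + 2) ⟶ Y :=
    adj.desc p₁ fun s => s.2
  refine ⟨_, adj.of X _ ≫ adj.of _ _, p, ?_, ?_, ?_, ?_⟩
  · rw [assoc, adj.of_desc, adj.of_desc]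
  · rintro (_ | i) y hy
    · refine ⟨(adj.of _ _) (adj.gen X (fun _ : Y.deg 1 => 1) ⟨y, hy⟩).1,
        Hom.map_deg _ (adj.gen X (fun _ : Y.deg 1 => 1) ⟨y, hy⟩).2, ?_⟩
      rw [← comp_apply, adj.of_desc, adj.desc_gen]
    · exact ⟨_, (adj.gen _ _ (⟨i, y, hy⟩ : Σ i, Y.deg (i + 2))).2, adj.desc_gen _ _ _⟩
  · exact LLPFib.comp (adj.of_llpFib (h := fun _ => one_ne_zero))
      (adj.of_llpFib (h := fun _ => Nat.succ_ne_zero _))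
  · exact QuasiIso.comp (quasiIso_adj_one X) (adj.quasiIso_of_add_two _ _)

end TDGA

/-! ### Simplicial abelian groups are Kan complexes -/

namespace Simp

open Simplicial SSet

section AddGroup

/-- The structure maps are additive. -/
abbrev IsAdd (V : SSet.{u}) [∀ k, AddCommGroup (V.obj k)] : Prop :=
  ∀ {k l : SimplexCategoryᵒᵖ} (θ : k ⟶ l) (x y : V.obj k), V.map θ (x - y) = V.map θ x - V.map θ y

variable {V : SSet.{u}}

lemma face_face {n : ℕ} {a b : Fin (n + 3)} (h : a < b) (x : V _⦋n + 2⦌) :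
    V.δ (b.pred (Fin.ne_zero_of_lt h)) (V.δ a x) =
      V.δ (a.castPred (Fin.ne_last_of_lt h)) (V.δ b x) := by
  obtain ⟨a, rfl⟩ := a.eq_castSucc_of_ne_last (Fin.ne_last_of_lt h)
  exact (ConcreteCategory.congr_hom (V.δ_comp_δ' h) x).symm

variable [∀ k, AddCommGroup (V.obj k)]

/-- Compatibility of families of faces. -/
def CompatOn {n : ℕ} (S : Fin (n + 3) → Prop) (y : Fin (n + 3) → V _⦋n + 1⦌) : Prop :=
  ∀ a b (h : a < b), S a → S b → V.δ (b.pred (Fin.ne_zero_of_lt h)) (y a) =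
    V.δ (a.castPred (Fin.ne_last_of_lt h)) (y b)

lemma exists_add_face (hV : IsAdd V) {n : ℕ} (S S' : Fin (n + 3) → Prop) (y : Fin (n + 3) → V _⦋n + 1⦌)
    (hy : CompatOn S' y) (hS : ∀ j, S j → S' j) (m : Fin (n + 2)) (f : Fin (n + 3))
    (hf : f = m.castSucc ∨ f = m.succ) (hfS' : S' f) (hm : ∀ j, S j → j < m.castSucc ∨ m.succ < j)
    (w : V _⦋n + 2⦌) (hw : ∀ j, S j → V.δ j w = y j) :
    ∃ w' : V _⦋n + 2⦌, ∀ j, S j ∨ j = f → V.δ j w' = y j := by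
  refine ⟨w - V.σ m (V.δ f w - y f), fun j hj => ?_⟩
  have hδ : ∀ {k : ℕ} (j : Fin (k + 2)) (a b : V _⦋k + 1⦌), V.δ j (a - b) = V.δ j a - V.δ j b :=
    fun j a b => hV _ a b
  have h0 : ∀ {k l : SimplexCategoryᵒᵖ} (θ : k ⟶ l), V.map θ 0 = 0 := fun {k l} θ => by
    have := hV θ 0 0
    rwa [sub_self, sub_self] at this
  obtain hj | rfl := hj
  · rw [hδ, hw j hj, sub_eq_self]
    obtain h | h := hm j hj
    · have hjf : j < f := by
        obtain rfl | rfl := hf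
        · exact h
        · exact h.trans m.castSucc_lt_succ
      obtain ⟨b, rfl⟩ := m.eq_succ_of_ne_zero (by rintro rfl; simp at h)
      have h1 := V.δ_comp_σ_of_le (i := j.castPred (Fin.ne_last_of_lt hjf)) (j := b) (by
        rw [Fin.lt_def] at h; rw [Fin.le_def]; simp at h ⊢; omega)
      rw [Fin.castSucc_castPred] at h1
      refine (ConcreteCategory.congr_hom h1 _).trans ?_
      change V.σ b (V.δ _ (V.δ f w - y f)) = 0
      rw [hδ, ← face_face hjf, hw j hj, hy _ _ hjf (hS j hj) hfS', sub_self]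
      exact h0 _
    · have hjf : f < j := by
        obtain rfl | rfl := hf
        · exact m.castSucc_lt_succ.trans h
        · exact h
      obtain ⟨b, rfl⟩ := m.eq_castSucc_of_ne_last (by
        rintro rfl; rw [Fin.lt_def] at h; have := j.2; simp at h; omega)
      have h1 := V.δ_comp_σ_of_gt (i := j.pred (Fin.ne_zero_of_lt hjf)) (j := b) (by
        rw [Fin.lt_def] at h ⊢; simp at h ⊢; omega)
      rw [Fin.succ_pred] at h1
      refine (ConcreteCategory.congr_hom h1 _).trans ?_
      change V.σ b (V.δ _ (V.δ f w - y f)) = 0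
      rw [hδ, face_face hjf, hw j hj, hy _ _ hjf hfS' (hS j hj), sub_self]
      exact h0 _
  · have h1 : V.σ m ≫ V.δ j = 𝟙 _ := by
      obtain rfl | rfl := hf
      · exact V.δ_comp_σ_self
      · exact V.δ_comp_σ_succ
    rw [hδ]
    refine (congrArg (V.δ j w - ·) (ConcreteCategory.congr_hom h1 _)).trans ?_
    exact sub_sub_cancel _ _

lemma exists_of_compatOn (hV : IsAdd V) {n : ℕ} (i : Fin (n + 3)) (y : Fin (n + 3) → V _⦋n + 1⦌)
    (hy : CompatOn (· ≠ i) y) : ∃ w : V _⦋n + 2⦌, ∀ j, j ≠ i → V.δ j w = y j := by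
  have h1 : ∀ t : ℕ, t ≤ i.val → ∃ w : V _⦋n + 2⦌, ∀ j, j.val < t → V.δ j w = y j := by
    intro t
    induction t with
    | zero => exact fun _ => ⟨0, fun j hj => absurd hj (Nat.not_lt_zero _)⟩
    | succ t ih =>
      intro ht
      obtain ⟨w, hw⟩ := ih (by omega)
      obtain ⟨w', hw'⟩ := exists_add_face hV (fun j => j.val < t) (· ≠ i) y hy
        (by rintro j hj rfl; omega) ⟨t, by omega⟩ ⟨t, by omega⟩ (Or.inl rfl)
        (fun h => by have := congrArg Fin.val h; simp at this; omega) (fun j hj => Or.inl hj) w hw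
      refine ⟨w', fun j hj => hw' j ?_⟩
      obtain h | h := Nat.lt_succ_iff_lt_or_eq.1 hj
      · exact Or.inl h
      · exact Or.inr (Fin.ext h)
  obtain ⟨w, hw⟩ := h1 i le_rfl
  have h2 : ∀ t : ℕ, t ≤ n + 2 - i.val → ∃ w : V _⦋n + 2⦌,
      ∀ j : Fin (n + 3), (j.val < i.val ∨ n + 2 - t < j.val) → V.δ j w = y j := by
    intro t
    induction t with
    | zero => exact fun _ => ⟨w, fun j hj => hw j (hj.resolve_right (by omega))⟩
    | succ t ih =>
      intro ht
      obtain ⟨w, hw⟩ := ih (by omega)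
      obtain ⟨w', hw'⟩ := exists_add_face hV (fun j => j.val < i.val ∨ n + 2 - t < j.val) (· ≠ i)
        y hy (by rintro j hj rfl; omega) ⟨n + 1 - t, by omega⟩ ⟨n + 2 - t, by omega⟩
        (Or.inr (Fin.ext (by simp; omega)))
        (fun h => by have := congrArg Fin.val h; simp at this; omega)
        (fun j hj => by
          simp only [Fin.lt_def, Fin.val_castSucc, Fin.val_succ] at hj ⊢
          omega) w hw
      refine ⟨w', fun j hj => hw' j ?_⟩
      rw [Fin.ext_iff]
      change _ ∨ _ = n + 2 - t
      omega
  obtain ⟨w, hw⟩ := h2 _ le_rfl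
  refine ⟨w, fun j hj => hw j ?_⟩
  have : j.val ≠ i.val := fun h => hj (Fin.ext h)
  omega

lemma yonedaEquiv_δ_comp {W : SSet.{u}} {n : ℕ} (j : Fin (n + 2)) (f : Δ[n + 1] ⟶ W) :
    SSet.yonedaEquiv (stdSimplex.δ j ≫ f) = W.δ j (SSet.yonedaEquiv f) := by
  obtain ⟨w, rfl⟩ := SSet.yonedaEquiv.symm.surjective f
  rw [Equiv.apply_symm_apply]
  rfl

lemma kanComplex_of_addCommGroup (hV : IsAdd V) : KanComplex V := by
  rw [KanComplex.iff]
  intro n i f hf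
  obtain _ | n := n
  · obtain ⟨j, hj⟩ : ∃ j : Fin 2, j ≠ i := ⟨i + 1, by fin_cases i <;> simp⟩
    refine ⟨yonedaEquiv.symm (V.σ 0 (yonedaEquiv (f j hj))), fun k hk => ?_⟩
    obtain rfl : k = j := by omega
    apply SSet.yonedaEquiv.injective
    have h1 : V.σ (0 : Fin 1) ≫ V.δ k = 𝟙 _ := by
      fin_cases k
      · exact V.δ_comp_σ_self
      · exact V.δ_comp_σ_succ
    exact ConcreteCategory.congr_hom h1 _
  · obtain ⟨w, hw⟩ := exists_of_compatOn hV i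
      (fun j => if hj : j ≠ i then yonedaEquiv (f j hj) else 0) (fun a b h ha hb => by
        refine (congrArg _ (dif_pos ha)).trans (Eq.trans ?_ (congrArg _ (dif_pos hb)).symm)
        rw [← yonedaEquiv_δ_comp, ← yonedaEquiv_δ_comp]
        exact congrArg SSet.yonedaEquiv (hf a b ha hb h))
    refine ⟨yonedaEquiv.symm w, fun j hj => ?_⟩
    apply SSet.yonedaEquiv.injective
    have := hw j hj
    rw [dif_pos hj] at this
    exact this

end AddGroup

end Simp

namespace TDGA

open Simplicial

/-! ### Existence of simplicial resolutions -/

section Resolution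

variable (B : TDGA T)

/-- The signature of simplicial algebras under `B` with a contraction in positive degrees. -/
abbrev resSig : Sig.{u} where
  ι := SimplexCategory
  G := Σ i, B.deg i
  gs _ := ⦋0⦌
  gd s := s.1
  U := (Σ k l : SimplexCategory, (l ⟶ k) × ℕ) ⊕ ℕ × ℕ
  us := Sum.elim (fun f => f.1) fun f => ⦋f.1⦌
  ut := Sum.elim (fun f => f.2.1) fun f => ⦋f.1 + 1⦌
  ud := Sum.elim (fun f => f.2.2.2) fun f => f.2 + 1
  vd := Sum.elim (fun f => f.2.2.2) fun f => f.2 + 1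

variable {B} in
abbrev contr (I : Interp T (resSig B)) (n j : ℕ) :
    (I.M ⦋n⦌).deg (j + 1) → (I.M ⦋n + 1⦌).deg (j + 1) := I.un (Sum.inr (n, j))

/-- Simplicial algebras under `B` with a contraction in positive degrees. -/
structure ResStr (I : Interp T (resSig B)) where
  h : ∀ {k l : SimplexCategory}, (l ⟶ k) → (I.M k ⟶ I.M l)
  h_un : ∀ {k l : SimplexCategory} (θ : l ⟶ k) (j : ℕ) (x : (I.M k).deg j),
    (I.un (Sum.inl ⟨k, l, θ, j⟩) x).1 = (h θ) x
  h_id : ∀ k, h (𝟙 k) = 𝟙 (I.M k)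
  h_comp : ∀ {k l m : SimplexCategory} (θ : l ⟶ k) (η : m ⟶ l), h (η ≫ θ) = h θ ≫ h η
  β : B ⟶ I.M ⦋0⦌
  g_eq : ∀ i (x : B.deg i), (I.g ⟨i, x⟩).1 = β x
  contr_zero : ∀ n j, contr I n j 0 = 0
  d_contr : ∀ n j x, (h (SimplexCategory.δ 0)) (contr I n j x).1 = x
  d_contr_zero : ∀ j x, (h (SimplexCategory.δ 1)) (contr I 0 j x).1 = 0
  d_contr_succ : ∀ n j (i : Fin (n + 2)) x, (h (SimplexCategory.δ i.succ))
    (contr I (n + 1) j x).1 = contr I n j ⟨(h (SimplexCategory.δ i)) x, (h _).map_deg x.2⟩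

abbrev ResModel (I : Interp T (resSig B)) : Prop := Nonempty (ResStr B I)

abbrev resFree : Interp T (resSig B) := Interp.free (ResModel B)

variable {B} in
abbrev resEv {I : Interp T (resSig B)} (s : ResStr B I) (k : SimplexCategory) :
    (resFree B).M k ⟶ I.M k := I.evHom ⟨s⟩ k

def resMap {k l : SimplexCategory} (θ : l ⟶ k) : (resFree B).M k ⟶ (resFree B).M l :=
  Interp.freeLift (fun I hI => I.evHom hI k ≫ hI.some.h θ) fun i x hx => by
    obtain ⟨t, rfl⟩ := Interp.free_exists_ev x
    refine ⟨.un (Γ := resSig B) (Sum.inl ⟨k, l, θ, i⟩) t, fun I hI => ?_⟩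
    refine (hI.some.h_un θ i _).trans (congrArg (hI.some.h θ).toAlgHom ?_)
    exact (congrArg ((I.M k).pr i) (I.evHom_ev hI t).symm).trans
      ((I.M k).pr_of_mem ((I.evHom hI k).map_deg hx))

variable {B}

lemma resMap_ev {I : Interp T (resSig B)} (hI : ResModel B I) {k l : SimplexCategory}
    (θ : l ⟶ k) : resMap B θ ≫ I.evHom hI l = I.evHom hI k ≫ hI.some.h θ :=
  Interp.freeLift_evHom _ _ I hI

lemma ResStr.h_unique {I : Interp T (resSig B)} (s s' : ResStr B I) {k l : SimplexCategory}
    (θ : l ⟶ k) : s.h θ = s'.h θ := by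
  refine TDGA.hom_ext fun x => ?_
  induction x using CDGA.hom_induction with
  | zero => rw [map_zero, map_zero]
  | homog i x hx => exact (s.h_un θ i ⟨x, hx⟩).symm.trans (s'.h_un θ i ⟨x, hx⟩)
  | add x y hx hy => rw [map_add, map_add, hx, hy]

lemma resMap_ev' {I : Interp T (resSig B)} (s : ResStr B I) {k l : SimplexCategory}
    (θ : l ⟶ k) : resMap B θ ≫ resEv s l = resEv s k ≫ s.h θ := by
  rw [s.h_unique (Nonempty.intro s : ResModel B I).some]
  exact resMap_ev _ _

lemma res_hom_ext {X : TDGA T} {k : SimplexCategory} {f g : X ⟶ (resFree B).M k}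
    (h : ∀ (I : Interp T (resSig B)) (s : ResStr B I), f ≫ resEv s k = g ≫ resEv s k) : f = g :=
  TDGA.hom_ext fun x => Interp.free_ext fun I hI =>
    congr_toAlgHom (h I hI.some) x

variable (B)

lemma resMap_id (k : SimplexCategory) : resMap B (𝟙 k) = 𝟙 _ :=
  res_hom_ext fun I s => by
    rw [resMap_ev', s.h_id, comp_id, id_comp]

lemma resMap_comp {k l m : SimplexCategory} (θ : l ⟶ k) (η : m ⟶ l) :
    resMap B (η ≫ θ) = resMap B θ ≫ resMap B η :=
  res_hom_ext fun I s => by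
    rw [resMap_ev', s.h_comp, assoc, resMap_ev' s η, ← assoc, ← assoc,
      resMap_ev']

def resObj : SimplicialObject (TDGA T) where
  obj k := (resFree B).M k.unop
  map θ := resMap B θ.unop
  map_id k := resMap_id B k.unop
  map_comp θ η := resMap_comp B θ.unop η.unop

def resBase : B ⟶ (resFree B).M ⦋0⦌ :=
  Interp.freeLift (fun _ hI => hI.some.β) fun i x hx =>
    ⟨.gen (Γ := resSig B) ⟨i, x, hx⟩, fun _ hI => hI.some.g_eq i ⟨x, hx⟩⟩

variable {B}

lemma ResStr.β_unique {I : Interp T (resSig B)} (s s' : ResStr B I) : s.β = s'.β := by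
  refine TDGA.hom_ext fun x => ?_
  induction x using CDGA.hom_induction with
  | zero => rw [map_zero, map_zero]
  | homog i x hx => exact (s.g_eq i ⟨x, hx⟩).symm.trans (s'.g_eq i ⟨x, hx⟩)
  | add x y hx hy => rw [map_add, map_add, hx, hy]

lemma resBase_ev {I : Interp T (resSig B)} (s : ResStr B I) : resBase B ≫ resEv s _ = s.β := by
  rw [s.β_unique (Nonempty.intro s : ResModel B I).some]
  exact Interp.freeLift_evHom _ _ I ⟨s⟩

lemma resBase_g (g : Σ i, B.deg i) : ((resFree B).g g).1 = (resBase B) g.2 :=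
  Interp.free_ext fun I hI => by
    rw [Interp.evHom_g, ← comp_apply]
    have := resBase_ev hI.some
    exact (hI.some.g_eq g.1 g.2).trans (congr_toAlgHom this g.2.1).symm

lemma res_ext {k : SimplexCategory} {x y : ((resFree B).M k).carrier}
    (h : ∀ (I : Interp T (resSig B)) (s : ResStr B I),
      (resEv s k) x = (resEv s k) y) : x = y :=
  Interp.free_ext fun I hI => h I hI.some

lemma resMap_ev_apply {I : Interp T (resSig B)} (s : ResStr B I) {k l : SimplexCategory}
    (θ : l ⟶ k) (x : ((resFree B).M k).carrier) :
    (resEv s l) ((resMap B θ) x) = (s.h θ) ((resEv s k) x) :=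
  congrArg (fun q : _ ⟶ I.M l => Hom.toAlgHom q x) (resMap_ev' s θ)

lemma contr_ev' {I : Interp T (resSig B)} (s : ResStr B I) (n j : ℕ)
    (x : ((resFree B).M ⦋n⦌).deg (j + 1)) :
    (resEv s ⦋n + 1⦌) (contr (resFree B) n j x).1 =
    (contr I n j ⟨(resEv s ⦋n⦌) x.1, Hom.map_deg _ x.2⟩).1 :=
  I.evHom_un ⟨s⟩ (Sum.inr (n, j)) x

/-- The free structure is a model. -/
def resFreeStr : ResStr B (resFree B) where
  h θ := resMap B θ
  h_un {k l} θ j x := res_ext fun I s => by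
    refine (I.evHom_un ⟨s⟩ (Sum.inl ⟨k, l, θ, j⟩) x).trans ?_
    exact (s.h_un θ j _).trans (resMap_ev_apply s θ x.1).symm
  h_id := resMap_id B
  h_comp := resMap_comp B
  β := resBase B
  g_eq i x := resBase_g ⟨i, x⟩
  contr_zero n j := Subtype.ext <| res_ext fun I s => by
    refine (contr_ev' s n j 0).trans ?_
    have h : (⟨(resEv s ⦋n⦌) (0 : ((resFree B).M ⦋n⦌).deg (j + 1)).1,
      Hom.map_deg _ (zero_mem _)⟩ : (I.M ⦋n⦌).deg (j + 1)) = 0 := Subtype.ext (map_zero _)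
    rw [h, s.contr_zero]
    exact (map_zero _).symm
  d_contr n j x := res_ext fun I s => by
    rw [resMap_ev_apply, contr_ev', s.d_contr]
  d_contr_zero j x := res_ext fun I s => by
    rw [resMap_ev_apply, contr_ev', s.d_contr_zero, map_zero]
  d_contr_succ n j i x := res_ext fun I s => by
    rw [resMap_ev_apply, contr_ev', s.d_contr_succ, contr_ev']
    exact congrArg (fun z => (contr I n j z).1) (Subtype.ext (resMap_ev_apply s _ x.1).symm)

variable (B)

def toZero (k : SimplexCategory) : k ⟶ ⦋0⦌ := SimplexCategory.isTerminalZero.from k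

def resι (k : SimplexCategory) : B ⟶ (resFree B).M k := resBase B ≫ resMap B (toZero k)

/-! The right Kan extension argument for the lifting property of `B ⟶ R k`. -/

variable {B} {k : SimplexCategory} {X Y : TDGA T} (p : X ⟶ Y) (g : (resFree B).M k ⟶ Y)

def ranData (m : SimplexCategory) : LimData T (ULift.{u} (Option (k ⟶ m))) (ULift.{u} (k ⟶ m)) where
  M θ := θ.down.elim ((resFree B).M m) fun _ => X
  N _ := Y
  a _ := ⟨none⟩
  b θ := ⟨some θ.down⟩
  f θ := resMap B θ.down ≫ g
  g _ := p

abbrev ran (m : SimplexCategory) : TDGA T := (ranData p g m).lim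

def ranFst (m : SimplexCategory) : ran p g m ⟶ (resFree B).M m := (ranData p g m).π ⟨none⟩

def ranSnd {m : SimplexCategory} (θ : k ⟶ m) : ran p g m ⟶ X := (ranData p g m).π ⟨some θ⟩

lemma ran_condition {m : SimplexCategory} (θ : k ⟶ m) :
    ranFst p g m ≫ resMap B θ ≫ g = ranSnd p g θ ≫ p := (ranData p g m).condition ⟨θ⟩

variable {p g}

lemma ran_hom_ext {W : TDGA T} {m : SimplexCategory} {a b : W ⟶ ran p g m}
    (h : a ≫ ranFst p g m = b ≫ ranFst p g m)
    (h' : ∀ θ, a ≫ ranSnd p g θ = b ≫ ranSnd p g θ) : a = b :=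
  (ranData p g m).hom_ext fun ⟨θ⟩ => by
    cases θ with
    | none => exact h
    | some θ => exact h' θ

lemma ran_ext {m : SimplexCategory} {a b : (ran p g m).carrier}
    (h : (ranFst p g m) a = (ranFst p g m) b)
    (h' : ∀ θ, (ranSnd p g θ) a = (ranSnd p g θ) b) : a = b :=
  (ranData p g m).ext fun ⟨θ⟩ => by
    cases θ with
    | none => exact h
    | some θ => exact h' θ

def ranLift {W : TDGA T} {m : SimplexCategory} (a : W ⟶ (resFree B).M m) (b : (k ⟶ m) → (W ⟶ X))
    (h : ∀ θ, a ≫ resMap B θ ≫ g = b θ ≫ p) : W ⟶ ran p g m :=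
  (ranData p g m).lift (fun θ => Option.rec (motive := fun θ => W ⟶ (ranData p g m).M ⟨θ⟩) a b
    θ.down) fun θ => h θ.down

lemma ranLift_fst {W : TDGA T} {m : SimplexCategory} (a : W ⟶ (resFree B).M m)
    (b : (k ⟶ m) → (W ⟶ X)) (h : ∀ θ, a ≫ resMap B θ ≫ g = b θ ≫ p) :
    ranLift a b h ≫ ranFst p g m = a := (ranData p g m).lift_π _ _ ⟨none⟩

lemma ranLift_snd {W : TDGA T} {m : SimplexCategory} (a : W ⟶ (resFree B).M m)
    (b : (k ⟶ m) → (W ⟶ X)) (h : ∀ θ, a ≫ resMap B θ ≫ g = b θ ≫ p) (θ : k ⟶ m) :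
    ranLift a b h ≫ ranSnd p g θ = b θ := (ranData p g m).lift_π _ _ ⟨some θ⟩

lemma ran_exists {m : SimplexCategory} {i : ℕ} (a : ((resFree B).M m).deg i)
    (b : (k ⟶ m) → X.deg i)
    (h : ∀ θ, g ((resMap B θ) a) = p (b θ)) :
    ∃ y : (ran p g m).deg i, (ranFst p g m) y = a ∧
      ∀ θ, (ranSnd p g θ) y.1 = b θ := by
  obtain ⟨y, hy, h'⟩ := (ranData p g m).exists_mk_deg (i := i)
    (fun θ => Option.rec (motive := fun θ => ((ranData p g m).M ⟨θ⟩).carrier) a.1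
      (fun θ => (b θ).1) θ.down)
    (fun ⟨θ⟩ => by
      cases θ with
      | none => exact a.2
      | some θ => exact (b θ).2) (fun θ => h θ.down)
  exact ⟨⟨y, hy⟩, h' ⟨none⟩, fun θ => h' ⟨some θ⟩⟩

def ranMap {k' l : SimplexCategory} (θ : l ⟶ k') : ran p g k' ⟶ ran p g l :=
  ranLift (ranFst p g k' ≫ resMap B θ) (fun η => ranSnd p g (η ≫ θ)) fun η => by
    rw [← ran_condition, resMap_comp]; simp only [assoc]

lemma exists_section (hp : IsFibration p) (j : ℕ) : ∃ σ : Y.deg (j + 1) → X.deg (j + 1),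
    σ 0 = 0 ∧ ∀ y, p (σ y) = y := by
  classical
  choose σ hσ hσ' using fun y : Y.deg (j + 1) => hp j y y.2
  refine ⟨fun y => if y = 0 then 0 else ⟨σ y, hσ y⟩, if_pos rfl, fun y => ?_⟩
  by_cases h : y = 0
  · subst h
    exact (congrArg (fun z : X.deg (j + 1) => p z.1) (if_pos rfl)).trans (map_zero _)
  · exact (congrArg (fun z : X.deg (j + 1) => p z.1) (if_neg h)).trans (hσ' y)

open Classical in
/-- The second component of the contraction. -/
def ranContrSnd (σ : ∀ j, Y.deg (j + 1) → X.deg (j + 1)) {n j : ℕ}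
    (x : (ran p g ⦋n⦌).deg (j + 1)) (r : ((resFree B).M ⦋n + 1⦌).deg (j + 1))
    (θ : k ⟶ ⦋n + 1⦌) : X.deg (j + 1) :=
  if h : ∃ θ' : k ⟶ ⦋n⦌, θ' ≫ SimplexCategory.δ 0 = θ then
    ⟨(ranSnd p g h.choose) x, Hom.map_deg _ x.2⟩
  else σ j ⟨g ((resMap B θ) r), Hom.map_deg _ (Hom.map_deg _ r.2)⟩

lemma ranContrSnd_δ (σ : ∀ j, Y.deg (j + 1) → X.deg (j + 1)) {n j : ℕ}
    (x : (ran p g ⦋n⦌).deg (j + 1)) (r : ((resFree B).M ⦋n + 1⦌).deg (j + 1)) (θ : k ⟶ ⦋n⦌) :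
    (ranContrSnd σ x r (θ ≫ SimplexCategory.δ 0)).1 = (ranSnd p g θ) x := by
  have h : ∃ θ' : k ⟶ ⦋n⦌, θ' ≫ SimplexCategory.δ 0 = θ ≫ SimplexCategory.δ 0 := ⟨θ, rfl⟩
  have h' : h.choose = θ := (cancel_mono _).1 h.choose_spec
  rw [ranContrSnd, dif_pos h]
  exact congrArg (fun θ => (ranSnd p g θ) x.1) h'

lemma ranContrSnd_of_not (σ : ∀ j, Y.deg (j + 1) → X.deg (j + 1)) {n j : ℕ}
    (x : (ran p g ⦋n⦌).deg (j + 1)) (r : ((resFree B).M ⦋n + 1⦌).deg (j + 1)) (θ : k ⟶ ⦋n + 1⦌)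
    (h : ¬ ∃ θ' : k ⟶ ⦋n⦌, θ' ≫ SimplexCategory.δ 0 = θ) :
    ranContrSnd σ x r θ =
      σ j ⟨g ((resMap B θ) r), Hom.map_deg _ (Hom.map_deg _ r.2)⟩ := dif_neg h

abbrev fstDeg {n j : ℕ} (x : (ran p g ⦋n⦌).deg j) : ((resFree B).M ⦋n⦌).deg j :=
  ⟨(ranFst p g _) x.1, Hom.map_deg _ x.2⟩

lemma exists_ranContr (σ : ∀ j, Y.deg (j + 1) → X.deg (j + 1))
    (hσ : ∀ j y, p (σ j y) = y) (n j : ℕ) (x : (ran p g ⦋n⦌).deg (j + 1)) :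
    ∃ y : (ran p g ⦋n + 1⦌).deg (j + 1),
      (ranFst p g ⦋n + 1⦌) y.1 = (contr (resFree B) n j (fstDeg x)).1 ∧
      ∀ θ, (ranSnd p g θ) y.1 =
        ranContrSnd σ x (contr (resFree B) n j (fstDeg x)) θ := by
  refine ran_exists _ _ fun θ => ?_
  by_cases h : ∃ θ' : k ⟶ ⦋n⦌, θ' ≫ SimplexCategory.δ 0 = θ
  · obtain ⟨θ', rfl⟩ := h
    rw [ranContrSnd_δ, resMap_comp, comp_apply]
    have h1 := resFreeStr.d_contr n j (fstDeg x)
    refine (congrArg (fun z => g ((resMap B θ') z)) h1).trans ?_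
    exact congr_toAlgHom (ran_condition p g θ') x.1
  · rw [ranContrSnd_of_not _ _ _ _ h, hσ]

section RanStr

variable (σ : ∀ j, Y.deg (j + 1) → X.deg (j + 1)) (hσ : ∀ j y, p (σ j y) = y)

def ranBase (f : B ⟶ X) (hf : f ≫ p = resι B k ≫ g) : B ⟶ ran p g ⦋0⦌ :=
  ranLift (resBase B) (fun _ => f) fun θ => by
    rw [hf, resι, assoc]
    congr 3
    exact SimplexCategory.isTerminalZero.hom_ext _ _

lemma ranBase_fst (f : B ⟶ X) (hf : f ≫ p = resι B k ≫ g) :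
    ranBase f hf ≫ ranFst p g _ = resBase B := ranLift_fst _ _ _

def ranInterp (f : B ⟶ X) (hf : f ≫ p = resι B k ≫ g) : Interp T (resSig B) where
  M m := ran p g m
  g s := ⟨(ranBase f hf) s.2, Hom.map_deg _ s.2.2⟩
  un
    | Sum.inl s => fun x => ⟨(ranMap s.2.2.1) x.1, Hom.map_deg _ x.2⟩
    | Sum.inr s => fun x => (exists_ranContr σ hσ s.1 s.2 x).choose

lemma contr_ranInterp (f : B ⟶ X) (hf : f ≫ p = resι B k ≫ g) (n j : ℕ)
    (x : (ran p g ⦋n⦌).deg (j + 1)) :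
    (ranFst p g ⦋n + 1⦌) (contr (ranInterp σ hσ f hf) n j x).1 =
      (contr (resFree B) n j (fstDeg x)).1 ∧
    ∀ θ, (ranSnd p g θ) (contr (ranInterp σ hσ f hf) n j x).1 =
        ranContrSnd σ x (contr (resFree B) n j (fstDeg x)) θ :=
  (exists_ranContr σ hσ n j x).choose_spec

lemma ranMap_fst {k' l : SimplexCategory} (θ : l ⟶ k') (x : (ran p g k').carrier) :
    (ranFst p g l) ((ranMap θ) x) =
      (resMap B θ) ((ranFst p g k') x) :=
  congr_toAlgHom (show ranMap θ ≫ ranFst p g l = _ from ranLift_fst _ _ _) x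

lemma ranMap_snd {k' l : SimplexCategory} (θ : l ⟶ k') (η : k ⟶ l) (x : (ran p g k').carrier) :
    (ranSnd p g η) ((ranMap θ) x) = (ranSnd p g (η ≫ θ)) x :=
  congr_toAlgHom (show ranMap θ ≫ ranSnd p g η = _ from ranLift_snd _ _ _ η) x

lemma not_exists_of_eq_zero {n : ℕ} {θ : k ⟶ ⦋n + 1⦌} (a : Fin (k.len + 1))
    (h : θ.toOrderHom a = 0) : ¬ ∃ θ' : k ⟶ ⦋n⦌, θ' ≫ SimplexCategory.δ 0 = θ := by
  rintro ⟨θ', rfl⟩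
  exact Fin.succ_ne_zero _ h

lemma not_exists_of_comp {n : ℕ} {θ : k ⟶ ⦋n + 1⦌} (i : Fin (n + 2))
    (h : ¬ ∃ θ' : k ⟶ ⦋n⦌, θ' ≫ SimplexCategory.δ 0 = θ) :
    ¬ ∃ θ' : k ⟶ ⦋n + 1⦌, θ' ≫ SimplexCategory.δ 0 = θ ≫ SimplexCategory.δ i.succ := by
  obtain ⟨a, ha⟩ : ∃ a, θ.toOrderHom a = 0 := by
    by_contra! h'
    exact h ⟨_, SimplexCategory.factor_δ_spec θ 0 h'⟩
  refine not_exists_of_eq_zero a ?_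
  change i.succ.succAbove (θ.toOrderHom a) = 0
  rw [ha]; exact Fin.succ_succAbove_zero i

lemma ranMap_comp_fst {k' l m : SimplexCategory} (θ : l ⟶ k') (η : m ⟶ l) :
    (ranMap (η ≫ θ) : ran p g k' ⟶ ran p g m) = ranMap θ ≫ ranMap η :=
  ran_hom_ext
    (TDGA.hom_ext fun x => by
      refine (ranMap_fst _ _).trans (Eq.trans ?_ ((ranMap_fst η _).trans
        (congrArg (resMap B η).toAlgHom (ranMap_fst θ x))).symm)
      rw [resMap_comp]; rfl)
    fun μ => TDGA.hom_ext fun x => by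
      refine (ranMap_snd _ _ _).trans (Eq.trans ?_ ((ranMap_snd η _ _).trans
        (ranMap_snd θ _ x)).symm)
      rw [assoc]

lemma ran_fstDeg_map {n n' : ℕ} (θ : ⦋n'⦌ ⟶ ⦋n⦌) {j : ℕ} (x : (ran p g ⦋n⦌).deg j) :
    fstDeg (⟨(ranMap θ) x, Hom.map_deg _ x.2⟩ : (ran p g ⦋n'⦌).deg j) =
      ⟨(resMap B θ) (fstDeg x).1, Hom.map_deg _ (fstDeg x).2⟩ :=
  Subtype.ext (ranMap_fst _ _)

def ranStr (hσ0 : ∀ j, σ j 0 = 0) (f : B ⟶ X) (hf : f ≫ p = resι B k ≫ g) :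
    ResStr B (ranInterp σ hσ f hf) where
  h θ := ranMap θ
  h_un _ _ _ := rfl
  h_id m := ran_hom_ext (by rw [ranMap, ranLift_fst, resMap_id]; rfl) fun η => by
    rw [ranMap, ranLift_snd, comp_id]; rfl
  h_comp θ η := ranMap_comp_fst θ η
  β := ranBase f hf
  g_eq _ _ := rfl
  contr_zero n j := by
    obtain ⟨h1, h2⟩ := contr_ranInterp σ hσ f hf n j 0
    have h0 : fstDeg (0 : (ran p g ⦋n⦌).deg (j + 1)) = 0 := Subtype.ext (map_zero _)
    rw [h0, resFreeStr.contr_zero] at h1 h2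
    refine Subtype.ext (ran_ext ?_ fun θ => ?_)
    · exact h1.trans (map_zero _).symm
    · refine (h2 θ).trans (Eq.trans ?_ (map_zero _).symm)
      by_cases h : ∃ θ' : k ⟶ ⦋n⦌, θ' ≫ SimplexCategory.δ 0 = θ
      · obtain ⟨θ', rfl⟩ := h
        rw [ranContrSnd_δ]; exact map_zero _
      · rw [ranContrSnd_of_not _ _ _ _ h]
        refine (congrArg (fun y => (σ j y).1) (a₂ := 0) (Subtype.ext ?_)).trans
          (congrArg Subtype.val (hσ0 j))
        exact (congrArg g.toAlgHom (map_zero (resMap B θ).toAlgHom)).trans (map_zero _)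
  d_contr n j x := by
    obtain ⟨h1, h2⟩ := contr_ranInterp σ hσ f hf n j x
    refine ran_ext ?_ fun θ => ?_
    · exact (ranMap_fst _ _).trans ((congrArg _ h1).trans (resFreeStr.d_contr n j _))
    · exact (ranMap_snd _ _ _).trans ((h2 _).trans (ranContrSnd_δ _ _ _ _))
  d_contr_zero := fun j (x : (ran p g ⦋0⦌).deg (j + 1)) => by
    obtain ⟨h1, h2⟩ := contr_ranInterp σ hσ f hf 0 j x
    have h3 := resFreeStr.d_contr_zero j (fstDeg x)
    refine ran_ext ?_ fun θ => ?_
    · exact (ranMap_fst _ _).trans ((congrArg _ h1).trans (h3.trans (map_zero _).symm))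
    · refine (ranMap_snd _ _ _).trans ((h2 _).trans (Eq.trans ?_ (map_zero _).symm))
      rw [ranContrSnd_of_not]
      · refine (congrArg (fun y => (σ j y).1) (a₂ := 0) (Subtype.ext ?_)).trans
          (congrArg Subtype.val (hσ0 j))
        refine (congrArg g.toAlgHom ?_).trans (map_zero _)
        rw [resMap_comp]
        exact (congrArg (resMap B θ).toAlgHom h3).trans (map_zero _)
      · refine not_exists_of_eq_zero 0 ?_
        change (1 : Fin 2).succAbove (θ.toOrderHom 0) = 0
        rw [Subsingleton.elim (α := Fin 1) (θ.toOrderHom 0) 0]; rfl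
  d_contr_succ := fun n j i (x : (ran p g ⦋n + 1⦌).deg (j + 1)) => by
    obtain ⟨h1, h2⟩ := contr_ranInterp σ hσ f hf (n + 1) j x
    obtain ⟨h3, h4⟩ := contr_ranInterp σ hσ f hf n j
      ⟨(ranMap (SimplexCategory.δ i)) x.1, Hom.map_deg _ x.2⟩
    have h5 := resFreeStr.d_contr_succ n j i (fstDeg x)
    have h6 := ran_fstDeg_map (SimplexCategory.δ i) x
    refine ran_ext ?_ fun θ => ?_
    · refine (ranMap_fst _ _).trans ((congrArg _ h1).trans ?_)
      refine h5.trans (Eq.trans ?_ h3.symm)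
      rw [h6]; rfl
    · refine (ranMap_snd _ _ _).trans ((h2 _).trans ?_)
      refine Eq.trans ?_ (h4 θ).symm
      by_cases h : ∃ θ' : k ⟶ ⦋n⦌, θ' ≫ SimplexCategory.δ 0 = θ
      · obtain ⟨θ', rfl⟩ := h
        have e : (θ' ≫ SimplexCategory.δ 0) ≫ SimplexCategory.δ i.succ =
            (θ' ≫ SimplexCategory.δ i) ≫ SimplexCategory.δ 0 := by
          rw [assoc, assoc]
          exact congrArg _ (SimplexCategory.δ_comp_δ (Fin.zero_le i))
        rw [ranContrSnd_δ, e, ranContrSnd_δ]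
        exact (ranMap_snd _ _ _).symm
      · rw [ranContrSnd_of_not _ _ _ _ h, ranContrSnd_of_not _ _ _ _ (not_exists_of_comp i h)]
        refine congrArg (fun y => (σ j y).1) (Subtype.ext (congrArg g.toAlgHom ?_))
        rw [resMap_comp, h6]
        exact congrArg (resMap B θ).toAlgHom h5

end RanStr

lemma llpFib_resι (k : SimplexCategory) : LLPFib (resι B k) := by
  intro X Y p hp f g hf
  choose σ hσ0 hσ using exists_section (p := p) hp
  let s := ranStr (k := k) σ hσ hσ0 f hf
  have e1 : ∀ m, resEv s m ≫ ranFst p g m = 𝟙 _ := by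
    refine Interp.free_hom_ext (Γ := resSig B) (P := ResModel B) (N := (resFree B).M)
      (φ := fun m => resEv s m ≫ ranFst p g m) (ψ := fun m => 𝟙 _) ?_ ?_
    · intro x
      rw [resBase_g]
      have e0 : resBase B ≫ resEv s _ ≫ ranFst p g _ = resBase B :=
        ((assoc _ _ _).symm.trans (congrArg (· ≫ _) (resBase_ev s))).trans
          (ranBase_fst f hf)
      exact congr_toAlgHom e0 x.2.1
    · rintro (⟨a, b, θ, j⟩ | ⟨n, j⟩) x hx
      · have h1 : (resEv s b) ((resMap B θ) x.1) =
          (ranMap θ) ((resEv s a) x.1) := resMap_ev_apply s θ x.1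
        change (ranFst p g b) ((resEv s b) ((resFree B).un _ x).1) = _
        have h2 : ((resFree B).un (Sum.inl ⟨a, b, θ, j⟩) x).1 = (resMap B θ) x.1 :=
          resFreeStr.h_un θ j x
        rw [h2]
        exact ((congrArg _ h1).trans (ranMap_fst θ _)).trans (congrArg (resMap B θ).toAlgHom hx)
      · refine (congrArg (ranFst p g ⦋n + 1⦌).toAlgHom (contr_ev' s n j x)).trans ?_
        refine (contr_ranInterp σ hσ f hf n j _).1.trans ?_
        exact congrArg (fun y => (contr (resFree B) n j y).1) (Subtype.ext hx)
  have e2 : (ranFst p g k ≫ g) = ranSnd p g (𝟙 k) ≫ p := by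
    rw [← ran_condition, resMap_id, id_comp]
  refine ⟨resEv s k ≫ ranSnd p g (𝟙 k), ?_, ?_⟩
  · have h1 : resι B k ≫ resEv s k = ranBase f hf ≫ ranMap (toZero k) := by
      refine (assoc _ _ _).trans ((congrArg _ (resMap_ev' s (toZero k))).trans ?_)
      exact (assoc _ _ _).symm.trans (congrArg (· ≫ _) (resBase_ev s))
    refine (assoc _ _ _).symm.trans ((congrArg (· ≫ _) h1).trans ?_)
    refine (assoc _ _ _).trans ((congrArg _ (ranLift_snd _ _ _ _)).trans ?_)
    exact ranLift_snd _ _ _ _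
  · refine (assoc _ _ _).trans ((congrArg _ e2.symm).trans ?_)
    exact (assoc _ _ _).symm.trans
      ((congrArg (· ≫ g) (e1 k)).trans (id_comp _))

lemma quasiIso_resι (k : SimplexCategory) : QuasiIso (resι B k) := by
  obtain ⟨C, i, p, hip, hp, -, hi⟩ := exists_factor (resι B k)
  obtain ⟨h, h1, h2⟩ := llpFib_resι k p hp i (𝟙 _) (by rw [hip, comp_id])
  exact hi.of_retract h p h1 h2

end Resolution

end TDGA

/-! ### Faces of maps from the boundary -/

namespace Simp

open Simplicial SSet

variable {V : SSet.{u}}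

/-- The faces of a map from the boundary. -/
abbrev bdFace {n : ℕ} (σ : (boundary (n + 1) : SSet.{u}) ⟶ V) (j : Fin (n + 2)) : V _⦋n⦌ :=
  SSet.yonedaEquiv (boundary.ι j ≫ σ)

lemma bdFace_compat {n : ℕ} (σ : (boundary (n + 2) : SSet.{u}) ⟶ V) (a b : Fin (n + 3))
    (h : a < b) : V.δ (b.pred (Fin.ne_zero_of_lt h)) (bdFace σ a) =
      V.δ (a.castPred (Fin.ne_last_of_lt h)) (bdFace σ b) := by
  rw [← yonedaEquiv_δ_comp, ← yonedaEquiv_δ_comp, ← assoc, ← assoc]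
  have : stdSimplex.δ (b.pred (Fin.ne_zero_of_lt h)) ≫ boundary.ι.{u} a =
      stdSimplex.δ (a.castPred (Fin.ne_last_of_lt h)) ≫ boundary.ι b := by
    obtain ⟨a, rfl⟩ := a.eq_castSucc_of_ne_last (Fin.ne_last_of_lt h)
    obtain ⟨b, rfl⟩ := b.eq_succ_of_ne_zero (Fin.ne_zero_of_lt h)
    rw [← cancel_mono (Subcomplex.ι _), assoc, assoc, boundary.ι_ι,
      boundary.ι_ι, Fin.pred_succ, Fin.castPred_castSucc]
    exact (stdSimplex.δ_comp_δ (by rw [Fin.lt_def] at h; rw [Fin.le_def]; simp at h ⊢; omega)).symm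
  rw [this]

lemma bdFace_ι_comp {n : ℕ} (τ : Δ[n + 1] ⟶ V) (j : Fin (n + 2)) :
    bdFace ((boundary (n + 1)).ι ≫ τ) j = V.δ j (SSet.yonedaEquiv τ) := by
  rw [bdFace, ← assoc, boundary.ι_ι, yonedaEquiv_δ_comp]

lemma bdFace_ext {n : ℕ} {σ τ : (boundary (n + 1) : SSet.{u}) ⟶ V}
    (h : ∀ j, bdFace σ j = bdFace τ j) : σ = τ :=
  boundary.hom_ext fun j => SSet.yonedaEquiv.injective (h j)

/-- All faces vanish. -/
def ZeroBd (V : SSet.{u}) [∀ k, AddCommGroup (V.obj k)] (n : ℕ) : V _⦋n⦌ → Prop :=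
  match n with
  | 0 => fun _ => True
  | _ + 1 => fun z => ∀ j, V.δ j z = 0

lemma exists_of_contraction [∀ k, AddCommGroup (V.obj k)] (hV : IsAdd V) {n : ℕ}
    (H : ∀ z : V _⦋n⦌, ZeroBd V n z → ∃ y : V _⦋n + 1⦌, V.δ 0 y = z ∧
      ∀ j : Fin (n + 1), V.δ j.succ y = 0)
    (σ : (boundary (n + 1) : SSet.{u}) ⟶ V) : ∃ τ : Δ[n + 1] ⟶ V, (boundary (n + 1)).ι ≫ τ = σ := by
  have hδ : ∀ {k : ℕ} (j : Fin (k + 2)) (a b : V _⦋k + 1⦌), V.δ j (a - b) = V.δ j a - V.δ j b :=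
    fun j a b => hV _ a b
  have hadd : ∀ {k : ℕ} (j : Fin (k + 2)) (a b : V _⦋k + 1⦌),
      V.δ j (a + b) = V.δ j a + V.δ j b := fun j a b => by
    have h1 := hδ j (a + b) b
    rw [add_sub_cancel_right] at h1
    rw [h1, sub_add_cancel]
  obtain ⟨w, hw⟩ : ∃ w : V _⦋n + 1⦌, ∀ j, j ≠ 0 → V.δ j w = bdFace σ j := by
    obtain _ | n := n
    · refine ⟨V.σ 0 (bdFace σ (0 : Fin 1).succ), fun j hj => ?_⟩
      obtain rfl : j = (0 : Fin 1).succ := Fin.eq_one_of_ne_zero j hj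
      exact ConcreteCategory.congr_hom (V.δ_comp_σ_succ (i := (0 : Fin 1))) _
    · exact exists_of_compatOn hV 0 _ fun a b h _ _ => bdFace_compat σ a b h
  obtain ⟨y, hy0, hy⟩ := H (bdFace σ 0 - V.δ 0 w) (by
    obtain _ | n := n
    · trivial
    · intro j
      rw [hδ, sub_eq_zero]
      refine (bdFace_compat σ 0 j.succ (Fin.succ_pos j)).trans ?_
      rw [← hw _ (Fin.succ_ne_zero j)]
      exact (face_face (Fin.succ_pos j) w).symm)
  refine ⟨SSet.yonedaEquiv.symm (w + y), bdFace_ext fun j => ?_⟩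
  rw [bdFace_ι_comp, Equiv.apply_symm_apply, hadd]
  refine Fin.cases ?_ (fun j => ?_) j
  · rw [hy0]; exact add_sub_cancel _ _
  · rw [hy, hw _ (Fin.succ_ne_zero j)]; exact add_zero _

end Simp

namespace TDGA

open Simplicial Simp

section Degree

/-- The simplicial set of elements of degree `i`. -/
abbrev degSSet (R : SimplicialObject (TDGA T)) (i : ℕ) : SSet.{u} := R ⋙ degFunctor i

instance (R : SimplicialObject (TDGA T)) (i : ℕ) (k : SimplexCategoryᵒᵖ) :
    AddCommGroup ((degSSet R i).obj k) := inferInstanceAs (AddCommGroup ((R.obj k).deg i))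

lemma isAdd_degSSet (R : SimplicialObject (TDGA T)) (i : ℕ) : IsAdd (degSSet R i) :=
  fun θ x y => Subtype.ext (map_sub (R.map θ).toAlgHom x.1 y.1)

end Degree

section Resolution

variable (B : TDGA T)

lemma resObj_fibrant (i n : ℕ)
    (σ : (SSet.boundary n : SSet.{u}) ⟶ degSSet (resObj B) (i + 1)) :
    ∃ τ : Δ[n] ⟶ degSSet (resObj B) (i + 1), (SSet.boundary n).ι ≫ τ = σ := by
  obtain _ | n := n
  · exact ⟨SSet.yonedaEquiv.symm (0 : (degSSet (resObj B) (i + 1)).obj _),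
      SSet.boundary.hom_ext₀⟩
  refine exists_of_contraction (V := degSSet (resObj B) (i + 1)) (isAdd_degSSet _ _) (fun z hz =>
    ⟨contr (resFree B) n i z, Subtype.ext (resFreeStr.d_contr n i z), fun j => ?_⟩) σ
  obtain _ | n := n
  · obtain rfl : j = 0 := by omega
    exact Subtype.ext (resFreeStr.d_contr_zero i z)
  · refine Subtype.ext ((resFreeStr.d_contr_succ n i j z).trans ?_)
    refine (congrArg (fun y => (contr (resFree B) n i y).1) (hz j)).trans ?_
    exact congrArg Subtype.val (resFreeStr.contr_zero n i)

/-- Simplicial resolutions exist. -/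
lemma nonempty_simplicialResolution : Nonempty B.SimplicialResolution :=
  ⟨{ obj := resObj B
     ι :=
      { app k := resι B k.unop
        naturality k l θ := by
          refine (id_comp _).trans ?_
          refine Eq.trans ?_ (assoc _ _ _).symm
          refine congrArg (resBase B ≫ ·) (Eq.trans ?_ (resMap_comp B _ θ.unop))
          exact congrArg (resMap B) (SimplexCategory.isTerminalZero.hom_ext _ _) }
     quasiIso := fun k => quasiIso_resι k.unop
     fibrant := resObj_fibrant B }⟩

end Resolution

end TDGA

namespace TDGA

open Simplicial Simp

/-! ### Cotensors of simplicial objects with simplicial sets -/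

section Cotensor

variable (R : SimplicialObject (TDGA T)) (K L : SSet.{u})

/-- Homotopically constant simplicial objects. -/
abbrev HConst : Prop := ∀ ⦃k l : SimplexCategoryᵒᵖ⦄ (θ : k ⟶ l), QuasiIso (R.map θ)

/-- The simplicial set of morphisms from `Q`. -/
abbrev homSSet (Q : TDGA T) : SSet.{u} := R ⋙ coyoneda.obj (op Q)

def cotData : LimData T (Σ k : SimplexCategoryᵒᵖ, K.obj k)
    (Σ kl : SimplexCategoryᵒᵖ × SimplexCategoryᵒᵖ, (kl.1 ⟶ kl.2) × K.obj kl.1) where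
  M s := R.obj s.1
  N c := R.obj c.1.2
  a c := ⟨c.1.1, c.2.2⟩
  b c := ⟨c.1.2, K.map c.2.1 c.2.2⟩
  f c := R.map c.2.1
  g _ := 𝟙 _

/-- The differential graded `T`-algebra of maps from a simplicial set to a simplicial one. -/
def cot : TDGA T := (cotData R K).lim

namespace cot

variable {K L}

def π {k : SimplexCategoryᵒᵖ} (x : K.obj k) : cot R K ⟶ R.obj k := (cotData R K).π ⟨k, x⟩

lemma π_comp_map {k l : SimplexCategoryᵒᵖ} (x : K.obj k) (θ : k ⟶ l) :
    π R x ≫ R.map θ = π R (K.map θ x) :=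
  ((cotData R K).condition ⟨(k, l), θ, x⟩).trans (comp_id _)

lemma map_π {k l : SimplexCategoryᵒᵖ} (x : K.obj k) (θ : k ⟶ l) (c : (cot R K).carrier) :
    (R.map θ) ((π R x) c) = (π R (K.map θ x)) c :=
  congr_toAlgHom (π_comp_map R x θ) c

variable {R}

lemma ext {a b : (cot R K).carrier}
    (h : ∀ k (x : K.obj k), (π R x) a = (π R x) b) : a = b :=
  (cotData R K).ext fun s => h s.1 s.2

lemma hom_ext {X : TDGA T} {a b : X ⟶ cot R K} (h : ∀ k (x : K.obj k), a ≫ π R x = b ≫ π R x) :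
    a = b := (cotData R K).hom_ext fun s => h s.1 s.2

/-- The morphism given by a map to the simplicial set of morphisms. -/
def lift {Q : TDGA T} (φ : K ⟶ homSSet R Q) : Q ⟶ cot R K :=
  (cotData R K).lift (fun s => φ.app s.1 s.2) fun c =>
    (ConcreteCategory.congr_hom (φ.naturality c.2.1) c.2.2).symm.trans (comp_id _).symm

lemma lift_π {Q : TDGA T} (φ : K ⟶ homSSet R Q) {k : SimplexCategoryᵒᵖ} (x : K.obj k) :
    lift φ ≫ π R x = φ.app k x := (cotData R K).lift_π _ _ ⟨k, x⟩

def toMap {i : ℕ} (c : (cot R K).deg i) : K ⟶ degSSet R i where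
  app k := ↾fun x => ⟨(π R x) c.1, Hom.map_deg _ c.2⟩
  naturality k l θ := by
    ext x
    exact Subtype.ext (map_π R x θ c.1).symm

lemma toMap_injective {i : ℕ} {c c' : (cot R K).deg i} (h : toMap c = toMap c') : c = c' :=
  Subtype.ext <| ext fun k x => congrArg (fun φ : K ⟶ degSSet R i => (φ.app k x).1) h

variable (R)

/-- Restriction along a map of simplicial sets. -/
def map (ι : K ⟶ L) : cot R L ⟶ cot R K :=
  (cotData R K).lift (fun s => π R (ι.app s.1 s.2)) fun c => by
    refine (π_comp_map R _ _).trans (Eq.trans ?_ (comp_id _).symm)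
    exact congrArg (π R) (ConcreteCategory.congr_hom (ι.naturality c.2.1) c.2.2).symm

lemma map_comp_π (ι : K ⟶ L) {k : SimplexCategoryᵒᵖ} (x : K.obj k) :
    map R ι ≫ π R x = π R (ι.app k x) := (cotData R K).lift_π _ _ ⟨k, x⟩

/-- Restriction of a simplex along a map to the standard simplex. -/
def res {n : ℕ} (ι : K ⟶ Δ[n]) : R _⦋n⦌ ⟶ cot R K :=
  (cotData R K).lift (fun s => R.map (SSet.stdSimplex.objEquiv (ι.app s.1 s.2)).op) fun c => by
    refine Eq.trans ?_ (comp_id _).symm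
    have h := ConcreteCategory.congr_hom (ι.naturality c.2.1) c.2.2
    refine Eq.trans ?_ (congrArg (fun y => R.map (SSet.stdSimplex.objEquiv y).op) h).symm
    exact (R.map_comp _ _).symm

lemma res_comp_π {n : ℕ} (ι : K ⟶ Δ[n]) {k : SimplexCategoryᵒᵖ} (x : K.obj k) :
    res R ι ≫ π R x = R.map (SSet.stdSimplex.objEquiv (ι.app k x)).op :=
  (cotData R K).lift_π _ _ ⟨k, x⟩

lemma π_res {n : ℕ} (ι : K ⟶ Δ[n]) {k : SimplexCategoryᵒᵖ} (x : K.obj k)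
    (c : (R _⦋n⦌).carrier) : (π R x) ((res R ι) c) =
      (R.map (SSet.stdSimplex.objEquiv (ι.app k x)).op) c :=
  congr_toAlgHom (res_comp_π R ι x) c

lemma res_comp_map {n : ℕ} (ι : L ⟶ Δ[n]) (κ : K ⟶ L) :
    res R ι ≫ map R κ = res R (κ ≫ ι) :=
  hom_ext fun k x => by
    rw [assoc, map_comp_π, res_comp_π, res_comp_π]; rfl

lemma toMap_res {n : ℕ} (ι : K ⟶ Δ[n]) {i : ℕ} (c : (R _⦋n⦌).deg i) :
    toMap ⟨(res R ι) c.1, Hom.map_deg _ c.2⟩ =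
      ι ≫ SSet.yonedaEquiv.symm (c : (degSSet R i) _⦋n⦌) := by
  ext k x
  exact Subtype.ext (π_res R ι x c.1)

lemma exists_res {n : ℕ} (ι : K ⟶ Δ[n]) {i : ℕ}
    (h : ∀ φ : K ⟶ degSSet R i, ∃ ψ : Δ[n] ⟶ degSSet R i, ι ≫ ψ = φ) (c : (cot R K).carrier)
    (hc : c ∈ (cot R K).deg i) :
    ∃ a ∈ (R _⦋n⦌).deg i, (res R ι) a = c := by
  obtain ⟨ψ, hψ⟩ := h (toMap ⟨c, hc⟩)
  obtain ⟨a, rfl⟩ := SSet.yonedaEquiv.symm.surjective ψ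
  exact ⟨a.1, a.2, congrArg Subtype.val (toMap_injective ((toMap_res R ι a).trans hψ))⟩

lemma lift_res {Q : TDGA T} {n : ℕ} (ι : K ⟶ Δ[n]) (φ : Q ⟶ R _⦋n⦌) :
    φ ≫ res R ι = lift (ι ≫ SSet.yonedaEquiv.symm (φ : (homSSet R Q) _⦋n⦌)) :=
  hom_ext fun k x => by
    rw [assoc, res_comp_π, lift_π]; rfl

lemma lift_injective {Q : TDGA T} {φ ψ : K ⟶ homSSet R Q} (h : lift φ = lift ψ) : φ = ψ := by
  ext k x
  exact (lift_π φ x).symm.trans ((congrArg (· ≫ π R x) h).trans (lift_π ψ x))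

end cot

end Cotensor

section Horn

variable {R : SimplicialObject (TDGA T)}

/-- The simplicial set of cycles of degree `i`. -/
def cycSSet (R : SimplicialObject (TDGA T)) (i : ℕ) : SSet.{u} where
  obj k := (R.obj k).cycles i
  map θ := ↾fun x => cyclesMap (R.map θ) i x
  map_id k := by
    refine ConcreteCategory.hom_ext _ _ fun (x : (R.obj k).cycles i) => ?_
    have h := congr_toAlgHom (R.map_id k) x.1
    exact Subtype.ext (p := fun y => y ∈ (R.obj k).cycles i) h
  map_comp {k l m} θ η := by
    refine ConcreteCategory.hom_ext _ _ fun (x : (R.obj k).cycles i) => ?_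
    have h := congr_toAlgHom (R.map_comp θ η) x.1
    exact Subtype.ext (p := fun y => y ∈ (R.obj m).cycles i) h

instance (R : SimplicialObject (TDGA T)) (i : ℕ) (k : SimplexCategoryᵒᵖ) :
    AddCommGroup ((cycSSet R i).obj k) := inferInstanceAs (AddCommGroup ((R.obj k).cycles i))

lemma isAdd_cycSSet (R : SimplicialObject (TDGA T)) (i : ℕ) : IsAdd (cycSSet R i) :=
  fun θ x y => map_sub (cyclesMap (R.map θ) i) x y

lemma exists_res_cycle {n : ℕ} (i : Fin (n + 2)) {j : ℕ} (c : (cot R (SSet.horn (n + 1) i)).carrier)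
    (hc : c ∈ (cot R (SSet.horn (n + 1) i)).cycles j) :
    ∃ a ∈ (R _⦋n + 1⦌).cycles j,
      (cot.res R (SSet.horn (n + 1) i).ι) a = c := by
  have := kanComplex_of_addCommGroup (isAdd_cycSSet R j)
  let φ : (SSet.horn (n + 1) i : SSet.{u}) ⟶ cycSSet R j :=
    { app k := ↾fun x => cyclesMap (cot.π R x) j ⟨c, hc⟩
      naturality k l θ := by
        ext x
        exact Subtype.ext (cot.map_π R x θ c).symm }
  obtain ⟨ψ, hψ⟩ := SSet.KanComplex.hornFilling φ
  obtain ⟨a, rfl⟩ := SSet.yonedaEquiv.symm.surjective ψ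
  refine ⟨a.1, a.2, cot.ext fun k x => (cot.π_res R _ x a.1).trans ?_⟩
  exact congrArg (fun ρ : (SSet.horn (n + 1) i : SSet.{u}) ⟶ cycSSet R j => (ρ.app k x).1) hψ.symm

lemma exists_res_horn {n : ℕ} (i : Fin (n + 2)) {j : ℕ} (c : (cot R (SSet.horn (n + 1) i)).carrier)
    (hc : c ∈ (cot R (SSet.horn (n + 1) i)).deg j) :
    ∃ a ∈ (R _⦋n + 1⦌).deg j,
      (cot.res R (SSet.horn (n + 1) i).ι) a = c := by
  have := kanComplex_of_addCommGroup (isAdd_degSSet R j)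
  refine cot.exists_res R _ (fun φ => ?_) c hc
  obtain ⟨ψ, hψ⟩ := SSet.KanComplex.hornFilling φ
  exact ⟨ψ, hψ.symm⟩

lemma horn_vertex {n : ℕ} (i : Fin (n + 2)) :
    Nonempty ((SSet.horn.{u} (n + 1) i : SSet.{u}).obj (op ⦋0⦌)) := by
  refine ⟨⟨SSet.stdSimplex.objEquiv.symm (SimplexCategory.const _ _ i), ?_⟩⟩
  rw [SSet.mem_horn_iff_notMem_range]
  obtain ⟨j, hj⟩ := exists_ne i
  refine ⟨j, hj, ?_⟩
  rintro ⟨x, hx⟩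
  exact hj hx.symm

/-- Restriction to a horn is a trivial fibration. -/
lemma isTF_res_horn (hR : HConst R) {n : ℕ}
    (i : Fin (n + 2)) : IsTF (cot.res R (SSet.horn (n + 1) i).ι) := by
  refine ⟨fun b hb => exists_res_horn i b hb, fun j z hz w hw hwz => ?_⟩
  obtain ⟨v, hv, rfl⟩ := exists_res_horn i w hw
  obtain ⟨x⟩ := horn_vertex.{u} i
  have h0 : (cot.res R (SSet.horn (n + 1) i).ι) (z - (R.obj _).d v) = 0 := by
    rw [map_sub, ← hwz, Hom.map_d, sub_self]
  have h1 := cot.π_res R (SSet.horn (n + 1) i).ι x (z - (R.obj _).d v)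
  rw [h0, map_zero] at h1
  obtain ⟨a, ha, haz⟩ := (quasiIso_iff.1 (hR (SSet.stdSimplex.objEquiv
    ((SSet.horn.{u} (n + 1) i).ι.app _ x)).op)).1 j (z - (R.obj _).d v)
      (sub_mem hz (d_mem_cycles hv)) 0 (zero_mem _) ((map_zero _).trans h1)
  obtain ⟨a', ha', h2⟩ := exists_res_cycle i (j := j + 1)
    ((cot.res R (SSet.horn (n + 1) i).ι) a) ⟨Hom.map_deg _ ha, by
      change CDGA.d _ _ = 0
      rw [← Hom.map_d, haz, h0]⟩
  refine ⟨v + (a - a'), add_mem hv (sub_mem ha ha'.1), ?_, ?_⟩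
  · rw [map_add, map_sub, haz, show (R.obj _).d a' = 0 from ha'.2, sub_zero, add_sub_cancel]
  · rw [map_add, map_sub, h2, sub_self, add_zero]

lemma kanComplex_homSSet (hR : HConst R)
    {Q : TDGA T} (hQ : Q.IsCofibrant) : SSet.KanComplex (homSSet R Q) := by
  rw [SSet.KanComplex.iff]
  intro n i f hf
  obtain ⟨φ, hφ⟩ := hf.exists_desc
  obtain ⟨ψ, hψ⟩ := hQ.lift (isTF_res_horn hR i) (cot.lift φ)
  refine ⟨SSet.yonedaEquiv.symm (ψ : (homSSet R Q) _⦋n + 1⦌), fun j hj => ?_⟩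
  rw [cot.lift_res] at hψ
  have h2 := cot.lift_injective R hψ
  rw [← hφ j hj, ← h2, ← assoc, SSet.horn.ι_ι]

end Horn

section Matching

variable {R : SimplicialObject (TDGA T)}

/-- Reedy fibrancy. -/
def ReedyFib (R : SimplicialObject (TDGA T)) : Prop :=
  ∀ (i n : ℕ) (σ : (SSet.boundary n : SSet.{u}) ⟶ degSSet R (i + 1)),
    ∃ τ : Δ[n] ⟶ degSSet R (i + 1), (SSet.boundary n).ι ≫ τ = σ

lemma isFibration_res_boundary (hF : ReedyFib R) (n : ℕ) :
    IsFibration (cot.res R (SSet.boundary n).ι) :=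
  fun i c hc => cot.exists_res R _ (hF i n) c hc

lemma horn_le_boundary {n : ℕ} (i : Fin (n + 1)) : SSet.horn.{u} n i ≤ SSet.boundary n := by
  intro k x hx h
  obtain ⟨j, hj⟩ : ∃ j, j ∉ Set.range (SSet.stdSimplex.asOrderHom x) ∪ {i} := by
    by_contra! h'
    exact hx (Set.eq_univ_of_forall h')
  exact hj (Or.inl (h j))

lemma mem_horn_of_boundary {n : ℕ} {i j : Fin (n + 1)} (hij : i ≠ j) {k : SimplexCategoryᵒᵖ}
    (x : (Δ[n] : SSet.{u}).obj k) (hx : x ∈ (SSet.boundary n).obj k) :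
    x ∈ (SSet.horn n i).obj k ∨ x ∈ (SSet.horn n j).obj k := by
  obtain ⟨a, ha⟩ : ∃ a, ∀ b, SSet.stdSimplex.asOrderHom x b ≠ a := by
    by_contra! h'
    exact hx h'
  have h (l : Fin (n + 1)) (hl : a ≠ l) : x ∈ (SSet.horn n l).obj k := fun h => by
    have h1 : a ∈ Set.range (SSet.stdSimplex.asOrderHom x) ∪ {l} := h ▸ Set.mem_univ a
    obtain ⟨b, hb⟩ | h1 := h1
    · exact ha b hb
    · exact hl h1
  by_cases hai : a = i
  · exact Or.inr (h j (by rw [hai]; exact hij))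
  · exact Or.inl (h i hai)

/-- A class on the boundary which vanishes on vertices is represented by an element which
vanishes on a given horn. -/
lemma exists_rep_horn (hR : HConst R) {n : ℕ}
    (i : Fin (n + 2)) (a : (cot R (SSet.boundary (n + 1))).deg 0)
    (ha : ∀ x : (SSet.boundary.{u} (n + 1) : SSet.{u}).obj (op ⦋0⦌),
      zeroMap (cot.π R x) a ∈ boundaryIdeal _) :
    ∃ b : (cot R (SSet.boundary (n + 1))).deg 0, b - a ∈ boundaryIdeal _ ∧
      ∀ k (x : (SSet.boundary.{u} (n + 1) : SSet.{u}).obj k), x.1 ∈ (SSet.horn (n + 1) i).obj k →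
        (cot.π R x) b = 0 := by
  let κ := SSet.Subcomplex.homOfLE (horn_le_boundary.{u} i)
  have hκ : cot.res R (SSet.boundary (n + 1)).ι ≫ cot.map R κ =
    cot.res R (SSet.horn (n + 1) i).ι := cot.res_comp_map _ _ _
  have hTF := isTF_res_horn hR i
  obtain ⟨x⟩ := horn_vertex.{u} i
  have hπ : QuasiIso (cot.π R x) := by
    refine hTF.quasiIso.of_comp_left ?_
    rw [cot.res_comp_π]
    exact hR _
  have h1 : (cot.π R x) ((cot.map R κ) a) = zeroMap (cot.π R (κ.app _ x)) a :=
    congr_toAlgHom (cot.map_comp_π R κ x) a.1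
  obtain ⟨y, hy, hya⟩ := ha (κ.app _ x)
  obtain ⟨c, hc, hca⟩ := (quasiIso_iff.1 hπ).1 0 ((cot.map R κ) a)
    ⟨Hom.map_deg _ a.2, CDGA.d_zero _ (Hom.map_deg _ a.2)⟩ y hy (hya.trans h1.symm)
  obtain ⟨c', hc', rfl⟩ := hTF.exists_lift hc
  refine ⟨a - ⟨_, CDGA.d_mem _ (Hom.map_deg (cot.res R (SSet.boundary (n + 1)).ι) hc')⟩, ?_, ?_⟩
  · rw [sub_sub_cancel_left]
    exact neg_mem ⟨_, Hom.map_deg (cot.res R (SSet.boundary (n + 1)).ι) hc', rfl⟩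
  · intro k y hy
    have h2 := cot.map_comp_π R κ (⟨y.1, hy⟩ : (SSet.horn (n + 1) i : SSet.{u}).obj k)
    have h3 : ∀ z, (cot.π R y) z = (cot.π R (K := SSet.horn (n + 1) i)
      ⟨y.1, hy⟩) ((cot.map R κ) z) := fun z =>
      congr_toAlgHom h2.symm z
    refine (h3 _).trans ((congrArg _ ?_).trans (map_zero _))
    have h4 : (cot.map R κ) ((cot.res R (SSet.boundary (n + 1)).ι) c') =
      (cot.res R (SSet.horn (n + 1) i).ι) c' :=
      congr_toAlgHom hκ c'
    refine (map_sub (cot.map R κ).toAlgHom a.1 _).trans ?_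
    rw [Hom.map_d, h4, hca, sub_self]

/-- Classes on the boundary which vanish on vertices have square zero. -/
lemma mul_eq_zero_of_vertex (hR : HConst R)
    {n : ℕ} (a b : (cot R (SSet.boundary (n + 1))).H0.carrier)
    (ha : ∀ x : (SSet.boundary.{u} (n + 1) : SSet.{u}).obj (op ⦋0⦌),
      (H0map (cot.π R x)) a = 0)
    (hb : ∀ x : (SSet.boundary.{u} (n + 1) : SSet.{u}).obj (op ⦋0⦌),
      (H0map (cot.π R x)) b = 0) : a * b = 0 := by
  obtain ⟨a, rfl⟩ := Ideal.Quotient.mk_surjective a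
  obtain ⟨b, rfl⟩ := Ideal.Quotient.mk_surjective b
  obtain ⟨a', h1, ha'⟩ := exists_rep_horn hR 0 a fun x => Ideal.Quotient.eq_zero_iff_mem.1 (ha x)
  obtain ⟨b', h2, hb'⟩ := exists_rep_horn hR 1 b fun x => Ideal.Quotient.eq_zero_iff_mem.1 (hb x)
  rw [← Ideal.Quotient.eq.2 h1, ← Ideal.Quotient.eq.2 h2]
  refine ((map_mul (Ideal.Quotient.mk _) a' b').symm.trans ?_)
  have h3 : a' * b' = 0 := by
    refine Subtype.ext (cot.ext fun k x => ?_)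
    refine (map_mul (cot.π R x).toAlgHom a'.1 b'.1).trans (Eq.trans ?_ (map_zero _).symm)
    obtain h | h := mem_horn_of_boundary (i := 0) (j := 1) (by simp) x.1 x.2
    · rw [ha' k x h, zero_mul]
    · rw [hb' k x h, mul_zero]
  rw [h3]
  exact map_zero _

end Matching

end TDGA

namespace TAlg

/-! ### Quotients and polynomial algebras -/

/-- A map which commutes with all operations is a morphism. -/
def homOfOp {A B : TAlg T} (f : A.carrier → B.carrier)
    (hf : ∀ {n : ℕ} (φ : T.Op n) (a : Fin n → A.carrier),
      f (A.str.op φ a) = B.str.op φ fun i => f (a i)) : A ⟶ B where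
  toAlgHom :=
    { toFun := f
      map_one' := by
        have h := hf (T.poly (1 : MvPolynomial (Fin 0) ℚ)) Fin.elim0
        rwa [A.str.op_poly, B.str.op_poly, map_one, map_one] at h
      map_mul' x y := by
        have h := hf (T.poly (.X 0 * .X 1)) ![x, y]
        rw [A.str.op_poly, B.str.op_poly] at h
        simpa using h
      map_zero' := by
        have h := hf (T.poly (0 : MvPolynomial (Fin 0) ℚ)) Fin.elim0
        rwa [A.str.op_poly, B.str.op_poly, map_zero, map_zero] at h
      map_add' x y := by
        have h := hf (T.poly (.X 0 + .X 1)) ![x, y]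
        rw [A.str.op_poly, B.str.op_poly] at h
        simpa using h
      commutes' q := by
        have h := hf (T.poly (.C q : MvPolynomial (Fin 0) ℚ)) Fin.elim0
        rwa [A.str.op_poly, B.str.op_poly, MvPolynomial.aeval_C, MvPolynomial.aeval_C] at h }
  map_op := hf

section Quot

variable (A : TAlg T) (I : Ideal A.carrier)

/-- The quotient of a `T`-algebra by an ideal. -/
def quot : TAlg T where
  carrier := A.carrier ⧸ I
  str := A.str.quotient I

def quotMk : A ⟶ quot A I where
  toAlgHom := Ideal.Quotient.mkₐ ℚ I
  map_op φ a := (A.str.quotient_op_mk I φ a).symm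

variable {A I}

lemma quotMk_surjective : Function.Surjective (quotMk A I).toAlgHom := Ideal.Quotient.mk_surjective

lemma quotMk_eq_zero {x : A.carrier} : (quotMk A I) x = 0 ↔ x ∈ I :=
  Ideal.Quotient.eq_zero_iff_mem

lemma hom_ext_of_surjective {B C : TAlg T} {p : A ⟶ B} (hp : Function.Surjective p.toAlgHom)
    {f g : B ⟶ C} (h : p ≫ f = p ≫ g) : f = g :=
  hom_ext fun x => by
    obtain ⟨x, rfl⟩ := hp x
    exact TAlg.congr_toAlgHom h x

/-- Morphisms descend along surjective morphisms. -/
lemma exists_desc {B D : TAlg T} {p : A ⟶ B} (hp : Function.Surjective p.toAlgHom) (f : A ⟶ D)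
    (h : ∀ x, p x = 0 → f x = 0) : ∃ g : B ⟶ D, p ≫ g = f := by
  choose s hs using hp
  have key : ∀ x, f (s (p x)) = f x := fun x => by
    rw [← sub_eq_zero, ← map_sub]
    exact h _ (by rw [map_sub, hs, sub_self])
  refine ⟨homOfOp (fun x => f (s x)) fun {n} φ a => ?_, hom_ext key⟩
  obtain ⟨b, rfl⟩ : ∃ b : Fin n → A.carrier, (fun i => p (b i)) = a :=
    ⟨fun i => s (a i), funext fun i => hs _⟩
  rw [← map_op', key, map_op']
  exact congrArg _ (funext fun i => (key _).symm)

end Quot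

end TAlg

namespace TDGA

/-- The morphism to a discrete algebra induced by a morphism out of `H₀`. -/
def disc {Z : TDGA T} {D : TAlg T} (h : Z.H0 ⟶ D) : Z ⟶ D.toTDGA where
  toAlgHom :=
    { toFun x := h (Z.toH0 ⟨Z.pr 0 x, Z.pr_mem 0 x⟩)
      map_one' := by
        have : (⟨Z.pr 0 1, Z.pr_mem 0 1⟩ : Z.deg 0) = 1 := Subtype.ext (Z.pr_of_mem Z.one_mem)
        rw [this]; exact (map_one _ : (Z.toH0 ≫ h) 1 = 1)
      map_mul' x y := by
        have : (⟨Z.pr 0 (x * y), Z.pr_mem 0 _⟩ : Z.deg 0) =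
            ⟨Z.pr 0 x, Z.pr_mem 0 x⟩ * ⟨Z.pr 0 y, Z.pr_mem 0 y⟩ :=
          Subtype.ext ((Z.pr_mul 0 x y).trans (by simp))
        rw [this]; exact map_mul (Z.toH0 ≫ h).toAlgHom _ _
      map_zero' := by
        have : (⟨Z.pr 0 0, Z.pr_mem 0 0⟩ : Z.deg 0) = 0 := Subtype.ext (map_zero _)
        rw [this]; exact map_zero (Z.toH0 ≫ h).toAlgHom
      map_add' x y := by
        have : (⟨Z.pr 0 (x + y), Z.pr_mem 0 _⟩ : Z.deg 0) =
            ⟨Z.pr 0 x, Z.pr_mem 0 x⟩ + ⟨Z.pr 0 y, Z.pr_mem 0 y⟩ :=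
          Subtype.ext (map_add _ _ _)
        rw [this]; exact map_add (Z.toH0 ≫ h).toAlgHom _ _
      commutes' q := by
        have : (⟨Z.pr 0 (algebraMap ℚ Z.carrier q), Z.pr_mem 0 _⟩ : Z.deg 0) =
            algebraMap ℚ (Z.deg 0) q := Subtype.ext (Z.pr_of_mem (Z.algebraMap_mem q))
        rw [this]; exact (Z.toH0 ≫ h).toAlgHom.commutes q }
  map_deg {i a} ha := by
    cases i with
    | zero => exact mem_deg_zero _
    | succ i =>
      have : (⟨Z.pr 0 a, Z.pr_mem 0 _⟩ : Z.deg 0) = 0 :=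
        Subtype.ext (Z.pr_of_mem_ne ha (Nat.succ_ne_zero i))
      change h (Z.toH0 ⟨Z.pr 0 a, Z.pr_mem 0 a⟩) = 0
      rw [this]; exact map_zero (Z.toH0 ≫ h).toAlgHom
  map_d x := by
    change h (Z.toH0 ⟨Z.pr 0 (Z.d x), Z.pr_mem 0 _⟩) = 0
    have : Z.toH0 ⟨Z.pr 0 (Z.d x), Z.pr_mem 0 _⟩ = 0 :=
      toH0_eq_zero.2 ⟨Z.pr 1 x, Z.pr_mem 1 x, (Z.pr_d 0 x).symm⟩
    exact (congrArg h.toAlgHom this).trans (map_zero _)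
  map_op φ a := by
    have : (⟨Z.pr 0 (Z.str.op φ a).1, Z.pr_mem 0 _⟩ : Z.deg 0) = Z.str.op φ a :=
      Subtype.ext (Z.pr_of_mem (Z.str.op φ a).2)
    change h (Z.toH0 ⟨Z.pr 0 (Z.str.op φ a).1, Z.pr_mem 0 _⟩) = D.str.op φ fun i =>
      h (Z.toH0 ⟨Z.pr 0 (a i).1, Z.pr_mem 0 _⟩)
    rw [this]
    refine (TAlg.map_op' (Z.toH0 ≫ h) φ a).trans (congrArg _ (funext fun i => ?_))
    have : (⟨Z.pr 0 (a i).1, Z.pr_mem 0 _⟩ : Z.deg 0) = a i := Subtype.ext (Z.pr_of_mem (a i).2)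
    rw [this]; rfl

lemma disc_apply {Z : TDGA T} {D : TAlg T} (h : Z.H0 ⟶ D) (x : Z.deg 0) :
    (disc h) x.1 = h (Z.toH0 x) := by
  have : (⟨Z.pr 0 x.1, Z.pr_mem 0 _⟩ : Z.deg 0) = x := Subtype.ext (Z.pr_of_mem x.2)
  exact congrArg (fun y => h (Z.toH0 y)) this

/-- The morphism out of `H₀` induced by a morphism to a discrete algebra. -/
lemma exists_undisc {Z : TDGA T} {D : TAlg T} (f : Z ⟶ D.toTDGA) :
    ∃ h : Z.H0 ⟶ D, ∀ x : Z.deg 0, h (Z.toH0 x) = f x.1 := by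
  let f0 : Z.zeroAlg ⟶ D := TAlg.homOfOp (A := Z.zeroAlg) (fun x => f x.1)
    fun φ a => f.map_op φ a
  obtain ⟨g, hg⟩ := TAlg.exists_desc Z.toH0_surjective f0 fun x hx => by
    obtain ⟨y, hy, hyx⟩ := toH0_eq_zero.1 hx
    change f x.1 = 0
    rw [← hyx, f.map_d]
    rfl
  exact ⟨g, fun x => TAlg.congr_toAlgHom hg x⟩

end TDGA

namespace TAlg

open TDGA

/-- The `T`-algebra freely generated over `A` by a set. -/
def poly (A : TAlg T) (S : Type u) : TAlg T := (adj A.toTDGA fun _ : S => 0).H0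

namespace poly

variable (A : TAlg T) (S : Type u)

def of : A ⟶ poly A S := unZero (adj.of A.toTDGA fun _ : S => 0) ≫ (adj A.toTDGA fun _ : S => 0).toH0

def gen (s : S) : (poly A S).carrier :=
  (adj A.toTDGA fun _ : S => 0).toH0.toAlgHom (adj.gen A.toTDGA (fun _ : S => 0) s)

variable {A S} {D : TAlg T}

lemma exists_hom (f : A ⟶ D) (x : S → D.carrier) :
    ∃ h : poly A S ⟶ D, of A S ≫ h = f ∧ ∀ s, h (gen A S s) = x s := by
  obtain ⟨h, hh⟩ := exists_undisc (adj.desc (e := fun _ : S => 0) (mapTDGA f)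
    fun s => ⟨x s, mem_deg_zero _⟩)
  refine ⟨h, TAlg.hom_ext fun a => (hh _).trans ?_, fun s => (hh _).trans (adj.desc_gen _ _ s)⟩
  exact TDGA.congr_toAlgHom (adj.of_desc (mapTDGA f) _) a

def desc (f : A ⟶ D) (x : S → D.carrier) : poly A S ⟶ D := (exists_hom f x).choose

lemma of_desc (f : A ⟶ D) (x : S → D.carrier) : of A S ≫ desc f x = f :=
  (exists_hom f x).choose_spec.1

lemma desc_of (f : A ⟶ D) (x : S → D.carrier) (a : A.carrier) :
    (desc f x) ((of A S) a) = f a :=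
  TAlg.congr_toAlgHom (of_desc f x) a

lemma desc_gen (f : A ⟶ D) (x : S → D.carrier) (s : S) :
    (desc f x) (gen A S s) = x s := (exists_hom f x).choose_spec.2 s

lemma hom_ext {f g : poly A S ⟶ D} (h : of A S ≫ f = of A S ≫ g)
    (h' : ∀ s, f (gen A S s) = g (gen A S s)) : f = g := by
  have key : disc f = disc g := by
    refine adj.hom_ext (TDGA.hom_ext fun a => ?_) fun s =>
      (disc_apply f (adj.gen _ _ s)).trans ((h' s).trans (disc_apply g (adj.gen _ _ s)).symm)
    refine (disc_apply f ((unZero (adj.of A.toTDGA fun _ : S => 0)) a)).trans (Eq.trans ?_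
      (disc_apply g ((unZero (adj.of A.toTDGA fun _ : S => 0)) a)).symm)
    exact TAlg.congr_toAlgHom h a
  refine TAlg.hom_ext fun x => ?_
  obtain ⟨x, rfl⟩ := toH0_surjective _ x
  exact (disc_apply f x).symm.trans ((congrArg (fun q : adj A.toTDGA (fun _ : S => 0) ⟶ D.toTDGA =>
    q x.1) key).trans (disc_apply g x))

/-- Functoriality in both variables. -/
def map {B : TAlg T} {S' : Type u} (f : A ⟶ B) (σ : S → S') : poly A S ⟶ poly B S' :=
  desc (f ≫ of B S') fun s => gen B S' (σ s)

lemma map_gen {B : TAlg T} {S' : Type u} (f : A ⟶ B) (σ : S → S') (s : S) :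
    (map f σ) (gen A S s) = gen B S' (σ s) := desc_gen _ _ _

lemma of_map {B : TAlg T} {S' : Type u} (f : A ⟶ B) (σ : S → S') :
    of A S ≫ map f σ = f ≫ of B S' := of_desc _ _

lemma map_comp {B C : TAlg T} {S' S'' : Type u} (f : A ⟶ B) (σ : S → S') (g : B ⟶ C)
    (τ : S' → S'') : map f σ ≫ map g τ = map (f ≫ g) (τ ∘ σ) :=
  hom_ext (by rw [← assoc, of_map, assoc, of_map, of_map, assoc])
    fun s => by rw [TAlg.comp_apply, map_gen, map_gen, map_gen]; rfl

lemma induction {Q : (poly A S).carrier → Prop} (of : ∀ a, Q ((of A S) a))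
    (gen : ∀ s, Q (gen A S s))
    (op : ∀ (n : ℕ) (φ : T.Op n) (x : Fin n → (poly A S).carrier), (∀ j, Q (x j)) →
      Q ((poly A S).str.op φ x)) (x : (poly A S).carrier) : Q x := by
  have h0 : Q 0 := by have := of 0; rwa [map_zero] at this
  have add : ∀ x y, Q x → Q y → Q (x + y) := fun x y hx hy => by
    have h := op 2 (T.poly (.X 0 + .X 1)) ![x, y] (by intro j; fin_cases j <;> assumption)
    rw [(poly A S).str.op_poly] at h
    simpa using h
  have mul : ∀ x y, Q x → Q y → Q (x * y) := fun x y hx hy => by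
    have h := op 2 (T.poly (.X 0 * .X 1)) ![x, y] (by intro j; fin_cases j <;> assumption)
    rw [(poly A S).str.op_poly] at h
    simpa using h
  let Z := adj A.toTDGA fun _ : S => 0
  let cl : Z.carrier → (poly A S).carrier := (disc (𝟙 Z.H0))
  have hcl : ∀ x : Z.deg 0, cl x.1 = Z.toH0 x := fun x => disc_apply (𝟙 Z.H0) x
  have key : ∀ x : Z.carrier, Q (cl x) := by
    refine adj.induction (fun x => ?_) (fun s => ?_) ?_ ?_ ?_ ?_ ?_ ?_
    · exact (hcl ((unZero (adj.of A.toTDGA fun _ : S => 0)) x)) ▸ of x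
    · exact (hcl (adj.gen A.toTDGA (fun _ : S => 0) s)) ▸ gen s
    · intro x y hx hy
      have : cl (x + y) = cl x + cl y := map_add (disc (𝟙 Z.H0)).toAlgHom x y
      rw [this]; exact add _ _ hx hy
    · intro x y hx hy
      have : cl (x * y) = cl x * cl y := map_mul (disc (𝟙 Z.H0)).toAlgHom x y
      rw [this]; exact mul _ _ hx hy
    · intro q x hx
      have : cl (q • x) = (poly.of A S) (algebraMap ℚ A.carrier q) * cl x := by
        rw [AlgHom.commutes, ← Algebra.smul_def]
        exact map_smul (disc (𝟙 Z.H0)).toAlgHom q x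
      rw [this]; exact mul _ _ (of _) hx
    · intro x _
      have : cl (Z.d x) = 0 := TDGA.Hom.map_d (disc (𝟙 Z.H0)) x
      rw [this]; exact h0
    · intro i x hx
      cases i with
      | zero =>
        have : cl (Z.pr 0 x) = cl x := by
          refine (hcl ⟨_, Z.pr_mem 0 x⟩).trans rfl
        rw [this]; exact hx
      | succ i =>
        have : cl (Z.pr (i + 1) x) = 0 :=
          eq_zero_of_mem_deg ((disc (𝟙 Z.H0)).map_deg (Z.pr_mem (i + 1) x))
        rw [this]; exact h0
    · intro n φ x hx
      have : cl (Z.str.op φ x).1 = (poly A S).str.op φ fun j => cl (x j).1 :=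
        TDGA.Hom.map_op (disc (𝟙 Z.H0)) φ x
      rw [this]; exact op n φ _ hx
  obtain ⟨x, rfl⟩ := toH0_surjective Z x
  exact hcl x ▸ key x.1

/-- Finitely many elements of a polynomial algebra involve finitely many variables. -/
lemma exists_finset (x : (poly A S).carrier) : ∃ t : Finset S, ∀ t' : Finset S, t ≤ t' →
    ∃ y : (poly A t').carrier, (map (𝟙 A) (fun s : t' => s.1)) y = x := by
  classical
  induction x using induction with
  | of a =>
    refine ⟨∅, fun t' _ => ⟨(of A t') a, ?_⟩⟩
    exact TAlg.congr_toAlgHom (of_map (𝟙 A) fun s : t' => s.1) a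
  | gen s =>
    exact ⟨{s}, fun t' h => ⟨gen A t' ⟨s, h (Finset.mem_singleton_self s)⟩, map_gen _ _ _⟩⟩
  | op n φ x ih =>
    choose t ht using ih
    refine ⟨Finset.univ.biUnion t, fun t' h => ?_⟩
    choose y hy using fun j => ht j t' ((Finset.subset_biUnion_of_mem t (Finset.mem_univ j)).trans h)
    exact ⟨(poly A t').str.op φ y, (map_op' _ φ y).trans (congrArg _ (funext hy))⟩

lemma map_injective {S' : Type u} (σ : S → S') (hσ : Function.Injective σ) :
    Function.Injective (map (𝟙 A) σ).toAlgHom := by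
  classical
  let r : poly A S' ⟶ poly A S := desc (of A S) fun s' =>
    if h : ∃ s, σ s = s' then gen A S h.choose else 0
  have h : map (𝟙 A) σ ≫ r = 𝟙 _ := hom_ext (by
    rw [← assoc, of_map, id_comp, of_desc, comp_id]) fun s => by
    rw [TAlg.comp_apply, map_gen, desc_gen]
    have h : ∃ s', σ s' = σ s := ⟨s, rfl⟩
    rw [dif_pos h, hσ h.choose_spec]
    rfl
  exact Function.LeftInverse.injective (g := r.toAlgHom) fun x =>
    TAlg.congr_toAlgHom h x

lemma isPushout_map {B : TAlg T} (f : A ⟶ B) :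
    IsPushout f (of A S) (of B S) (map f (id : S → S)) := by
  refine ⟨⟨(of_map f id).symm⟩, ⟨Limits.PushoutCocone.IsColimit.mk _
    (fun c => desc c.inl fun s => c.inr (gen A S s)) (fun c => of_desc _ _)
    (fun c => hom_ext ?_ fun s => ?_) fun c m h1 h2 => hom_ext ?_ fun s => ?_⟩⟩
  · rw [← assoc, of_map, assoc, of_desc, c.condition]
  · rw [TAlg.comp_apply, map_gen, desc_gen]; rfl
  · rw [h1, of_desc]
  · rw [desc_gen, ← h2, TAlg.comp_apply, map_gen]; rfl

end poly

/-! ### Pushouts -/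

section Pushout

variable {A B C : TAlg T} (f : A ⟶ B) (g : A ⟶ C)

lemma exists_isPushout : ∃ (P : TAlg T) (b : B ⟶ P) (c : C ⟶ P), IsPushout f g b c := by
  let I : Ideal (poly C B.carrier).carrier := Ideal.span
    ({x | ∃ (n : ℕ) (φ : T.Op n) (b : Fin n → B.carrier),
      x = poly.gen C _ (B.str.op φ b) - (poly C B.carrier).str.op φ fun i => poly.gen C _ (b i)} ∪
     {x | ∃ a : A.carrier, x = poly.gen C _ (f a) -
      (poly.of C B.carrier) (g a)})
  let p := quotMk (poly C B.carrier) I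
  have hp : ∀ x y, x - y ∈ I → p x = p y := fun x y h => by
    rw [← sub_eq_zero, ← map_sub]; exact quotMk_eq_zero.2 h
  let inl : B ⟶ quot _ I := homOfOp (fun b => p (poly.gen C _ b)) fun φ b => by
    rw [← map_op']
    exact hp _ _ (Ideal.subset_span (Or.inl ⟨_, φ, b, rfl⟩))
  have w : f ≫ inl = g ≫ poly.of C _ ≫ p := hom_ext fun a =>
    hp _ _ (Ideal.subset_span (Or.inr ⟨a, rfl⟩))
  have hd : ∀ {D : TAlg T} (b : B ⟶ D) (c : C ⟶ D), f ≫ b = g ≫ c → ∃ h : quot _ I ⟶ D,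
      p ≫ h = poly.desc c b.toAlgHom := fun {D} b c h => by
    refine exists_desc quotMk_surjective _ fun x hx => ?_
    have hI : I ≤ RingHom.ker (poly.desc c b.toAlgHom).toAlgHom := by
      refine Ideal.span_le.2 ?_
      rintro _ (⟨n, φ, b', rfl⟩ | ⟨a, rfl⟩)
      · refine (map_sub _ _ _).trans (sub_eq_zero.2 ?_)
        rw [poly.desc_gen, map_op', map_op']
        exact congrArg _ (funext fun i => (poly.desc_gen _ _ _).symm)
      · refine (map_sub _ _ _).trans (sub_eq_zero.2 ?_)
        rw [poly.desc_gen, poly.desc_of]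
        exact TAlg.congr_toAlgHom h a
    exact hI (quotMk_eq_zero.1 hx)
  refine ⟨quot _ I, inl, poly.of C _ ≫ p, ⟨w⟩, ⟨Limits.PushoutCocone.IsColimit.mk w
    (fun s => (hd s.inl s.inr s.condition).choose) (fun s => ?_) (fun s => ?_) fun s m h1 h2 => ?_⟩⟩
  · refine hom_ext fun b => ?_
    exact (congrArg (fun q : _ ⟶ s.pt => TAlg.Hom.toAlgHom q (poly.gen C _ b))
      (hd s.inl s.inr s.condition).choose_spec).trans (poly.desc_gen _ _ _)
  · rw [assoc, (hd s.inl s.inr s.condition).choose_spec, poly.of_desc]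
  · refine hom_ext_of_surjective quotMk_surjective ?_
    refine Eq.trans ?_ (hd s.inl s.inr s.condition).choose_spec.symm
    refine poly.hom_ext ?_ fun b => ?_
    · rw [poly.of_desc, ← assoc]; exact h2
    · rw [poly.desc_gen]
      exact TAlg.congr_toAlgHom h1 b

variable {f g}

/-- Pushouts along surjective morphisms are quotients. -/
lemma isPushout_of_surjective {P : TAlg T} {b : B ⟶ P} {c : C ⟶ P} (h : IsPushout f g b c)
    (hg : Function.Surjective g.toAlgHom) : Function.Surjective b.toAlgHom ∧
      RingHom.ker b.toAlgHom = (RingHom.ker g.toAlgHom).map f.toAlgHom := by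
  let I : Ideal B.carrier := (RingHom.ker g.toAlgHom).map f.toAlgHom
  obtain ⟨c', hc'⟩ := exists_desc hg (f ≫ quotMk B I) fun x hx =>
    quotMk_eq_zero.2 (Ideal.mem_map_of_mem _ hx)
  have h1 := h.inl_desc (quotMk B I) c' hc'.symm
  have hI : ∀ x ∈ I, b x = 0 := fun x hx => by
    have : I ≤ RingHom.ker b.toAlgHom := Ideal.map_le_iff_le_comap.2 fun y hy => by
      refine (TAlg.congr_toAlgHom h.w y).trans ?_
      exact (congrArg c.toAlgHom hy).trans (map_zero _)
    exact this hx
  obtain ⟨e, he⟩ := exists_desc (quotMk_surjective (A := B) (I := I)) b fun x hx =>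
    hI x (quotMk_eq_zero.1 hx)
  have h2 : h.desc (quotMk B I) c' hc'.symm ≫ e = 𝟙 P := by
    refine h.hom_ext ?_ ?_
    · rw [← assoc, h1, he, comp_id]
    · rw [← assoc, h.inr_desc, comp_id]
      refine hom_ext_of_surjective hg ?_
      rw [← assoc, hc', assoc, he, h.w]
  constructor
  · intro x
    obtain ⟨y, hy⟩ := quotMk_surjective ((h.desc (quotMk B I) c' hc'.symm) x)
    refine ⟨y, ?_⟩
    have h3 := TAlg.congr_toAlgHom he y
    refine h3.symm.trans ((congrArg e.toAlgHom hy).trans ?_)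
    exact TAlg.congr_toAlgHom h2 x
  · refine le_antisymm (fun x hx => quotMk_eq_zero.1 ?_) fun x hx => hI x hx
    have h3 := TAlg.congr_toAlgHom h1 x
    refine h3.symm.trans ?_
    exact (congrArg (h.desc (quotMk B I) c' hc'.symm).toAlgHom hx).trans (map_zero _)

end Pushout

end TAlg

namespace TAlg

/-! ### Universally flat morphisms -/

section Flat

variable {A B : TAlg T}

abbrev Flat (f : A ⟶ B) : Prop := (f.toAlgHom : A.carrier →+* B.carrier).Flat

lemma Flat.exists_of_sum_eq_zero {f : A ⟶ B} (hf : Flat f) {ι : Type} [Fintype ι]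
    (a : ι → A.carrier) (x : ι → B.carrier) (h : ∑ i, f (a i) * x i = 0) :
    ∃ (k : ℕ) (c : ι → Fin k → A.carrier) (y : Fin k → B.carrier),
      (∀ i, x i = ∑ j, f (c i j) * y j) ∧ ∀ j, ∑ i, a i * c i j = 0 := by
  let := (f.toAlgHom : A.carrier →+* B.carrier).toAlgebra
  have : Module.Flat A.carrier B.carrier := hf
  obtain ⟨k, c, y, h1, h2⟩ := Module.Flat.isTrivialRelation_of_sum_smul_eq_zero (R := A.carrier)
    (M := B.carrier) (f := a) (x := x) h
  exact ⟨k, c, y, h1, h2⟩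

lemma flat_of {f : A ⟶ B} (H : ∀ {l : ℕ} (a : Fin l → A.carrier) (x : Fin l → B.carrier),
    ∑ i, f (a i) * x i = 0 →
    ∃ (k : ℕ) (c : Fin l → Fin k → A.carrier) (y : Fin k → B.carrier),
      (∀ i, x i = ∑ j, f (c i j) * y j) ∧ ∀ j, ∑ i, a i * c i j = 0) : Flat f := by
  let := (f.toAlgHom : A.carrier →+* B.carrier).toAlgebra
  exact Module.Flat.of_forall_isTrivialRelation (R := A.carrier) (M := B.carrier)
    fun {l} {a} {x} h => H a x h

/-- Flatness descends along quotients of the source. -/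
lemma Flat.of_isPushout {A' B' : TAlg T} {f : A ⟶ B} {g : A ⟶ A'} {g' : B ⟶ B'} {f' : A' ⟶ B'}
    (hf : Flat f) (h : IsPushout f g g' f') (hg : Function.Surjective g.toAlgHom) : Flat f' := by
  obtain ⟨hs, hk⟩ := isPushout_of_surjective h hg
  have hw : ∀ x, f' (g x) = g' (f x) := fun x =>
    TAlg.congr_toAlgHom h.w.symm x
  refine flat_of fun {l} a x hax => ?_
  choose a' ha' using fun i => hg (a i)
  choose x' hx' using fun i => hs (x i)
  have h1 : ∑ i, f (a' i) * x' i ∈ (RingHom.ker g.toAlgHom).map f.toAlgHom := by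
    rw [← hk, RingHom.mem_ker, map_sum, ← hax]
    exact Finset.sum_congr rfl fun i _ => by rw [map_mul, ← hw, ha', hx']
  obtain ⟨m, r, s, hr, hrs⟩ : ∃ (m : ℕ) (r : Fin m → A.carrier) (s : Fin m → B.carrier),
      (∀ i, g (r i) = 0) ∧
      ∑ i, f (a' i) * x' i = ∑ i, f (r i) * s i := by
    refine Submodule.span_induction (p := fun y _ => ∃ (m : ℕ) (r : Fin m → A.carrier)
      (s : Fin m → B.carrier), (∀ i, g (r i) = 0) ∧ y = ∑ i, f (r i) * s i)
      ?_ ?_ ?_ ?_ h1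
    · rintro _ ⟨r, hr, rfl⟩
      exact ⟨1, fun _ => r, fun _ => 1, fun _ => hr, by simp⟩
    · exact ⟨0, Fin.elim0, Fin.elim0, fun i => i.elim0, by simp⟩
    · rintro _ _ _ _ ⟨m, r, s, h, rfl⟩ ⟨m', r', s', h', rfl⟩
      refine ⟨m + m', Fin.append r r', Fin.append s s', fun i => ?_, ?_⟩
      · refine Fin.addCases (fun i => ?_) (fun i => ?_) i
        · rw [Fin.append_left]; exact h i
        · rw [Fin.append_right]; exact h' i
      · simp [Fin.sum_univ_add]
    · rintro b _ _ ⟨m, r, s, h, rfl⟩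
      refine ⟨m, r, fun i => b * s i, h, ?_⟩
      rw [smul_eq_mul, Finset.mul_sum]
      exact Finset.sum_congr rfl fun i _ => by ring
  obtain ⟨k, c, y, hy, hc⟩ := hf.exists_of_sum_eq_zero (Sum.elim a' fun i => -r i) (Sum.elim x' s)
    (by simp [hrs])
  refine ⟨k, fun i j => g (c (Sum.inl i) j), fun j => g' (y j), fun i => ?_,
    fun j => ?_⟩
  · rw [← hx' i]
    refine (congrArg g'.toAlgHom (hy (Sum.inl i))).trans ?_
    rw [map_sum]
    exact Finset.sum_congr rfl fun j _ => by rw [map_mul, hw]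
  · have := congrArg g.toAlgHom (hc j)
    simp only [Fintype.sum_sum_type, Sum.elim_inl, Sum.elim_inr, map_add, map_sum, map_mul, map_neg,
      hr, neg_zero, zero_mul, Finset.sum_const_zero, add_zero, ha', map_zero] at this
    exact this

/-- Polynomial extensions in infinitely many variables are flat if finite ones are. -/
lemma flat_poly_map {f : A ⟶ B} {S : Type u}
    (H : ∀ t : Finset S, Flat (poly.map f (id : t → t))) : Flat (poly.map f (id : S → S)) := by
  classical
  refine flat_of fun {l} a x hax => ?_
  choose t ht using fun i => poly.exists_finset (a i)
  choose t' ht' using fun i => poly.exists_finset (x i)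
  let s := Finset.univ.biUnion t ∪ Finset.univ.biUnion t'
  choose a' ha' using fun i => ht i s ((Finset.subset_biUnion_of_mem t (Finset.mem_univ i)).trans
    Finset.subset_union_left)
  choose x' hx' using fun i => ht' i s ((Finset.subset_biUnion_of_mem t' (Finset.mem_univ i)).trans
    Finset.subset_union_right)
  have hw : ∀ z, (poly.map (𝟙 B) fun s : s => s.1) ((poly.map f id) z) =
      (poly.map f id) ((poly.map (𝟙 A) fun s : s => s.1) z) := fun z => by
    refine TAlg.congr_toAlgHom ((poly.map_comp f id (𝟙 B) fun s : s => s.1).trans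
        (Eq.trans ?_ (poly.map_comp (𝟙 A) (fun s : s => s.1) f id).symm)) z
    rw [comp_id, id_comp]; rfl
  obtain ⟨k, c, y, hy, hc⟩ := (H s).exists_of_sum_eq_zero a' x'
    (poly.map_injective _ Subtype.val_injective (by
      rw [map_zero, map_sum, ← hax]
      exact Finset.sum_congr rfl fun i _ => by rw [map_mul, hw, ha', hx']))
  refine ⟨k, fun i j => (poly.map (𝟙 A) fun s : s => s.1) (c i j),
    fun j => (poly.map (𝟙 B) fun s : s => s.1) (y j), fun i => ?_, fun j => ?_⟩
  · rw [← hx' i, hy, map_sum]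
    exact Finset.sum_congr rfl fun j _ => by rw [map_mul, hw]
  · have := congrArg (poly.map (𝟙 A) fun s : s => s.1).toAlgHom (hc j)
    rw [map_sum, map_zero] at this
    rw [← this]
    exact Finset.sum_congr rfl fun i _ => by rw [map_mul, ha']

/-- Universally flat morphisms. -/
structure UFlat (f : A ⟶ B) : Prop where
  out : ∀ {A' B' : TAlg T} (g : A ⟶ A') (g' : B ⟶ B') (f' : A' ⟶ B'), IsPushout f g g' f' → Flat f'

lemma UFlat.flat {f : A ⟶ B} (h : UFlat f) : Flat f :=
  h.out (𝟙 _) (𝟙 _) f (IsPushout.of_vert_isIso ⟨by simp⟩)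

lemma UFlat.of_isPushout {A' B' : TAlg T} {f : A ⟶ B} {g : A ⟶ A'} {g' : B ⟶ B'} {f' : A' ⟶ B'}
    (hf : UFlat f) (h : IsPushout f g g' f') : UFlat f' :=
  ⟨fun _ _ _ h' => hf.out _ _ _ (h.paste_vert h')⟩

lemma UFlat.comp {C : TAlg T} {f : A ⟶ B} {h : B ⟶ C} (hf : UFlat f) (hh : UFlat h) :
    UFlat (f ≫ h) := by
  constructor
  intro A' B' g g' k hk
  obtain ⟨P, p, q, hP⟩ := exists_isPushout f g
  have hc : g ≫ k = f ≫ h ≫ g' := by rw [← assoc, hk.w]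
  let d : P ⟶ B' := hP.desc (h ≫ g') k hc.symm
  have h1 : q ≫ d = k := hP.inr_desc _ _ _
  have h2 : p ≫ d = h ≫ g' := hP.inl_desc _ _ _
  have h3 : IsPushout h p g' d := IsPushout.of_left (h₂₁ := q) (v₁₁ := g) (by rw [h1]; exact hk)
    h2.symm hP
  have h4 := RingHom.Flat.comp (hf.out _ _ _ hP) (hh.out _ _ _ h3)
  rw [← h1]
  exact h4

lemma uflat_of_bijective {f : A ⟶ B} (hf : Function.Bijective f.toAlgHom) : UFlat f :=
  ⟨fun g g' f' h => RingHom.Flat.of_bijective (by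
    obtain ⟨h1, h2⟩ := isPushout_of_surjective h.flip hf.2
    refine ⟨(injective_iff_map_eq_zero f'.toAlgHom).2 fun x hx => ?_, h1⟩
    have h3 : RingHom.ker f.toAlgHom = ⊥ := (RingHom.injective_iff_ker_eq_bot _).1 hf.1
    rw [h3, Ideal.map_bot] at h2
    exact (Submodule.mem_bot _).1 (h2 ▸ (RingHom.mem_ker.2 hx)))⟩

/-- Flatness of all pushouts follows from flatness of polynomial extensions. -/
lemma uflat_of_poly {f : A ⟶ B} (H : ∀ S : Type u, Flat (poly.map f (id : S → S))) : UFlat f := by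
  constructor
  intro A' B' g g' f' h
  let π : poly A A'.carrier ⟶ A' := poly.desc g id
  let π' : poly B A'.carrier ⟶ B' := poly.desc g' f'.toAlgHom
  have h1 : poly.map f id ≫ π' = π ≫ f' := poly.hom_ext (by
    rw [← assoc, poly.of_map, assoc, poly.of_desc, ← assoc,
      poly.of_desc, h.w]) fun s => by
    rw [TAlg.comp_apply, poly.map_gen, poly.desc_gen, TAlg.comp_apply, poly.desc_gen]
  have h2 : IsPushout π (poly.map f id) f' π' := by
    refine IsPushout.of_left (h₁₁ := poly.of A _) (h₂₁ := poly.of B _) (v₁₁ := f) ?_ h1.symm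
      (poly.isPushout_map f).flip
    rw [poly.of_desc, poly.of_desc]; exact h.flip
  exact (H _).of_isPushout h2.flip fun a => ⟨poly.gen A _ a, poly.desc_gen _ _ _⟩

lemma isFinPres_poly (hA : A.IsFinPres) (S : Type u) [Finite S] : (poly A S).IsFinPres := by
  obtain ⟨n, p, hp, hker⟩ := hA
  obtain ⟨m, ⟨e⟩⟩ := Finite.exists_equiv_fin S
  let ι : free T n ⟶ free T (n + m) := freeDesc _ fun i => T.var (Fin.castAdd m i)
  let P : free T (n + m) ⟶ poly A S := freeDesc _ (Fin.append
    (fun i => (poly.of A S) (p (T.var i))) fun j => poly.gen A S (e.symm j))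
  have hι : ι ≫ P = p ≫ poly.of A S := free_hom_ext fun i => by
    refine (congrArg P.toAlgHom (freeDesc_var _ _ i)).trans ((freeDesc_var _ _ _).trans ?_)
    rw [Fin.append_left]; rfl
  have hP : Function.Surjective P.toAlgHom := fun x => by
    induction x using poly.induction with
    | of a =>
      obtain ⟨φ, rfl⟩ := hp a
      exact ⟨ι φ, TAlg.congr_toAlgHom hι φ⟩
    | gen s =>
      refine ⟨T.var (Fin.natAdd n (e s)), (freeDesc_var _ _ _).trans ?_⟩
      rw [Fin.append_right, e.symm_apply_apply]
    | op k φ x ih =>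
      choose y hy using ih
      exact ⟨_, (map_op' P φ y).trans (congrArg _ (funext hy))⟩
  refine ⟨n + m, P, hP, ?_⟩
  have h1 : RingHom.ker P.toAlgHom = (RingHom.ker p.toAlgHom).map ι.toAlgHom := by
    refine le_antisymm (fun x hx => ?_) (Ideal.map_le_iff_le_comap.2 fun y hy => ?_)
    · obtain ⟨g, hg⟩ := exists_desc hp (ι ≫ quotMk _ ((RingHom.ker p.toAlgHom).map ι.toAlgHom))
        fun y hy => quotMk_eq_zero.2 (Ideal.mem_map_of_mem _ hy)
      let h := poly.desc (S := S) g fun s =>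
        (quotMk _ ((RingHom.ker p.toAlgHom).map ι.toAlgHom)) (T.var (Fin.natAdd n (e s)))
      have h2 : P ≫ h = quotMk _ _ := free_hom_ext fun i => by
        refine (congrArg h.toAlgHom (freeDesc_var _ _ i)).trans ?_
        refine Fin.addCases (fun i => ?_) (fun i => ?_) i
        · rw [Fin.append_left, poly.desc_of]
          refine (congrArg (fun q : free T n ⟶ _ => TAlg.Hom.toAlgHom q (T.var i)) hg).trans ?_
          exact congrArg _ (freeDesc_var (free T (n + m)) _ i)
        · rw [Fin.append_right, poly.desc_gen, e.apply_symm_apply]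
      refine quotMk_eq_zero.1 ?_
      rw [← h2]
      exact (congrArg h.toAlgHom hx).trans (map_zero _)
    · refine (TAlg.congr_toAlgHom hι y).trans ?_
      exact (congrArg (poly.of A S).toAlgHom hy).trans (map_zero _)
  rw [h1]
  exact hker.map _

end Flat

/-! ### Properties of the class `E` -/

end TAlg

namespace IsOpenEtaleClass

open TAlg

variable {E : MorphismProperty (TAlg T)} {A₀ B₀ : TAlg T} {f₀ : A₀ ⟶ B₀}

lemma uflat (hE : IsOpenEtaleClass E) (h₀ : E f₀) : UFlat f₀ :=
  uflat_of_poly fun _ => flat_poly_map fun t => hE.flat _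
    (hE.pushout _ _ _ _ h₀ (isFinPres_poly (hE.finPres_source _ h₀) t) (poly.isPushout_map f₀))

/-- The diagonal is universally flat. -/
lemma uflat_diag (hE : IsOpenEtaleClass E) (h₀ : E f₀)
    {P : TAlg T} {p q : B₀ ⟶ P} (h : IsPushout f₀ f₀ p q) :
    UFlat (h.desc (𝟙 B₀) (𝟙 B₀) rfl) := by
  have hq : E q := hE.pushout _ _ _ _ h₀ (hE.finPres_target _ h₀) h
  have h1 : q ≫ h.desc (𝟙 B₀) (𝟙 B₀) rfl = 𝟙 _ := h.inr_desc _ _ _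
  obtain ⟨B', j, k, hj, hjk, hk⟩ := hE.factor q (h.desc (𝟙 B₀) (𝟙 B₀) rfl) hq
    (by rw [h1]; exact fun x => ⟨x, rfl⟩)
  rw [h1] at hk
  obtain ⟨h2, h3⟩ := isPushout_of_surjective hk fun x => ⟨x, rfl⟩
  rw [← hjk]
  refine UFlat.comp (hE.uflat hj) (uflat_of_bijective ⟨?_, h2⟩)
  refine (injective_iff_map_eq_zero k.toAlgHom).2 fun x hx => ?_
  have h4 : RingHom.ker (𝟙 B₀ : B₀ ⟶ B₀).toAlgHom = ⊥ :=
    (RingHom.injective_iff_ker_eq_bot _).1 fun _ _ h => h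
  rw [h4, Ideal.map_bot] at h3
  exact (Submodule.mem_bot _).1 (h3 ▸ (RingHom.mem_ker.2 hx))

/-- Morphisms out of the target which agree on the source and modulo an ideal of square zero
agree. -/
lemma rigid (hE : IsOpenEtaleClass E) (h₀ : E f₀)
    {D D' : TAlg T} {u v : B₀ ⟶ D} (huv : f₀ ≫ u = f₀ ≫ v) (ρ : D ⟶ D')
    (hρ : u ≫ ρ = v ≫ ρ)
    (hsq : ∀ x y, ρ x = 0 → ρ y = 0 → x * y = 0) : u = v := by
  obtain ⟨P, p, q, hP⟩ := exists_isPushout f₀ f₀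
  let δ : P ⟶ B₀ := hP.desc (𝟙 B₀) (𝟙 B₀) rfl
  have hp : p ≫ δ = 𝟙 _ := hP.inl_desc _ _ _
  have hq : q ≫ δ = 𝟙 _ := hP.inr_desc _ _ _
  let w : P ⟶ D := hP.desc u v huv
  have hpw : p ≫ w = u := hP.inl_desc _ _ _
  have hqw : q ≫ w = v := hP.inr_desc _ _ _
  have hw : w ≫ ρ = δ ≫ u ≫ ρ := hP.hom_ext
    (by rw [← assoc, hpw, ← assoc, hp, id_comp])
    (by rw [← assoc, hqw, ← assoc, hq, id_comp, hρ])
  have hwρ : ∀ k, δ k = 0 → ρ (w k) = 0 := fun k hk => by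
    refine (TAlg.congr_toAlgHom hw k).trans ?_
    exact (congrArg (u ≫ ρ).toAlgHom hk).trans (map_zero _)
  have hpδ : ∀ b, δ (p b) = b := fun b =>
    TAlg.congr_toAlgHom hp b
  have key : ∀ k, δ k = 0 → w k = 0 := fun k hk => by
    obtain ⟨m, c, y, hy, hc⟩ := (UFlat.flat (hE.uflat_diag h₀ hP)).exists_of_sum_eq_zero
      (fun _ : Unit => k) (fun _ => 1) (by simpa using hk)
    have hy' : (1 : B₀.carrier) = ∑ j, δ (c () j) * y j := hy ()
    have h1 := hwρ (1 - ∑ j, c () j * p (y j)) (by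
      rw [map_sub, map_one, map_sum, sub_eq_zero, hy']
      exact Finset.sum_congr rfl fun j _ => by rw [map_mul, hpδ])
    have h2 : k = k * (1 - ∑ j, c () j * p (y j)) := by
      rw [mul_sub, mul_one, Finset.mul_sum, Finset.sum_eq_zero, sub_zero]
      intro j _
      have := hc j
      simp only [Finset.univ_unique, Finset.sum_singleton] at this
      rw [← mul_assoc]
      exact (congrArg (· * p (y j)) this).trans (zero_mul _)
    rw [h2, map_mul]
    exact hsq _ _ (hwρ k hk) h1
  refine hom_ext fun b => ?_
  have h1 := key (p b - q b) (by
    rw [map_sub, hpδ, sub_eq_zero]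
    exact (TAlg.congr_toAlgHom hq b).symm)
  rw [map_sub, sub_eq_zero] at h1
  rw [← hpw, ← hqw]
  exact h1

end IsOpenEtaleClass

namespace TAlg

/-! ### Neighbourhoods -/

/-- `L` is a flat neighbourhood of the quotient `H` of `R`. -/
structure IsNbhd {R H L : TAlg T} (c : R ⟶ H) (g : R ⟶ L) (ν : L ⟶ H) : Prop where
  uflat : UFlat g
  isPushout : IsPushout g c ν (𝟙 H)

variable {R H L : TAlg T} {c : R ⟶ H} {g : R ⟶ L} {ν : L ⟶ H}

lemma IsNbhd.w (h : IsNbhd c g ν) : g ≫ ν = c := by rw [h.isPushout.w, comp_id]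

lemma IsNbhd.trans (h : IsNbhd c g ν) {L' : TAlg T} {g' : L ⟶ L'} {ν' : L' ⟶ H}
    (h' : IsNbhd ν g' ν') : IsNbhd c (g ≫ g') ν' where
  uflat := UFlat.comp h.uflat h'.uflat
  isPushout := by
    have := h.isPushout.paste_horiz h'.isPushout
    rwa [comp_id] at this

lemma IsNbhd.exists_push (h : IsNbhd c g ν) {R' H' : TAlg T} {c' : R' ⟶ H'} (r : R ⟶ R')
    (b : H ⟶ H') (w : c ≫ b = r ≫ c') : ∃ (L' : TAlg T) (g' : R' ⟶ L') (ν' : L' ⟶ H')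
      (l : L ⟶ L'), IsNbhd c' g' ν' ∧ g ≫ l = r ≫ g' ∧ l ≫ ν' = ν ≫ b := by
  obtain ⟨L', l, g', hL⟩ := exists_isPushout g r
  have hw : g ≫ ν ≫ b = r ≫ c' := by rw [← assoc, h.w, w]
  let ν' : L' ⟶ H' := hL.desc (ν ≫ b) c' hw
  have h1 : l ≫ ν' = ν ≫ b := hL.inl_desc _ _ _
  have h2 : g' ≫ ν' = c' := hL.inr_desc _ _ _
  refine ⟨L', g', ν', l, ⟨UFlat.of_isPushout h.uflat hL, ?_⟩, hL.w, h1⟩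
  have h3 : IsPushout (r ≫ c') g (𝟙 H') (l ≫ ν') := by
    rw [← w, h1]
    have : IsPushout b (𝟙 H) (𝟙 H') b := IsPushout.of_vert_isIso ⟨by simp⟩
    exact h.isPushout.flip.paste_horiz this
  exact (IsPushout.of_left h3 (by rw [comp_id, h2]) hL.flip).flip

end TAlg

namespace IsOpenEtaleClass

open TAlg

variable {E : MorphismProperty (TAlg T)} {A₀ B₀ : TAlg T} {f₀ : A₀ ⟶ B₀}

lemma exists_nbhd (hE : IsOpenEtaleClass E) (h₀ : E f₀)
    {R H : TAlg T} {c : R ⟶ H} (hc : Function.Surjective c.toAlgHom) (a : A₀ ⟶ R)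
    (b : B₀ ⟶ H) (w : f₀ ≫ b = a ≫ c) : ∃ (L : TAlg T) (g : R ⟶ L) (ν : L ⟶ H) (β : B₀ ⟶ L),
      IsNbhd c g ν ∧ f₀ ≫ β = a ≫ g ∧ β ≫ ν = b := by
  obtain ⟨k, p, hp, -⟩ := hE.finPres_target _ h₀
  choose y hy using fun i : Fin k => hc (b (p (T.var i)))
  let S := ULift.{u} (Fin k)
  let r : poly A₀ S ⟶ R := poly.desc a fun s => y s.down
  let c₁ : poly A₀ S ⟶ B₀ := poly.desc f₀ fun s => p (T.var s.down)
  let i : poly B₀ S ⟶ B₀ := poly.desc (𝟙 B₀) fun s => p (T.var s.down)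
  have hi : poly.map f₀ (id : S → S) ≫ i = c₁ := poly.hom_ext (by
    rw [← assoc, poly.of_map, assoc, poly.of_desc, poly.of_desc,
      comp_id]) fun s => by
    rw [TAlg.comp_apply, poly.map_gen, poly.desc_gen, poly.desc_gen]; rfl
  have hc₁ : Function.Surjective c₁.toAlgHom := fun x => by
    obtain ⟨φ, rfl⟩ := hp x
    refine ⟨(poly A₀ S).str.op φ fun i => poly.gen A₀ S ⟨i⟩, ?_⟩
    refine (map_op' c₁ _ _).trans (Eq.trans ?_ (free_hom_apply p φ).symm)
    exact congrArg _ (funext fun i => poly.desc_gen _ _ _)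
  obtain ⟨B', j, k', hj, hjk, hk⟩ := hE.factor (poly.map f₀ (id : S → S)) i
    (hE.pushout _ _ _ _ h₀ (isFinPres_poly (hE.finPres_source _ h₀) S) (poly.isPushout_map f₀))
    (by rw [hi]; exact hc₁)
  rw [hi] at hk
  have hf₁ : UFlat (poly.map f₀ (id : S → S)) :=
    UFlat.of_isPushout (hE.uflat h₀) (poly.isPushout_map f₀)
  have hn : IsNbhd c₁ (poly.map f₀ id ≫ j) k' := ⟨UFlat.comp hf₁ (hE.uflat hj), hk⟩
  obtain ⟨L, g, ν, l, hL, h1, h2⟩ := hn.exists_push r b (c' := c) (poly.hom_ext (by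
    rw [← assoc, poly.of_desc, ← assoc, poly.of_desc, w]) fun s => by
    rw [TAlg.comp_apply, poly.desc_gen, TAlg.comp_apply, poly.desc_gen, hy])
  refine ⟨L, g, ν, poly.of B₀ S ≫ j ≫ l, hL, ?_, ?_⟩
  · rw [← assoc, ← poly.of_map f₀ (id : S → S), assoc, ← assoc _ j l,
      h1, ← assoc, poly.of_desc]
  · rw [assoc, assoc, h2, ← assoc j, hjk, ← assoc,
      poly.of_desc, id_comp]

lemma exists_equalize (hE : IsOpenEtaleClass E) (h₀ : E f₀)
    {L H : TAlg T} (ν : L ⟶ H) {u v : B₀ ⟶ L} (huv : f₀ ≫ u = f₀ ≫ v)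
    (hν : u ≫ ν = v ≫ ν) : ∃ (L' : TAlg T) (g : L ⟶ L') (ν' : L' ⟶ H), IsNbhd ν g ν' ∧
      u ≫ g = v ≫ g := by
  obtain ⟨P, p, q, hP⟩ := exists_isPushout f₀ f₀
  let δ : P ⟶ B₀ := hP.desc (𝟙 B₀) (𝟙 B₀) rfl
  have hp : p ≫ δ = 𝟙 _ := hP.inl_desc _ _ _
  have hq : q ≫ δ = 𝟙 _ := hP.inr_desc _ _ _
  let w : P ⟶ L := hP.desc u v huv
  have hpw : p ≫ w = u := hP.inl_desc _ _ _
  have hqw : q ≫ w = v := hP.inr_desc _ _ _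
  have hw : δ ≫ u ≫ ν = w ≫ ν := hP.hom_ext
    (by rw [← assoc p, hp, ← assoc p, hpw, id_comp])
    (by rw [← assoc q, hq, ← assoc q, hqw, id_comp, hν])
  obtain ⟨L', e, g, hL⟩ := exists_isPushout δ w
  let ν' : L' ⟶ H := hL.desc (u ≫ ν) ν hw
  have h1 : e ≫ ν' = u ≫ ν := hL.inl_desc _ _ _
  have h2 : g ≫ ν' = ν := hL.inr_desc _ _ _
  refine ⟨L', g, ν', ⟨UFlat.of_isPushout (hE.uflat_diag h₀ hP) hL, ?_⟩, ?_⟩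
  · have h3 : IsPushout (w ≫ ν) δ (𝟙 H) (e ≫ ν') := by
      rw [h1]
      refine ⟨⟨by rw [comp_id, hw]⟩, ⟨Limits.PushoutCocone.IsColimit.mk _
        (fun s => s.inl) (fun s => id_comp _) (fun s => ?_) fun s m hm _ => ?_⟩⟩
      · have h4 : δ ≫ (u ≫ ν) ≫ s.inl = δ ≫ s.inr := by
          rw [← s.condition, ← assoc, hw]
        have h5 : p ≫ δ ≫ (u ≫ ν) ≫ s.inl = p ≫ δ ≫ s.inr := congrArg (p ≫ ·) h4
        rwa [← assoc, hp, ← assoc p, hp, id_comp, id_comp] at h5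
      · rw [← hm, id_comp]
    exact (IsPushout.of_left h3 (by rw [comp_id, h2]) hL.flip).flip
  · rw [← hpw, ← hqw, assoc, assoc, ← hL.w, ← assoc, ← assoc,
      hp, hq]

end IsOpenEtaleClass

open scoped TensorProduct

/-! ### Base change of a differential graded algebra along a morphism from its degree zero part -/

/-- Transport of a `T`-algebra structure along an isomorphism. -/
abbrev TStructure.transport {R S : Type u} [CommRing R] [Algebra ℚ R] [CommRing S] [Algebra ℚ S]
    (A : TStructure T R) (e : R ≃ₐ[ℚ] S) : TStructure T S where
  op φ a := e (A.op φ fun i => e.symm (a i))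
  op_var i a := by rw [A.op_var, e.apply_symm_apply]
  op_subst f g a := by simp only [A.op_subst, e.symm_apply_apply]
  op_poly p a := by
    rw [A.op_poly]
    have h := MvPolynomial.comp_aeval_apply (fun i => e.symm (a i)) e.toAlgHom p
    refine h.trans (congrArg (fun b => MvPolynomial.aeval b p) (funext fun i => ?_))
    exact e.apply_symm_apply _

namespace TDGA

variable {X : TDGA T} {L : TAlg T}

instance : Algebra (X.deg 0) X.carrier :=
  RingHom.toAlgebra' (R := X.deg 0)
    { toFun c := c.1
      map_one' := rfl
      map_mul' _ _ := rfl
      map_zero' := rfl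
      map_add' _ _ := rfl } fun c x => X.central c.2 x

lemma zero_smul_def (c : X.deg 0) (x : X.carrier) : c • x = c.1 * x := rfl

instance : IsScalarTower ℚ (X.deg 0) X.carrier :=
  ⟨fun q c x => smul_mul_assoc q c.1 x⟩

/-- The `T`-algebra `L`, regarded as an algebra over the degree zero part of `X`. -/
def Over (_ : X.zeroAlg ⟶ L) : Type u := L.carrier

instance (g : X.zeroAlg ⟶ L) : CommRing (Over g) := inferInstanceAs (CommRing L.carrier)
instance (g : X.zeroAlg ⟶ L) : Algebra ℚ (Over g) := inferInstanceAs (Algebra ℚ L.carrier)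
instance (g : X.zeroAlg ⟶ L) : Algebra (X.deg 0) (Over g) :=
  (show X.deg 0 →+* L.carrier from g.toAlgHom.toRingHom).toAlgebra

/-- The identification of `L` with the same algebra over the degree zero part. -/
def toOver (g : X.zeroAlg ⟶ L) : L.carrier ≃ₐ[ℚ] Over g := AlgEquiv.refl (A₁ := L.carrier)

/-- The degree `i` component, as a map linear over the degree zero part. -/
def prL (X : TDGA T) (i : ℕ) : X.carrier →ₗ[X.deg 0] X.carrier where
  toFun := X.pr i
  map_add' := map_add _
  map_smul' c x := by
    change X.pr i (c.1 * x) = c.1 * X.pr i x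
    induction x using X.hom_induction with
    | zero => simp
    | add a b ha hb => rw [mul_add, map_add, ha, hb, map_add, mul_add]
    | homog j a ha =>
      have h := X.mul_mem c.2 ha
      rw [zero_add] at h
      by_cases e : j = i
      · subst e; rw [X.pr_of_mem h, X.pr_of_mem ha]
      · rw [X.pr_of_mem_ne h e, X.pr_of_mem_ne ha e, mul_zero]

/-- The differential, as a map linear over the degree zero part. -/
def dL (X : TDGA T) : X.carrier →ₗ[X.deg 0] X.carrier where
  toFun := X.d
  map_add' := map_add _
  map_smul' c x := by
    change X.d (c.1 * x) = c.1 * X.d x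
    rw [X.leibniz x c.2, X.d_zero c.2]; simp

variable (g : X.zeroAlg ⟶ L)

/-- The carrier of the base change. -/
abbrev BC : Type u := Over g ⊗[X.deg 0] X.carrier

namespace BC

variable {g}

abbrev map (f : X.carrier →ₗ[X.deg 0] X.carrier) : BC g →ₗ[ℚ] BC g :=
  (f.baseChange (Over g)).restrictScalars ℚ

lemma map_tmul (f : X.carrier →ₗ[X.deg 0] X.carrier) (l : Over g) (x : X.carrier) :
    map f (l ⊗ₜ[X.deg 0] x) = l ⊗ₜ[X.deg 0] f x := rfl

lemma tmul_congr {l : Over g} {x z : X.carrier} (h : x = z) :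
    l ⊗ₜ[X.deg 0] x = l ⊗ₜ[X.deg 0] z := congrArg _ h

lemma tmul_zero_mul (l : Over g) (c : X.deg 0) (x : X.carrier) :
    l ⊗ₜ[X.deg 0] (c.1 * x) = (l * toOver g (g c)) ⊗ₜ[X.deg 0] x := by
  rw [← zero_smul_def, ← TensorProduct.smul_tmul, mul_comm, Algebra.smul_def]
  rfl

lemma pr_mul_pr (i j : ℕ) (x z : BC g) : map (X.prL (i + j)) (map (X.prL i) x * map (X.prL j) z) =
    map (X.prL i) x * map (X.prL j) z := by
  induction x using TensorProduct.induction_on with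
  | zero => simp
  | add a b ha hb => rw [map_add, add_mul, map_add, ha, hb]
  | tmul l x =>
    induction z using TensorProduct.induction_on with
    | zero => simp
    | add a b ha hb => rw [map_add, mul_add, map_add, ha, hb]
    | tmul m z =>
      rw [map_tmul, map_tmul, Algebra.TensorProduct.tmul_mul_tmul, map_tmul]
      exact congrArg _ (X.pr_of_mem (X.mul_mem (X.pr_mem i x) (X.pr_mem j z)))

variable (g) in
def grading : ProjGrading (BC g) where
  pr i := map (X.prL i)
  pr_pr i j x := by
    induction x using TensorProduct.induction_on with
    | zero => simp
    | add a b ha hb => rw [map_add, map_add, ha, hb]; split_ifs <;> simp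
    | tmul l x =>
      rw [map_tmul, map_tmul]
      have h : X.prL i (X.prL j x) = if i = j then X.prL j x else 0 := X.pr_pr i j x
      rw [h]
      split_ifs
      · rfl
      · exact TensorProduct.tmul_zero _ _
  bound x := by
    suffices h : ∃ N, ∀ N' ≥ N, x = ∑ i ∈ Finset.range N', map (X.prL i) x from
      ⟨_, h.choose_spec _ le_rfl⟩
    induction x using TensorProduct.induction_on with
    | zero => exact ⟨0, by simp⟩
    | add a b ha hb =>
      obtain ⟨N, hN⟩ := ha
      obtain ⟨N', hN'⟩ := hb
      refine ⟨N + N', fun M hM => ?_⟩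
      simp only [map_add, Finset.sum_add_distrib]
      exact congrArg₂ _ (hN M (by omega)) (hN' M (by omega))
    | tmul l x =>
      obtain ⟨N, hN⟩ := X.exists_bound x
      refine ⟨N, fun M hM => ?_⟩
      simp only [map_tmul]
      rw [← TensorProduct.tmul_sum]
      exact congrArg _ (X.sum_pr x fun i hi => hN i (by omega))
  one := congrArg (fun x : X.carrier => (1 : Over g) ⊗ₜ[X.deg 0] x) (X.pr_of_mem X.one_mem)
  mul i j x z hx hz := by rw [← hx, ← hz]; exact pr_mul_pr i j x z

lemma mem_deg {i : ℕ} {x : BC g} : x ∈ (grading g).deg i ↔ map (X.prL i) x = x := Iff.rfl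

lemma neg_one_pow_mul' {R : Type*} [Ring R] [Algebra ℚ R] (n : ℕ) (x : R) :
    (-1) ^ n * x = (-1 : ℚ) ^ n • x := by
  rw [Algebra.smul_def, map_pow, map_neg, map_one]

lemma induction₂ {P : BC g → BC g → Prop} (h₁ : ∀ b, P 0 b) (h₂ : ∀ a, P a 0)
    (h₃ : ∀ a a' b, P a b → P a' b → P (a + a') b) (h₄ : ∀ a b b', P a b → P a b' → P a (b + b'))
    (h : ∀ l x m z, P (l ⊗ₜ x) (m ⊗ₜ z)) (a b : BC g) : P a b := by
  induction a using TensorProduct.induction_on with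
  | zero => exact h₁ b
  | add a a' ih ih' => exact h₃ _ _ _ ih ih'
  | tmul l x =>
    induction b using TensorProduct.induction_on with
    | zero => exact h₂ _
    | add b b' ih ih' => exact h₄ _ _ _ ih ih'
    | tmul m z => exact h l x m z

lemma pr_comm (i j : ℕ) (a b : BC g) : map (X.prL i) a * map (X.prL j) b =
    (-1 : ℚ) ^ (i * j) • (map (X.prL j) b * map (X.prL i) a) := by
  refine induction₂ (P := fun a b => map (X.prL i) a * map (X.prL j) b =
    (-1 : ℚ) ^ (i * j) • (map (X.prL j) b * map (X.prL i) a)) (fun b => by simp) (fun a => by simp)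
    (fun a a' b h h' => ?_) (fun a b b' h h' => ?_) (fun l x m z => ?_) a b
  · rw [map_add, add_mul, mul_add, h, h', smul_add]
  · rw [map_add, add_mul, mul_add, h, h', smul_add]
  · simp only [map_tmul, Algebra.TensorProduct.tmul_mul_tmul]
    rw [← TensorProduct.tmul_smul, mul_comm m l]
    exact congrArg _ (X.comm' (X.pr_mem i x) (X.pr_mem j z))

lemma d_pr_mul (i : ℕ) (a b : BC g) : map X.dL (map (X.prL i) a * b) =
    map X.dL (map (X.prL i) a) * b + (-1 : ℚ) ^ i • (map (X.prL i) a * map X.dL b) := by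
  refine induction₂ (P := fun a b => map X.dL (map (X.prL i) a * b) =
    map X.dL (map (X.prL i) a) * b + (-1 : ℚ) ^ i • (map (X.prL i) a * map X.dL b))
    (fun b => by simp) (fun a => by simp)
    (fun a a' b h h' => ?_) (fun a b b' h h' => ?_) (fun l x m z => ?_) a b
  · simp only [map_add, add_mul, h, h', smul_add]; abel
  · simp only [map_add, mul_add, h, h', smul_add]; abel
  · simp only [map_tmul, Algebra.TensorProduct.tmul_mul_tmul]
    rw [← TensorProduct.tmul_smul, ← TensorProduct.tmul_add]
    refine congrArg _ ((X.leibniz z (X.pr_mem i x)).trans ?_)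
    rw [X.neg_one_pow_mul]; rfl

variable (g) in
def toCDGA : CDGA.{u} where
  carrier := BC g
  deg := (grading g).deg
  graded_comm {i j a b} ha hb := by
    rw [neg_one_pow_mul', ← mem_deg.1 ha, ← mem_deg.1 hb, pr_comm]
  d := map X.dL
  d_mem {i a} ha := by
    rw [← mem_deg.1 ha, mem_deg]
    clear ha
    induction a using TensorProduct.induction_on with
    | zero => simp
    | add a b ha hb => simp only [map_add, ha, hb]
    | tmul l x => exact tmul_congr (X.pr_of_mem (X.d_mem (X.pr_mem (i + 1) x)))
  d_zero {a} ha := by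
    rw [← mem_deg.1 ha]
    clear ha
    induction a using TensorProduct.induction_on with
    | zero => simp
    | add a b ha hb => rw [map_add, map_add, ha, hb, add_zero]
    | tmul l x =>
      exact (congrArg _ (X.d_zero (X.pr_mem 0 x))).trans (TensorProduct.tmul_zero _ _)
  d_d a := by
    induction a using TensorProduct.induction_on with
    | zero => simp
    | add a b ha hb => rw [map_add, map_add, ha, hb, add_zero]
    | tmul l x => exact (congrArg _ (X.d_d x)).trans (TensorProduct.tmul_zero _ _)
  leibniz {i a} b ha := by
    rw [neg_one_pow_mul', ← mem_deg.1 ha, d_pr_mul]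

variable (g) in
/-- The composite of the projection to the degree zero part with `g`. -/
def zeroOver : X.carrier →ₗ[X.deg 0] Over g where
  toFun x := toOver g (g (⟨X.pr 0 x, X.pr_mem 0 x⟩ : X.deg 0))
  map_add' x y := by
    have h : (⟨X.pr 0 (x + y), X.pr_mem 0 _⟩ : X.deg 0) =
      ⟨X.pr 0 x, X.pr_mem 0 _⟩ + ⟨X.pr 0 y, X.pr_mem 0 _⟩ := Subtype.ext (map_add _ x y)
    rw [h]
    exact map_add (g.toAlgHom) _ _
  map_smul' c x := by
    have h : (⟨X.pr 0 (c • x), X.pr_mem 0 _⟩ : X.deg 0) = c * ⟨X.pr 0 x, X.pr_mem 0 _⟩ :=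
      Subtype.ext ((X.prL 0).map_smul c x)
    rw [h]
    exact map_mul (g.toAlgHom) _ _

variable (g) in
/-- The retraction of the base change onto its degree zero part. -/
def ret : BC g →ₗ[X.deg 0] Over g :=
  TensorProduct.lift ((LinearMap.mul (X.deg 0) (Over g)).compl₂ (zeroOver g))

lemma ret_tmul (l : Over g) (x : X.carrier) : ret g (l ⊗ₜ[X.deg 0] x) =
    l * toOver g (g (⟨X.pr 0 x, X.pr_mem 0 x⟩ : X.deg 0)) := rfl

lemma ret_one (l : Over g) : ret g (l ⊗ₜ[X.deg 0] (1 : X.carrier)) = l := by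
  have h : (⟨X.pr 0 1, X.pr_mem 0 _⟩ : X.deg 0) = 1 := Subtype.ext (X.pr_of_mem X.one_mem)
  rw [ret_tmul, h]
  exact (congrArg (fun y => l * toOver g y) (map_one g.toAlgHom)).trans (by simp)

lemma ret_tmul_one (a : BC g) : ret g a ⊗ₜ[X.deg 0] (1 : X.carrier) = map (X.prL 0) a := by
  induction a using TensorProduct.induction_on with
  | zero => simp
  | add a b ha hb => rw [map_add, TensorProduct.add_tmul, ha, hb, map_add]
  | tmul l x =>
    rw [ret_tmul, ← tmul_zero_mul, map_tmul]
    exact tmul_congr (mul_one _)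

variable (g) in
/-- The degree zero part of the base change along `g : X₀ ⟶ L` is `L`. -/
def zeroEquiv : L.carrier ≃ₐ[ℚ] (toCDGA g).deg 0 where
  toFun l := ⟨toOver g l ⊗ₜ[X.deg 0] (1 : X.carrier), mem_deg.2 (tmul_congr (X.pr_of_mem X.one_mem))⟩
  invFun a := (toOver g).symm (ret g a.1)
  left_inv l := by
    change (toOver g).symm (ret g (toOver g l ⊗ₜ[X.deg 0] (1 : X.carrier))) = l
    rw [ret_one, AlgEquiv.symm_apply_apply]
  right_inv a := Subtype.ext ((ret_tmul_one a.1).trans a.2)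
  map_mul' l m := Subtype.ext (by
    refine Eq.trans ?_ (Algebra.TensorProduct.tmul_mul_tmul (toOver g l) (toOver g m)
      (1 : X.carrier) 1).symm
    rw [mul_one, map_mul])
  map_add' l m := Subtype.ext (TensorProduct.add_tmul (toOver g l) (toOver g m) _)
  commutes' q := rfl

lemma zeroEquiv_apply (l : L.carrier) :
    (zeroEquiv g l).1 = toOver g l ⊗ₜ[X.deg 0] (1 : X.carrier) := rfl

lemma one_tmul_zero (c : X.deg 0) :
    (1 : Over g) ⊗ₜ[X.deg 0] c.1 = (zeroEquiv g (g c)).1 := by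
  have h := tmul_zero_mul (1 : Over g) c 1
  rw [mul_one, one_mul] at h
  exact h

end BC

/-- The base change of `X` along `g : X₀ ⟶ L`. -/
def bc : TDGA T where
  toCDGA := BC.toCDGA g
  str := L.str.transport (BC.zeroEquiv g)

namespace bc

/-- The canonical morphism to the base change. -/
def of : X ⟶ bc g where
  toAlgHom := (Algebra.TensorProduct.includeRight (R := X.deg 0) (A := Over g)
    (B := X.carrier)).restrictScalars ℚ
  map_deg ha := BC.mem_deg.2 (BC.tmul_congr (X.pr_of_mem ha))
  map_d a := rfl
  map_op {n} φ a := by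
    refine (BC.one_tmul_zero (X.str.op φ a)).trans (congrArg (fun y => (BC.zeroEquiv g y).1) ?_)
    refine (TAlg.map_op' g φ a).trans (congrArg _ (funext fun i => ?_))
    refine ((BC.zeroEquiv g).symm_apply_apply _).symm.trans (congrArg _ ?_)
    exact Subtype.ext (BC.one_tmul_zero (a i)).symm

/-- The inclusion of `L` in degree zero. -/
def inc : L ⟶ (bc g).zeroAlg where
  toAlgHom := (BC.zeroEquiv g).toAlgHom
  map_op φ a := by
    refine congrArg (BC.zeroEquiv g) (congrArg _ (funext fun i => ?_))
    exact (AlgEquiv.symm_apply_apply _ _).symm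

lemma comp_inc : g ≫ inc g = zeroAlgMap (of g) :=
  TAlg.hom_ext fun c => Subtype.ext (BC.one_tmul_zero c).symm

variable {g}

lemma exists_desc {Z : TDGA T} (a : X ⟶ Z) (b : L ⟶ Z.zeroAlg) (h : zeroAlgMap a = g ≫ b) :
    ∃ c : bc g ⟶ Z, of g ≫ c = a ∧ inc g ≫ zeroAlgMap c = b := by
  let zm : X.deg 0 →+* Z.deg 0 := (zeroMap a).toRingHom
  let : Algebra (X.deg 0) Z.carrier :=
    ((algebraMap (Z.deg 0) Z.carrier).comp zm).toAlgebra' fun c x => Z.central (zm c).2 x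
  let bz : L.carrier →+* Z.deg 0 := b.toAlgHom.toRingHom
  let φ : Over g →ₐ[X.deg 0] Z.carrier :=
    { ((algebraMap (Z.deg 0) Z.carrier).comp bz).comp (toOver g).symm.toRingEquiv.toRingHom with
      commutes' := fun c =>
        congrArg (fun q : X.zeroAlg ⟶ Z.zeroAlg => (show Z.deg 0 from q c).1) h.symm }
  let ψ : X.carrier →ₐ[X.deg 0] Z.carrier :=
    { a.toAlgHom.toRingHom with commutes' := fun c => rfl }
  obtain ⟨c, hc⟩ : ∃ c : BC g →ₐ[ℚ] Z.carrier, ∀ l x,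
      c (l ⊗ₜ x) = (bz ((toOver g).symm l)).1 * a x :=
    ⟨(Algebra.TensorProduct.lift φ ψ fun l x =>
      Z.central (bz ((toOver g).symm l)).2 (ψ x)).toRingHom.toRatAlgHom, fun l x =>
      Algebra.TensorProduct.lift_tmul φ ψ (fun l x => Z.central (bz ((toOver g).symm l)).2 (ψ x)) l x⟩
  have hz : ∀ l, c (BC.zeroEquiv g l).1 = (bz l).1 := fun l => by
    rw [BC.zeroEquiv_apply, hc, map_one, mul_one, AlgEquiv.symm_apply_apply]
  have hm : ∀ i y, c (BC.map (X.prL i) y) ∈ Z.deg i := fun i y => by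
    induction y using TensorProduct.induction_on with
    | zero => rw [map_zero, map_zero]; exact zero_mem _
    | add y y' h h' => rw [map_add, map_add]; exact add_mem h h'
    | tmul l x =>
      rw [BC.map_tmul, hc]
      have := Z.mul_mem (bz ((toOver g).symm l)).2 (a.map_deg (X.pr_mem i x))
      rwa [zero_add] at this
  have hd : ∀ y : BC g, c (BC.map X.dL y) = Z.d (c y) := fun y => by
    induction y using TensorProduct.induction_on with
    | zero => simp
    | add y y' h h' => simp only [map_add, h, h']
    | tmul l x =>
      have hb := (bz ((toOver g).symm l)).2
      rw [BC.map_tmul, hc, hc, Z.leibniz _ hb, Z.d_zero hb, ← a.map_d]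
      simp only [zero_mul, pow_zero, one_mul, zero_add]
      rfl
  have hmd : ∀ {i} {y : BC g}, y ∈ (bc g).deg i → c y ∈ Z.deg i := fun {i y} hy => by
    have := hm i y
    rwa [BC.mem_deg.1 hy] at this
  refine ⟨{ toAlgHom := c, map_deg := hmd, map_d := hd, map_op := fun {n} f y => ?_ }, ?_, ?_⟩
  · refine (hz _).trans (congrArg Subtype.val ((TAlg.map_op' b f _).trans
      (congrArg (Z.str.op f) (funext fun i => Subtype.ext ?_))))
    refine (hz ((BC.zeroEquiv g).symm (y i))).symm.trans ?_
    exact congrArg (fun q : (BC.toCDGA g).deg 0 => c q.1) ((BC.zeroEquiv g).apply_symm_apply (y i))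
  · refine TDGA.hom_ext fun x => (hc 1 x).trans ?_
    rw [map_one, map_one]
    exact one_mul _
  · exact TAlg.hom_ext fun l => Subtype.ext (hz l)

lemma inc_toH0 {ν : L ⟶ X.H0} (hν : TAlg.IsNbhd X.toH0 g ν) :
    inc g ≫ (bc g).toH0 = ν ≫ H0map (of g) := by
  obtain ⟨-, hk⟩ := TAlg.isPushout_of_surjective hν.isPushout X.toH0_surjective
  have h0 : g ≫ inc g ≫ (bc g).toH0 = X.toH0 ≫ H0map (of g) := by
    rw [← assoc, comp_inc, toH0_naturality]
  have hker : RingHom.ker ν.toAlgHom ≤ RingHom.ker (inc g ≫ (bc g).toH0).toAlgHom := by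
    rw [hk, Ideal.map_le_iff_le_comap]
    intro c hc
    refine (TAlg.congr_toAlgHom h0 c).trans ?_
    exact (congrArg (H0map (of g)).toAlgHom hc).trans (map_zero _)
  refine TAlg.hom_ext fun l => ?_
  obtain ⟨c, hc⟩ := X.toH0_surjective (ν l)
  have hl : l - g c ∈ RingHom.ker ν.toAlgHom := by
    rw [RingHom.mem_ker, map_sub, ← hc, sub_eq_zero]
    exact TAlg.congr_toAlgHom hν.w.symm c
  have h1 := hker hl
  rw [RingHom.mem_ker, map_sub, sub_eq_zero] at h1
  refine h1.trans ((TAlg.congr_toAlgHom h0 c).trans ?_)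
  exact congrArg (H0map (of g)).toAlgHom hc

lemma quasiIso_of {ν : L ⟶ X.H0} (hν : TAlg.IsNbhd X.toH0 g ν) : QuasiIso (of g) := by
  obtain ⟨-, hk⟩ := TAlg.isPushout_of_surjective hν.isPushout X.toH0_surjective
  have hflat : Module.Flat (X.deg 0) (Over g) := hν.uflat.flat
  let Z : Submodule (X.deg 0) X.carrier := LinearMap.ker X.dL
  let d' : X.carrier →ₗ[X.deg 0] Z := X.dL.codRestrict Z fun x => X.d_d x
  let Hm := Z ⧸ LinearMap.range d'
  let νL : Over g →ₗ[X.deg 0] (X.deg 0 ⧸ X.boundaryIdeal) :=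
    { toFun := fun l => ν ((toOver g).symm l)
      map_add' := fun l m => map_add ν.toAlgHom _ _
      map_smul' := fun c l => by
        rw [Algebra.smul_def, RingHom.id_apply]
        refine Eq.trans ?_ (Algebra.smul_def (A := X.deg 0 ⧸ X.boundaryIdeal) c _).symm
        refine (map_mul ν.toAlgHom (g c) _).trans (congrArg (· * _) ?_)
        exact TAlg.congr_toAlgHom hν.w c }
  let ev : (X.deg 0 ⧸ X.boundaryIdeal) →ₗ[X.deg 0] Z →ₗ[X.deg 0] Hm :=
    Submodule.liftQ X.boundaryIdeal (LinearMap.toSpanSingleton (X.deg 0) _ (Submodule.mkQ _))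
      fun c ⟨y, hy, hyc⟩ => LinearMap.ext fun z => by
        refine (Submodule.Quotient.mk_eq_zero (LinearMap.range d') (x := c • z)).2
          ⟨y * z.1, Subtype.ext ?_⟩
        change X.d (y * z.1) = c.1 * z.1
        have hz : X.d z.1 = 0 := z.2
        rw [X.leibniz _ hy, hz, hyc]; simp
  have hev : ∀ c z, ev (Submodule.Quotient.mk c) z = Submodule.Quotient.mk (c • z) :=
    fun c z => rfl
  let r : Over g ⊗[X.deg 0] Z →ₗ[X.deg 0] Hm := TensorProduct.lift (ev ∘ₗ νL)
  have hr : ∀ y, r (d'.lTensor (Over g) y) = 0 := fun y => by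
    induction y using TensorProduct.induction_on with
    | zero => simp
    | add y y' h h' => rw [map_add, map_add, h, h', add_zero]
    | tmul l x =>
      change ev (νL l) (d' x) = 0
      obtain ⟨c, hc⟩ := Submodule.Quotient.mk_surjective X.boundaryIdeal (νL l)
      rw [← hc, hev, ← map_smul]
      exact (Submodule.Quotient.mk_eq_zero _).2 ⟨_, rfl⟩
  have hr1 : ∀ z, r (1 ⊗ₜ z) = Submodule.Quotient.mk z := fun z => by
    have h1 : νL 1 = Submodule.Quotient.mk 1 := map_one ν.toAlgHom
    change ev (νL 1) z = _
    rw [h1, hev, one_smul]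
  have hinj : Function.Injective (Z.subtype.lTensor (Over g)) :=
    Module.Flat.lTensor_preserves_injective_linearMap _ Z.subtype_injective
  have hex : Function.Exact (Z.subtype.lTensor (Over g)) (X.dL.lTensor (Over g)) :=
    Module.Flat.lTensor_exact (Over g) (LinearMap.exact_subtype_ker_map X.dL)
  have hd : ∀ w, Z.subtype.lTensor (Over g) (d'.lTensor (Over g) w) = BC.map X.dL w := fun w =>
    (LinearMap.lTensor_comp_apply (Over g) Z.subtype d' w).symm
  rw [quasiIso_iff]
  constructor
  · intro i z hz w hw hwz
    have h1 : d'.lTensor (Over g) w = 1 ⊗ₜ (⟨z, hz.2⟩ : Z) := hinj ((hd w).trans hwz)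
    have h2 := hr w
    rw [h1, hr1, Submodule.Quotient.mk_eq_zero] at h2
    obtain ⟨x, hx⟩ := h2
    have hx' : X.d x = z := congrArg Subtype.val hx
    refine ⟨X.pr (i + 1) x, X.pr_mem _ _, ?_⟩
    rw [← X.pr_d, hx', X.pr_of_mem hz.1]
  · intro i z hz
    obtain ⟨y, hy⟩ := (hex z).1 hz.2
    obtain ⟨x, w, hxw⟩ : ∃ (x : Z) (w : BC g),
        BC.map X.dL w = (1 : Over g) ⊗ₜ x.1 - Z.subtype.lTensor (Over g) y := by
      clear hy hz
      induction y using TensorProduct.induction_on with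
      | zero => exact ⟨0, 0, by simp⟩
      | add y y' h h' =>
        obtain ⟨x, w, h⟩ := h
        obtain ⟨x', w', h'⟩ := h'
        refine ⟨x + x', w + w', ?_⟩
        rw [map_add, h, h', map_add, Submodule.coe_add, TensorProduct.tmul_add]
        abel
      | tmul l ζ =>
        obtain ⟨c, hc⟩ := X.toH0_surjective (ν ((toOver g).symm l))
        have hl : (toOver g).symm l - g c ∈ (RingHom.ker X.toH0.toAlgHom).map g.toAlgHom := by
          rw [← hk, RingHom.mem_ker, map_sub, ← hc, sub_eq_zero]
          exact TAlg.congr_toAlgHom hν.w.symm c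
        obtain ⟨w, hw⟩ : ∃ w : BC g, BC.map X.dL w =
            toOver g ((toOver g).symm l - g c) ⊗ₜ[X.deg 0] ζ.1 := by
          refine Submodule.span_induction (p := fun m _ => ∃ w : BC g, BC.map X.dL w =
            toOver g m ⊗ₜ[X.deg 0] ζ.1) ?_ ?_ ?_ ?_ hl
          · rintro _ ⟨b, hb, rfl⟩
            obtain ⟨u, hu, hub⟩ := toH0_eq_zero.1 hb
            refine ⟨1 ⊗ₜ (u * ζ.1), ?_⟩
            have hζ : X.d ζ.1 = 0 := ζ.2
            have h2 : X.d (u * ζ.1) = (show X.deg 0 from b).1 * ζ.1 := by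
              rw [X.leibniz _ hu, hζ, hub]; simp
            refine (BC.tmul_congr h2).trans ((BC.tmul_zero_mul 1 _ _).trans ?_)
            rw [one_mul]
          · exact ⟨0, by simp⟩
          · rintro m m' - - ⟨w, h⟩ ⟨w', h'⟩
            exact ⟨w + w', by rw [map_add, h, h', map_add, TensorProduct.add_tmul]⟩
          · rintro a m - ⟨w, h⟩
            refine ⟨toOver g a • w, ?_⟩
            refine ((X.dL.baseChange (Over g)).map_smul _ _).trans ((congrArg _ h).trans ?_)
            rw [smul_eq_mul, map_mul]
            rfl
        refine ⟨(show X.deg 0 from c) • ζ, -w, ?_⟩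
        rw [map_neg, hw, map_sub, TensorProduct.sub_tmul, AlgEquiv.apply_symm_apply, neg_sub]
        refine congrArg (· - _) ?_
        have h3 := BC.tmul_zero_mul (1 : Over g) c ζ.1
        rw [one_mul] at h3
        exact h3.symm
    refine ⟨X.pr i x.1, ⟨X.pr_mem _ _, ?_⟩, (bc g).pr (i + 1) w, (bc g).pr_mem _ _, ?_⟩
    · have hx : X.d x.1 = 0 := x.2
      change X.d (X.pr i x.1) = 0
      cases i with
      | zero => exact X.d_zero (X.pr_mem 0 _)
      | succ i =>
        rw [← X.pr_d, hx, map_zero]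
    · refine ((bc g).pr_d i w).symm.trans ?_
      rw [map_pr]
      refine (congrArg ((bc g).pr i) (hxw.trans (congrArg _ hy))).trans ((map_sub _ _ _).trans ?_)
      rw [(bc g).pr_of_mem hz.1]
      rfl

end bc

end TDGA

/-! ### Lifting against fibrations -/

/-- The lifting properties of pushouts of morphisms in an open or étale class. -/
structure TAlg.Etale {F A : TAlg T} (f : F ⟶ A) : Prop where
  exists_nbhd {R H : TAlg T} {c : R ⟶ H} (hc : Function.Surjective c.toAlgHom) (a : F ⟶ R)
    (b : A ⟶ H) (w : f ≫ b = a ≫ c) : ∃ (L : TAlg T) (g : R ⟶ L) (ν : L ⟶ H) (β : A ⟶ L),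
      IsNbhd c g ν ∧ f ≫ β = a ≫ g ∧ β ≫ ν = b
  exists_equalize {L H : TAlg T} (ν : L ⟶ H) {u v : A ⟶ L} (huv : f ≫ u = f ≫ v)
    (hν : u ≫ ν = v ≫ ν) : ∃ (L' : TAlg T) (g : L ⟶ L') (ν' : L' ⟶ H), IsNbhd ν g ν' ∧
      u ≫ g = v ≫ g
  rigid {D D' : TAlg T} {u v : A ⟶ D} (huv : f ≫ u = f ≫ v) (ρ : D ⟶ D')
    (hρ : u ≫ ρ = v ≫ ρ)
    (hsq : ∀ x y, ρ x = 0 → ρ y = 0 → x * y = 0) : u = v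

lemma IsOpenEtaleClass.etale {E : MorphismProperty (TAlg T)} (hE : IsOpenEtaleClass E)
    {F A : TAlg T} {f : F ⟶ A} (hf : E.pushouts f) : TAlg.Etale f := by
  obtain ⟨A₀, B₀, f₀, a, b, h₀, h⟩ := hf
  refine ⟨fun hc x ψ w => ?_, fun {L H} ν {u v} huv hν => ?_, fun {D D' u v} huv ρ hρ hsq => ?_⟩
  · obtain ⟨L, g, ν, β, hL, h1, h2⟩ := hE.exists_nbhd h₀ hc (a ≫ x) (b ≫ ψ) (by
      rw [← assoc, ← h.w, assoc, w, assoc])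
    have hd : a ≫ x ≫ g = f₀ ≫ β := by rw [h1, assoc]
    refine ⟨L, g, ν, h.desc (x ≫ g) β hd, hL, h.inl_desc _ _ _, h.hom_ext ?_ ?_⟩
    · rw [← assoc, h.inl_desc, assoc, hL.w, w]
    · rw [← assoc, h.inr_desc, h2]
  · obtain ⟨L', g, ν', hL, h1⟩ := hE.exists_equalize h₀ ν (u := b ≫ u) (v := b ≫ v)
      (by rw [← assoc, ← assoc, ← h.w, assoc, huv, assoc])
      (by rw [assoc, hν, assoc])
    refine ⟨L', g, ν', hL, h.hom_ext ?_ ?_⟩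
    · rw [← assoc, huv, assoc]
    · rw [← assoc, h1, assoc]
  · refine h.hom_ext huv (hE.rigid h₀ ?_ ρ ?_ hsq)
    · rw [← assoc, ← assoc, ← h.w, assoc, huv, assoc]
    · rw [assoc, hρ, assoc]

namespace TDGA

lemma toH0_comp_H0map {A : TAlg T} {Z : TDGA T} (α : A.toTDGA ⟶ Z) :
    A.toH0 ≫ H0map α = unZero α ≫ Z.toH0 := TAlg.hom_ext fun _ => rfl

/-- Simultaneous strictification of morphisms to `H₀`, after passage to flat neighbourhoods. -/
lemma exists_strictify {F A : TAlg T} {f : F ⟶ A} (hf : TAlg.Etale f) {Q X Y : TDGA T}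
    (φ : Q ⟶ Y) (p : X ⟶ Y) (j : F.toTDGA ⟶ Q) (x : F.toTDGA ⟶ X) (w : j ≫ φ = x ≫ p)
    (jQ : A ⟶ Q.H0) (ψ : A ⟶ X.H0) (hjQ : f ≫ jQ = unZero j ≫ Q.toH0)
    (hψ : f ≫ ψ = unZero x ≫ X.toH0) (hw : jQ ≫ H0map φ = ψ ≫ H0map p) :
    ∃ (Q' X' Y' : TDGA T) (sQ : Q ⟶ Q') (sX : X ⟶ X') (sY : Y ⟶ Y') (φ' : Q' ⟶ Y')
      (p' : X' ⟶ Y') (α : A.toTDGA ⟶ Q') (β : A.toTDGA ⟶ X'),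
      (QuasiIso sQ ∧ QuasiIso sX ∧ QuasiIso sY) ∧ (sQ ≫ φ' = φ ≫ sY ∧ sX ≫ p' = p ≫ sY) ∧
      (TAlg.mapTDGA f ≫ α = j ≫ sQ ∧ TAlg.mapTDGA f ≫ β = x ≫ sX) ∧ α ≫ φ' = β ≫ p' ∧
      A.toH0 ≫ H0map α = jQ ≫ H0map sQ ∧ A.toH0 ≫ H0map β = ψ ≫ H0map sX := by
  obtain ⟨L, gQ, νQ, αQ, hL, h1, h2⟩ := hf.exists_nbhd Q.toH0_surjective _ _ hjQ
  obtain ⟨M, gX, νX, αX, hM, h3, h4⟩ := hf.exists_nbhd X.toH0_surjective _ _ hψ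
  obtain ⟨L₁, g₁, ν₁, l₁, hL₁, h5, h6⟩ := hL.exists_push (zeroAlgMap φ) _ (toH0_naturality φ)
  obtain ⟨L₂, g₂, ν₂, l₂, hL₂, h7, h8⟩ := hM.exists_push (zeroAlgMap p) _ (toH0_naturality p)
  obtain ⟨L₃, g₃, ν₃, l₃, hL₃, h9, h10⟩ := hL₁.exists_push g₂ (𝟙 _)
    (by rw [comp_id, hL₂.w])
  obtain ⟨N, g₄, ν, hN, h11⟩ := hf.exists_equalize ν₃ (u := αQ ≫ l₁ ≫ l₃) (v := αX ≫ l₂ ≫ g₃)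
    (by
      rw [← assoc, h1, ← assoc f, h3, assoc, ← assoc gQ, h5,
        assoc, h9, assoc, ← assoc gX, h7, assoc,
        ← assoc, ← assoc (unZero x)]
      exact congrArg (fun q : F.toTDGA ⟶ Y => unZero q ≫ g₂ ≫ g₃) w)
    (by
      rw [assoc, assoc, h10, comp_id, h6, ← assoc, h2, hw,
        assoc, assoc, hL₃.w, h8, ← assoc, h4])
  have hN' := (hL₂.trans hL₃).trans hN
  let gN := (g₂ ≫ g₃) ≫ g₄
  have e1 : gQ ≫ (l₁ ≫ l₃ ≫ g₄) = zeroAlgMap φ ≫ gN := by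
    rw [← assoc, h5, assoc, ← assoc g₁, h9]
  have e2 : gX ≫ (l₂ ≫ g₃ ≫ g₄) = zeroAlgMap p ≫ gN := by
    rw [← assoc, h7, assoc, ← assoc g₂]
  have hd : ∀ {Z : TDGA T} {R : TAlg T} (g : Z.zeroAlg ⟶ R) (κ : Z ⟶ Y) (l : R ⟶ N)
      (_ : g ≫ l = zeroAlgMap κ ≫ gN), ∃ κ' : bc g ⟶ bc gN,
        bc.of g ≫ κ' = κ ≫ bc.of gN ∧ bc.inc g ≫ zeroAlgMap κ' = l ≫ bc.inc gN :=
    fun g κ l h => bc.exists_desc (κ ≫ bc.of gN) (l ≫ bc.inc gN) (by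
      rw [← assoc, h, assoc, bc.comp_inc]; rfl)
  obtain ⟨φ', hφ1, hφ2⟩ := hd gQ φ _ e1
  obtain ⟨p', hp1, hp2⟩ := hd gX p _ e2
  refine ⟨bc gQ, bc gX, bc gN, bc.of gQ, bc.of gX, bc.of gN, φ', p', ofZero (αQ ≫ bc.inc gQ),
    ofZero (αX ≫ bc.inc gX), ⟨bc.quasiIso_of hL, bc.quasiIso_of hM, bc.quasiIso_of hN'⟩,
    ⟨hφ1, hp1⟩, ⟨toTDGA_hom_ext ?_, toTDGA_hom_ext ?_⟩, toTDGA_hom_ext ?_, ?_, ?_⟩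
  · change f ≫ αQ ≫ bc.inc gQ = unZero j ≫ zeroAlgMap (bc.of gQ)
    rw [← assoc, h1, assoc, bc.comp_inc]
  · change f ≫ αX ≫ bc.inc gX = unZero x ≫ zeroAlgMap (bc.of gX)
    rw [← assoc, h3, assoc, bc.comp_inc]
  · change (αQ ≫ bc.inc gQ) ≫ zeroAlgMap φ' = (αX ≫ bc.inc gX) ≫ zeroAlgMap p'
    rw [assoc, hφ2, assoc αX, hp2]
    have := congrArg (· ≫ bc.inc gN) h11
    simpa only [assoc] using this
  · rw [toH0_comp_H0map]
    change (αQ ≫ bc.inc gQ) ≫ _ = _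
    rw [assoc, bc.inc_toH0 hL, ← assoc, h2]
  · rw [toH0_comp_H0map]
    change (αX ≫ bc.inc gX) ≫ _ = _
    rw [assoc, bc.inc_toH0 hM, ← assoc, h4]

lemma quasiIso_of_discrete {A : TAlg T} {W Z : TDGA T} (s : A.toTDGA ⟶ Z) {t : W ⟶ Z}
    (ht : QuasiIso t) {q : W ⟶ A.toTDGA} (hq : QuasiIso q) {jW : A ⟶ W.H0}
    (hj : jW ≫ H0map q = A.toH0) (hs : A.toH0 ≫ H0map s = jW ≫ H0map t) : QuasiIso s := by
  have hs' : ∀ a : A.carrier, Z.toH0 ((unZero s) a) =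
      (H0map t) (jW a) := fun a =>
    TAlg.congr_toAlgHom hs a
  have hj' : ∀ a : A.carrier, (H0map q) (jW a) = A.toH0 a := fun a =>
    TAlg.congr_toAlgHom hj a
  have hq' := hq.bijective_H0map
  obtain ⟨h1, -⟩ := quasiIso_iff.1 hq
  obtain ⟨-, h2⟩ := quasiIso_iff.1 ht
  refine quasiIso_iff.2 ⟨fun i z hz w hw hwz => ?_, fun i z hz => ?_⟩
  · cases i with
    | zero =>
      have hz0 : Z.toH0 ((unZero s) z) = 0 := toH0_eq_zero.2 ⟨w, hw, hwz⟩
      have hz1 := ht.bijective_H0map.1 (((hs' z).symm.trans hz0).trans (map_zero _).symm)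
      have hz2 := (hj' z).symm.trans ((congrArg _ hz1).trans (map_zero _))
      exact toH0_eq_zero.1 hz2
    | succ i =>
      have hz0 : z = 0 := eq_zero_of_mem_deg hz.1
      exact ⟨0, zero_mem _, by rw [hz0, map_zero]⟩
  · cases i with
    | zero =>
      obtain ⟨y, hy⟩ := ht.bijective_H0map.2 (Z.toH0 ⟨z, hz.1⟩)
      obtain ⟨a, ha⟩ := Ideal.Quotient.mk_surjective ((H0map q) y)
      have hay : jW a.1 = y := hq'.1 ((hj' a.1).trans ha)
      have h3 : Z.toH0 ((unZero s) a.1) = Z.toH0 ⟨z, hz.1⟩ :=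
        (hs' a.1).trans ((congrArg _ hay).trans hy)
      obtain ⟨v, hv, hvz⟩ := toH0_eq_zero.1
        ((map_sub Z.toH0.toAlgHom _ _).trans (sub_eq_zero.2 h3))
      exact ⟨a.1, ⟨a.2, A.toTDGA.d_zero a.2⟩, v, hv, hvz⟩
    | succ i =>
      obtain ⟨y, hy, w, hw, hwz⟩ := h2 _ z hz
      obtain ⟨v, hv, hvy⟩ := h1 _ y hy 0 (zero_mem _) (by
        rw [map_zero]; exact (eq_zero_of_mem_deg (q.map_deg hy.1)).symm)
      refine ⟨0, zero_mem _, w - t v, sub_mem hw (t.map_deg hv), ?_⟩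
      rw [map_sub, hwz, ← t.map_d, hvy, map_zero]
      abel

theorem exists_lift_fibration {F A : TAlg T} {f : F ⟶ A} (hf : TAlg.Etale f) {Q X Y : TDGA T}
    {j : F.toTDGA ⟶ Q} (hj : LLPTriv j) {q : Q ⟶ A.toTDGA} (hq : QuasiIso q)
    (hjq : j ≫ q = TAlg.mapTDGA f) {jQ : A ⟶ Q.H0} (hjQ : jQ ≫ H0map q = A.toH0)
    {p : X ⟶ Y} (hp : IsFibration p) (φ : Q ⟶ Y) (x : F.toTDGA ⟶ X) (w : j ≫ φ = x ≫ p)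
    (ψ : A ⟶ X.H0) (hψ : f ≫ ψ = unZero x ≫ X.toH0) (hw : jQ ≫ H0map φ = ψ ≫ H0map p) :
    ∃ Φ : Q ⟶ X, j ≫ Φ = x ∧ Φ ≫ p = φ ∧ jQ ≫ H0map Φ = ψ := by
  have hq0 := hq.isIso_H0map
  have hfj : f ≫ jQ = unZero j ≫ Q.toH0 := by
    rw [← cancel_mono (H0map q), assoc, hjQ, assoc, toH0_naturality]
    exact congrArg (fun r : F.toTDGA ⟶ A.toTDGA => unZero r ≫ A.toTDGA.toH0) hjq.symm
  obtain ⟨Q', X', Y', sQ, sX, sY, φ', p', α, β, ⟨hsQ, hsX, hsY⟩, ⟨hφ', hp'⟩, ⟨hα, hβ⟩, hαβ, hα0,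
    hβ0⟩ := exists_strictify hf φ p j x w jQ ψ hfj hψ hw
  have hαq : QuasiIso α := quasiIso_of_discrete α hsQ hq hjQ hα0
  obtain ⟨C, iC, pC, hC, hpC, hiC, hiCq⟩ := exists_factor α
  obtain ⟨E, iE, pE, hE, hpE, hiE, hiEq⟩ := exists_factor p'
  have hpCt : IsTF pC := isTF_of hpC (QuasiIso.of_comp_left hiCq (hC ▸ hαq))
  obtain ⟨k, hk1, hk2⟩ := hiC pE hpE (β ≫ iE) (pC ≫ φ') (by
    rw [assoc, hE, ← hαβ, ← assoc, hC])
  obtain ⟨m, hm1, hm2⟩ := hj pC hpCt (TAlg.mapTDGA f ≫ iC) sQ (by rw [assoc, hC, hα])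
  let n : Q ⟶ pb sY pE := pbLift φ (m ≫ k) (by
    rw [assoc, hk2, ← assoc, hm2, hφ'])
  let e : X ⟶ pb sY pE := pbLift p (sX ≫ iE) (by rw [assoc, hE, hp'])
  have hn1 : n ≫ pbSnd sY pE = m ≫ k := pbLift_snd _ _ _
  have hn2 : n ≫ pbFst sY pE = φ := pbLift_fst _ _ _
  have he1 : e ≫ pbSnd sY pE = sX ≫ iE := pbLift_snd _ _ _
  have he2 : e ≫ pbFst sY pE = p := pbLift_fst _ _ _
  have hsi : QuasiIso (sX ≫ iE) := hsX.comp hiEq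
  have heq : QuasiIso e := QuasiIso.of_comp_right (hsY.pb hpE) (he1.symm ▸ hsi)
  obtain ⟨X'', i, p'', hi, hp'', hil, hiq⟩ := exists_factor e
  have hp''t : IsTF p'' := isTF_of hp'' (QuasiIso.of_comp_left hiq (hi ▸ heq))
  obtain ⟨r, hr1, hr2⟩ := hil p hp (𝟙 X) (p'' ≫ pbFst sY pE) (by
    rw [id_comp, ← assoc, hi, he2])
  obtain ⟨t, ht1, ht2⟩ := hj p'' hp''t (x ≫ i) n (by
    rw [assoc, hi]
    refine pb_hom_ext ?_ ?_
    · rw [assoc, he2, assoc, hn2, w]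
    · rw [assoc, he1, assoc, hn1, ← assoc, ← hβ, assoc, ← hk1,
        ← assoc, ← hm1, assoc])
  refine ⟨t ≫ r, ?_, ?_, ?_⟩
  · rw [← assoc, ht1, assoc, hr1, comp_id]
  · rw [assoc, hr2, ← assoc, ht2, hn2]
  · have h1 := hiq.isIso_H0map
    have h2 := hsi.isIso_H0map
    have h3 : IsIso (H0map pC) := hpCt.quasiIso.isIso_H0map
    have hr : H0map r ≫ H0map i = 𝟙 _ := by
      have : H0map i ≫ H0map r = 𝟙 _ := by
        rw [← H0map_comp, hr1]
        exact TAlg.hom_ext fun a => by obtain ⟨b, rfl⟩ := X.toH0_surjective a; rfl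
      rw [← cancel_epi (H0map i), ← assoc, this, id_comp, comp_id]
    have hm : jQ ≫ H0map m = A.toH0 ≫ H0map iC := by
      rw [← cancel_mono (H0map pC), assoc, ← H0map_comp, hm2, assoc,
        ← H0map_comp, hC, hα0]
    rw [← cancel_mono (H0map (sX ≫ iE)), ← he1, ← hi, H0map_comp t, assoc i,
      H0map_comp i, assoc, assoc, ← assoc (H0map r), hr,
      id_comp, ← H0map_comp, ← assoc t, ht2, hn1, H0map_comp, ← assoc,
      hm, assoc, ← H0map_comp, hk1, H0map_comp, ← assoc, hβ0, assoc,
      ← H0map_comp, ← H0map_comp, ← assoc, hi, he1]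

end TDGA

/-! ### Trivial fibrations and homotopies of simplicial sets -/

namespace Simp

open Simplicial SSet MonoidalCategory CartesianMonoidalCategory

/-- The constant simplices at the end points of the interval. -/
def endpt (b : Fin 2) (k : SimplexCategoryᵒᵖ) : (Δ[1] : SSet.{u}).obj k :=
  (SSet.const (X := Δ[1]) (stdSimplex.obj₀Equiv.symm b)).app k (stdSimplex.const 1 0 k)

lemma map_endpt (b : Fin 2) {k l : SimplexCategoryᵒᵖ} (θ : k ⟶ l) :
    (Δ[1] : SSet.{u}).map θ (endpt b k) = endpt b l :=
  (ConcreteCategory.congr_hom ((SSet.const (X := Δ[1])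
    (stdSimplex.obj₀Equiv.{u}.symm b)).naturality θ) (stdSimplex.const 1 0 k)).symm

lemma endpt_ne (k : SimplexCategoryᵒᵖ) : endpt.{u} 0 k ≠ endpt 1 k := fun h => by
  have h1 : (0 : Fin 2) = 1 := congrArg (fun x => stdSimplex.asOrderHom x 0) h
  exact absurd h1 (by decide)

lemma app_congr {X Y : SSet.{u}} {f g : X ⟶ Y} (h : f = g) (k : SimplexCategoryᵒᵖ) (x : X.obj k) :
    f.app k x = g.app k x := by rw [h]

variable {X Y : SSet.{u}}

/-- Trivial Kan fibrations. -/
abbrev TFib (φ : X ⟶ Y) : Prop := (MorphismProperty.monomorphisms SSet.{u}).rlp φ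

lemma tFib_of_boundary {φ : X ⟶ Y}
    (h : ∀ (n : ℕ) (a : (boundary n : SSet.{u}) ⟶ X) (b : Δ[n] ⟶ Y),
      a ≫ φ = (boundary n).ι ≫ b → ∃ l : Δ[n] ⟶ X, (boundary n).ι ≫ l = a ∧ l ≫ φ = b) :
    TFib φ := by
  change (MorphismProperty.monomorphisms SSet.{u}).rlp φ
  rw [rlp_monomorphisms]
  rintro _ _ _ ⟨n⟩
  refine ⟨fun {a b} sq => ?_⟩
  obtain ⟨l, h1, h2⟩ := h n a b sq.w
  exact ⟨⟨⟨l, h1, h2⟩⟩⟩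

lemma TFib.exists_lift {φ : X ⟶ Y} (hφ : TFib φ) {L : SSet.{u}} (K : L.Subcomplex)
    (a : (K : SSet.{u}) ⟶ X) (b : L ⟶ Y) (w : a ≫ φ = K.ι ≫ b) :
    ∃ l : L ⟶ X, K.ι ≫ l = a ∧ l ≫ φ = b := by
  have : HasLiftingProperty K.ι φ := hφ K.ι (MorphismProperty.monomorphisms.infer_property _)
  have sq : CommSq a K.ι φ b := ⟨w⟩
  exact ⟨sq.lift, sq.fac_left, sq.fac_right⟩

lemma TFib.exists_section {φ : X ⟶ Y} (hφ : TFib φ) : ∃ s : Y ⟶ X, s ≫ φ = 𝟙 Y := by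
  obtain ⟨l, -, h⟩ := hφ.exists_lift (⊥ : Y.Subcomplex) (Subcomplex.isInitialBot.to _) (𝟙 Y)
    (Subcomplex.isInitialBot.hom_ext _ _)
  exact ⟨l, h⟩

/-- The union of `K × Δ¹` and `L × ∂Δ¹`. -/
def cylBd {L : SSet.{u}} (K : L.Subcomplex) : (L ⊗ Δ[1]).Subcomplex where
  obj k := {z | z.1 ∈ K.obj k ∨ z.2 = endpt 0 k ∨ z.2 = endpt 1 k}
  map {k l} θ z hz := by
    obtain h | h | h := hz
    · exact Or.inl (K.map θ h)
    · exact Or.inr (Or.inl ((congrArg ((Δ[1] : SSet.{u}).map θ) h).trans (map_endpt 0 θ)))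
    · exact Or.inr (Or.inr ((congrArg ((Δ[1] : SSet.{u}).map θ) h).trans (map_endpt 1 θ)))

open Classical in
lemma exists_cylBd {L E : SSet.{u}} (K : L.Subcomplex) (f g : L ⟶ E) (hfg : K.ι ≫ f = K.ι ≫ g) :
    ∃ a : (cylBd K : SSet.{u}) ⟶ E, ∀ k (z : (cylBd K : SSet.{u}).obj k),
      (z.1.2 = endpt 1 k → a.app k z = g.app k z.1.1) ∧
      (z.1.2 ≠ endpt 1 k → a.app k z = f.app k z.1.1) := by
  refine ⟨{ app k := ↾fun z => if z.1.2 = endpt 1 k then g.app k z.1.1 else f.app k z.1.1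
            naturality k l θ := ?_ }, fun k z => ⟨fun h => if_pos h, fun h => if_neg h⟩⟩
  ext z
  change (if (Δ[1] : SSet.{u}).map θ z.1.2 = endpt 1 l then g.app l (L.map θ z.1.1) else
    f.app l (L.map θ z.1.1)) =
      E.map θ (if z.1.2 = endpt 1 k then g.app k z.1.1 else f.app k z.1.1)
  have hf := ConcreteCategory.congr_hom (f.naturality θ) z.1.1
  have hg := ConcreteCategory.congr_hom (g.naturality θ) z.1.1
  by_cases h : z.1.2 = endpt 1 k
  · rw [if_pos h, if_pos (by rw [h, map_endpt])]
    exact hg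
  rw [if_neg h]
  refine Eq.trans ?_ hf
  split_ifs with h'
  · obtain h1 | h1 | h1 := z.2
    · exact (app_congr hfg l
        (⟨L.map θ z.1.1, K.map θ h1⟩ : (K : SSet.{u}).obj l)).symm
    · rw [h1, map_endpt] at h'
      exact absurd h' (endpt_ne l)
    · exact absurd h1 h
  · rfl

/-- Lifting of relative homotopies. -/
lemma TFib.exists_homotopy {φ : X ⟶ Y} (hφ : TFib φ) {L : SSet.{u}} (K : L.Subcomplex)
    (f g : L ⟶ X) (hfg : K.ι ≫ f = K.ι ≫ g) (H : L ⊗ Δ[1] ⟶ Y) (h₀ : ι₀ ≫ H = f ≫ φ)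
    (h₁ : ι₁ ≫ H = g ≫ φ) (hK : K.ι ▷ _ ≫ H = fst _ _ ≫ K.ι ≫ f ≫ φ) :
    ∃ H' : L ⊗ Δ[1] ⟶ X, ι₀ ≫ H' = f ∧ ι₁ ≫ H' = g ∧ K.ι ▷ _ ≫ H' = fst _ _ ≫ K.ι ≫ f := by
  obtain ⟨a, ha⟩ := exists_cylBd K f g hfg
  obtain ⟨H', hH, -⟩ := hφ.exists_lift (cylBd K) a H (by
    ext k z
    change φ.app k (a.app k z) = H.app k z.1
    by_cases h : z.1.2 = endpt 1 k
    · rw [(ha k z).1 h, show z.1 = (z.1.1, endpt 1 k) from Prod.ext rfl h]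
      exact (app_congr h₁ k z.1.1).symm
    · rw [(ha k z).2 h]
      obtain h1 | h1 | h1 := z.2
      · exact (app_congr hK k
          ((⟨z.1.1, h1⟩ : (K : SSet.{u}).obj k), z.1.2)).symm
      · rw [show z.1 = (z.1.1, endpt 0 k) from Prod.ext rfl h1]
        exact (app_congr h₀ k z.1.1).symm
      · exact absurd h1 h)
  have hH' : ∀ k (z : (L ⊗ Δ[1]).obj k) (hz : z ∈ (cylBd K).obj k),
      H'.app k z = a.app k ⟨z, hz⟩ := fun k z hz =>
    app_congr hH k (⟨z, hz⟩ : (cylBd K : SSet.{u}).obj k)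
  refine ⟨H', ?_, ?_, ?_⟩
  · ext k x
    exact (hH' k (x, endpt 0 k) (Or.inr (Or.inl rfl))).trans ((ha k _).2 (endpt_ne k))
  · ext k x
    exact (hH' k (x, endpt 1 k) (Or.inr (Or.inr rfl))).trans ((ha k _).1 rfl)
  · ext k ⟨x, θ⟩
    refine (hH' k (x.1, θ) (Or.inl x.2)).trans ?_
    by_cases h : θ = endpt 1 k
    · exact ((ha k _).1 h).trans
        (app_congr hfg k x).symm
    · exact (ha k _).2 h

/-- Homotopic maps of simplicial sets. -/
abbrev Htpc (f g : X ⟶ Y) : Prop := Nonempty (SSet.Homotopy f g)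

lemma htpc_iff {f g : X ⟶ Y} : Htpc f g ↔ ∃ H : X ⊗ Δ[1] ⟶ Y, ι₀ ≫ H = f ∧ ι₁ ≫ H = g := by
  refine ⟨fun ⟨H⟩ => ⟨H.h, H.h₀, H.h₁⟩, fun ⟨H, h₀, h₁⟩ => ⟨⟨H, h₀, h₁, ?_⟩⟩⟩
  ext k x
  exact x.1.2.elim

lemma Htpc.refl (f : X ⟶ Y) : Htpc f f :=
  htpc_iff.2 ⟨fst _ _ ≫ f, rfl, rfl⟩

lemma Htpc.postcomp {Z : SSet.{u}} {f g : X ⟶ Y} (h : Htpc f g) (k : Y ⟶ Z) :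
    Htpc (f ≫ k) (g ≫ k) := by
  obtain ⟨H, rfl, rfl⟩ := htpc_iff.1 h
  exact htpc_iff.2 ⟨H ≫ k, rfl, rfl⟩

lemma Htpc.precomp {Z : SSet.{u}} {f g : X ⟶ Y} (h : Htpc f g) (k : Z ⟶ X) :
    Htpc (k ≫ f) (k ≫ g) := by
  obtain ⟨H, rfl, rfl⟩ := htpc_iff.1 h
  exact htpc_iff.2 ⟨k ▷ _ ≫ H, rfl, rfl⟩

lemma KanComplex.exists_edge {L : SSet.{u}} [KanComplex L] (e e' : Δ[1] ⟶ L)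
    (h : stdSimplex.δ (1 : Fin 2) ≫ e = stdSimplex.δ (1 : Fin 2) ≫ e') :
    ∃ e'' : Δ[1] ⟶ L, stdSimplex.δ (1 : Fin 2) ≫ e'' = stdSimplex.δ (0 : Fin 2) ≫ e ∧
      stdSimplex.δ (0 : Fin 2) ≫ e'' = stdSimplex.δ (0 : Fin 2) ≫ e' := by
  let f : ∀ (j : Fin 3) (_ : j ≠ 0), Δ[1] ⟶ L := fun j _ => if j = 2 then e else e'
  have hf : horn.IsCompatible f := by
    intro j k hj hk hjk
    obtain ⟨rfl, rfl⟩ : j = 1 ∧ k = 2 := by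
      revert j k
      decide
    exact h.symm
  obtain ⟨φ, hφ⟩ := hf.exists_lift_of_kanComplex
  have h1 : stdSimplex.δ (1 : Fin 3) ≫ φ = e' := hφ 1 (by decide)
  have h2 : stdSimplex.δ (2 : Fin 3) ≫ φ = e := hφ 2 (by decide)
  refine ⟨stdSimplex.δ (0 : Fin 3) ≫ φ, ?_, ?_⟩
  · rw [← h2, ← assoc, ← assoc]
    exact congrArg (· ≫ φ)
      (stdSimplex.δ_comp_δ (i := (0 : Fin 2)) (j := (1 : Fin 2)) (by decide)).symm
  · rw [← h1, ← assoc, ← assoc]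
    exact congrArg (· ≫ φ)
      (stdSimplex.δ_comp_δ (i := (0 : Fin 2)) (j := (0 : Fin 2)) (by decide)).symm

lemma htpc_iff_curry {f g : X ⟶ Y} : Htpc f g ↔ ∃ e : Δ[1] ⟶ (ihom X).obj Y,
    stdSimplex.δ (1 : Fin 2) ≫ e = MonoidalClosed.curry (fst X Δ[0] ≫ f) ∧
    stdSimplex.δ (0 : Fin 2) ≫ e = MonoidalClosed.curry (fst X Δ[0] ≫ g) := by
  have h0 : X ◁ stdSimplex.{u}.δ (1 : Fin 2) = fst X Δ[0] ≫ ι₀ := by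
    rw [stdSimplex.δ_one_eq_const]
    rfl
  have h1 : X ◁ stdSimplex.{u}.δ (0 : Fin 2) = fst X Δ[0] ≫ ι₁ := by
    rw [stdSimplex.δ_zero_eq_const]
    rfl
  have hfst : ∀ {Z : SSet.{u}} {a b : X ⟶ Z}, fst X Δ[0] ≫ a = fst X Δ[0] ≫ b → a = b :=
    fun {Z a b} h => by
      have h' := congrArg (lift (𝟙 X) (SSet.const (stdSimplex.obj₀Equiv.symm 0)) ≫ ·) h
      rwa [lift_fst_assoc, lift_fst_assoc, id_comp, id_comp] at h'
  rw [htpc_iff]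
  constructor
  · rintro ⟨H, rfl, rfl⟩
    refine ⟨MonoidalClosed.curry H, ?_, ?_⟩
    · rw [← MonoidalClosed.curry_natural_left, h0, assoc]
    · rw [← MonoidalClosed.curry_natural_left, h1, assoc]
  · rintro ⟨e, he0, he1⟩
    obtain ⟨H, rfl⟩ : ∃ H, e = MonoidalClosed.curry H :=
      ⟨_, (MonoidalClosed.curry_uncurry e).symm⟩
    rw [← MonoidalClosed.curry_natural_left, h0, assoc] at he0
    rw [← MonoidalClosed.curry_natural_left, h1, assoc] at he1
    exact ⟨H, hfst (MonoidalClosed.curry_injective he0),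
      hfst (MonoidalClosed.curry_injective he1)⟩

lemma Htpc.euclidean [KanComplex Y] {f g h : X ⟶ Y} (hfg : Htpc f g) (hfh : Htpc f h) :
    Htpc g h := by
  rw [htpc_iff_curry] at hfg hfh ⊢
  obtain ⟨e, h1, h2⟩ := hfg
  obtain ⟨e', h1', h2'⟩ := hfh
  obtain ⟨e'', h, h'⟩ := KanComplex.exists_edge e e' (h1.trans h1'.symm)
  exact ⟨e'', h.trans h2, h'.trans h2'⟩

lemma Htpc.symm [KanComplex Y] {f g : X ⟶ Y} (h : Htpc f g) : Htpc g f := h.euclidean (.refl f)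

lemma Htpc.trans [KanComplex Y] {f g h : X ⟶ Y} (hfg : Htpc f g) (hgh : Htpc g h) : Htpc f h :=
  hfg.symm.euclidean hgh

/-- Formal properties of homotopy invariants of maps of simplicial sets. -/
structure Formal (P : ∀ {X Y : SSet.{u}}, (X ⟶ Y) → Prop) : Prop where
  tFib {X Y : SSet.{u}} (φ : X ⟶ Y) : TFib φ → P φ
  comp {X Y Z : SSet.{u}} (φ : X ⟶ Y) (ψ : Y ⟶ Z) : P φ → P ψ → P (φ ≫ ψ)
  cancel {X Y Z : SSet.{u}} (a : X ⟶ Y) (c : Y ⟶ Z) (d : Z ⟶ Y) (e : Z ⟶ X) :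
    c ≫ d = 𝟙 Y → (a ≫ c) ≫ e = 𝟙 X → P e → P a

lemma formal_weakEquiv : Formal.{u} WeakEquiv where
  tFib {X Y} φ hφ K hK := by
    obtain ⟨s, hs⟩ := hφ.exists_section
    obtain ⟨H, h0, h1, -⟩ := hφ.exists_homotopy (⊥ : X.Subcomplex) (φ ≫ s) (𝟙 X)
      (Subcomplex.isInitialBot.hom_ext _ _) (fst _ _ ≫ φ)
      (by rw [assoc, hs]; exact (comp_id φ).symm)
      rfl (by ext k x; exact x.1.2.elim)
    have hH : Htpc (φ ≫ s) (𝟙 X) := htpc_iff.2 ⟨H, h0, h1⟩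
    refine ⟨fun g => ⟨s ≫ g, ?_⟩, fun h h' hh => ?_⟩
    · simpa only [assoc, id_comp] using hH.postcomp g
    · have h2 := Htpc.precomp hh s
      rwa [← assoc, ← assoc, hs, id_comp, id_comp] at h2
  comp φ ψ hφ hψ K hK := by
    refine ⟨fun g => ?_, fun h h' hh => (hψ K hK).2 h h' ((hφ K hK).2 _ _ ?_)⟩
    · obtain ⟨h, hh⟩ := (hφ K hK).1 g
      obtain ⟨k, hk⟩ := (hψ K hK).1 h
      refine ⟨k, ?_⟩
      rw [assoc]
      exact (Htpc.precomp hk φ).trans hh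
    · rwa [assoc, assoc] at hh
  cancel a c d e hcd he hP K hK := by
    have key : ∀ H H', Htpc ((a ≫ c) ≫ H) ((a ≫ c) ≫ H') → Htpc (Y := K) H H' := by
      intro H H' hH
      obtain ⟨k, hk⟩ := (hP K hK).1 H
      obtain ⟨k', hk'⟩ := (hP K hK).1 H'
      have h1 := Htpc.precomp hk (a ≫ c)
      have h1' := Htpc.precomp hk' (a ≫ c)
      rw [← assoc, he, id_comp] at h1 h1'
      exact Htpc.trans (Htpc.symm hk) (Htpc.trans (Htpc.precomp (Htpc.trans (Htpc.trans h1 hH) (Htpc.symm h1')) e) hk')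
    refine ⟨fun g => ⟨c ≫ e ≫ g, ?_⟩, fun h h' hh => ?_⟩
    · rw [← assoc, ← assoc, he, id_comp]
      exact Htpc.refl g
    · have h1 := Htpc.precomp (key (d ≫ h) (d ≫ h') (by
        rwa [assoc, assoc, ← assoc c, ← assoc c, hcd,
          id_comp, id_comp])) c
      rwa [← assoc, ← assoc, hcd, id_comp, id_comp] at h1

lemma WeakEquiv.of_comp_eq_id {a : X ⟶ Y} {b : Y ⟶ X} (hab : a ≫ b = 𝟙 X) (ha : WeakEquiv a) :
    WeakEquiv b := by
  refine fun K hK => ⟨fun g => ⟨a ≫ g, (ha K hK).2 _ _ ?_⟩, fun h h' hh => ?_⟩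
  · rw [← assoc, hab, id_comp]
    exact Htpc.refl _
  · have := Htpc.precomp hh a
    rwa [← assoc, ← assoc, hab, id_comp, id_comp] at this

end Simp

namespace Simp

open Simplicial SSet MonoidalCategory CartesianMonoidalCategory

/-! ### Connected components and homotopy groups -/

lemma bijective_of_retract {α β γ : Type*} {a : α → β} {c : β → γ} {d : γ → β} {e : γ → α}
    (hcd : ∀ y, d (c y) = y) (he : ∀ x, e (c (a x)) = x) (h : Function.Bijective e) :
    Function.Bijective a := by
  refine ⟨fun x y hxy => by rw [← he x, ← he y, hxy], fun y => ⟨e (c y), ?_⟩⟩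
  rw [← hcd (a _), h.1 (he (e (c y))), hcd]

variable {X Y : SSet.{u}}

lemma map_const_zero (x : X _⦋0⦌) (θ : ⦋0⦌ ⟶ ⦋0⦌) : X.map θ.op x = x := by
  obtain rfl : θ = 𝟙 _ := SimplexCategory.isTerminalZero.hom_ext _ _
  exact ConcreteCategory.congr_hom (X.map_id _) x

lemma Htpc.mapπ₀_eq {f g : X ⟶ Y} (h : Htpc f g) (x : π₀ X) : mapπ₀ f x = mapπ₀ g x := by
  obtain ⟨H, rfl, rfl⟩ := htpc_iff.1 h
  obtain ⟨x, rfl⟩ := π₀.mk_surjective x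
  have hx : ∀ j : Fin 2, X.δ j (X.σ 0 x) = x := fun j => by
    have h1 : X.σ (0 : Fin 1) ≫ X.δ j = 𝟙 _ := by
      fin_cases j
      · exact X.δ_comp_σ_self
      · exact X.δ_comp_σ_succ
    exact ConcreteCategory.congr_hom h1 x
  let e : (X ⊗ Δ[1] : SSet.{u}) _⦋1⦌ := (X.σ 0 x, stdSimplex.objEquiv.symm (𝟙 _))
  refine π₀.sound (Edge.mk (H.app _ e) ?_ ?_)
  · refine (ConcreteCategory.congr_hom (H.naturality (SimplexCategory.δ 1).op) e).symm.trans ?_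
    refine congrArg (H.app (op ⦋0⦌)) (Prod.ext (hx 1) ?_)
    exact app_congr stdSimplex.δ_one_eq_const.{u} _ (stdSimplex.objEquiv.symm (𝟙 _))
  · refine (ConcreteCategory.congr_hom (H.naturality (SimplexCategory.δ 0).op) e).symm.trans ?_
    refine congrArg (H.app (op ⦋0⦌)) (Prod.ext (hx 0) ?_)
    exact app_congr stdSimplex.δ_zero_eq_const.{u} _ (stdSimplex.objEquiv.symm (𝟙 _))

lemma TFib.exists_htpc {φ : X ⟶ Y} (hφ : TFib φ) {s : Y ⟶ X} (hs : s ≫ φ = 𝟙 Y) :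
    Htpc (φ ≫ s) (𝟙 X) := by
  obtain ⟨H, h0, h1, -⟩ := hφ.exists_homotopy (⊥ : X.Subcomplex) (φ ≫ s) (𝟙 X)
    (Subcomplex.isInitialBot.hom_ext _ _) (fst _ _ ≫ φ)
    (by rw [assoc, hs]; exact (comp_id φ).symm)
    rfl (by ext k x; exact x.1.2.elim)
  exact htpc_iff.2 ⟨H, h0, h1⟩

lemma mapπ₀_of_eq_id {f : X ⟶ X} (hf : f = 𝟙 X) (x : π₀ X) : mapπ₀ f x = x := by
  rw [hf, mapπ₀_id_apply]

lemma formal_π₀ : Formal.{u} fun φ => Function.Bijective (mapπ₀ φ) where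
  tFib {X Y} φ hφ := by
    obtain ⟨s, hs⟩ := hφ.exists_section
    refine Function.bijective_iff_has_inverse.2 ⟨mapπ₀ s, fun x => ?_, fun y => ?_⟩
    · rw [← mapπ₀_comp_apply, (hφ.exists_htpc hs).mapπ₀_eq, mapπ₀_id_apply]
    · rw [← mapπ₀_comp_apply, mapπ₀_of_eq_id hs]
  comp φ ψ hφ hψ := by
    rw [show mapπ₀ (φ ≫ ψ) = mapπ₀ ψ ∘ mapπ₀ φ from funext (mapπ₀_comp_apply φ ψ)]
    exact hψ.comp hφ
  cancel a c d e hcd he h := by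
    refine bijective_of_retract (c := mapπ₀ c) (d := mapπ₀ d) (fun y => ?_) (fun x => ?_) h
    · rw [← mapπ₀_comp_apply, mapπ₀_of_eq_id hcd]
    · rw [← mapπ₀_comp_apply a c, ← mapπ₀_comp_apply, mapπ₀_of_eq_id he]

section HomotopyGroup

variable {n : ℕ}

/-- The image of a pointed simplex. -/
def ptMap (φ : X ⟶ Y) {x : X _⦋0⦌} {y : Y _⦋0⦌} (h : φ.app _ x = y) (f : X.PtSimplex n x) :
    Y.PtSimplex n y :=
  f.comp (RelativeMorphism.ofSimplex₀ φ x y h) rfl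

/-- The map of homotopy groups. -/
def hg (φ : X ⟶ Y) {x : X _⦋0⦌} {y : Y _⦋0⦌} (h : φ.app _ x = y) :
    HomotopyGroup X n x → HomotopyGroup Y n y :=
  fun c => c.postcomp (RelativeMorphism.ofSimplex₀ φ x y h) rfl

lemma hg_comp {Z : SSet.{u}} (φ : X ⟶ Y) (ψ : Y ⟶ Z) {x : X _⦋0⦌} {y : Y _⦋0⦌} {z : Z _⦋0⦌}
    (h : φ.app _ x = y) (h' : ψ.app _ y = z) (h'' : (φ ≫ ψ).app _ x = z)
    (c : HomotopyGroup X n x) : hg (φ ≫ ψ) h'' c = hg ψ h' (hg φ h c) := by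
  obtain ⟨f, rfl⟩ := c.eq_homotopyClass
  exact congrArg RelativeMorphism.homotopyClass (RelativeMorphism.ext (assoc _ _ _).symm)

lemma hg_of_eq_id {φ : X ⟶ X} (hφ : φ = 𝟙 X) {x : X _⦋0⦌} (h : φ.app _ x = x)
    (c : HomotopyGroup X n x) : hg φ h c = c := by
  subst hφ
  obtain ⟨f, rfl⟩ := c.eq_homotopyClass
  exact congrArg RelativeMorphism.homotopyClass (RelativeMorphism.ext (comp_id _))

lemma hg_bijective {φ : X ⟶ Y} {x : X _⦋0⦌} {y : Y _⦋0⦌} (h : φ.app _ x = y)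
    (hs : ∀ g : Y.PtSimplex n y, ∃ f : X.PtSimplex n x, ptMap φ h f = g)
    (hi : ∀ f g : X.PtSimplex n x, (ptMap φ h f).Homotopy (ptMap φ h g) →
      Nonempty (f.Homotopy g)) : Function.Bijective (hg (n := n) φ h) := by
  choose s hs using hs
  refine Function.bijective_iff_has_inverse.2 ⟨Quot.lift (fun g => (s g).homotopyClass)
    fun g g' ⟨H⟩ => ?_, fun c => ?_, fun c => ?_⟩
  · obtain ⟨H'⟩ := hi (s g) (s g') (by rw [hs, hs]; exact H)
    exact H'.eq
  · obtain ⟨f, rfl⟩ := c.eq_homotopyClass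
    obtain ⟨H⟩ := hi (s (ptMap φ h f)) f (.ofEq (hs _))
    exact H.eq
  · obtain ⟨g, rfl⟩ := c.eq_homotopyClass
    exact congrArg RelativeMorphism.homotopyClass (hs g)

lemma formal_hg : Formal.{u} fun φ => ∀ x y (h : φ.app _ x = y),
    Function.Bijective (hg (n := n) φ h) where
  tFib {X Y} φ hφ x y h := by
    subst h
    refine hg_bijective rfl (fun g => ?_) fun f g H => ?_
    · obtain ⟨l, h1, h2⟩ := hφ.exists_lift (boundary n) (SSet.const x) g.map (by
        rw [g.comm]; ext k z; exact ConcreteCategory.congr_hom (φ.naturality _) x)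
      exact ⟨⟨l, h1.trans rfl⟩, RelativeMorphism.ext h2⟩
    · obtain ⟨H', h0, h1, h2⟩ := hφ.exists_homotopy (boundary n) f.map g.map
        (f.comm.trans g.comm.symm) H.h H.h₀ H.h₁ (H.rel.trans (by
          rw [← assoc (boundary n).ι, f.comm]
          ext k z; exact (ConcreteCategory.congr_hom (φ.naturality _) x).symm))
      exact ⟨⟨H', h0, h1, h2.trans (by rw [f.comm])⟩⟩
  comp {X Y Z} φ ψ hφ hψ x z h := by
    rw [show hg (n := n) (φ ≫ ψ) h = hg ψ h ∘ hg φ rfl from funext (hg_comp φ ψ rfl h h)]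
    exact (hψ _ _ _).comp (hφ _ _ _)
  cancel {X Y Z} a c d e hcd he hP x y h := by
    subst h
    have h1 : e.app _ (c.app _ (a.app _ x)) = x := app_congr he _ x
    have h2 : d.app _ (c.app _ (a.app _ x)) = a.app _ x := app_congr hcd _ _
    refine bijective_of_retract (c := hg c rfl) (d := hg d h2) (fun v => ?_) (fun v => ?_)
      (hP _ _ h1)
    · exact (hg_comp c d rfl h2 h2 v).symm.trans (hg_of_eq_id hcd _ v)
    · refine (congrArg (hg e h1) (hg_comp a c rfl rfl rfl v).symm).trans ?_
      exact (hg_comp (a ≫ c) e rfl h1 h1 v).symm.trans (hg_of_eq_id he _ v)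

end HomotopyGroup

/-! ### Discrete simplicial sets -/

section Disc

variable {S : Type u}

lemma disc_stdSimplex {m : ℕ} (φ : Δ[m] ⟶ disc S) {k l : SimplexCategoryᵒᵖ} (x : Δ[m].obj k)
    (y : Δ[m].obj l) : φ.app k x = φ.app l y := by
  have h : ∀ {k : SimplexCategoryᵒᵖ} (x : Δ[m].obj k),
      φ.app k x = φ.app _ (stdSimplex.objEquiv.symm (𝟙 ⦋m⦌)) := fun {k} x => by
    have h1 := ConcreteCategory.congr_hom (φ.naturality (stdSimplex.objEquiv x).op)
      (stdSimplex.objEquiv.symm (𝟙 ⦋m⦌))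
    refine Eq.trans (congrArg (φ.app k) ?_) h1
    exact stdSimplex.objEquiv.injective (comp_id _).symm
  rw [h x, h y]

lemma disc_cyl (φ : X ⊗ Δ[1] ⟶ disc S) (k : SimplexCategoryᵒᵖ) (z : (X ⊗ Δ[1]).obj k) :
    φ.app k z = (ι₀ ≫ φ).app k z.1 := by
  let v : k ⟶ op ⦋0⦌ := (SimplexCategory.const ⦋0⦌ k.unop 0).op
  have h1 : ∀ z, φ.app k z = φ.app _ ((X ⊗ Δ[1]).map v z) := fun z =>
    (ConcreteCategory.congr_hom (φ.naturality v) z).symm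
  have h2 : ∀ y : (Δ[1] : SSet.{u}) _⦋0⦌, φ.app _ (X.map v z.1, y) =
      (lift (SSet.const (X.map v z.1)) (𝟙 _) ≫ φ).app _ y := fun y =>
    congrArg (φ.app _) (Prod.ext (map_const_zero _ _).symm rfl)
  refine (h1 z).trans (Eq.trans ?_ (h1 _).symm)
  refine (h2 _).trans (Eq.trans ?_ (h2 _).symm)
  exact disc_stdSimplex (lift (SSet.const (X.map v z.1)) (𝟙 _) ≫ φ) (Δ[1].map v z.2)
    (Δ[1].map v (endpt 0 k))

lemma disc_ptSimplex {n : ℕ} {x : X _⦋0⦌} (f : X.PtSimplex (n + 1) x) (φ : X ⟶ disc S) :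
    f.map ≫ φ = SSet.const (φ.app _ x) := by
  ext k z
  let v : (Δ[n + 1] : SSet.{u}) _⦋0⦌ := stdSimplex.objEquiv.symm (SimplexCategory.const _ _ 0)
  have hv : v ∈ (boundary (n + 1)).obj _ := by
    rw [boundary_obj_eq_univ 0 (n + 1)]
    trivial
  refine (disc_stdSimplex (f.map ≫ φ) z v).trans ?_
  refine congrArg (φ.app (op ⦋0⦌)) ((f.map_eq_of_mem v hv).trans ?_)
  exact map_const_zero x _

lemma hg_bijective_pullback {S' : Type u} {n : ℕ} (φ : X ⟶ disc S) (f : S' → S)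
    (x : (Limits.pullback φ (discMap f)) _⦋0⦌) :
    Function.Bijective (hg (n := n + 1) (Limits.pullback.fst φ (discMap f)) (x := x) rfl) := by
  have hx : φ.app _ ((Limits.pullback.fst φ (discMap f)).app _ x) =
      f ((Limits.pullback.snd φ (discMap f)).app _ x) :=
    app_congr (Limits.pullback.condition (f := φ) (g := discMap f)) _ x
  refine hg_bijective rfl (fun g => ?_) fun g g' H => ?_
  · refine ⟨⟨Limits.pullback.lift g.map
      (SSet.const ((Limits.pullback.snd φ (discMap f)).app _ x)) ?_, ?_⟩, ?_⟩
    · rw [disc_ptSimplex g φ, hx]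
      rfl
    · refine Limits.pullback.hom_ext ?_ ?_
      · rw [assoc, Limits.pullback.lift_fst, g.comm]
        ext k z
        exact (ConcreteCategory.congr_hom
          ((Limits.pullback.fst φ (discMap f)).naturality _) x).symm
      · rw [assoc, Limits.pullback.lift_snd]
        ext k z
        exact (ConcreteCategory.congr_hom
          ((Limits.pullback.snd φ (discMap f)).naturality _) x).symm
    · exact RelativeMorphism.ext (Limits.pullback.lift_fst _ _ _)
  · refine ⟨⟨Limits.pullback.lift H.h
      (SSet.const ((Limits.pullback.snd φ (discMap f)).app _ x)) ?_, ?_, ?_, ?_⟩⟩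
    · ext k z
      refine (disc_cyl (H.h ≫ φ) k z).trans ?_
      rw [← assoc, H.h₀]
      exact (app_congr (disc_ptSimplex (ptMap _ rfl g) φ) k z.1).trans hx
    · refine Limits.pullback.hom_ext ?_ ?_
      · rw [assoc, Limits.pullback.lift_fst, H.h₀]
        rfl
      · rw [assoc, Limits.pullback.lift_snd, disc_ptSimplex]
        rfl
    · refine Limits.pullback.hom_ext ?_ ?_
      · rw [assoc, Limits.pullback.lift_fst, H.h₁]
        rfl
      · rw [assoc, Limits.pullback.lift_snd, disc_ptSimplex]
        rfl
    · refine Limits.pullback.hom_ext ?_ ?_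
      · rw [assoc, Limits.pullback.lift_fst, H.rel]
        ext k z
        exact (ConcreteCategory.congr_hom
          ((Limits.pullback.fst φ (discMap f)).naturality _) x).symm
      · rw [assoc, Limits.pullback.lift_snd]
        ext k z
        exact (ConcreteCategory.congr_hom
          ((Limits.pullback.snd φ (discMap f)).naturality _) x).symm

open HomotopicalAlgebra modelCategoryQuillen in
lemma fibration_disc [KanComplex X] (φ : X ⟶ disc S) : Fibration φ := by
  rw [fibration_iff]
  intro _ _ i hi
  simp only [J, MorphismProperty.iSup_iff] at hi
  obtain ⟨n, ⟨i⟩⟩ := hi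
  refine ⟨fun {a b} sq => ?_⟩
  obtain ⟨l, hl⟩ := KanComplex.hornFilling a
  refine ⟨⟨⟨l, hl.symm, ?_⟩⟩⟩
  obtain ⟨v⟩ := TDGA.horn_vertex.{u} i
  ext k z
  refine (disc_stdSimplex (l ≫ φ) z v.1).trans (Eq.trans ?_ (disc_stdSimplex b z v.1).symm)
  exact (congrArg (φ.app _) (app_congr hl _ v)).symm.trans (app_congr sq.w _ v)

end Disc

end Simp

namespace TDGA

open Simplicial Simp

/-! ### Normalised cycles in a simplicial resolution -/

section Normalised

variable (R : SimplicialObject (TDGA T))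

/-- The face maps. -/
abbrev face {k : ℕ} (j : Fin (k + 2)) :
    (R _⦋k + 1⦌).carrier →ₐ[ℚ] (R _⦋k⦌).carrier :=
  (R.δ j).toAlgHom

/-- The degeneracy maps. -/
abbrev degen {k : ℕ} (j : Fin (k + 1)) :
    (R _⦋k⦌).carrier →ₐ[ℚ] (R _⦋k + 1⦌).carrier :=
  (R.σ j).toAlgHom

/-- All faces vanish. -/
def Flat (k : ℕ) (z : (R _⦋k⦌).carrier) : Prop :=
  match k with
  | 0 => True
  | _ + 1 => ∀ j, face R j z = 0

/-- All faces except the first one vanish. -/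
def SemiFlat (k : ℕ) (z : (R _⦋k + 1⦌).carrier) : Prop :=
  ∀ j : Fin (k + 1), face R j.succ z = 0

/-- Boundaries in the normalised complex of cycles. -/
def NBd (k i : ℕ) (z : (R _⦋k⦌).carrier) : Prop :=
  ∃ w ∈ (R _⦋k + 1⦌).cycles i, SemiFlat R k w ∧ face R 0 w = z

variable {R}

lemma Flat.sub {k : ℕ} {z z' : (R _⦋k⦌).carrier} (h : Flat R k z)
    (h' : Flat R k z') : Flat R k (z - z') := by
  cases k with
  | zero => trivial
  | succ k => exact fun j => by rw [map_sub, h j, h' j, sub_zero]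

lemma SemiFlat.sub {k : ℕ} {z z' : (R _⦋k + 1⦌).carrier} (h : SemiFlat R k z)
    (h' : SemiFlat R k z') : SemiFlat R k (z - z') := fun j => by
  rw [map_sub, h j, h' j, sub_zero]

lemma SemiFlat.face_zero {k : ℕ} {z : (R _⦋k + 1⦌).carrier}
    (h : SemiFlat R k z) : Flat R k (face R 0 z) := by
  cases k with
  | zero => trivial
  | succ k =>
    intro j
    have h1 := congr_toAlgHom (R.δ_comp_δ (Fin.zero_le j)) z
    exact h1.symm.trans ((congrArg (face R 0) (h j)).trans (map_zero _))

lemma SemiFlat.flat {k : ℕ} {z : (R _⦋k + 1⦌).carrier} (h : SemiFlat R k z)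
    (h0 : face R 0 z = 0) : Flat R (k + 1) z := fun j => by
  obtain rfl | ⟨j, rfl⟩ := j.eq_zero_or_eq_succ
  · exact h0
  · exact h j

lemma Flat.semiFlat {k : ℕ} {z : (R _⦋k + 1⦌).carrier} (h : Flat R (k + 1) z) :
    SemiFlat R k z := fun j => h j.succ

lemma SemiFlat.d {k : ℕ} {z : (R _⦋k + 1⦌).carrier} (h : SemiFlat R k z) :
    SemiFlat R k ((R.obj _).d z) := fun j => by
  rw [Hom.map_d, h j, map_zero]

lemma Flat.map_eq_zero {k : ℕ} {z : (R _⦋k⦌).carrier} (h : Flat R k z)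
    {l : SimplexCategory} (b : l ⟶ ⦋k⦌) (hb : ∃ i, ∀ x, b.toOrderHom x ≠ i) :
    (R.map b.op) z = 0 := by
  obtain ⟨i, hi⟩ := hb
  cases k with
  | zero => exact absurd (Subsingleton.elim (α := Fin 1) _ _) (hi 0)
  | succ k =>
    obtain ⟨b', rfl⟩ := SimplexCategory.eq_comp_δ_of_not_surjective' b i hi
    refine (congr_toAlgHom (R.map_comp (SimplexCategory.δ i).op b'.op) z).trans ?_
    exact (congrArg (R.map b'.op).toAlgHom (h i)).trans (map_zero _)

lemma res_horn_eq_zero {k : ℕ} {z : (R _⦋k + 1⦌).carrier} :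
    (cot.res R (SSet.horn (k + 1) 0).ι) z = 0 ↔ SemiFlat R k z := by
  constructor
  · intro h j
    have hj : (SSet.stdSimplex.objEquiv.symm (SimplexCategory.δ j.succ) :
        (Δ[k + 1] : SSet.{u}).obj (op ⦋k⦌)) ∈ (SSet.horn (k + 1) 0).obj _ := by
      rw [SSet.mem_horn_iff_notMem_range]
      refine ⟨j.succ, Fin.succ_ne_zero j, ?_⟩
      rintro ⟨x, hx⟩
      exact Fin.succAbove_ne j.succ x hx
    have h1 := cot.π_res R (SSet.horn (k + 1) 0).ι ⟨_, hj⟩ z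
    rw [h, map_zero] at h1
    exact h1.symm
  · intro h
    refine cot.ext fun l x => (cot.π_res R _ x z).trans (Eq.trans ?_ (map_zero _).symm)
    obtain ⟨j, hj0, hj⟩ := (SSet.mem_horn_iff_notMem_range x.1 0).1 x.2
    obtain ⟨j, rfl⟩ := Fin.exists_succ_eq.2 hj0
    obtain ⟨b, hb⟩ := SimplexCategory.eq_comp_δ_of_not_surjective'
      (SSet.stdSimplex.objEquiv x.1) j.succ fun y hy => hj ⟨y, hy⟩
    refine (congr_toAlgHom (congrArg (fun θ => R.map (Quiver.Hom.op θ)) hb) z).trans ?_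
    refine (congr_toAlgHom (R.map_comp (SimplexCategory.δ j.succ).op b.op) z).trans ?_
    exact (congrArg (R.map b.op).toAlgHom (h j)).trans (map_zero _)

lemma SemiFlat.exists_d_eq (hR : HConst R)
    {k i : ℕ} {z : (R _⦋k + 1⦌).carrier} (h : SemiFlat R k z)
    (hz : z ∈ (R _⦋k + 1⦌).cycles i) :
    ∃ b ∈ (R _⦋k + 1⦌).deg (i + 1), (R.obj _).d b = z ∧ SemiFlat R k b := by
  obtain ⟨b, hb, h1, h2⟩ := (isTF_res_horn hR 0).2 i z hz 0 (zero_mem _)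
    ((map_zero _).trans (res_horn_eq_zero.2 h).symm)
  exact ⟨b, hb, h1, res_horn_eq_zero.1 h2⟩

open Classical in
lemma ReedyFib.exists_face_zero (hF : ReedyFib R) {k i : ℕ}
    {y : (R _⦋k⦌).carrier} (hy : y ∈ (R _⦋k⦌).deg (i + 1))
    (h : Flat R k y) : ∃ e ∈ (R _⦋k + 1⦌).deg (i + 1),
      SemiFlat R k e ∧ face R 0 e = y := by
  let val (l : SimplexCategoryᵒᵖ) (a : l.unop ⟶ ⦋k + 1⦌) : (R.obj l).deg (i + 1) :=
    if ∀ x, a.toOrderHom x ≠ 0 then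
      ⟨(R.map (a ≫ SimplexCategory.σ 0).op) y, Hom.map_deg _ hy⟩ else 0
  let σ : (SSet.boundary (k + 1) : SSet.{u}) ⟶ degSSet R (i + 1) :=
    { app l := ↾fun a => val l (SSet.stdSimplex.objEquiv a.1)
      naturality l l' θ := by
        ext a
        obtain ⟨a, ha⟩ := a
        obtain ⟨a, rfl⟩ := SSet.stdSimplex.objEquiv.symm.surjective a
        refine Subtype.ext ?_
        change (val l' (θ.unop ≫ a)).1 = (R.map θ) (val l a).1
        by_cases h1 : ∀ x, a.toOrderHom x ≠ 0
        · have h2 : ∀ x, (θ.unop ≫ a).toOrderHom x ≠ 0 := fun x => h1 _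
          refine (congrArg Subtype.val (if_pos h2)).trans
            (Eq.trans ?_ (congrArg (fun v => (R.map θ) (Subtype.val v)) (if_pos h1)).symm)
          exact congr_toAlgHom (R.map_comp (a ≫ SimplexCategory.σ 0).op θ) y
        · refine Eq.trans ?_
            (congrArg (fun v => (R.map θ) (Subtype.val v)) (if_neg h1)).symm
          refine Eq.trans ?_ (map_zero _).symm
          by_cases h2 : ∀ x, (θ.unop ≫ a).toOrderHom x ≠ 0
          · refine (congrArg Subtype.val (if_pos h2)).trans (h.map_eq_zero _ ?_)
            rw [SSet.mem_boundary_iff_notMem_range] at ha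
            obtain ⟨j, hj⟩ := ha
            obtain ⟨j, rfl⟩ := Fin.exists_succ_eq.2 (fun hj0 : j = 0 => h1 fun x hx =>
              hj ⟨x, hx.trans hj0.symm⟩)
            refine ⟨j, fun x hx => hj ⟨θ.unop.toOrderHom x, ?_⟩⟩
            obtain ⟨c, hc⟩ := Fin.exists_succ_eq.2 (h2 x)
            have h3 : (0 : Fin (k + 1)).predAbove ((θ.unop ≫ a).toOrderHom x) = j := hx
            rw [← hc, Fin.predAbove_zero_succ] at h3
            exact hc.symm.trans (congrArg Fin.succ h3)
          · exact congrArg Subtype.val (if_neg h2) }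
  obtain ⟨τ, hτ⟩ := hF i (k + 1) σ
  obtain ⟨e, rfl⟩ := SSet.yonedaEquiv.symm.surjective τ
  have key : ∀ j : Fin (k + 2), face R j e.1 = (val _ (SimplexCategory.δ j)).1 := fun j => by
    have hj : (SSet.stdSimplex.objEquiv.symm (SimplexCategory.δ j) :
        (Δ[k + 1] : SSet.{u}).obj (op ⦋k⦌)) ∈ (SSet.boundary (k + 1)).obj _ := by
      rw [SSet.mem_boundary_iff_notMem_range]
      exact ⟨j, fun ⟨x, hx⟩ => Fin.succAbove_ne j x hx⟩
    exact congrArg Subtype.val (app_congr hτ _ ⟨_, hj⟩)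
  refine ⟨e.1, e.2, fun j => (key _).trans (congrArg Subtype.val (if_neg ?_)), (key 0).trans
    ((congrArg Subtype.val (if_pos fun x => Fin.succAbove_ne 0 x)).trans ?_)⟩
  · intro h0
    exact h0 0 (Fin.succAbove_ne_zero_zero (Fin.succ_ne_zero j))
  · refine (congr_toAlgHom (congrArg (fun θ => R.map (Quiver.Hom.op θ))
      (SimplexCategory.δ_comp_σ_self (i := (0 : Fin (k + 1))))) y).trans ?_
    exact congr_toAlgHom (R.map_id _) y

lemma NBd.sub {k i : ℕ} {z z' : (R _⦋k⦌).carrier} (h : NBd R k i z)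
    (h' : NBd R k i z') : NBd R k i (z - z') := by
  obtain ⟨w, hw, hw', rfl⟩ := h
  obtain ⟨v, hv, hv', rfl⟩ := h'
  exact ⟨w - v, sub_mem hw hv, hw'.sub hv', map_sub _ _ _⟩

lemma NBd.zero (k i : ℕ) : NBd R k i 0 :=
  ⟨0, zero_mem _, fun j => map_zero _, map_zero _⟩

/-- An additive map from the normalised cycles to a group, which is surjective and has the
boundaries as its kernel. -/
structure IsClassMap (R : SimplicialObject (TDGA T)) (k i : ℕ) {G : Type*} [AddCommGroup G]
    (Φ : (R _⦋k⦌).carrier → G) : Prop where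
  sub : ∀ z ∈ (R _⦋k⦌).cycles i, ∀ z' ∈ (R _⦋k⦌).cycles i,
    Flat R k z → Flat R k z' → Φ (z - z') = Φ z - Φ z'
  ker : ∀ z ∈ (R _⦋k⦌).cycles i, Flat R k z → (Φ z = 0 ↔ NBd R k i z)
  surj : ∀ g, ∃ z ∈ (R _⦋k⦌).cycles i, Flat R k z ∧ Φ z = g

/-- The relation between normalised cycles of adjacent bidegrees. -/
def Zig (R : SimplicialObject (TDGA T)) (k i : ℕ) (z : (R _⦋k + 1⦌).carrier)
    (z' : (R _⦋k⦌).carrier) : Prop :=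
  ∃ b ∈ (R _⦋k + 1⦌).deg (i + 1), (R.obj _).d b = z ∧ SemiFlat R k b ∧
    face R 0 b = z'

lemma Zig.sub {k i : ℕ} {z w : (R _⦋k + 1⦌).carrier}
    {z' w' : (R _⦋k⦌).carrier} (h : Zig R k i z z') (h' : Zig R k i w w') :
    Zig R k i (z - w) (z' - w') := by
  obtain ⟨b, hb, rfl, hb', rfl⟩ := h
  obtain ⟨c, hc, rfl, hc', rfl⟩ := h'
  exact ⟨b - c, sub_mem hb hc, map_sub _ _ _, hb'.sub hc', map_sub _ _ _⟩

lemma Zig.mem_cycles {k i : ℕ} {z : (R _⦋k + 1⦌).carrier}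
    {z' : (R _⦋k⦌).carrier} (h : Zig R k i z z') (hz : Flat R (k + 1) z) :
    z' ∈ (R _⦋k⦌).cycles (i + 1) := by
  obtain ⟨b, hb, rfl, hb', rfl⟩ := h
  refine ⟨Hom.map_deg _ hb, ?_⟩
  change CDGA.d _ _ = 0
  rw [← Hom.map_d]
  exact hz 0

lemma Zig.flat {k i : ℕ} {z : (R _⦋k + 1⦌).carrier}
    {z' : (R _⦋k⦌).carrier} (h : Zig R k i z z') : Flat R k z' := by
  obtain ⟨b, hb, rfl, hb', rfl⟩ := h
  exact hb'.face_zero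

lemma Zig.nBd_iff (hR : HConst R)
    (hF : ReedyFib R) {k i : ℕ} {z : (R _⦋k + 1⦌).carrier}
    {z' : (R _⦋k⦌).carrier} (h : Zig R k i z z') :
    NBd R k (i + 1) z' ↔ NBd R (k + 1) i z := by
  obtain ⟨b, hb, rfl, hb', rfl⟩ := h
  constructor
  · rintro ⟨w, hw, hw', hwb⟩
    obtain ⟨e, he, he', heb⟩ := hF.exists_face_zero (y := b - w) (sub_mem hb hw.1)
      ((hb'.sub hw').flat (by rw [map_sub, hwb, sub_self]))
    refine ⟨_, d_mem_cycles he, he'.d, ?_⟩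
    rw [Hom.map_d, heb, map_sub, show (R.obj _).d w = 0 from hw.2, sub_zero]
  · rintro ⟨c, hc, hc', hcb⟩
    obtain ⟨e, he, rfl, he'⟩ := hc'.exists_d_eq hR hc
    refine ⟨b - face R 0 e, ⟨sub_mem hb (Hom.map_deg _ he), ?_⟩,
      hb'.sub he'.face_zero.semiFlat, ?_⟩
    · change CDGA.d _ _ = 0
      rw [map_sub, ← Hom.map_d, hcb, sub_self]
    · rw [map_sub, he'.face_zero 0, sub_zero]

lemma exists_isClassMap (hR : HConst R)
    (hF : ReedyFib R) {G : ℕ → Type*} [∀ i, AddCommGroup (G i)]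
    (e : ∀ i, (R _⦋0⦌).H i ≃+ G i) :
    ∀ k i N, k + i = N → ∃ Φ : (R _⦋k⦌).carrier → G N, IsClassMap R k i Φ := by
  classical
  intro k
  induction k with
  | zero =>
    rintro i _ rfl
    rw [Nat.zero_add]
    refine ⟨fun z => if hz : z ∈ (R _⦋0⦌).cycles i then
      e i (Submodule.Quotient.mk ⟨z, hz⟩) else 0, ⟨fun z hz z' hz' _ _ => ?_, fun z hz _ => ?_,
        fun g => ?_⟩⟩
    · rw [dif_pos hz, dif_pos hz', dif_pos (sub_mem hz hz'), ← map_sub]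
      rfl
    · rw [dif_pos hz, EmbeddingLike.map_eq_zero_iff, homology_mk_eq_zero]
      constructor
      · rintro ⟨b, hb, hbz⟩
        obtain ⟨c, hc, hc', hcb⟩ := hF.exists_face_zero hb trivial
        refine ⟨_, d_mem_cycles hc, hc'.d, ?_⟩
        rw [Hom.map_d, hcb, hbz]
      · rintro ⟨w, hw, hw', rfl⟩
        obtain ⟨v, hv, rfl⟩ := (quasiIso_iff.1 (hR (SimplexCategory.δ (1 : Fin 2)).op)).1 i w hw 0
          (zero_mem _) ((map_zero _).trans (hw' 0).symm)
        exact ⟨_, Hom.map_deg (R.δ 0) hv, (Hom.map_d _ _).symm⟩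
    · obtain ⟨z, hz⟩ := Submodule.Quotient.mk_surjective _ ((e i).symm g)
      refine ⟨z.1, z.2, trivial, ?_⟩
      rw [dif_pos z.2, Subtype.coe_eta, hz, AddEquiv.apply_symm_apply]
  | succ k ih =>
    rintro i N hN
    obtain ⟨Φ, hΦ⟩ := ih (i + 1) N (by omega)
    have hex : ∀ z : (R _⦋k + 1⦌).carrier, ∃ z',
        z ∈ (R _⦋k + 1⦌).cycles i → Flat R (k + 1) z → Zig R k i z z' := by
      intro z
      by_cases h : z ∈ (R _⦋k + 1⦌).cycles i ∧ Flat R (k + 1) z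
      · obtain ⟨b, hb, hbz, hb'⟩ := h.2.semiFlat.exists_d_eq hR h.1
        exact ⟨_, fun _ _ => ⟨b, hb, hbz, hb', rfl⟩⟩
      · exact ⟨0, fun h1 h2 => absurd ⟨h1, h2⟩ h⟩
    choose c hc using hex
    have hΦc : ∀ z ∈ (R _⦋k + 1⦌).cycles i, Flat R (k + 1) z →
        ∀ z', Zig R k i z z' → Φ (c z) = Φ z' := fun z hz hz0 z' h => by
      have h1 := hc z hz hz0
      have h2 := (hΦ.ker _ (sub_mem (h1.mem_cycles hz0) (h.mem_cycles hz0))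
        (h1.flat.sub h.flat)).2 (((h1.sub h).nBd_iff hR hF).2 (by rw [sub_self]; exact .zero _ _))
      rwa [hΦ.sub _ (h1.mem_cycles hz0) _ (h.mem_cycles hz0) h1.flat h.flat, sub_eq_zero] at h2
    refine ⟨fun z => Φ (c z), ⟨fun z hz z' hz' h h' => ?_, fun z hz h => ?_, fun g => ?_⟩⟩
    · have h1 := hc z hz h
      have h2 := hc z' hz' h'
      rw [hΦc _ (sub_mem hz hz') (h.sub h') _ (h1.sub h2),
        hΦ.sub _ (h1.mem_cycles h) _ (h2.mem_cycles h') h1.flat h2.flat]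
    · have h1 := hc z hz h
      rw [hΦ.ker _ (h1.mem_cycles h) h1.flat, h1.nBd_iff hR hF]
    · obtain ⟨z', hz', h, rfl⟩ := hΦ.surj g
      obtain ⟨b, hb, hb', rfl⟩ := hF.exists_face_zero hz'.1 h
      have hfl : Flat R (k + 1) ((R.obj _).d b) := hb'.d.flat (by rw [Hom.map_d]; exact hz'.2)
      exact ⟨_, d_mem_cycles hb, hfl, hΦc _ (d_mem_cycles hb) hfl _ ⟨b, hb, rfl, hb', rfl⟩⟩

lemma Flat.face_degen {n : ℕ} {y : (R _⦋n + 1⦌).carrier} (h : Flat R (n + 1) y)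
    (t : Fin (n + 2)) (j : Fin (n + 3)) (hj : j ≠ t.castSucc) (hj' : j ≠ t.succ) :
    face R j (degen R t y) = 0 := by
  obtain h1 | h1 := lt_or_gt_of_ne hj
  · obtain ⟨t, rfl⟩ := t.eq_succ_of_ne_zero (by rintro rfl; exact absurd h1 (Fin.not_lt_zero _))
    obtain ⟨j, rfl⟩ := j.eq_castSucc_of_ne_last (Fin.ne_last_of_lt h1)
    refine (congr_toAlgHom (R.δ_comp_σ_of_le (i := j) (j := t) (by
      rw [Fin.lt_def] at h1; rw [Fin.le_def]; simp at h1 ⊢; omega)) y).trans ?_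
    exact (congrArg (degen R t) (h j)).trans (map_zero _)
  · have h2 : t.succ < j := lt_of_le_of_ne (Fin.castSucc_lt_iff_succ_le.1 h1) hj'.symm
    obtain ⟨t, rfl⟩ := t.eq_castSucc_of_ne_last (by
      rintro rfl; exact absurd h2 (Fin.not_lt.2 (Fin.le_last _)))
    obtain ⟨j, rfl⟩ := j.eq_succ_of_ne_zero (Fin.ne_zero_of_lt h2)
    refine (congr_toAlgHom (R.δ_comp_σ_of_gt (i := j) (j := t) (by
      rw [Fin.lt_def] at h2 ⊢; simp at h2 ⊢; omega)) y).trans ?_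
    exact (congrArg (degen R t) (h j)).trans (map_zero _)

lemma face_castSucc_degen {n : ℕ} (y : (R _⦋n⦌).carrier) (t : Fin (n + 1)) :
    face R t.castSucc (degen R t y) = y := congr_toAlgHom R.δ_comp_σ_self y

lemma face_succ_degen {n : ℕ} (y : (R _⦋n⦌).carrier) (t : Fin (n + 1)) :
    face R t.succ (degen R t y) = y := congr_toAlgHom R.δ_comp_σ_succ y

/-- A normalised cycle which is the only nonzero face of a cycle is a boundary. -/
lemma nBd_of_face {n i : ℕ} (t : Fin (n + 3)) (w : (R _⦋n + 2⦌).carrier)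
    (hw : w ∈ (R _⦋n + 2⦌).cycles i) (h : ∀ j, j ≠ t → face R j w = 0)
    (hf : Flat R (n + 1) (face R t w)) : NBd R (n + 1) i (face R t w) := by
  induction t using Fin.induction generalizing w with
  | zero => exact ⟨w, hw, fun j => h _ (Fin.succ_ne_zero j), rfl⟩
  | succ t ih =>
    have h1 : face R t.castSucc (w - degen R t (face R t.succ w)) = - face R t.succ w := by
      rw [map_sub, face_castSucc_degen, h _ t.castSucc_lt_succ.ne, zero_sub]
    have h2 := ih (w - degen R t (face R t.succ w)) (sub_mem hw (map_cycles _ (map_cycles _ hw)))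
      (fun j hj => by
        by_cases hj' : j = t.succ
        · rw [hj', map_sub, face_succ_degen, sub_self]
        · rw [map_sub, h j hj', hf.face_degen t j hj hj', sub_zero]) (by
        rw [h1, ← zero_sub]
        exact Flat.sub (fun j => map_zero _) hf)
    rw [h1] at h2
    simpa using (NBd.zero (R := R) (n + 1) i).sub h2

/-- If all but two adjacent faces of a cycle vanish, then these are homologous. -/
lemma nBd_of_two_faces {n i : ℕ} (t : Fin (n + 2)) (w : (R _⦋n + 2⦌).carrier)
    (hw : w ∈ (R _⦋n + 2⦌).cycles i)
    (h : ∀ j, j ≠ t.castSucc → j ≠ t.succ → face R j w = 0)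
    (hf : Flat R (n + 1) (face R t.castSucc w)) (hf' : Flat R (n + 1) (face R t.succ w)) :
    NBd R (n + 1) i (face R t.castSucc w - face R t.succ w) := by
  have h1 : face R t.castSucc (w - degen R t (face R t.succ w)) =
      face R t.castSucc w - face R t.succ w := by
    rw [map_sub, face_castSucc_degen]
  have h2 := nBd_of_face t.castSucc (w - degen R t (face R t.succ w))
    (sub_mem hw (map_cycles _ (map_cycles _ hw))) (fun j hj => by
        by_cases hj' : j = t.succ
        · rw [hj', map_sub, face_succ_degen, sub_self]
        · rw [map_sub, h j hj hj', hf'.face_degen t j hj hj', sub_zero]) (by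
        rw [h1]; exact hf.sub hf')
  rwa [h1] at h2

/-- If all but the last three faces of a cycle vanish, then their alternating sum is a
boundary. -/
lemma nBd_of_three_faces {n i : ℕ} (w : (R _⦋n + 2⦌).carrier)
    (hw : w ∈ (R _⦋n + 2⦌).cycles i)
    (h : ∀ j : Fin (n + 3), j < (Fin.last n).castSucc.castSucc → face R j w = 0)
    (hf : ∀ j, Flat R (n + 1) (face R j w)) :
    NBd R (n + 1) i (face R (Fin.last n).castSucc.castSucc w -
      (face R (Fin.last n).castSucc.succ w - face R (Fin.last n).succ.succ w)) := by
  let y := face R (Fin.last (n + 1)).succ w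
  have hy : Flat R (n + 1) y := hf _
  have h1 : face R (Fin.last n).castSucc.castSucc (w - degen R (Fin.last (n + 1)) y) =
      face R (Fin.last n).castSucc.castSucc w := by
    rw [map_sub, hy.face_degen _ _ (fun h => by simp [Fin.ext_iff] at h)
      (fun h => by simp [Fin.ext_iff] at h; omega), sub_zero]
  have h2 : face R (Fin.last n).castSucc.succ (w - degen R (Fin.last (n + 1)) y) =
      face R (Fin.last n).castSucc.succ w - y := by
    rw [map_sub]
    exact congrArg (face R (Fin.last n).castSucc.succ w - ·) (face_castSucc_degen y (Fin.last (n + 1)))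
  have h3 := nBd_of_two_faces (Fin.last n).castSucc (w - degen R (Fin.last (n + 1)) y)
    (sub_mem hw (map_cycles _ (map_cycles _ hw))) (fun j hj hj' => by
      by_cases hl : j = Fin.last (n + 2)
      · rw [hl, map_sub]
        exact (congrArg (y - ·) (face_succ_degen y (Fin.last (n + 1)))).trans (sub_self y)
      · have hlt : j < (Fin.last n).castSucc.castSucc := by
          simp only [ne_eq, Fin.ext_iff, Fin.lt_def, Fin.val_castSucc, Fin.val_succ,
            Fin.val_last] at hj hj' hl ⊢
          omega
        rw [map_sub, h j hlt, hy.face_degen _ _ (fun h => by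
            rw [h] at hlt; simp [Fin.lt_def] at hlt) (fun h => by
            rw [h] at hlt; simp [Fin.lt_def] at hlt; try omega), sub_zero])
    (by rw [h1]; exact hf _) (by rw [h2]; exact (hf _).sub hy)
  rw [h1, h2] at h3
  exact h3

end Normalised

end TDGA

namespace Simp

open Simplicial SSet MonoidalCategory CartesianMonoidalCategory

lemma map_mem_boundary {m : ℕ} {k : SimplexCategoryᵒᵖ} {a : (Δ[m] : SSet.{u}).obj k}
    (ha : a ∈ (boundary m).obj k) {l : SimplexCategoryᵒᵖ} (θ : k ⟶ l) :
    (Δ[m] : SSet.{u}).map θ a ∈ (boundary m).obj l := (boundary m).map θ ha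

lemma exists_δ_σ (X : SSet.{u}) {n : ℕ} (t : Fin (n + 2)) (j : Fin (n + 3))
    (hj : j ≠ t.castSucc) (hj' : j ≠ t.succ) (x : X _⦋n + 1⦌) :
    ∃ (i : Fin (n + 2)) (s : Fin (n + 1)), X.δ j (X.σ t x) = X.σ s (X.δ i x) := by
  obtain h1 | h1 := lt_or_gt_of_ne hj
  · obtain ⟨t, rfl⟩ := t.eq_succ_of_ne_zero (by rintro rfl; exact absurd h1 (Fin.not_lt_zero _))
    obtain ⟨j, rfl⟩ := j.eq_castSucc_of_ne_last (Fin.ne_last_of_lt h1)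
    exact ⟨j, t, ConcreteCategory.congr_hom (X.δ_comp_σ_of_le (i := j) (j := t) (by
      rw [Fin.lt_def] at h1; rw [Fin.le_def]; simp at h1 ⊢; omega)) x⟩
  · have h2 : t.succ < j := lt_of_le_of_ne (Fin.castSucc_lt_iff_succ_le.1 h1) hj'.symm
    obtain ⟨t, rfl⟩ := t.eq_castSucc_of_ne_last (by
      rintro rfl; exact absurd h2 (Fin.not_lt.2 (Fin.le_last _)))
    obtain ⟨j, rfl⟩ := j.eq_succ_of_ne_zero (Fin.ne_zero_of_lt h2)
    exact ⟨j, t, ConcreteCategory.congr_hom (X.δ_comp_σ_of_gt (i := j) (j := t) (by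
      rw [Fin.lt_def] at h2 ⊢; simp at h2 ⊢; omega)) x⟩

/-- The shear map from the prism to the simplex. -/
def shear (m : ℕ) : (Δ[m] ⊗ Δ[1] : SSet.{u}) ⟶ Δ[m + 1] where
  app k := ↾fun z => stdSimplex.objEquiv.symm (SimplexCategory.Hom.mk
    ⟨fun i => if stdSimplex.asOrderHom z.2 i = 0 then (1 : Fin (m + 2)).succAbove
      (stdSimplex.asOrderHom z.1 i) else (stdSimplex.asOrderHom z.1 i).succ, fun i j hij => by
        have h1 := (stdSimplex.asOrderHom z.1).monotone hij
        have h2 := (stdSimplex.asOrderHom z.2).monotone hij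
        change (if _ then _ else _) ≤ (if _ then _ else _)
        split_ifs with h h' h'
        · exact (Fin.strictMono_succAbove 1).monotone h1
        · refine le_trans ((Fin.strictMono_succAbove 1).monotone h1) ?_
          rw [Fin.succAbove]
          split_ifs
          · exact (Fin.castSucc_lt_succ).le
          · exact le_rfl
        · rw [h'] at h2
          exact absurd (Fin.le_zero_iff.1 h2) h
        · exact Fin.succ_le_succ_iff.2 h1⟩)
  naturality k l θ := by
    ext z
    rfl

lemma ι₀_shear (m : ℕ) : ι₀ ≫ shear.{u} m = stdSimplex.δ 1 := by
  ext k a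
  obtain ⟨a, rfl⟩ := stdSimplex.objEquiv.symm.surjective a
  refine stdSimplex.objEquiv.injective ?_
  ext i
  rfl

lemma ι₁_shear (m : ℕ) : ι₁ ≫ shear.{u} m = stdSimplex.δ 0 := by
  ext k a
  obtain ⟨a, rfl⟩ := stdSimplex.objEquiv.symm.surjective a
  refine stdSimplex.objEquiv.injective ?_
  ext i
  rfl

lemma nonempty_homotopy_of_faces {X : SSet.{u}} {m : ℕ} {x : X _⦋0⦌}
    (f g : X.PtSimplex (m + 1) x) (H : Δ[m + 2] ⟶ X) (h0 : stdSimplex.δ 0 ≫ H = f.map)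
    (h1 : stdSimplex.δ 1 ≫ H = g.map)
    (h : ∀ j : Fin (m + 1), stdSimplex.δ j.succ.succ ≫ H = SSet.const x) :
    Nonempty (g.Homotopy f) := by
  refine ⟨⟨shear (m + 1) ≫ H, ?_, ?_, ?_⟩⟩
  · rw [← assoc, ι₀_shear, h1]
  · rw [← assoc, ι₁_shear, h0]
  · ext k ⟨⟨a, ha⟩, θ⟩
    change H.app k ((shear (m + 1)).app k (a, θ)) = X.map _ x
    by_cases hs : ∃ j : Fin (m + 1), ∀ i, stdSimplex.asOrderHom a i ≠ j.succ
    · obtain ⟨j, hj⟩ := hs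
      obtain ⟨b, hb⟩ := SimplexCategory.eq_comp_δ_of_not_surjective'
        (stdSimplex.objEquiv ((shear.{u} (m + 1)).app k (a, θ))) j.succ.succ (fun i hi => by
          change (if stdSimplex.asOrderHom θ i = 0 then (1 : Fin (m + 3)).succAbove
            (stdSimplex.asOrderHom a i) else (stdSimplex.asOrderHom a i).succ) = j.succ.succ at hi
          refine hj i ?_
          split_ifs at hi
          · have h2 : (1 : Fin (m + 3)).succAbove j.succ = j.succ.succ :=
              Fin.succAbove_of_le_castSucc _ _ (by simp [Fin.le_def])
            exact Fin.succAbove_right_injective (hi.trans h2.symm)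
          · exact Fin.succ_injective _ hi)
      have h2 : (shear.{u} (m + 1)).app k (a, θ) =
          (stdSimplex.δ j.succ.succ).app k (stdSimplex.objEquiv.symm b) :=
        stdSimplex.objEquiv.injective hb
      rw [h2]
      exact app_congr (h j) k (stdSimplex.objEquiv.symm b)
    · have hz : ∀ i, stdSimplex.asOrderHom a i ≠ 0 := by
        rw [mem_boundary_iff_notMem_range] at ha
        obtain ⟨j, hj⟩ := ha
        obtain rfl | ⟨j, rfl⟩ := j.eq_zero_or_eq_succ
        · exact fun i hi => hj ⟨i, hi⟩
        · exact absurd ⟨j, fun i hi => hj ⟨i, hi⟩⟩ hs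
      have h2 : (shear.{u} (m + 1)).app k (a, θ) = (stdSimplex.δ 0).app k a := by
        refine stdSimplex.objEquiv.injective ?_
        ext i
        change ((if stdSimplex.asOrderHom θ i = 0 then (1 : Fin (m + 3)).succAbove
            (stdSimplex.asOrderHom a i) else (stdSimplex.asOrderHom a i).succ) : Fin (m + 3)).val =
          (stdSimplex.asOrderHom a i).succ.val
        split_ifs
        · obtain ⟨c, hc⟩ := Fin.exists_succ_eq.2 (hz i)
          rw [← hc, Fin.succAbove_of_le_castSucc _ _ (by simp [Fin.le_def])]
        · rfl
      rw [h2]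
      exact (app_congr h0 k a).trans (f.map_eq_of_mem a ha)

/-- The image of a product of pointed simplices. -/
lemma MulStruct.ptMap {X Y : SSet.{u}} (φ : X ⟶ Y) {x : X _⦋0⦌} {y : Y _⦋0⦌}
    (h : φ.app _ x = y) {m : ℕ} {f g fg : X.PtSimplex m x} {i : Fin m}
    (s : PtSimplex.MulStruct f g fg i) :
    Nonempty (PtSimplex.MulStruct (ptMap φ h f) (ptMap φ h g) (ptMap φ h fg) i) := by
  subst h
  have h1 {k : ℕ} : (SSet.const x : Δ[k] ⟶ X) ≫ φ = SSet.const (φ.app _ x) := const_comp x φ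
  exact ⟨⟨s.map ≫ φ, by rw [← assoc, s.δ_castSucc_castSucc_map]; rfl,
    by rw [← assoc, s.δ_succ_castSucc_map]; rfl,
    by rw [← assoc, s.δ_succ_succ_map]; rfl,
    fun j hj => by rw [← assoc, s.δ_map_of_lt j hj, h1],
    fun j hj => by rw [← assoc, s.δ_map_of_gt j hj, h1]⟩⟩

end Simp

namespace TDGA

open Simplicial Simp SSet MonoidalCategory CartesianMonoidalCategory

section Coord

variable {R : SimplicialObject (TDGA T)} {X : SSet.{u}} (c : X ⟶ degSSet R 0) (x : X _⦋0⦌)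

/-- The constant simplex. -/
abbrev ptAt (k : SimplexCategoryᵒᵖ) : X.obj k := X.map (k.unop.const ⦋0⦌ 0).op x

lemma map_ptAt {k l : SimplexCategoryᵒᵖ} (θ : k ⟶ l) : X.map θ (ptAt x k) = ptAt x l :=
  (ConcreteCategory.congr_hom ((SSet.const (X := X) x).naturality θ) (ptAt x k)).symm

/-- The difference of a simplex and the constant simplex, in a given coordinate. -/
def nv {k : SimplexCategoryᵒᵖ} (f : X.obj k) : (R.obj k).carrier :=
  (c.app k f).1 - (c.app k (ptAt x k)).1

lemma nv_mem {k : SimplexCategoryᵒᵖ} (f : X.obj k) : nv c x f ∈ (R.obj k).cycles 0 :=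
  ⟨sub_mem (c.app k f).2 (c.app k _).2, CDGA.d_zero _ (sub_mem (c.app k f).2 (c.app k _).2)⟩

lemma nv_ptAt {k : SimplexCategoryᵒᵖ} : nv c x (ptAt x k) = 0 := sub_self _

lemma map_nv {k l : SimplexCategoryᵒᵖ} (θ : k ⟶ l) (f : X.obj k) :
    (R.map θ) (nv c x f) = nv c x (X.map θ f) := by
  have h (g : X.obj k) : (R.map θ) (c.app k g).1 = (c.app l (X.map θ g)).1 := by
    have h1 := ConcreteCategory.congr_hom (c.naturality θ) g
    exact congrArg (fun y : (R.obj l).deg 0 => y.1) h1.symm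
  refine (map_sub _ _ _).trans ?_
  rw [h, h, map_ptAt]
  rfl

lemma face_nv {k : ℕ} (j : Fin (k + 2)) (f : X _⦋k + 1⦌) :
    face R j (nv c x f) = nv c x (X.δ j f) := map_nv c x _ f

variable {x}

/-- The simplex of a pointed simplex. -/
abbrev smp {m : ℕ} (f : X.PtSimplex m x) : X _⦋m⦌ := SSet.yonedaEquiv f.map

lemma δ_smp {m : ℕ} (f : X.PtSimplex (m + 1) x) (j : Fin (m + 2)) :
    X.δ j (smp f) = ptAt x _ := by
  rw [← Simp.yonedaEquiv_δ_comp, f.δ_map]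
  rfl

lemma flat_nv {m : ℕ} {f : X _⦋m + 1⦌} (h : ∀ j, X.δ j f = ptAt x _) :
    Flat R (m + 1) (nv c x f) := fun j => by
  rw [face_nv, h, nv_ptAt]

variable {G : Type*} [AddCommGroup G] {m : ℕ} {Φ : (R _⦋m + 1⦌).carrier → G}
  (hΦ : IsClassMap R (m + 1) 0 Φ)

lemma IsClassMap.eq_iff (hΦ : IsClassMap R (m + 1) 0 Φ) {f g : X _⦋m + 1⦌}
    (hf : ∀ j, X.δ j f = ptAt x _) (hg : ∀ j, X.δ j g = ptAt x _) :
    Φ (nv c x f) = Φ (nv c x g) ↔ NBd R (m + 1) 0 (nv c x f - nv c x g) := by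
  rw [← hΦ.ker _ (sub_mem (nv_mem c x f) (nv_mem c x g)) ((flat_nv c hf).sub (flat_nv c hg)),
    hΦ.sub _ (nv_mem c x f) _ (nv_mem c x g) (flat_nv c hf) (flat_nv c hg), sub_eq_zero]

lemma IsClassMap.map_mul (hΦ : IsClassMap R (m + 1) 0 Φ) {f g fg : X.PtSimplex (m + 1) x}
    (h : PtSimplex.MulStruct f g fg (Fin.last m)) :
    Φ (nv c x (smp fg)) = Φ (nv c x (smp f)) + Φ (nv c x (smp g)) := by
  have hface (j : Fin (m + 3)) : X.δ j (SSet.yonedaEquiv h.map) =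
    SSet.yonedaEquiv (stdSimplex.δ j ≫ h.map) := (Simp.yonedaEquiv_δ_comp j h.map).symm
  have h1 := congrArg (nv c x) ((hface _).trans
    (congrArg SSet.yonedaEquiv h.δ_castSucc_castSucc_map))
  have h2 := congrArg (nv c x) ((hface _).trans (congrArg SSet.yonedaEquiv h.δ_succ_castSucc_map))
  have h3 := congrArg (nv c x) ((hface _).trans (congrArg SSet.yonedaEquiv h.δ_succ_succ_map))
  rw [← face_nv] at h1 h2 h3
  have h0 (j : Fin (m + 3)) (hj : j < (Fin.last m).castSucc.castSucc) :
      face R j (nv c x (SSet.yonedaEquiv h.map)) = 0 := by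
    rw [face_nv, hface, h.δ_map_of_lt j hj]
    exact nv_ptAt c x
  have hfl (f : X.PtSimplex (m + 1) x) := flat_nv c (δ_smp f)
  have h4 := nBd_of_three_faces (nv c x (SSet.yonedaEquiv h.map)) (nv_mem c x _) h0 fun j => by
    obtain hj | hj := lt_or_ge j (Fin.last m).castSucc.castSucc
    · rw [h0 j hj]
      exact fun _ => map_zero _
    · obtain rfl | rfl | rfl : j = (Fin.last m).castSucc.castSucc ∨
          j = (Fin.last m).castSucc.succ ∨ j = (Fin.last m).succ.succ := by
        simp only [Fin.ext_iff, Fin.le_def, Fin.val_castSucc, Fin.val_succ, Fin.val_last] at hj ⊢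
        omega
      · rw [h1]; exact hfl g
      · rw [h2]; exact hfl fg
      · rw [h3]; exact hfl f
  rw [h1, h2, h3] at h4
  have hc (f : X.PtSimplex (m + 1) x) := nv_mem c x (smp f)
  have h5 := (hΦ.ker _ (sub_mem (hc g) (sub_mem (hc fg) (hc f)))
    ((hfl g).sub ((hfl fg).sub (hfl f)))).2 h4
  rw [hΦ.sub _ (hc g) _ (sub_mem (hc fg) (hc f)) (hfl g) ((hfl fg).sub (hfl f)),
    hΦ.sub _ (hc fg) _ (hc f) (hfl fg) (hfl f), sub_eq_zero] at h5
  rw [h5, add_sub_cancel]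

/-- The simplices of the interval. -/
def stair (m s : ℕ) : (Δ[1] : SSet.{u}) _⦋m⦌ :=
  stdSimplex.objMk ⟨fun i => if s ≤ i.val then 1 else 0, fun i j hij => by
    change (if _ then _ else _) ≤ (if _ then _ else _)
    have : i.val ≤ j.val := hij
    split_ifs
    · exact le_rfl
    · omega
    · exact Fin.zero_le _
    · exact le_rfl⟩

lemma δ_stair (m : ℕ) (j : Fin (m + 2)) (s s' : ℕ)
    (h : ∀ i : Fin (m + 1), s ≤ (j.succAbove i).val ↔ s' ≤ i.val) :
    (Δ[1] : SSet.{u}).δ j (stair (m + 1) s) = stair m s' := by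
  refine stdSimplex.objEquiv.injective ?_
  ext i
  exact congrArg Fin.val (if_congr (h i) (Eq.refl (1 : Fin 2)) (Eq.refl 0))

lemma IsClassMap.eq_of_homotopy (hΦ : IsClassMap R (m + 1) 0 Φ) {f g : X.PtSimplex (m + 1) x}
    (H : f.Homotopy g) : Φ (nv c x (smp f)) = Φ (nv c x (smp g)) := by
  let id : (Δ[m + 1] : SSet.{u}) _⦋m + 1⦌ := stdSimplex.objEquiv.symm (𝟙 _)
  let gs (s : ℕ) : X _⦋m + 1⦌ := H.h.app _ (id, stair (m + 1) s)
  have hbd {k : SimplexCategoryᵒᵖ} (a : (Δ[m + 1] : SSet.{u}).obj k)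
      (ha : a ∈ (boundary (m + 1)).obj k) (θ) : H.h.app k (a, θ) = ptAt x k :=
    app_congr H.rel k ((⟨a, ha⟩ : (boundary (m + 1) : SSet.{u}).obj k), θ)
  have hδ {k : ℕ} (j : Fin (k + 2)) (z : (Δ[m + 1] ⊗ Δ[1] : SSet.{u}) _⦋k + 1⦌) :
      X.δ j (H.h.app _ z) = H.h.app _ (Δ[m + 1].δ j z.1, Δ[1].δ j z.2) :=
    (ConcreteCategory.congr_hom (H.h.naturality (SimplexCategory.δ j).op) z).symm
  have hgs (s : ℕ) (j) : X.δ j (gs s) = ptAt x _ := by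
    refine (hδ j _).trans (hbd _ ?_ _)
    rw [boundary_obj_eq_univ m (m + 1)]
    trivial
  have step (i : ℕ) (hi : i ≤ m + 1) : Φ (nv c x (gs i)) = Φ (nv c x (gs (i + 1))) := by
    let t : Fin (m + 2) := ⟨i, by omega⟩
    let P : X _⦋m + 2⦌ := H.h.app _ (Δ[m + 1].σ t id, stair (m + 2) (i + 1))
    have h1 : X.δ t.castSucc P = gs i := by
      refine (hδ _ _).trans (congrArg (H.h.app _) (Prod.ext
        (ConcreteCategory.congr_hom (Δ[m + 1].δ_comp_σ_self (i := t)) id) ?_))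
      refine δ_stair _ _ _ _ fun l => ?_
      simp only [Fin.succAbove, Fin.lt_def, Fin.val_castSucc, t]
      split_ifs <;> simp <;> omega
    have h2 : X.δ t.succ P = gs (i + 1) := by
      refine (hδ _ _).trans (congrArg (H.h.app _) (Prod.ext
        (ConcreteCategory.congr_hom (Δ[m + 1].δ_comp_σ_succ (i := t)) id) ?_))
      refine δ_stair _ _ _ _ fun l => ?_
      simp only [Fin.succAbove, Fin.lt_def, Fin.val_castSucc, Fin.val_succ, t]
      split_ifs <;> simp <;> omega
    have h3 := nBd_of_two_faces t (nv c x P) (nv_mem c x P) (fun j hj hj' => by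
      rw [face_nv]
      refine (congrArg (nv c x) ((hδ j _).trans (hbd _ ?_ _))).trans (nv_ptAt c x)
      obtain ⟨i', s, hs⟩ := exists_δ_σ Δ[m + 1] t j hj hj' id
      refine hs ▸ map_mem_boundary ?_ (SimplexCategory.σ s).op
      rw [boundary_obj_eq_univ m (m + 1)]
      trivial)
      (by rw [face_nv, h1]; exact flat_nv c (hgs _))
      (by rw [face_nv, h2]; exact flat_nv c (hgs _))
    rw [face_nv, face_nv, h1, h2] at h3
    exact (hΦ.eq_iff c (hgs _) (hgs _)).2 h3
  have all (i : ℕ) (hi : i ≤ m + 2) : Φ (nv c x (gs 0)) = Φ (nv c x (gs i)) := by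
    induction i with
    | zero => rfl
    | succ i ih => exact (ih (by omega)).trans (step i (by omega))
  have h0 : gs 0 = smp g := app_congr H.h₁ _ id
  have h1 : gs (m + 2) = smp f := by
    have h2 : stair.{u} (m + 1) (m + 2) = endpt 0 _ := by
      refine stdSimplex.objEquiv.injective ?_
      ext i
      have h3 : ¬ m + 2 ≤ i.val := by have := i.2; simp at this; omega
      exact congrArg Fin.val (if_neg h3)
    refine (congrArg (fun θ => H.h.app _ (id, θ)) h2).trans (app_congr H.h₀ _ id)
  rw [← h0, ← h1]
  exact (all _ le_rfl).symm

end Coord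

section Free

variable {R : SimplicialObject (TDGA T)} {n : ℕ}

/-- The coordinates of a morphism from a free algebra. -/
def crd (R : SimplicialObject (TDGA T)) (l : Fin n) :
    homSSet R (TAlg.free T n).toTDGA ⟶ degSSet R 0 where
  app k := ↾fun f : (TAlg.free T n).toTDGA ⟶ R.obj k =>
    ⟨f (T.var l), f.map_deg (mem_deg_zero _)⟩
  naturality _ _ _ := rfl

lemma crd_freeDesc {k : SimplexCategoryᵒᵖ} (a : Fin n → (R.obj k).deg 0) (l : Fin n) :
    ((crd R l).app k (freeDesc a)).1 = (a l).1 := freeDesc_var a l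

lemma crd_ext {k : SimplexCategoryᵒᵖ} {f g : (homSSet R (TAlg.free T n).toTDGA).obj k}
    (h : ∀ l, ((crd R l).app k f).1 = ((crd R l).app k g).1) : f = g := free_hom_ext h

lemma crd_δ {k : ℕ} (l : Fin n) (j : Fin (k + 2))
    (f : (homSSet R (TAlg.free T n).toTDGA) _⦋k + 1⦌) :
    ((crd R l).app _ ((homSSet R (TAlg.free T n).toTDGA).δ j f)).1 =
      face R j ((crd R l).app _ f).1 := rfl

variable {y : (homSSet R (TAlg.free T n).toTDGA) _⦋0⦌} {m : ℕ}

lemma exists_ptSimplex (z : Fin n → (R _⦋m + 1⦌).carrier)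
    (hz : ∀ l, z l ∈ (R _⦋m + 1⦌).cycles 0) (hfl : ∀ l, Flat R (m + 1) (z l)) :
    ∃ f : (homSSet R (TAlg.free T n).toTDGA).PtSimplex (m + 1) y,
      ∀ l, nv (crd R l) y (smp f) = z l := by
  let p := ptAt y (op ⦋m + 1⦌)
  let F : (homSSet R (TAlg.free T n).toTDGA) _⦋m + 1⦌ :=
    freeDesc fun l => ⟨z l + ((crd R l).app _ p).1, add_mem (hz l).1 ((crd R l).app _ p).2⟩
  have hF (l) : ((crd R l).app _ F).1 = z l + ((crd R l).app _ p).1 := crd_freeDesc _ l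
  refine ⟨⟨SSet.yonedaEquiv.symm F, SSet.boundary.hom_ext fun j => ?_⟩, fun l => ?_⟩
  · rw [← assoc, ← assoc]
    refine SSet.yonedaEquiv.injective ?_
    change (homSSet R (TAlg.free T n).toTDGA).δ j F = ptAt y (op ⦋m⦌)
    rw [← map_ptAt y (SimplexCategory.δ j).op]
    refine crd_ext fun l => ?_
    rw [crd_δ, hF, map_add, hfl l j, zero_add]
    rfl
  · refine (congrArg (nv (crd R l) y) (Equiv.apply_symm_apply _ F)).trans ?_
    change ((crd R l).app _ F).1 - _ = _
    rw [hF, add_sub_cancel_right]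

lemma nonempty_homotopy_of_nBd (f g : (homSSet R (TAlg.free T n).toTDGA).PtSimplex (m + 1) y)
    (h : ∀ l, NBd R (m + 1) 0 (nv (crd R l) y (smp f) - nv (crd R l) y (smp g))) :
    Nonempty (g.Homotopy f) := by
  choose w hw hw' hwz using h
  let a (l : Fin n) := ((crd R l).app _ (smp f)).1
  let b (l : Fin n) := ((crd R l).app _ (smp g)).1
  have hb (l) : b l ∈ (R _⦋m + 1⦌).deg 0 := ((crd R l).app _ (smp g)).2
  have hwab (l) : face R 0 (w l) = a l - b l := (hwz l).trans (sub_sub_sub_cancel_right _ _ _)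
  let W : (homSSet R (TAlg.free T n).toTDGA) _⦋m + 2⦌ :=
    freeDesc fun l => ⟨w l + degen R 0 (b l), add_mem (hw l).1 (Hom.map_deg _ (hb l))⟩
  have hW (l) : ((crd R l).app _ W).1 = w l + degen R 0 (b l) := crd_freeDesc _ l
  refine nonempty_homotopy_of_faces f g (SSet.yonedaEquiv.symm W) ?_ ?_ fun j => ?_
  · refine SSet.yonedaEquiv.injective ?_
    rw [Simp.yonedaEquiv_δ_comp, Equiv.apply_symm_apply]
    refine crd_ext fun l => ?_
    rw [crd_δ, hW, map_add, hwab]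
    refine (congrArg (a l - b l + ·) (face_castSucc_degen (b l) 0)).trans ?_
    exact sub_add_cancel _ _
  · refine SSet.yonedaEquiv.injective ?_
    rw [Simp.yonedaEquiv_δ_comp, Equiv.apply_symm_apply]
    refine crd_ext fun l => ?_
    rw [crd_δ, hW, map_add]
    refine (congrArg₂ (· + ·) (hw' l 0) (face_succ_degen (b l) 0)).trans ?_
    exact zero_add _
  · refine SSet.yonedaEquiv.injective ?_
    rw [Simp.yonedaEquiv_δ_comp, Equiv.apply_symm_apply]
    change _ = ptAt y (op ⦋m + 1⦌)
    rw [← map_ptAt y (SimplexCategory.σ (0 : Fin (m + 1))).op, ← δ_smp g j.succ]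
    refine crd_ext fun l => ?_
    rw [crd_δ, hW, map_add, hw' l j.succ, zero_add]
    have h1 := R.δ_comp_σ_of_gt (i := j.succ) (j := (0 : Fin (m + 1))) (by simp [Fin.lt_def])
    exact congr_toAlgHom h1 (b l)

lemma exists_homotopyGroup_equiv {G : Type u} [AddCommGroup G]
    {Φ : (R _⦋m + 1⦌).carrier → G} (hΦ : IsClassMap R (m + 1) 0 Φ) :
    ∃ e : HomotopyGroup (homSSet R (TAlg.free T n).toTDGA) (m + 1) y ≃ (Fin n → G),
      ∀ f : (homSSet R (TAlg.free T n).toTDGA).PtSimplex (m + 1) y,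
        e f.homotopyClass = fun l => Φ (nv (crd R l) y (smp f)) := by
  let F : HomotopyGroup (homSSet R (TAlg.free T n).toTDGA) (m + 1) y → (Fin n → G) :=
    Quot.lift (fun f l => Φ (nv (crd R l) y (smp f))) fun f g ⟨H⟩ => funext fun l =>
      hΦ.eq_of_homotopy (crd R l) H
  refine ⟨Equiv.ofBijective F ⟨fun c c' h => ?_, fun g => ?_⟩, fun f => rfl⟩
  · obtain ⟨f, rfl⟩ := c.eq_homotopyClass
    obtain ⟨f', rfl⟩ := c'.eq_homotopyClass
    obtain ⟨H⟩ := nonempty_homotopy_of_nBd f' f fun l =>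
      (hΦ.eq_iff (crd R l) (δ_smp f') (δ_smp f)).1 (congrFun h l).symm
    exact H.eq
  · choose z hz hfl hzg using fun l => hΦ.surj (g l)
    obtain ⟨f, hf⟩ := exists_ptSimplex (y := y) z hz hfl
    exact ⟨f.homotopyClass, funext fun l => (congrArg Φ (hf l)).trans (hzg l)⟩

end Free

end TDGA

namespace TDGA

open Simplicial Simp

section Precomp

variable (R : SimplicialObject (TDGA T))

/-- Precomposition on simplicial sets of morphisms. -/
def pre {Q Q' : TDGA T} (g : Q ⟶ Q') : homSSet R Q' ⟶ homSSet R Q :=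
  Functor.whiskerLeft R (coyoneda.map g.op)

lemma pre_comp {Q Q' Q'' : TDGA T} (g : Q ⟶ Q') (g' : Q' ⟶ Q'') :
    pre R (g ≫ g') = pre R g' ≫ pre R g := by
  ext k x
  exact assoc _ _ _

lemma pre_id (Q : TDGA T) : pre R (𝟙 Q) = 𝟙 _ := by
  ext k x
  exact id_comp _

variable {R}

lemma lift_pre {K : SSet.{u}} {Q Q' : TDGA T} (g : Q ⟶ Q') (φ : K ⟶ homSSet R Q') :
    cot.lift (φ ≫ pre R g) = g ≫ cot.lift φ :=
  cot.hom_ext fun k x => by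
    rw [cot.lift_π, assoc, cot.lift_π]; rfl

lemma yonedaEquiv_symm_pre {Q Q' : TDGA T} (g : Q ⟶ Q') {n : ℕ}
    (φ : Q' ⟶ R _⦋n⦌) :
    SSet.yonedaEquiv.symm (φ : (homSSet R Q') _⦋n⦌) ≫ pre R g =
      SSet.yonedaEquiv.symm (g ≫ φ : (homSSet R Q) _⦋n⦌) :=
  SSet.yonedaEquiv_symm_comp _ _

lemma tFib_pre (hF : ReedyFib R) {Q Q' : TDGA T} {i : Q ⟶ Q'} (hi : LLPFib i) :
    TFib (pre R i) := by
  refine tFib_of_boundary fun n a b w => ?_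
  obtain ⟨b, rfl⟩ := SSet.yonedaEquiv.symm.surjective b
  obtain ⟨l, hl, hl'⟩ := hi (cot.res R (SSet.boundary n).ι) (isFibration_res_boundary hF n)
    (b : Q ⟶ R _⦋n⦌) (cot.lift a)
    (by rw [cot.lift_res, ← w, lift_pre])
  refine ⟨SSet.yonedaEquiv.symm (l : (homSSet R Q') _⦋n⦌), ?_, ?_⟩
  · rw [cot.lift_res] at hl'
    exact cot.lift_injective R hl'
  · rw [yonedaEquiv_symm_pre, hl]

lemma formal_pre {P : ∀ {X Y : SSet.{u}}, (X ⟶ Y) → Prop} (hP : Simp.Formal P)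
    (hF : ReedyFib R) {C Q : TDGA T} {p : C ⟶ Q} (hp : IsTF p) (hC : C.IsCofibrant)
    (hQ : Q.IsCofibrant) : P (pre R p) := by
  obtain ⟨s, hs⟩ := hQ.lift hp (𝟙 Q)
  have hsq : QuasiIso s := QuasiIso.of_comp_right hp.quasiIso (by
    rw [hs]; exact QuasiIso.id)
  obtain ⟨D, i, r, hir, hr, hi, hiq⟩ := exists_factor s
  have hrt : IsTF r := isTF_of hr (QuasiIso.of_comp_left hiq (hir ▸ hsq))
  obtain ⟨t, ht⟩ := hC.lift hrt (𝟙 C)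
  refine hP.cancel (pre R p) (pre R r) (pre R t) (pre R i) ?_ ?_ (hP.tFib _ (tFib_pre hF hi))
  · rw [← pre_comp, ht, pre_id]
  · rw [← pre_comp, ← pre_comp, ← assoc, hir, hs, pre_id]

end Precomp

end TDGA

lemma TAlg.Etale.eq_of_forall {F A : TAlg T} {f : F ⟶ A} (hf : TAlg.Etale f) {D : TAlg T}
    {u v : A ⟶ D} (huv : f ≫ u = f ≫ v) {S : Type*} {D' : S → TAlg T} (ρ : ∀ s, D ⟶ D' s)
    (hρ : ∀ s, u ≫ ρ s = v ≫ ρ s) (hsq : ∀ x y, (∀ s, (ρ s) x = 0) →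
      (∀ s, (ρ s) y = 0) → x * y = 0) : u = v := by
  let I : Ideal D.carrier := ⨅ s, RingHom.ker (ρ s).toAlgHom
  have hI : ∀ x, (D.quotMk I) x = 0 ↔ ∀ s, (ρ s) x = 0 := fun x =>
    Ideal.Quotient.eq_zero_iff_mem.trans (by simp only [I, Ideal.mem_iInf, RingHom.mem_ker])
  refine hf.rigid huv (D.quotMk I) (TAlg.hom_ext fun a => ?_)
    fun x y hx hy => hsq x y ((hI x).1 hx) ((hI y).1 hy)
  refine sub_eq_zero.1 ((map_sub (D.quotMk I).toAlgHom _ _).symm.trans ((hI _).2 fun s => ?_))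
  refine (map_sub (ρ s).toAlgHom _ _).trans (sub_eq_zero.2 ?_)
  exact TAlg.congr_toAlgHom (hρ s) a

namespace TDGA

open Simplicial Simp

section Resolution

variable {B : TDGA T} (R : SimplicialResolution B)

lemma SimplicialResolution.ι_map {k l : SimplexCategoryᵒᵖ} (θ : k ⟶ l) :
    R.ι.app k ≫ R.obj.map θ = R.ι.app l :=
  (R.ι.naturality θ).symm.trans (id_comp _)

lemma SimplicialResolution.quasiIso_map : HConst R.obj := fun k l θ => (R.quasiIso k).of_comp_left (by rw [R.ι_map]; exact R.quasiIso l)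

variable {A : TAlg T}

/-- The morphism from a `T`-algebra to `H₀` of a cofibrant replacement. -/
def CofibrantReplacement.toH0 (Q : CofibrantReplacement A.toTDGA) : A ⟶ Q.obj.H0 :=
  haveI := Q.quasiIso.isIso_H0map
  A.toH0 ≫ inv (H0map Q.hom)

lemma CofibrantReplacement.toH0_comp (Q : CofibrantReplacement A.toTDGA) :
    Q.toH0 ≫ H0map Q.hom = A.toH0 := by
  have := Q.quasiIso.isIso_H0map
  rw [CofibrantReplacement.toH0, assoc, IsIso.inv_hom_id, comp_id]

lemma CofibrantReplacement.comp_toH0 {F : TAlg T} {f : F ⟶ A} (P : CofibrantReplacement F.toTDGA)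
    (Q : CofibrantReplacement A.toTDGA) {q : P.obj ⟶ Q.obj}
    (hq : q ≫ Q.hom = P.hom ≫ TAlg.mapTDGA f) : f ≫ Q.toH0 = P.toH0 ≫ H0map q := by
  have := Q.quasiIso.isIso_H0map
  rw [← cancel_mono (H0map Q.hom), assoc, Q.toH0_comp, assoc, ← H0map_comp, hq,
    H0map_comp, ← assoc, P.toH0_comp]
  rfl

lemma mapSpaceToHom_comp (Q : CofibrantReplacement A.toTDGA) {k : SimplexCategoryᵒᵖ}
    (φ : Q.obj ⟶ R.obj.obj k) :
    ((mapSpaceToHom Q R).app k φ : A ⟶ B.H0) ≫ H0map (R.ι.app k) = Q.toH0 ≫ H0map φ := by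
  have := Q.quasiIso.isIso_H0map
  have := (R.quasiIso k).isIso_H0map
  change (A.toH0 ≫ inv (H0map Q.hom) ≫ H0map φ ≫ inv (H0map (R.ι.app k))) ≫ _ = _
  rw [assoc, assoc, assoc, IsIso.inv_hom_id, comp_id,
    CofibrantReplacement.toH0, assoc]

lemma mapSpaceToHom_eq_iff (Q : CofibrantReplacement A.toTDGA) {k : SimplexCategoryᵒᵖ}
    (φ : Q.obj ⟶ R.obj.obj k) (g : A ⟶ B.H0) :
    (mapSpaceToHom Q R).app k φ = g ↔ Q.toH0 ≫ H0map φ = g ≫ H0map (R.ι.app k) := by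
  have := (R.quasiIso k).isIso_H0map
  rw [← mapSpaceToHom_comp, cancel_mono]

lemma mapSpacePrecomp_toHom {F : TAlg T} {f : F ⟶ A} (P : CofibrantReplacement F.toTDGA)
    (Q : CofibrantReplacement A.toTDGA) {q : P.obj ⟶ Q.obj}
    (hq : q ≫ Q.hom = P.hom ≫ TAlg.mapTDGA f) :
    mapSpacePrecomp q R ≫ mapSpaceToHom P R =
      mapSpaceToHom Q R ≫ discMap fun g : A ⟶ B.H0 => f ≫ g := by
  ext k φ
  refine (mapSpaceToHom_eq_iff R P (q ≫ (φ : Q.obj ⟶ R.obj.obj k)) _).2 ?_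
  refine (congrArg (P.toH0 ≫ ·) (H0map_comp q (φ : Q.obj ⟶ R.obj.obj k))).trans ?_
  rw [← assoc, ← P.comp_toH0 Q hq, assoc]
  refine (congrArg (f ≫ ·) (mapSpaceToHom_comp R Q φ).symm).trans ?_
  exact (assoc _ _ _).symm

lemma mapSpacePrecomp_toHom_self (P Q : CofibrantReplacement A.toTDGA) {q : P.obj ⟶ Q.obj}
    (hq : q ≫ Q.hom = P.hom) : mapSpacePrecomp q R ≫ mapSpaceToHom P R = mapSpaceToHom Q R := by
  refine (mapSpacePrecomp_toHom R (f := 𝟙 A) P Q (hq.trans (comp_id _).symm)).trans ?_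
  ext k φ
  exact id_comp _

/-- The free `T`-algebra is its own cofibrant replacement. -/
def freeReplacement (n : ℕ) : CofibrantReplacement (TAlg.free T n).toTDGA :=
  ⟨_, 𝟙 _, isCofibrant_free n, QuasiIso.id⟩

lemma freeReplacement_toH0 (n : ℕ) :
    (freeReplacement n : CofibrantReplacement (TAlg.free T n).toTDGA).toH0 =
      (TAlg.free T n).toH0 := by
  rw [← (freeReplacement n).toH0_comp]
  refine (comp_id _).symm.trans ?_
  refine congrArg ((freeReplacement n).toH0 ≫ ·) ?_
  refine TAlg.hom_ext fun a => ?_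
  obtain ⟨b, rfl⟩ := toH0_surjective _ a
  rfl

variable {n : ℕ} {f : TAlg.free T n ⟶ A} (C : CofibrantReplacement A.toTDGA)
  {t : (TAlg.free T n).toTDGA ⟶ C.obj} (htC : t ≫ C.hom = TAlg.mapTDGA f)

/-- The fibre product of mapping spaces out of free algebras and of sets of morphisms. -/
abbrev fibProd (f : TAlg.free T n ⟶ A) : SSet.{u} :=
  Limits.pullback (mapSpaceToHom (freeReplacement n) R) (discMap fun g : A ⟶ B.H0 => f ≫ g)

/-- The comparison with the fibre product. -/
def comparison : mapSpace C R ⟶ fibProd R f :=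
  Limits.pullback.lift (mapSpacePrecomp (Q := freeReplacement n) t R) (mapSpaceToHom C R)
    (mapSpacePrecomp_toHom R (freeReplacement n) C (htC.trans (id_comp _).symm))

lemma tFib_comparison (hf : TAlg.Etale f) (ht : LLPTriv t) : TFib (comparison R C htC) := by
  refine tFib_of_boundary fun m a b w => ?_
  have hft : f ≫ C.toH0 = (TAlg.free T n).toH0 ≫ H0map t := by
    rw [← freeReplacement_toH0]
    exact (freeReplacement n).comp_toH0 C (htC.trans (id_comp _).symm)
  let b₁ := b ≫ Limits.pullback.fst _ _
  let b₂ := b ≫ Limits.pullback.snd _ _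
  have hb : b₁ ≫ mapSpaceToHom (freeReplacement n) R = b₂ ≫ discMap fun g : A ⟶ B.H0 => f ≫ g := by
    rw [assoc, Limits.pullback.condition, assoc]
  have w₁ : a ≫ mapSpacePrecomp (Q := freeReplacement n) t R = (SSet.boundary m).ι ≫ b₁ := by
    rw [← assoc, ← w, assoc, comparison, Limits.pullback.lift_fst]
  have w₂ : a ≫ mapSpaceToHom C R = (SSet.boundary m).ι ≫ b₂ := by
    rw [← assoc, ← w, assoc, comparison, Limits.pullback.lift_snd]
  let x : (TAlg.free T n).toTDGA ⟶ R.obj _⦋m⦌ := SSet.yonedaEquiv b₁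
  let g : A ⟶ B.H0 := SSet.yonedaEquiv b₂
  have hg : f ≫ g ≫ H0map (R.ι.app (op ⦋m⦌)) = (TAlg.free T n).toH0 ≫ H0map x := by
    rw [← freeReplacement_toH0, ← assoc]
    exact ((mapSpaceToHom_eq_iff R (freeReplacement n) x (f ≫ g)).1 (app_congr hb _ _)).symm
  have hx : t ≫ cot.lift (R := R.obj) (Q := C.obj) a = x ≫ cot.res R.obj (SSet.boundary m).ι := by
    refine ((lift_pre t _).symm.trans ?_).trans (cot.lift_res R.obj _ x).symm
    exact congrArg cot.lift (w₁.trans (congrArg ((SSet.boundary m).ι ≫ ·)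
      (SSet.yonedaEquiv.symm_apply_apply b₁).symm))
  obtain ⟨Φ, h1, h2, h3⟩ := exists_lift_fibration hf ht C.quasiIso htC C.toH0_comp
    (isFibration_res_boundary R.fibrant m) (cot.lift (R := R.obj) (Q := C.obj) a) x hx
    (g ≫ H0map (R.ι.app (op ⦋m⦌))) (hg.trans (toH0_comp_H0map x)) (by
      refine hf.eq_of_forall ?_ (fun s : (∂Δ[m] : SSet.{u}).obj (op ⦋0⦌) =>
        H0map (cot.π R.obj s)) (fun s => ?_) ?_
      · rw [← assoc, hft, assoc, ← H0map_comp, hx, H0map_comp, ← assoc,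
          ← hg]
        simp only [assoc]
      · have e₁ := congrArg (C.toH0 ≫ ·) ((H0map_comp _ _).symm.trans
          (congrArg H0map (cot.lift_π (R := R.obj) (Q := C.obj) a s)))
        have e₂ := (H0map_comp _ _).symm.trans
          (congrArg H0map (cot.res_comp_π R.obj (SSet.boundary m).ι s))
        have e₃ := (H0map_comp _ _).symm.trans (congrArg H0map
          (R.ι_map (SSet.stdSimplex.objEquiv ((SSet.boundary.{u} m).ι.app _ s)).op))
        have e₄ : (mapSpaceToHom C R).app (op ⦋0⦌) (a.app (op ⦋0⦌) s) = g :=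
          (app_congr w₂ _ s).trans (disc_stdSimplex b₂ _ _)
        refine (assoc _ _ _).trans (e₁.trans (((mapSpaceToHom_eq_iff R C
          (a.app (op ⦋0⦌) s) g).1 e₄).trans ?_))
        refine (congrArg (g ≫ ·) (e₃.symm.trans (congrArg (_ ≫ ·) e₂.symm))).trans ?_
        simp only [assoc]
      · cases m with
        | zero =>
          refine fun x _ _ _ => ?_
          obtain ⟨c, rfl⟩ := Ideal.Quotient.mk_surjective x
          rw [show c = 0 from Subtype.ext (cot.ext fun k x =>
            (x.2 fun b => ⟨0, Subsingleton.elim (α := Fin 1) _ _⟩).elim)]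
          exact zero_mul _
        | succ m => exact fun x y hx hy => mul_eq_zero_of_vertex R.quasiIso_map x y hx hy)
  refine ⟨SSet.yonedaEquiv.symm (Φ : (homSSet R.obj C.obj) _⦋m⦌), ?_, ?_⟩
  · rw [cot.lift_res] at h2
    exact cot.lift_injective R.obj h2
  · refine Limits.pullback.hom_ext ?_ ?_
    · refine (assoc _ _ _).trans
        ((congrArg (_ ≫ ·) (Limits.pullback.lift_fst _ _ _)).trans ?_)
      refine (yonedaEquiv_symm_pre t Φ).trans ?_
      rw [h1]
      exact SSet.yonedaEquiv.symm_apply_apply b₁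
    · refine (assoc _ _ _).trans
        ((congrArg (_ ≫ ·) (Limits.pullback.lift_snd _ _ _)).trans ?_)
      refine (SSet.yonedaEquiv_symm_comp _ _).trans ?_
      refine (congrArg SSet.yonedaEquiv.symm ?_).trans (SSet.yonedaEquiv.symm_apply_apply b₂)
      exact (mapSpaceToHom_eq_iff R C Φ g).2 h3

end Resolution

end TDGA

namespace Simp

open Simplicial SSet

section Pullback

variable {X Y Z : SSet.{u}} {φ : X ⟶ Z} {ψ : Y ⟶ Z}

lemma pullback_ext {m : ℕ} {b b' : (Limits.pullback φ ψ : SSet.{u}) _⦋m⦌}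
    (h₁ : (Limits.pullback.fst φ ψ).app _ b = (Limits.pullback.fst φ ψ).app _ b')
    (h₂ : (Limits.pullback.snd φ ψ).app _ b = (Limits.pullback.snd φ ψ).app _ b') : b = b' := by
  refine yonedaEquiv.symm.injective (Limits.pullback.hom_ext ?_ ?_)
  · rw [yonedaEquiv_symm_comp, yonedaEquiv_symm_comp, h₁]
  · rw [yonedaEquiv_symm_comp, yonedaEquiv_symm_comp, h₂]

lemma exists_pullback {m : ℕ} (x : X _⦋m⦌) (y : Y _⦋m⦌) (h : φ.app _ x = ψ.app _ y) :
    ∃ b : (Limits.pullback φ ψ : SSet.{u}) _⦋m⦌,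
      (Limits.pullback.fst φ ψ).app _ b = x ∧ (Limits.pullback.snd φ ψ).app _ b = y := by
  have h' : yonedaEquiv.symm x ≫ φ = yonedaEquiv.symm y ≫ ψ := by
    rw [yonedaEquiv_symm_comp, yonedaEquiv_symm_comp, h]
  refine ⟨yonedaEquiv (Limits.pullback.lift _ _ h'), ?_, ?_⟩
  · refine (yonedaEquiv_comp _ _).symm.trans ?_
    rw [Limits.pullback.lift_fst, Equiv.apply_symm_apply]
  · refine (yonedaEquiv_comp _ _).symm.trans ?_
    rw [Limits.pullback.lift_snd, Equiv.apply_symm_apply]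

lemma π₀_pullback_bijective {S S' : Type u} (φ : X ⟶ disc S) (f : S' → S)
    (hs : ∀ s, ∃ x : X _⦋0⦌, φ.app _ x = s) (he : ∀ x y : X _⦋0⦌, φ.app _ x = φ.app _ y →
      ∃ z : X _⦋1⦌, X.δ 0 z = x ∧ X.δ 1 z = y) :
    Function.Bijective (π₀ToSet (Limits.pullback.snd φ (discMap f))) := by
  constructor
  · intro c c' h
    obtain ⟨c, rfl⟩ := π₀.mk_surjective c
    obtain ⟨c', rfl⟩ := π₀.mk_surjective c'
    let p₁ := Limits.pullback.fst φ (discMap f)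
    let p₂ := Limits.pullback.snd φ (discMap f)
    have h : p₂.app _ c = p₂.app _ c' := h
    have hc (c) : φ.app (op ⦋0⦌) (p₁.app _ c) = f (p₂.app _ c) :=
      app_congr Limits.pullback.condition _ c
    obtain ⟨z, hz, hz'⟩ := he (p₁.app _ c') (p₁.app _ c)
      ((hc c').trans ((congrArg f h).symm.trans (hc c).symm))
    have hz1 : φ.app (op ⦋1⦌) z = f (p₂.app (op ⦋0⦌) c) :=
      (ConcreteCategory.congr_hom (φ.naturality (SimplexCategory.δ (1 : Fin 2)).op) z).symm.trans
        ((congrArg (φ.app _) hz').trans (hc c))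
    obtain ⟨E, hE, hE'⟩ := exists_pullback (φ := φ) (ψ := discMap f) (m := 1) z
      (p₂.app (op ⦋0⦌) c) hz1
    have hδ (j : Fin 2) (c₁) (h₁ : X.δ j z = p₁.app _ c₁)
        (h₂ : p₂.app _ c = p₂.app _ c₁) :
        (Limits.pullback φ (discMap f) : SSet.{u}).δ j E = c₁ := by
      refine pullback_ext ?_ ?_
      · refine (ConcreteCategory.congr_hom (p₁.naturality (SimplexCategory.δ j).op) E).trans ?_
        exact (congrArg (X.δ j) hE).trans h₁
      · refine (ConcreteCategory.congr_hom (p₂.naturality (SimplexCategory.δ j).op) E).trans ?_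
        exact hE'.trans h₂
    exact π₀.sound ⟨E, hδ 1 c hz' rfl, hδ 0 c' hz h⟩
  · intro s
    obtain ⟨x, hx⟩ := hs (f s)
    obtain ⟨b, -, hb⟩ := exists_pullback (φ := φ) (ψ := discMap f) (m := 0) x s hx
    exact ⟨π₀.mk b, hb⟩

end Pullback

end Simp

namespace TDGA

open Simplicial Simp

section ConnectedComponents

variable {B : TDGA T} (R : SimplicialResolution B) {A : TAlg T} {n : ℕ} {f : TAlg.free T n ⟶ A}

lemma mapSpaceToHom_free_eq_iff {k : SimplexCategoryᵒᵖ} (φ : (TAlg.free T n).toTDGA ⟶ R.obj.obj k)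
    (g : TAlg.free T n ⟶ B.H0) : (mapSpaceToHom (freeReplacement n) R).app k φ = g ↔
      unZero φ ≫ (R.obj.obj k).toH0 = g ≫ H0map (R.ι.app k) := by
  rw [← toH0_comp_H0map, ← freeReplacement_toH0]
  exact mapSpaceToHom_eq_iff R (freeReplacement n) φ g

lemma exists_toHom_eq (g : TAlg.free T n ⟶ B.H0) :
    ∃ φ : (TAlg.free T n).toTDGA ⟶ R.obj _⦋0⦌,
      (mapSpaceToHom (freeReplacement n) R).app (op ⦋0⦌) φ = g := by
  choose x hx using fun l : Fin n => toH0_surjective (R.obj _⦋0⦌)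
    ((g ≫ H0map (R.ι.app (op ⦋0⦌))) (T.var l))
  refine ⟨freeDesc x, (mapSpaceToHom_free_eq_iff R _ _).2 (TAlg.free_hom_ext fun l => ?_)⟩
  refine Eq.trans (congrArg (toH0 _).toAlgHom ?_) (hx l)
  exact Subtype.ext (freeDesc_var x l)

/-- Morphisms from a free algebra with the same effect on `H₀` are joined by an edge. -/
lemma exists_edge_of_toHom_eq {x y : (TAlg.free T n).toTDGA ⟶ R.obj _⦋0⦌}
    (h : (mapSpaceToHom (freeReplacement n) R).app (op ⦋0⦌) x =
      (mapSpaceToHom (freeReplacement n) R).app (op ⦋0⦌) y) :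
    ∃ z : (TAlg.free T n).toTDGA ⟶ R.obj _⦋1⦌,
      z ≫ R.obj.δ 0 = x ∧ z ≫ R.obj.δ 1 = y := by
  have h1 := ((mapSpaceToHom_free_eq_iff R x _).1 h).trans
    ((mapSpaceToHom_free_eq_iff R y _).1 rfl).symm
  have h2 : ∀ l : Fin n, ∃ b ∈ (R.obj _⦋0⦌).deg 1,
      (R.obj _⦋0⦌).d b = x (T.var l) - y (T.var l) := fun l => by
    have h3 : (toH0 _) ((unZero x) (T.var l)) =
        (toH0 _) ((unZero y) (T.var l)) :=
      TAlg.congr_toAlgHom h1 (T.var l)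
    exact toH0_eq_zero.1 ((map_sub (toH0 _).toAlgHom _ _).trans (sub_eq_zero.2 h3))
  choose b hb hbd using h2
  choose e he hes hef using fun l => ReedyFib.exists_face_zero R.fibrant (k := 0) (hb l) trivial
  let a (l : Fin n) : (R.obj _⦋1⦌).deg 0 :=
    ⟨degen R.obj 0 (y (T.var l)) + (R.obj.obj _).d (e l),
      add_mem (Hom.map_deg _ (y.map_deg (mem_deg_zero _))) (CDGA.d_mem _ (he l))⟩
  have ha (j : Fin 2) (l : Fin n) : (freeDesc a ≫ R.obj.δ j) (T.var l) =
      face R.obj j (degen R.obj 0 (y (T.var l))) +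
        (R.obj.obj _).d (face R.obj j (e l)) :=
    (congrArg (face R.obj j) (freeDesc_var a l)).trans
      ((map_add _ _ _).trans (congrArg _ (Hom.map_d _ _)))
  refine ⟨freeDesc a, free_hom_ext fun l => (ha 0 l).trans ?_, free_hom_ext fun l =>
    (ha 1 l).trans ?_⟩
  · rw [hef, hbd]
    refine (congrArg (· + _) (face_castSucc_degen (y (T.var l)) 0)).trans ?_
    exact add_sub_cancel _ _
  · refine (congrArg₂ (· + ·) (face_succ_degen (y (T.var l)) 0)
      ((congrArg _ (hes l 0)).trans (map_zero _))).trans (add_zero _)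

end ConnectedComponents

end TDGA

namespace TDGA

open Simplicial Simp

lemma LLPTriv.comp {X Y Z : TDGA T} {i : X ⟶ Y} {j : Y ⟶ Z} (hi : LLPTriv i) (hj : LLPTriv j) :
    LLPTriv (i ≫ j) := by
  intro U V p hp f g w
  obtain ⟨k, hk, hk'⟩ := hi p hp f (j ≫ g) (w.trans (assoc _ _ _))
  obtain ⟨l, hl, hl'⟩ := hj p hp k g hk'
  exact ⟨l, by rw [assoc, hl, hk], hl'⟩

section Replacement

variable {A : TAlg T} {n : ℕ} {f : TAlg.free T n ⟶ A}

/-- Comparison of a lift of `f` to cofibrant replacements with a relative cell complex over the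
free algebra. -/
lemma exists_relative_replacement (P : CofibrantReplacement (TAlg.free T n).toTDGA)
    (Q : CofibrantReplacement A.toTDGA) (q : P.obj ⟶ Q.obj)
    (hq : q ≫ Q.hom = P.hom ≫ TAlg.mapTDGA f) :
    ∃ (C : CofibrantReplacement A.toTDGA) (t : (TAlg.free T n).toTDGA ⟶ C.obj) (p : C.obj ⟶ Q.obj)
      (σ : (TAlg.free T n).toTDGA ⟶ P.obj), t ≫ C.hom = TAlg.mapTDGA f ∧ LLPTriv t ∧ IsTF p ∧
        p ≫ Q.hom = C.hom ∧ t ≫ p = σ ≫ q ∧ σ ≫ P.hom = 𝟙 _ := by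
  have hQ := isTF_of_discrete Q.quasiIso
  obtain ⟨σ, hσ⟩ := IsCofibrant.lift (isCofibrant_free n) (isTF_of_discrete P.quasiIso) (𝟙 _)
  obtain ⟨h, h1, h2⟩ := repl.of_llpTriv (c := TAlg.mapTDGA f) Q.hom hQ (σ ≫ q)
    (repl.π (TAlg.mapTDGA f)) (by
      rw [assoc, hq, ← assoc, hσ, id_comp, repl.of_π])
  have hhq : QuasiIso h := QuasiIso.of_comp_right Q.quasiIso (by rw [h2]; exact repl.quasiIso_π)
  obtain ⟨C, i, p, hip, hp, hi, hiq⟩ := exists_factor h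
  have hpq : QuasiIso p := QuasiIso.of_comp_left hiq (by rw [hip]; exact hhq)
  have ht : LLPTriv (repl.of (TAlg.mapTDGA f) ≫ i) := LLPTriv.comp repl.of_llpTriv hi.llpTriv
  refine ⟨⟨C, p ≫ Q.hom, ht.isCofibrant (isCofibrant_free n), hpq.comp Q.quasiIso⟩, _, p, σ, ?_, ht,
    isTF_of hp hpq, rfl, ?_, hσ⟩
  · refine (assoc _ _ _).trans ?_
    rw [← assoc i, hip, h2, repl.of_π]
  · rw [assoc, hip, h1]

lemma exists_replacements (f : TAlg.free T n ⟶ A) :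
    ∃ (P : CofibrantReplacement (TAlg.free T n).toTDGA) (Q : CofibrantReplacement A.toTDGA)
      (q : P.obj ⟶ Q.obj), q ≫ Q.hom = P.hom ≫ TAlg.mapTDGA f :=
  ⟨freeReplacement n, ⟨_, repl.π (TAlg.mapTDGA f), repl.of_llpTriv.isCofibrant (isCofibrant_free n),
    repl.quasiIso_π⟩, repl.of _, repl.of_π.trans (id_comp _).symm⟩

end Replacement

end TDGA

namespace TDGA

open Simplicial Simp

section Main

variable {B : TDGA T} (R : SimplicialResolution B) {A : TAlg T} {n : ℕ} {f : TAlg.free T n ⟶ A}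

lemma exists_map_fibProd (hf : TAlg.Etale f) (P : CofibrantReplacement (TAlg.free T n).toTDGA)
    (Q : CofibrantReplacement A.toTDGA) (q : P.obj ⟶ Q.obj)
    (hq : q ≫ Q.hom = P.hom ≫ TAlg.mapTDGA f) :
    ∃ (σ : (TAlg.free T n).toTDGA ⟶ P.obj) (c : mapSpace Q R ⟶ fibProd R f),
      σ ≫ P.hom = 𝟙 _ ∧
      c ≫ Limits.pullback.fst _ _ =
        mapSpacePrecomp q R ≫ mapSpacePrecomp (Q := freeReplacement n) σ R ∧
      c ≫ Limits.pullback.snd _ _ = mapSpaceToHom Q R ∧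
      ∀ W : ∀ {X Y : SSet.{u}}, (X ⟶ Y) → Prop, Simp.Formal W → W c := by
  obtain ⟨C, t, p, σ, htC, ht, hp, hpC, htp, hσ⟩ := exists_relative_replacement P Q q hq
  refine ⟨σ, mapSpacePrecomp p R ≫ comparison R C htC, hσ, ?_, ?_, fun W hW => ?_⟩
  · rw [assoc, comparison, Limits.pullback.lift_fst]
    exact (pre_comp R.obj t p).symm.trans ((congrArg (pre R.obj) htp).trans (pre_comp R.obj σ q))
  · rw [assoc, comparison, Limits.pullback.lift_snd]
    exact mapSpacePrecomp_toHom_self R C Q hpC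
  · exact hW.comp _ _ (formal_pre hW R.fibrant hp C.cofibrant Q.cofibrant)
      (hW.tFib _ (tFib_comparison R C htC hf ht))

lemma kanComplex_mapSpace (Q : CofibrantReplacement A.toTDGA) : SSet.KanComplex (mapSpace Q R) :=
  kanComplex_homSSet R.quasiIso_map Q.cofibrant

lemma isHomotopyPullback_mapSpace (hf : TAlg.Etale f)
    (P : CofibrantReplacement (TAlg.free T n).toTDGA) (Q : CofibrantReplacement A.toTDGA)
    (q : P.obj ⟶ Q.obj) (hq : q ≫ Q.hom = P.hom ≫ TAlg.mapTDGA f) :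
    IsHomotopyPullback (mapSpacePrecomp q R) (mapSpaceToHom Q R) (mapSpaceToHom P R)
      (discMap fun g : A ⟶ B.H0 => f ≫ g) := by
  obtain ⟨σ, c, hσ, h1, h2, hc⟩ := exists_map_fibProd R hf P Q q hq
  have := kanComplex_mapSpace R (freeReplacement n)
  refine ⟨mapSpacePrecomp_toHom R P Q hq, mapSpace (freeReplacement n) R,
    mapSpacePrecomp (Q := freeReplacement n) σ R, mapSpaceToHom (freeReplacement n) R,
    mapSpacePrecomp_toHom_self R (freeReplacement n) P hσ, ?_, fibration_disc _, ?_⟩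
  · refine WeakEquiv.of_comp_eq_id (a := pre R.obj P.hom) ?_ (formal_pre formal_weakEquiv R.fibrant
      (isTF_of_discrete P.quasiIso) P.cofibrant (isCofibrant_free n))
    exact (pre_comp R.obj σ P.hom).symm.trans ((congrArg (pre R.obj) hσ).trans (pre_id R.obj _))
  · convert hc WeakEquiv formal_weakEquiv using 1
    refine Limits.pullback.hom_ext ?_ ?_
    · rw [Limits.pullback.lift_fst, h1]
    · rw [Limits.pullback.lift_snd, h2]

lemma π₀_mapSpace_bijective (hf : TAlg.Etale f)
    (P : CofibrantReplacement (TAlg.free T n).toTDGA) (Q : CofibrantReplacement A.toTDGA)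
    (q : P.obj ⟶ Q.obj) (hq : q ≫ Q.hom = P.hom ≫ TAlg.mapTDGA f) :
    Function.Bijective (π₀ToSet (mapSpaceToHom Q R)) := by
  obtain ⟨σ, c, hσ, h1, h2, hc⟩ := exists_map_fibProd R hf P Q q hq
  have h3 := π₀_pullback_bijective (mapSpaceToHom (freeReplacement n) R)
    (fun g : A ⟶ B.H0 => f ≫ g) (exists_toHom_eq R) fun x y h => exists_edge_of_toHom_eq R h
  have h4 : Function.Bijective (SSet.mapπ₀ c) := hc _ formal_π₀
  refine (congrArg Function.Bijective (funext fun x => ?_)).mp (h3.comp h4)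
  obtain ⟨x, rfl⟩ := SSet.π₀.mk_surjective x
  exact app_congr h2 _ x

/-- The homology of `B` and of the vertices of a simplicial resolution. -/
def SimplicialResolution.homologyEquiv (i : ℕ) : (R.obj _⦋0⦌).H i ≃+ B.H i :=
  (LinearEquiv.ofBijective (homologyMap (R.ι.app (op ⦋0⦌)) i)
    (R.quasiIso _ i)).symm.toAddEquiv

lemma nonempty_homotopyGroupIso (hf : TAlg.Etale f)
    (P : CofibrantReplacement (TAlg.free T n).toTDGA) (Q : CofibrantReplacement A.toTDGA)
    (q : P.obj ⟶ Q.obj) (hq : q ≫ Q.hom = P.hom ≫ TAlg.mapTDGA f) (i : ℕ)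
    (x : (mapSpace Q R).obj (op ⦋0⦌)) :
    Nonempty (HomotopyGroupIso (mapSpace Q R) i x (Fin n → B.H (i + 1))) := by
  obtain ⟨σ, c, hσ, h1, h2, hc⟩ := exists_map_fibProd R hf P Q q hq
  let χ : mapSpace Q R ⟶ homSSet R.obj (TAlg.free T n).toTDGA :=
    c ≫ Limits.pullback.fst (mapSpaceToHom (freeReplacement n) R) _
  have hχ : ∀ x y (h : χ.app _ x = y), Function.Bijective (hg (n := i + 1) χ h) :=
    formal_hg.comp _ _ (hc _ formal_hg) fun x y h => by
      subst h
      exact hg_bijective_pullback _ _ _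
  obtain ⟨Φ, hΦ⟩ := exists_isClassMap (G := fun i => B.H i) R.quasiIso_map R.fibrant
    R.homologyEquiv (i + 1) 0 (i + 1) rfl
  obtain ⟨e, he⟩ := exists_homotopyGroup_equiv (n := n) (y := χ.app _ x) hΦ
  refine ⟨(Equiv.ofBijective _ (hχ x _ rfl)).trans e, fun g g' gg' ⟨s⟩ => ?_⟩
  obtain ⟨s'⟩ := MulStruct.ptMap χ rfl s
  have key (h) : ((Equiv.ofBijective _ (hχ x _ rfl)).trans e) h.homotopyClass =
    fun l => Φ (nv (crd R.obj l) (χ.app _ x) (smp (ptMap χ rfl h))) := he _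
  rw [key, key, key]
  exact funext fun l => hΦ.map_mul (crd R.obj l) s'

end Main

end TDGA

end FermatDG
end

/-- Let `f : T[x₁, …, xₙ] ⟶ A` be a pushout of a morphism of the class `E`, and let `B` be a
non-negatively graded differential graded `T`-algebra. Derived mapping spaces out of the morphism
`f` and into `B` exist, and for every way of computing them the conclusions hold. -/
theorem mainTheorem10 (T : FermatDG.RationalFermatTheory.{u})
    (E : MorphismProperty (FermatDG.TAlg T)) (hE : FermatDG.IsOpenEtaleClass E)
    (n : ℕ) (A : FermatDG.TAlg T) (f : FermatDG.TAlg.free T n ⟶ A) (hf : E.pushouts f)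
    (B : FermatDG.TDGA T) :
    (∃ (P : (FermatDG.TAlg.free T n).toTDGA.CofibrantReplacement)
      (Q : A.toTDGA.CofibrantReplacement) (q : P.obj ⟶ Q.obj),
      q ≫ Q.hom = P.hom ≫ FermatDG.TAlg.mapTDGA f) ∧
    Nonempty B.SimplicialResolution ∧
    ∀ (P : (FermatDG.TAlg.free T n).toTDGA.CofibrantReplacement)
      (Q : A.toTDGA.CofibrantReplacement) (q : P.obj ⟶ Q.obj)
      (_ : q ≫ Q.hom = P.hom ≫ FermatDG.TAlg.mapTDGA f) (R : B.SimplicialResolution),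
      SSet.KanComplex (FermatDG.TDGA.mapSpace Q R) ∧
      FermatDG.Simp.IsHomotopyPullback
        (FermatDG.TDGA.mapSpacePrecomp q R)
        (FermatDG.TDGA.mapSpaceToHom Q R)
        (FermatDG.TDGA.mapSpaceToHom P R)
        (FermatDG.Simp.discMap fun g : A ⟶ B.H0 => f ≫ g) ∧
      Function.Bijective (FermatDG.Simp.π₀ToSet (FermatDG.TDGA.mapSpaceToHom Q R)) ∧
      ∀ (i : ℕ) (x : (FermatDG.TDGA.mapSpace Q R).obj (Opposite.op (SimplexCategory.mk 0))),
        Nonempty (FermatDG.Simp.HomotopyGroupIso (FermatDG.TDGA.mapSpace Q R) i x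
          (Fin n → B.H (i + 1))) :=
  ⟨FermatDG.TDGA.exists_replacements f, FermatDG.TDGA.nonempty_simplicialResolution B,
    fun P Q q hq R => ⟨FermatDG.TDGA.kanComplex_mapSpace R Q,
      FermatDG.TDGA.isHomotopyPullback_mapSpace R (hE.etale hf) P Q q hq,
      FermatDG.TDGA.π₀_mapSpace_bijective R (hE.etale hf) P Q q hq,
      FermatDG.TDGA.nonempty_homotopyGroupIso R (hE.etale hf) P Q q hq⟩⟩
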